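/- Let $n\ge 1$. For an open set $\Omega\subset\mathbb R^n$, $H^1_0(\Omega)$ is the closure of $C_c^\infty(\Omega)$ in $H^1(\Omega)$. We say that an inequality is *not attained* if it is strict for every $u\in H^1_0$ that is not a.e. zero. **(I) General Hardy inequality.** Let $\Omega\subset\mathbb R^n$ be a domain (open, connected, nonempty), and let $A(x)$, $x\in\Omega$, be a measurable symmetric $n\times n$ matrix field that is uniformly elliptic: for some $0<\lambda\le\Lambda$, $\lambda|\xi|^2\le|\xi|_A^2:=\langle A(x)\xi,\xi\rangle\le\Lambda|\xi|^2$ for all $x\in\Omega$, $\xi\in\mathbb R^n$. Let $\mu$ be a nonnegative finite measure, and let $E:\Omega\to(0,\infty]$ be a positive solution of $-\mathrm{div}(A\nabla E)=\mu$ in $\Omega$, that is, $E\in W^{1,1}_{loc}(\Omega)$ and $\int_\Omega\langle A\nabla E,\nabla\varphi\rangle\,dx=\int_\Omega\varphi\,d\mu$ for all $\varphi\in C_c^\infty(\Omega)$; as usual, $E$ is taken lower semicontinuous and equal at every point of $\Omega$ to the limit of its averages over shrinking balls. Assume that either $A$ is locally Lipschitz in $\Omega$, or $E$ is continuous from $\Omega$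 to $(0,\infty]$ with $\nabla E\in L^2_{loc}(\{E<\infty\})$. Then $$\int_\Omega|\nabla u|_A^2\,dx\;\ge\;\frac14\int_\Omega\frac{|\nabla E|_A^2}{E^2}\,u^2\,dx\qquad\text{for all }u\in H^1_0(\Omega).\tag{1}$$ Suppose moreover that $\mu(\Omega)\ne0$, and that $E$ is an *interior weight*, i.e. $E=\infty$ on $\Omega\cap\operatorname{supp}\mu$, or a *boundary weight*, i.e. $E=0$ on $\partial\Omega$ (meaning that $\Omega$ is bounded and $E(x)\to0$ as $x\in\Omega$ tends to any point of $\partial\Omega$, or that $\min(E,k)\in H^1_0(\Omega)$ for all $k\ge 0$). Then the constant $\frac14$ in (1) is optimal (no larger constant is admissible) and (1) is not attained. If $\mu(\Omega)\ne0$ and $E$ is a boundary weight, then $$\int_\Omega|\nabla u|_A^2\,dx\;\ge\;\frac14\int_\Omega\frac{|\nabla E|_A^2}{E^2}\,u^2\,dx+\frac12\int_\Omega\frac{u^2}{E}\,d\mu\qquad\text{for all }u\in H^1_0(\Omega),\tag{2}$$ where $\frac{1}{\infty}=0$ and, in the last integral, $u^2(x)=\liminf_{r\to0}\big(\frac{1}{|B_r(x)|}\int_{B_r(x)}u\,dy\big)^2$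 is computed from the precise representative of $u$. Inequality (2) is not attained, and it is optimal: with $\frac12$ fixed, $\frac14$ cannot be replaced by a larger constant, and, provided $\mu(\{x\in\Omega:E(x)<\infty\})\neq0$, with $\frac14$ fixed, $\frac12$ cannot be replaced by a larger constant. **(II) Hardy's boundary inequality.** Let $\Omega\subset\mathbb R^n$ be a nonempty bounded convex open set. Then $$\int_\Omega|\nabla u|^2\,dx\ge\frac14\int_\Omega\frac{u^2}{\operatorname{dist}(x,\partial\Omega)^2}\,dx\qquad\text{for all }u\in H^1_0(\Omega),$$ and the constant $\frac14$ is optimal and not attained. **(III) Distance to a set of codimension $k$.** Let $\Omega\subset\mathbb R^n$ be open, let $k\in\{1,\dots,n\}$, $k\ne2$, let $M\subset\mathbb R^n$ be a nonempty set (for instance a piecewise smooth surface of codimension $k$), and put $d(x)=\operatorname{dist}(x,M)$. If $-\Delta d^{2-k}\ge0$ in $\Omega\setminus\overline M$ in the sense of distributions, then $$\int_{\Omega\setminus\overline M}|\nabla u|^2\,dx\ge\frac{(k-2)^2}{4}\int_{\Omega\setminus\overline M}\frac{u^2}{d^2}\,dx\qquad\text{for all }u\in H^1_0(\Omega\setminus\overline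 M),$$ and this inequality is not attained. -/

import Mathlib

open MeasureTheory Filter Topology Set
open scoped ENNReal NNReal ContDiff

/-- `φ ∈ C_c^∞(Ω)`. -/
structure IsTestFunction {n : ℕ} (Ω : Set (EuclideanSpace ℝ (Fin n)))
    (φ : EuclideanSpace ℝ (Fin n) → ℝ) : Prop where
  smooth : ContDiff ℝ ∞ φ
  compactSupport : HasCompactSupport φ
  support_subset : tsupport φ ⊆ Ω

/-- `u ∈ H¹₀(Ω)` with weak gradient `g`: `(u, g)` is the limit in `L²(Ω) × L²(Ω)ⁿ` of
`(φⱼ, ∇φⱼ)` for some `φⱼ ∈ C_c^∞(Ω)`. The field `g` is determined by `u` a.e. in `Ω`. -/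
structure MemH10 {n : ℕ} (Ω : Set (EuclideanSpace ℝ (Fin n)))
    (u : EuclideanSpace ℝ (Fin n) → ℝ)
    (g : EuclideanSpace ℝ (Fin n) → EuclideanSpace ℝ (Fin n)) : Prop where
  memLp : MemLp u 2 (volume.restrict Ω)
  memLp_grad : MemLp g 2 (volume.restrict Ω)
  approx : ∃ φ : ℕ → EuclideanSpace ℝ (Fin n) → ℝ,
    (∀ j, IsTestFunction Ω (φ j)) ∧
    Tendsto (fun j => eLpNorm (fun x => φ j x - u x) 2 (volume.restrict Ω)) atTop (𝓝 0) ∧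
    Tendsto (fun j => eLpNorm (fun x => gradient (φ j) x - g x) 2 (volume.restrict Ω))
      atTop (𝓝 0)

/-- `v ∈ W^{1,1}_loc(Ω)` with weak gradient `g`. -/
structure HasWeakGradient {n : ℕ} (Ω : Set (EuclideanSpace ℝ (Fin n)))
    (v : EuclideanSpace ℝ (Fin n) → ℝ)
    (g : EuclideanSpace ℝ (Fin n) → EuclideanSpace ℝ (Fin n)) : Prop where
  locInt : LocallyIntegrableOn v Ω volume
  locInt_grad : LocallyIntegrableOn g Ω volume
  parts : ∀ φ : EuclideanSpace ℝ (Fin n) → ℝ, IsTestFunction Ω φ →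
    ∫ x in Ω, v x • gradient φ x = -∫ x in Ω, φ x • g x

/-- The bilinear form `⟨B ξ, η⟩` of a matrix `B`. -/
noncomputable def matForm {n : ℕ} (B : Matrix (Fin n) (Fin n) ℝ)
    (ξ η : EuclideanSpace ℝ (Fin n)) : ℝ :=
  inner ℝ (Matrix.toEuclideanLin B ξ) η

/-- `A` is a measurable, symmetric and uniformly elliptic matrix field on `Ω`. -/
structure IsUniformlyElliptic {n : ℕ} (Ω : Set (EuclideanSpace ℝ (Fin n)))
    (A : EuclideanSpace ℝ (Fin n) → Matrix (Fin n) (Fin n) ℝ) : Prop where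
  measurable : ∀ i j, AEMeasurable (fun x => A x i j) (volume.restrict Ω)
  symm : ∀ x ∈ Ω, (A x).IsSymm
  elliptic : ∃ lam Lam : ℝ, 0 < lam ∧ ∀ x ∈ Ω, ∀ ξ : EuclideanSpace ℝ (Fin n),
    lam * ‖ξ‖ ^ 2 ≤ matForm (A x) ξ ξ ∧ matForm (A x) ξ ξ ≤ Lam * ‖ξ‖ ^ 2

/-- `E : Ω → (0, ∞]`, with weak gradient `gE`, is a positive distributional solution in
`W^{1,1}_loc(Ω)` of `-div (A ∇E) = μ`. As `E` is evaluated on sets that may be Lebesgue-null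
(the support of `μ`, or `μ`-almost everywhere), its pointwise values are normalized in the usual
way for superharmonic functions (fields `lsc` and `precise`). -/
structure IsPositiveSolution {n : ℕ} (Ω : Set (EuclideanSpace ℝ (Fin n)))
    (A : EuclideanSpace ℝ (Fin n) → Matrix (Fin n) (Fin n) ℝ)
    (E : EuclideanSpace ℝ (Fin n) → ℝ≥0∞)
    (gE : EuclideanSpace ℝ (Fin n) → EuclideanSpace ℝ (Fin n))
    (μ : Measure (EuclideanSpace ℝ (Fin n))) : Prop where
  pos : ∀ x ∈ Ω, 0 < E x
  finite_ae : ∀ᵐ x ∂(volume.restrict Ω), E x < ⊤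
  lsc : LowerSemicontinuousOn E Ω
  precise : ∀ x ∈ Ω, Tendsto (fun r : ℝ => ⨍⁻ y in Metric.ball x r, E y ∂volume) (𝓝[>] 0) (𝓝 (E x))
  weakGrad : HasWeakGradient Ω (fun x => (E x).toReal) gE
  equation : ∀ φ : EuclideanSpace ℝ (Fin n) → ℝ, IsTestFunction Ω φ →
    ∫ x in Ω, matForm (A x) (gE x) (gradient φ x) = ∫ x in Ω, φ x ∂μ

/-- Regularity of the data: either the coefficients are locally Lipschitz in `Ω` (and then nothing
is asked of `E`), or the coefficients are arbitrary and `E` is continuous as a map into `(0, ∞]`,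
with locally square integrable gradient in the open set `{E < ∞}`. -/
def RegularData {n : ℕ} (Ω : Set (EuclideanSpace ℝ (Fin n)))
    (A : EuclideanSpace ℝ (Fin n) → Matrix (Fin n) (Fin n) ℝ)
    (E : EuclideanSpace ℝ (Fin n) → ℝ≥0∞)
    (gE : EuclideanSpace ℝ (Fin n) → EuclideanSpace ℝ (Fin n)) : Prop :=
  (∀ i j, LocallyLipschitzOn Ω (fun x => A x i j)) ∨
  (ContinuousOn E Ω ∧ LocallyIntegrableOn (fun x => ‖gE x‖ ^ 2) {x ∈ Ω | E x < ⊤} volume)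

/-- `E` is an interior weight: `E = ∞` on the support of `μ` in `Ω`. -/
def IsInteriorWeight {n : ℕ} (Ω : Set (EuclideanSpace ℝ (Fin n)))
    (E : EuclideanSpace ℝ (Fin n) → ℝ≥0∞) (μ : Measure (EuclideanSpace ℝ (Fin n))) : Prop :=
  ∀ x ∈ Ω, x ∈ μ.support → E x = ⊤

/-- `E` is a boundary weight: `E = 0` on `∂Ω`, either classically (`Ω` bounded and `E(x) → 0`
as `x` tends to any boundary point) or in the Sobolev sense (`min (E, k) ∈ H¹₀(Ω)` for all `k`). -/
def IsBoundaryWeight {n : ℕ} (Ω : Set (EuclideanSpace ℝ (Fin n)))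
    (E : EuclideanSpace ℝ (Fin n) → ℝ≥0∞) : Prop :=
  (Bornology.IsBounded Ω ∧ ∀ y ∈ frontier Ω, Tendsto E (𝓝[Ω] y) (𝓝 0)) ∨
  (∀ k : ℝ≥0, ∃ g : EuclideanSpace ℝ (Fin n) → EuclideanSpace ℝ (Fin n),
    MemH10 Ω (fun x => (min (E x) k).toReal) g)

/-- `∫_Ω |g|_A² dx`, in `[0, ∞]`. -/
noncomputable def energyA {n : ℕ} (Ω : Set (EuclideanSpace ℝ (Fin n)))
    (A : EuclideanSpace ℝ (Fin n) → Matrix (Fin n) (Fin n) ℝ)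
    (g : EuclideanSpace ℝ (Fin n) → EuclideanSpace ℝ (Fin n)) : ℝ≥0∞ :=
  ∫⁻ x in Ω, ENNReal.ofReal (matForm (A x) (g x) (g x))

/-- `∫_Ω (|∇E|_A² / E²) u² dx`, in `[0, ∞]`. -/
noncomputable def hardyTerm {n : ℕ} (Ω : Set (EuclideanSpace ℝ (Fin n)))
    (A : EuclideanSpace ℝ (Fin n) → Matrix (Fin n) (Fin n) ℝ)
    (E : EuclideanSpace ℝ (Fin n) → ℝ≥0∞)
    (gE : EuclideanSpace ℝ (Fin n) → EuclideanSpace ℝ (Fin n))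
    (u : EuclideanSpace ℝ (Fin n) → ℝ) : ℝ≥0∞ :=
  ∫⁻ x in Ω, ENNReal.ofReal (matForm (A x) (gE x) (gE x)) / E x ^ 2 * ENNReal.ofReal (u x ^ 2)

/-- The value at `x` of `u²` for the precise representative of a Sobolev function `u`: the lower
limit of the squared ball averages of `u` as the radius tends to `0`. For `u ∈ H¹₀(Ω)` it is a
limit, and equals the square of the quasicontinuous representative, off a set of capacity zero. -/
noncomputable def preciseSq {n : ℕ} (u : EuclideanSpace ℝ (Fin n) → ℝ)
    (x : EuclideanSpace ℝ (Fin n)) : ℝ≥0∞ :=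
  liminf (fun r : ℝ => ENNReal.ofReal ((⨍ y in Metric.ball x r, u y) ^ 2)) (𝓝[>] 0)

/-- `∫_Ω (u² / E) dμ`, in `[0, ∞]`, with `1 / ∞ = 0`. -/
noncomputable def measureTerm {n : ℕ} (Ω : Set (EuclideanSpace ℝ (Fin n)))
    (E : EuclideanSpace ℝ (Fin n) → ℝ≥0∞) (μ : Measure (EuclideanSpace ℝ (Fin n)))
    (u : EuclideanSpace ℝ (Fin n) → ℝ) : ℝ≥0∞ :=
  ∫⁻ x in Ω, preciseSq u x / E x ∂μ

/-- `∫_Ω |g|² dx`, in `[0, ∞]`. -/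
noncomputable def energy {n : ℕ} (Ω : Set (EuclideanSpace ℝ (Fin n)))
    (g : EuclideanSpace ℝ (Fin n) → EuclideanSpace ℝ (Fin n)) : ℝ≥0∞ :=
  ∫⁻ x in Ω, ENNReal.ofReal (‖g x‖ ^ 2)

/-- `∫_Ω u² / dist(x, M)² dx`, in `[0, ∞]`. -/
noncomputable def distTerm {n : ℕ} (Ω M : Set (EuclideanSpace ℝ (Fin n)))
    (u : EuclideanSpace ℝ (Fin n) → ℝ) : ℝ≥0∞ :=
  ∫⁻ x in Ω, ENNReal.ofReal (u x ^ 2 / Metric.infDist x M ^ 2)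

/-- `-Δ f ≥ 0` in `Ω` in the sense of distributions. -/
def IsSuperharmonicDistrib {n : ℕ} (Ω : Set (EuclideanSpace ℝ (Fin n)))
    (f : EuclideanSpace ℝ (Fin n) → ℝ) : Prop :=
  ∀ φ : EuclideanSpace ℝ (Fin n) → ℝ, IsTestFunction Ω φ → (∀ x, 0 ≤ φ x) →
    0 ≤ -∫ x in Ω, f x * Laplacian.laplacian φ x

/-- `u` does not vanish almost everywhere in `Ω`. -/
def IsNontrivialOn {n : ℕ} (Ω : Set (EuclideanSpace ℝ (Fin n)))
    (u : EuclideanSpace ℝ (Fin n) → ℝ) : Prop :=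
  ¬ ∀ᵐ x ∂(volume.restrict Ω), u x = 0

/-! Everything rests on one pointwise identity. If e > 0 has gradient G, completing the square gives
|∇φ|² = |∇φ − φG/(2e)|² + ¼ (φ²/e²)|G|² + ½ ⟨AG, ∇(φ²/e)⟩ in the norm of A. If −div(AG) ≥ ν ≥ 0, the
last term integrates to at least ½ ∫ φ²/e dν. This yields the Hardy inequality, its measure term,
and a remainder that decides when equality can hold (`hardy_test`, `hardy_memH10`). All three parts
apply it: (I) with e = E, (II) with e the distance to the boundary, (III) with e = d^(2−k).

Admissibility. The function φ²/E is not a smooth test function, and ∇E is only locally integrable.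
One therefore tests with φ l(E), where l is smooth with compact support in (0, ∞); only the part of
μ on {E < ∞} is then seen (`IsTruncSolution`). If E is continuous, φ l(E) lives in the open set {E <
∞}, where ∇E is locally square integrable, and mollification suffices. If A is locally Lipschitz,
the equation is mollified instead: Friedrichs' commutator lemma makes the error vanish against
merely bounded test functions (`tendsto_commPairing`). Testing with ψ h(E), h bounded and
nondecreasing, then gives square integrability of ∇E on bands {a ≤ E ≤ b} and a one-sided truncated
equation, which is upgraded to an identity (`abs_truncForm_sub_le`, `isTruncSolution_of_lipschitz`).

Measure term. For u in H¹₀ the integral ∫ u²/e dν uses the precise representative. The Hardy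
inequality is its own trace inequality L²(ν/e) ← H¹₀; applied to ball averages, with Fatou as the
radius tends to 0, it carries the term over from test functions (`setLIntegral_preciseSq_le`).

Strictness. Equality forces ∇u = u∇e/(2e). With p = (u/e)∇e, testing with u² k(e)/e gives ∫ e
k'(e)|p|² ≥ 0 for every cutoff k ≥ 0. A k that rises slowly and falls quickly in log e forces p = 0,
so ∇u = 0 and u = 0 (`hardy_strict`).

Sharpness in (I). The formal optimizer is √E, cut off logarithmically: u = √E η(log E), times a test
function φ for interior weights. The Hardy term grows without bound while the energy exceeds a
quarter of it by a bounded amount. For interior weights, boundedness would make φ²|∇E|²/E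
integrable, and then φ² cannot charge {E = ∞} (`setIntegral_sq_eq_zero`). For boundary weights,
boundedness would force μ = 0 by inequality (2) itself (`exists_lt_integral_bumpCut`). The same
functions saturate ½, since the excess tends to ½ μ({E < ∞}).

Parts (II) and (III). Outside the closure of M one has |∇d| = 1 almost everywhere, so e = d^s turns
the Hardy weight into s²/d². On a convex domain the distance to the boundary is concave, hence
superharmonic. There ¼ is approached by d^a with a slightly above ½, which is admissible because |{d
< τ}| = O(τ). -/

open Gradient Metric Real ENNReal Measure
open ENNReal (ofReal)

open smoothTransition renaming nonneg → σ_nonneg, le_one → σ_le_one,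
  zero_of_nonpos → σ_eq_zero, one_of_one_le → σ_eq_one

local notation "σ" => smoothTransition

local notation:max "vol[" Ω "]" => Measure.restrict volume Ω

/-- The Euclidean space `ℝⁿ`. -/
abbrev Eu (n : ℕ) := EuclideanSpace ℝ (Fin n)

/-- The square matrices of size `n`. -/
abbrev Mat (n : ℕ) := Matrix (Fin n) (Fin n) ℝ

/-- The value `E x` of an extended function, as a real number. -/
local notation:max E:max "§" x:max => ENNReal.toReal (E x)

/-- The bilinear form of `A x` at two vector fields. -/
local notation:max "Q[" A "," ξ "," η "]" x:max => matForm (A x) (ξ x) (η x)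

/-- The remainder field `w - u G / (2 e)` at `x`. -/
local notation:max "R[" w "," u "," e "," G "]" x:max => w x - (u x / (2 * e x)) • G x

/-- The energy density of the remainder field plus the Hardy density. -/
local notation:max "P[" A "," w "," u "," e "," G "]" x:max =>
  matForm (A x) R[w,u,e,G]x R[w,u,e,G]x + 1 / 4 * (u x ^ 2 / e x ^ 2 * matForm (A x) (G x) (G x))

variable {n : ℕ} {Ω : Set (Eu n)} {A : Eu n → Mat n} {E : Eu n → ℝ≥0∞} {G g : Eu n → Eu n}
  {μ ν : Measure (Eu n)} {K : Set (Eu n)} {φ ψ f u v e κ : Eu n → ℝ} {l : ℝ → ℝ} {x : Eu n} {t c N δ r s L C M B D a ε : ℝ}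

lemma IsOpen.ae_mem (hΩ : IsOpen Ω) : ∀ᵐ x ∂μ.restrict Ω, x ∈ Ω :=
  ae_restrict_mem hΩ.measurableSet

lemma Continuous.aesm {F : Type*} [NormedAddCommGroup F] {f : Eu n → F} (h : Continuous f) :
    AEStronglyMeasurable f μ :=
  h.aestronglyMeasurable

lemma eq_zero_of_notMem {F : Type*} [Zero F] {f : Eu n → F} (hx : x ∉ tsupport f) : f x = 0 :=
  image_eq_zero_of_notMem_tsupport hx

lemma integral_congr_fun {α F : Type*} {_ : MeasurableSpace α} {m : Measure α} [NormedAddCommGroup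
    F] [NormedSpace ℝ F] {p q : α → F} (h : ∀ a, p a = q a) : ∫ a, p a ∂m = ∫ a, q a ∂m :=
  integral_congr_ae (.of_forall h)

lemma MeasureTheory.LocallyIntegrableOn.integrable_indicator {F : Type*} [NormedAddCommGroup F] {f :
    Eu n → F} (h : LocallyIntegrableOn f Ω volume) (hKΩ : K ⊆ Ω) (hK : IsCompact K) : Integrable
    (K.indicator f) :=
  (h.integrableOn_compact_subset hKΩ hK).integrable_indicator hK.measurableSet

lemma tendsto_zero_of_le {ι : Type*} {b : Filter ι} {p q : ι → ℝ≥0∞} (hq : Tendsto q b (𝓝 0)) (h : ∀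
    i, p i ≤ q i) : Tendsto p b (𝓝 0) :=
  tendsto_of_tendsto_of_tendsto_of_le_of_le tendsto_const_nhds hq (fun _ => zero_le) h

/-! ### The quadratic form of the coefficients. -/

section MatForm

lemma matForm_add_left (B : Mat n) (ξ ξ' η : Eu n) : matForm B (ξ + ξ') η = matForm B ξ η + matForm
    B ξ' η := by
  simp [matForm, inner_add_left]

lemma matForm_add_right (B : Mat n) (ξ η η' : Eu n) : matForm B ξ (η + η') = matForm B ξ η + matForm
    B ξ η' := by
  simp [matForm, inner_add_right]

lemma matForm_sub_left (B : Mat n) (ξ ξ' η : Eu n) : matForm B (ξ - ξ') η = matForm B ξ η - matForm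
    B ξ' η := by
  simp [matForm, inner_sub_left]

lemma matForm_sub_right (B : Mat n) (ξ η η' : Eu n) : matForm B ξ (η - η') = matForm B ξ η - matForm
    B ξ η' := by
  simp [matForm, inner_sub_right]

lemma matForm_smul_left (B : Mat n) (c : ℝ) (ξ η : Eu n) : matForm B (c • ξ) η = c * matForm B ξ η
    := by
  simp [matForm, inner_smul_left]

lemma matForm_smul_right (B : Mat n) (c : ℝ) (ξ η : Eu n) : matForm B ξ (c • η) = c * matForm B ξ η
    := by
  simp [matForm, inner_smul_right]

@[simp] lemma matForm_zero_left (B : Mat n) (η : Eu n) :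
    matForm B 0 η = 0 := by simp [matForm]

@[simp] lemma matForm_zero_right (B : Mat n) (ξ : Eu n) :
    matForm B ξ 0 = 0 := by simp [matForm]

lemma matForm_eq_sum (B : Mat n) (ξ η : Eu n) : matForm B ξ η = ∑ i, ∑ j, B i j * ξ j * η i := by
  simp [matForm, PiLp.inner_apply, Matrix.mulVec, dotProduct, Finset.mul_sum]
  refine Finset.sum_congr rfl fun i _ => Finset.sum_congr rfl fun j _ => ?_; ring

lemma matForm_comm {B : Mat n} (hB : B.IsSymm) (ξ η : Eu n) : matForm B ξ η = matForm B η ξ := by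
  rw [matForm_eq_sum, matForm_eq_sum, Finset.sum_comm]
  refine Finset.sum_congr rfl fun i _ => Finset.sum_congr rfl fun j _ => ?_; rw [hB.apply]; ring

lemma matForm_one (ξ η : Eu n) : matForm 1 ξ η = inner ℝ ξ η := by
  simp [matForm]

/-- Polarization and the parallelogram law give |⟨Bξ, η⟩| ≤ (M/2)(‖ξ‖² + ‖η‖²); homogeneity, through
normalized vectors, turns the sum of squares into the product. -/
lemma abs_matForm_le {B : Mat n} (hB : B.IsSymm) (hM : 0 ≤ M) (h0 : ∀ ξ, 0 ≤ matForm B ξ ξ) (h1 : ∀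
    ξ, matForm B ξ ξ ≤ M * ‖ξ‖ ^ 2) (ξ η : Eu n) : |matForm B ξ η| ≤ M * ‖ξ‖ * ‖η‖ := by
  have key : ∀ ξ η : Eu n, |matForm B ξ η| ≤ M / 2 * (‖ξ‖ ^ 2 + ‖η‖ ^ 2) := by
    intro ξ η; have a1 := h1 (ξ + η); have a2 := h1 (ξ - η); have a3 := h0 (ξ + η)
    have a4 := h0 (ξ - η)
    have e1 : matForm B (ξ + η) (ξ + η) = matForm B ξ ξ + 2 * matForm B ξ η + matForm B η η := by
      rw [matForm_add_left, matForm_add_right, matForm_add_right, matForm_comm hB η ξ]; ring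
    have e2 : matForm B (ξ - η) (ξ - η) = matForm B ξ ξ - 2 * matForm B ξ η + matForm B η η := by
      rw [matForm_sub_left, matForm_sub_right, matForm_sub_right, matForm_comm hB η ξ]; ring
    have p := parallelogram_law_with_norm ℝ ξ η; rw [abs_le]; constructor <;> nlinarith
  rcases eq_or_ne ξ 0 with rfl | hξ
  · simp
  rcases eq_or_ne η 0 with rfl | hη
  · simp
  have hx : 0 < ‖ξ‖ := norm_pos_iff.2 hξ; have hy : 0 < ‖η‖ := norm_pos_iff.2 hη
  have := key (‖ξ‖⁻¹ • ξ) (‖η‖⁻¹ • η)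
  rw [matForm_smul_left, matForm_smul_right, norm_smul, norm_smul] at this
  simp only [norm_inv, norm_norm, inv_mul_cancel₀ hx.ne', inv_mul_cancel₀ hy.ne', abs_mul,
    abs_inv, abs_norm] at this
  have h2 : ‖ξ‖ * (‖η‖ * (‖ξ‖⁻¹ * (‖η‖⁻¹ * |matForm B ξ η|))) = |matForm B ξ η| := by field_simp
  rw [← h2]
  calc _ ≤ ‖ξ‖ * (‖η‖ * (M / 2 * (1 ^ 2 + 1 ^ 2))) := by gcongr
    _ = _ := by ring

lemma IsUniformlyElliptic.exists_bounds (hA : IsUniformlyElliptic Ω A) : ∃ lam Lam : ℝ, 0 < lam ∧ 0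
    < Lam ∧ ∀ x ∈ Ω, (∀ ξ, lam * ‖ξ‖ ^ 2 ≤ matForm (A x) ξ ξ) ∧ ∀ ξ η, |matForm (A x) ξ η| ≤ Lam *
    ‖ξ‖ * ‖η‖ := by
  obtain ⟨lam, Lam, h0, h⟩ := hA.elliptic
  refine ⟨lam, max Lam 1, h0, by positivity, fun x hx => ⟨fun ξ => (h x hx ξ).1, ?_⟩⟩
  refine abs_matForm_le (hA.symm x hx) (by positivity) (fun ξ => ?_) fun ξ => ?_
  · exact le_trans (by positivity) (h x hx ξ).1
  · exact (h x hx ξ).2.trans (by gcongr; exact le_max_left _ _)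

lemma IsUniformlyElliptic.matForm_nonneg (hA : IsUniformlyElliptic Ω A) (hx : x ∈ Ω) (ξ : Eu n) : 0
    ≤ matForm (A x) ξ ξ := by
  obtain ⟨lam, Lam, h0, h⟩ := hA.elliptic; exact le_trans (by positivity) (h x hx ξ).1

lemma IsUniformlyElliptic.ae_nonneg (hA : IsUniformlyElliptic Ω A) (hΩ : IsOpen Ω) (F : Eu n → Eu n)
    : ∀ᵐ x ∂vol[Ω], 0 ≤ Q[A,F,F]x := by
  filter_upwards [hΩ.ae_mem] with x hx using hA.matForm_nonneg hx _

lemma IsUniformlyElliptic.aestronglyMeasurable (hA : IsUniformlyElliptic Ω A) {F H : Eu n → Eu n}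
    (hF : AEStronglyMeasurable F vol[Ω]) (hH : AEStronglyMeasurable H vol[Ω]) : AEStronglyMeasurable
    (fun x => Q[A,F,H]x) vol[Ω] := by
  simp only [matForm_eq_sum]
  refine Finset.aestronglyMeasurable_fun_sum _ fun i _ =>
    Finset.aestronglyMeasurable_fun_sum _ fun j _ => ?_
  have h1 : ∀ i, AEStronglyMeasurable (fun x => F x i) vol[Ω] := fun i =>
    (EuclideanSpace.proj (𝕜 := ℝ) i).continuous.comp_aestronglyMeasurable hF
  have h2 : ∀ i, AEStronglyMeasurable (fun x => H x i) vol[Ω] := fun i =>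
    (EuclideanSpace.proj (𝕜 := ℝ) i).continuous.comp_aestronglyMeasurable hH
  exact ((hA.measurable i j).aestronglyMeasurable.mul (h1 j)).mul (h2 i)

lemma isUniformlyElliptic_one (Ω : Set (Eu n)) : IsUniformlyElliptic Ω (fun _ => (1 : Mat n)) where
  measurable i j := aemeasurable_const
  symm x _ := Matrix.isSymm_one
  elliptic := ⟨1, 1, one_pos, fun x _ ξ => by simp [matForm_one]⟩

end MatForm

/-! ### Gradients and test functions. -/

section TestFunctions

lemma gradient_fun_mul {g : Eu n → ℝ} (hf : DifferentiableAt ℝ f x) (hg : DifferentiableAt ℝ g x) :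
    ∇ (fun y => f y * g y) x = f x • ∇ g x + g x • ∇ f x := by
  simp only [gradient, fderiv_fun_mul hf hg, map_add, map_smul]

lemma gradient_fun_add {g : Eu n → ℝ} (hf : DifferentiableAt ℝ f x) (hg : DifferentiableAt ℝ g x) :
    ∇ (fun y => f y + g y) x = ∇ f x + ∇ g x := by
  simp only [gradient, fderiv_fun_add hf hg, map_add]

lemma gradient_fun_sub {g : Eu n → ℝ} (hf : DifferentiableAt ℝ f x) (hg : DifferentiableAt ℝ g x) :
    ∇ (fun y => f y - g y) x = ∇ f x - ∇ g x := by
  simp only [gradient, fderiv_fun_sub hf hg, map_sub]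

lemma gradient_const_mul' (c : ℝ) (hf : DifferentiableAt ℝ f x) : ∇ (fun y => c * f y) x = c • ∇ f x
    := by
  simp only [gradient, fderiv_const_mul hf, map_smul]

lemma gradient_scomp {h : ℝ → ℝ} (hh : DifferentiableAt ℝ h (f x)) (hf : DifferentiableAt ℝ f x) : ∇
    (fun y => h (f y)) x = deriv h (f x) • ∇ f x := by
  have : fderiv ℝ (fun y => h (f y)) x = deriv h (f x) • fderiv ℝ f x := by
    have h1 := hh.hasDerivAt.comp_hasFDerivAt x hf.hasFDerivAt; exact h1.fderiv
  simp only [gradient, this, map_smul]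

lemma continuous_gradient (hf : ContDiff ℝ 1 f) : Continuous (∇ f) :=
  (InnerProductSpace.toDual ℝ (Eu n)).symm.continuous.comp (hf.continuous_fderiv one_ne_zero)

lemma tsupport_gradient_subset (f : Eu n → ℝ) : tsupport (∇ f) ⊆ tsupport f := by
  refine (closure_mono ?_).trans (tsupport_fderiv_subset ℝ (f := f)); intro x hx hx'
  exact hx (by simp [gradient, hx'])

lemma gradient_eq_zero (hx : x ∉ tsupport f) : ∇ f x = 0 :=
  eq_zero_of_notMem fun h => hx (tsupport_gradient_subset f h)

namespace IsTestFunction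

lemma differentiable (h : IsTestFunction Ω φ) : Differentiable ℝ φ :=
  h.smooth.differentiable (by simp)

lemma continuous (h : IsTestFunction Ω φ) : Continuous φ := h.smooth.continuous

lemma continuous_gradient (h : IsTestFunction Ω φ) : Continuous (∇ φ) :=
  _root_.continuous_gradient (h.smooth.of_le (by exact_mod_cast le_top))

lemma hasCompactSupport_gradient (h : IsTestFunction Ω φ) : HasCompactSupport (∇ φ) :=
  h.compactSupport.of_isClosed_subset (isClosed_tsupport _) (tsupport_gradient_subset φ)

lemma mul_left (h : IsTestFunction Ω φ) (hf : ContDiff ℝ ∞ f) :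
    IsTestFunction Ω (fun x => f x * φ x) where
  smooth := hf.mul h.smooth
  compactSupport := h.compactSupport.mul_left
  support_subset := (tsupport_mul_subset_right (f := f) (g := φ)).trans h.support_subset

lemma mul_right (h : IsTestFunction Ω φ) (hf : ContDiff ℝ ∞ f) :
    IsTestFunction Ω (fun x => φ x * f x) where
  smooth := h.smooth.mul hf
  compactSupport := h.compactSupport.mul_right
  support_subset := (tsupport_mul_subset_left (f := φ) (g := f)).trans h.support_subset

lemma const_mul (h : IsTestFunction Ω φ) (c : ℝ) : IsTestFunction Ω (fun x => c * φ x) :=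
  h.mul_left contDiff_const

lemma add (h : IsTestFunction Ω φ) (h' : IsTestFunction Ω ψ) :
    IsTestFunction Ω (fun x => φ x + ψ x) where
  smooth := h.smooth.add h'.smooth
  compactSupport := h.compactSupport.add h'.compactSupport
  support_subset := (tsupport_add φ ψ).trans (union_subset h.support_subset h'.support_subset)

lemma sub (h : IsTestFunction Ω φ) (h' : IsTestFunction Ω ψ) : IsTestFunction Ω (fun x => φ x - ψ x)
    := by
  simpa [sub_eq_add_neg] using h.add (h'.const_mul (-1))

lemma sq (h : IsTestFunction Ω φ) : IsTestFunction Ω (fun x => φ x ^ 2) := by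
  simpa [pow_two] using h.mul_left h.smooth

lemma comp (h : IsTestFunction Ω φ) {f : ℝ → ℝ} (hf : ContDiff ℝ ∞ f) (h0 : f 0 = 0) :
    IsTestFunction Ω (fun x => f (φ x)) where
  smooth := hf.comp h.smooth
  compactSupport := h.compactSupport.comp_left (g := f) h0
  support_subset := by
    refine (closure_mono ?_).trans h.support_subset; intro x hx hx'; exact hx (by simp [hx', h0])

lemma mono (h : IsTestFunction Ω φ) {Ω' : Set (Eu n)} (hs : Ω ⊆ Ω') : IsTestFunction Ω' φ :=
  ⟨h.smooth, h.compactSupport, h.support_subset.trans hs⟩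

lemma bounded (h : IsTestFunction Ω φ) : ∃ C, ∀ x, |φ x| ≤ C :=
  h.continuous.bounded_above_of_compact_support h.compactSupport

lemma gradient_bounded (h : IsTestFunction Ω φ) : ∃ C, ∀ x, ‖∇ φ x‖ ≤ C :=
  h.continuous_gradient.bounded_above_of_compact_support h.hasCompactSupport_gradient

lemma memLp (h : IsTestFunction Ω φ) (p : ℝ≥0∞) (μ : Measure (Eu n)) [IsFiniteMeasureOnCompacts μ] :
    MemLp φ p μ := h.continuous.memLp_of_hasCompactSupport h.compactSupport

lemma memLp_gradient (h : IsTestFunction Ω φ) (p : ℝ≥0∞) (μ : Measure (Eu n))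
    [IsFiniteMeasureOnCompacts μ] : MemLp (∇ φ) p μ :=
  h.continuous_gradient.memLp_of_hasCompactSupport h.hasCompactSupport_gradient

lemma gradient_sq (h : IsTestFunction Ω φ) (x : Eu n) : ∇ (fun y => φ y ^ 2) x = (2 * φ x) • ∇ φ x
    := by
  have := gradient_fun_mul (h.differentiable x) (h.differentiable x); simp only [pow_two]
  rw [this, ← add_smul]; ring_nf

end IsTestFunction

/-- The value one is attained on an open neighbourhood of K and not only on K, so that
multiplication by χ also leaves gradients on K unchanged. -/
lemma exists_testFunction (hK : IsCompact K) (hΩ : IsOpen Ω) (h : K ⊆ Ω) : ∃ χ : Eu n → ℝ,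
    IsTestFunction Ω χ ∧ (∀ x, 0 ≤ χ x) ∧ (∀ x, χ x ≤ 1) ∧ ∃ U, IsOpen U ∧ K ⊆ U ∧ ∀ x ∈ U, χ x = 1
    := by
  obtain ⟨K', hK', hKK', hK'Ω⟩ := exists_compact_between hK hΩ h
  obtain ⟨K₂, hK₂, hKK₂, hK₂Ω⟩ := exists_compact_between hK' hΩ hK'Ω
  obtain ⟨f, hf, h01, hsub, h1⟩ := exists_contMDiff_support_eq_eq_one_iff
    (modelWithCornersSelf ℝ (Eu n)) (n := ⊤) (s := interior K₂) (t := K') isOpen_interior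
    hK'.isClosed hKK₂
  replace hf := hf.contDiff
  have hs : tsupport f ⊆ K₂ := by
    rw [tsupport, hsub]; exact closure_minimal interior_subset hK₂.isClosed
  refine ⟨f, ⟨hf, hK₂.of_isClosed_subset (isClosed_tsupport _) hs, hs.trans hK₂Ω⟩,
    fun x => (h01 (mem_range_self x)).1, fun x => (h01 (mem_range_self x)).2,
    interior K', isOpen_interior, hKK', fun x hx => (h1 x).1 (interior_subset hx)⟩

end TestFunctions

/-! ### Cutoffs of the weight, and plateaus. -/

section Cutoff

/-- `l` is a smooth function on the line with compact support in `(0, ∞)`. -/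
structure IsCutoff (l : ℝ → ℝ) : Prop where
  smooth : ContDiff ℝ ∞ l
  support : ∃ a b : ℝ, 0 < a ∧ ∀ t, t ∉ Icc a b → l t = 0

namespace IsCutoff

variable {k : ℝ → ℝ}

lemma continuous (h : IsCutoff l) : Continuous l := h.smooth.continuous

lemma differentiable (h : IsCutoff l) : Differentiable ℝ l := h.smooth.differentiable (by simp)

lemma eq_zero_of_nonpos (h : IsCutoff l) (ht : t ≤ 0) : l t = 0 := by
  obtain ⟨a, b, ha, hl⟩ := h.support; exact hl t fun h' => absurd h'.1 (by linarith)

lemma hasCompactSupport (h : IsCutoff l) : HasCompactSupport l := by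
  obtain ⟨a, b, ha, hl⟩ := h.support
  exact HasCompactSupport.intro isCompact_Icc fun t ht => hl t ht

lemma bounded (h : IsCutoff l) : ∃ C, ∀ t, |l t| ≤ C :=
  h.continuous.bounded_above_of_compact_support h.hasCompactSupport

lemma deriv (h : IsCutoff l) : IsCutoff (deriv l) where
  smooth := (contDiff_infty_iff_deriv.1 h.smooth).2
  support := by
    obtain ⟨a, b, ha, hl⟩ := h.support; refine ⟨a, b, ha, fun t ht => ?_⟩
    have : l =ᶠ[𝓝 t] fun _ => 0 := by
      filter_upwards [isClosed_Icc.isOpen_compl.mem_nhds ht] with s hs using hl s hs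
    rw [this.deriv_eq]; simp

/-- Smoothness of f is asked only on (0, ∞), because l vanishes near the rest of the line. This
admits division by t and real powers of t. -/
lemma mul_left (h : IsCutoff l) {f : ℝ → ℝ} (hf : ContDiffOn ℝ ∞ f (Ioi 0)) :
    IsCutoff (fun t => f t * l t) where
  smooth := by
    obtain ⟨a, b, ha, hl⟩ := h.support
    rw [contDiff_iff_contDiffAt]
    intro t
    rcases lt_or_ge t a with hta | hta
    · have : (fun t => f t * l t) =ᶠ[𝓝 t] fun _ => 0 := by
        filter_upwards [Iio_mem_nhds hta] with s hs
        rw [hl s fun h' => absurd h'.1 (not_le.2 hs), mul_zero]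
      exact contDiffAt_const.congr_of_eventuallyEq this
    · exact (hf.contDiffAt (Ioi_mem_nhds (ha.trans_le hta))).mul h.smooth.contDiffAt
  support := by
    obtain ⟨a, b, ha, hl⟩ := h.support
    exact ⟨a, b, ha, fun t ht => by rw [hl t ht, mul_zero]⟩

lemma div_id (h : IsCutoff l) : IsCutoff (fun t => l t / t) := by
  have := h.mul_left (f := fun t => t⁻¹) (fun t ht =>
    (contDiffAt_inv ℝ (ne_of_gt ht)).contDiffWithinAt)
  simpa [div_eq_inv_mul] using this

lemma mul (h : IsCutoff l) (h' : IsCutoff k) : IsCutoff (fun t => l t * k t) :=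
  h'.mul_left h.smooth.contDiffOn

/-- Smooth compactly supported functions of `log t`. -/
lemma of_log {H : ℝ → ℝ} (hH : ContDiff ℝ ∞ H) {b : ℝ} (hs : ∀ s, s ∉ Icc a b → H s = 0) :
    IsCutoff (fun t => if 0 < t then H (log t) else 0) where
  smooth := by
    rw [contDiff_iff_contDiffAt]
    intro t
    rcases lt_or_ge t (exp a) with hta | hta
    · have : (fun t => if 0 < t then H (log t) else 0) =ᶠ[𝓝 t] fun _ => 0 := by
        filter_upwards [Iio_mem_nhds hta] with s h's
        split_ifs with h0
        · refine hs _ fun h' => absurd h'.1 (not_le.2 ?_)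
          rwa [log_lt_iff_lt_exp h0]
        · rfl
      exact contDiffAt_const.congr_of_eventuallyEq this
    · have ht : 0 < t := (exp_pos a).trans_le hta
      have : (fun t => if 0 < t then H (log t) else 0) =ᶠ[𝓝 t] fun t => H (log t) := by
        filter_upwards [Ioi_mem_nhds ht] with s h's
        exact if_pos h's
      exact (hH.contDiffAt.comp t (contDiffAt_log.2 ht.ne')).congr_of_eventuallyEq this
  support := by
    refine ⟨exp a, exp b, exp_pos a, fun t ht => ?_⟩
    split_ifs with h0
    · refine hs _ fun h' => ht ⟨?_, ?_⟩
      · rw [← le_log_iff_exp_le h0]; exact h'.1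
      · rw [← log_le_iff_le_exp h0]; exact h'.2
    · rfl

lemma deriv_log {H : ℝ → ℝ} (hH : ContDiff ℝ ∞ H) (ht : 0 < t) : _root_.deriv (fun t => if 0 < t
    then H (log t) else 0) t = _root_.deriv H (log t) / t := by
  have : (fun t => if 0 < t then H (log t) else 0) =ᶠ[𝓝 t] fun t => H (log t) := by
    filter_upwards [Ioi_mem_nhds ht] with s h's; exact if_pos h's
  rw [this.deriv_eq]
  have h1 : HasDerivAt H (_root_.deriv H (log t)) (log t) :=
    (hH.differentiable (by simp) _).hasDerivAt
  have := h1.comp t (hasDerivAt_log ht.ne'); rw [div_eq_mul_inv]; exact this.deriv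

end IsCutoff

lemma σ_deriv_nonneg (s : ℝ) : 0 ≤ deriv σ s :=
  smoothTransition.monotone.deriv_nonneg

/-- Outside (0, 1), endpoints included, σ is at its minimum 0 or its maximum 1. -/
lemma σ_deriv_of_notMem (hs : s ∉ Ioo 0 1) : deriv σ s = 0 := by
  rcases le_or_gt s 0 with h | h
  · have : IsLocalMin σ s := .of_forall fun t => by rw [σ_eq_zero h]; exact σ_nonneg t
    exact this.deriv_eq_zero
  · have h1 : 1 ≤ s := by by_contra h'; exact hs ⟨h, not_le.1 h'⟩
    have : IsLocalMax σ s := .of_forall fun t => by rw [σ_eq_one h1]; exact σ_le_one t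
    exact this.deriv_eq_zero

lemma σ_contDiff : ContDiff ℝ ∞ σ :=
  smoothTransition.contDiff

lemma exists_σ_deriv_le : ∃ M : ℝ, 0 < M ∧ ∀ s, deriv σ s ≤ M := by
  have hc : Continuous (deriv σ) := σ_contDiff.continuous_deriv (by simp)
  have hs : HasCompactSupport (deriv σ) :=
    HasCompactSupport.intro (isCompact_Icc (a := (0 : ℝ)) (b := 1)) fun s hs =>
      σ_deriv_of_notMem fun h => hs (Ioo_subset_Icc_self h)
  obtain ⟨M, hM⟩ := hc.bounded_above_of_compact_support hs
  exact ⟨max M 1, by positivity, fun s => (le_abs_self _).trans ((hM s).trans (le_max_left _ _))⟩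

/-- A cutoff equal to one on `[c, N]` and supported in `[c / 2, 2 N]`. -/
noncomputable def plateau (c N t : ℝ) : ℝ :=
  σ (2 * t / c - 1) * σ (2 - t / N)

section plateau

lemma plateau_isCutoff (hc : 0 < c) (hN : 0 < N) : IsCutoff (plateau c N) where
  smooth := by
    unfold plateau
    exact (σ_contDiff.comp (by fun_prop)).mul
      (σ_contDiff.comp (by fun_prop))
  support := by
    refine ⟨c / 2, 2 * N, by positivity, fun t ht => ?_⟩
    unfold plateau
    rcases lt_or_ge t (c / 2) with h | h
    · rw [σ_eq_zero, zero_mul]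
      rw [sub_nonpos, div_le_one hc]; linarith
    · rw [σ_eq_zero (x := 2 - t / N), mul_zero]
      have : 2 * N < t := by
        by_contra h'
        exact ht ⟨h, not_lt.1 h'⟩
      rw [sub_nonpos, le_div_iff₀ hN]; linarith

lemma plateau_nonneg (t : ℝ) : 0 ≤ plateau c N t :=
  mul_nonneg (σ_nonneg _) (σ_nonneg _)

lemma plateau_le_one (t : ℝ) : plateau c N t ≤ 1 :=
  mul_le_one₀ (σ_le_one _) (σ_nonneg _) (σ_le_one _)

/-- In the applications e ≥ c on the support of the test function, so the lower ramp is never met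
and only the decreasing upper ramp matters. -/
lemma plateau_of_ge (hc : 0 < c) (ht : c ≤ t) : plateau c N t = σ (2 - t / N) := by
  unfold plateau; rw [σ_eq_one, one_mul]; rw [le_sub_iff_add_le, le_div_iff₀ hc]; linarith

lemma plateau_eq_one (hc : 0 < c) (hN : 0 < N) (ht : c ≤ t) (htN : t ≤ N) : plateau c N t = 1 := by
  rw [plateau_of_ge hc ht, σ_eq_one]; have : t / N ≤ 1 := (div_le_one hN).2 htN; linarith

lemma deriv_plateau (hc : 0 < c) (ht : c ≤ t) : deriv (plateau c N) t = -(deriv σ (2 - t / N) / N)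
    := by
  have h1 : HasDerivAt (fun t => σ (2 * t / c - 1)) 0 t := by
    have e : deriv σ (2 * t / c - 1) = 0 := by
      apply σ_deriv_of_notMem; intro h; have : 2 * t / c < 2 := by linarith [h.2]
      rw [div_lt_iff₀ hc] at this; linarith
    have h2 : HasDerivAt (fun t : ℝ => 2 * t / c - 1) (2 * 1 / c) t :=
      (((hasDerivAt_id t).const_mul 2).div_const c).sub_const 1
    have h3 := (σ_contDiff.differentiable (by simp) (2 * t / c - 1)).hasDerivAt.comp t h2
    rw [e, zero_mul] at h3; exact h3
  have h2 : HasDerivAt (fun t => σ (2 - t / N)) (deriv σ (2 - t / N) * -(1 / N)) t := by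
    have h2 : HasDerivAt (fun t : ℝ => 2 - t / N) (-(1 / N)) t :=
      ((hasDerivAt_id t).div_const N).const_sub 2
    exact (σ_contDiff.differentiable (by simp) (2 - t / N)).hasDerivAt.comp t h2
  have h3 := (h1.mul h2).deriv
  have e1 : σ (2 * t / c - 1) = 1 := by
    apply σ_eq_one; rw [le_sub_iff_add_le, le_div_iff₀ hc]; linarith
  rw [e1, zero_mul, zero_add, one_mul] at h3
  rw [show plateau c N = (fun t => σ (2 * t / c - 1)) * fun t => σ (2 - t / N) from rfl, h3]; ring

/-- This sign makes truncation harmless: the terms produced by the upper ramp can be dropped. -/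
lemma deriv_plateau_nonpos (hc : 0 < c) (hN : 0 < N) (ht : c ≤ t) : deriv (plateau c N) t ≤ 0 := by
  rw [deriv_plateau hc ht, neg_nonpos]; exact div_nonneg (σ_deriv_nonneg _) hN.le

lemma tendsto_plateau (hc : 0 < c) (ht : c ≤ t) : ∀ᶠ j : ℕ in atTop, plateau c (j + 1) t = 1 := by
  obtain ⟨N, hN⟩ := exists_nat_ge t; filter_upwards [eventually_ge_atTop N] with j hj
  have : (N : ℝ) ≤ j := by exact_mod_cast hj
  exact plateau_eq_one hc (by positivity) ht (by linarith)

end plateau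

end Cutoff

/-! ### Fatou's lemma for a sum of two integrals. -/

section Fatou

lemma ENNReal.le_liminf_add_nat (u v : ℕ → ℝ≥0∞) : liminf u atTop + liminf v atTop ≤ liminf (fun j
    => u j + v j) atTop := by
  simp only [liminf_eq_iSup_iInf_of_nat]
  have hm : ∀ w : ℕ → ℝ≥0∞, Monotone fun j => ⨅ i ≥ j, w i := fun w j k hjk =>
    biInf_mono fun i hi => hjk.trans hi
  rw [iSup_add_iSup_of_monotone (hm u) (hm v)]; refine iSup_mono fun j => le_iInf₂ fun i hi => ?_
  exact add_le_add (iInf₂_le i hi) (iInf₂_le i hi)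

/-- The Lebesgue term and the ν-term are bounded only jointly, so Fatou's lemma is applied to both
inside a single inequality. -/
lemma lintegral_add_lintegral_le_of_tendsto {α β : Type*} [MeasurableSpace α] [MeasurableSpace β] {μ
    : Measure α} {ν : Measure β} {f : ℕ → α → ℝ≥0∞} {F : α → ℝ≥0∞} {h : ℕ → β → ℝ≥0∞} {H : β → ℝ≥0∞}
    {c : ℕ → ℝ≥0∞} {C : ℝ≥0∞} (hf : ∀ j, AEMeasurable (f j) μ) (hh : ∀ j, AEMeasurable (h j) ν) (hF
    : ∀ᵐ x ∂μ, Tendsto (fun j => f j x) atTop (𝓝 (F x))) (hH : ∀ᵐ x ∂ν, Tendsto (fun j => h j x)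
    atTop (𝓝 (H x))) (hc : Tendsto c atTop (𝓝 C)) (hle : ∀ j, ∫⁻ x, f j x ∂μ + ∫⁻ x, h j x ∂ν ≤ c j)
    : ∫⁻ x, F x ∂μ + ∫⁻ x, H x ∂ν ≤ C := by
  have h1 : ∫⁻ x, F x ∂μ ≤ liminf (fun j => ∫⁻ x, f j x ∂μ) atTop := by
    rw [lintegral_congr_ae (hF.mono fun x hx => hx.liminf_eq.symm)]; exact lintegral_liminf_le' hf
  have h2 : ∫⁻ x, H x ∂ν ≤ liminf (fun j => ∫⁻ x, h j x ∂ν) atTop := by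
    rw [lintegral_congr_ae (hH.mono fun x hx => hx.liminf_eq.symm)]; exact lintegral_liminf_le' hh
  calc _ ≤ _ := add_le_add h1 h2
    _ ≤ liminf (fun j => ∫⁻ x, f j x ∂μ + ∫⁻ x, h j x ∂ν) atTop := ENNReal.le_liminf_add_nat _ _
    _ ≤ liminf c atTop := liminf_le_liminf (.of_forall hle)
    _ = C := hc.liminf_eq

end Fatou

/-! ### The Hardy inequality with remainder, for test functions. -/

section Hardy

lemma ofReal_half : ofReal (1 / 2) = 1 / 2 := by
  rw [ofReal_div_of_pos two_pos]; simp

lemma ofReal_quarter : ofReal (1 / 4) = 1 / 4 := by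
  rw [ofReal_div_of_pos four_pos]; simp

/-- The functional `φ ↦ ∫ ⟨A∇e, ∇(φ l(e))⟩`, for a function `e` with ∇ `G`. -/
noncomputable def truncForm (Ω : Set (Eu n)) (A : Eu n → Mat n) (e : Eu n → ℝ)
    (G : Eu n → Eu n) (φ : Eu n → ℝ) (l : ℝ → ℝ) : ℝ :=
  ∫ x in Ω, (l (e x) * Q[A,G,∇ φ]x
    + φ x * deriv l (e x) * Q[A,G,G]x)

/-- `e` is positive with ∇ field `G`, and satisfies `-div (A∇e) ≥ ν ≥ 0`, tested against
products of test functions and cutoffs of `e`. -/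
structure IsSupersolution (Ω : Set (Eu n)) (A : Eu n → Mat n) (e : Eu n → ℝ)
    (G : Eu n → Eu n) (ν : Measure (Eu n)) : Prop where
  isOpen : IsOpen Ω
  elliptic : IsUniformlyElliptic Ω A
  meas : AEStronglyMeasurable e vol[Ω]
  meas' : AEMeasurable e ν
  loc : LocallyIntegrableOn G Ω volume
  lower : ∀ K ⊆ Ω, IsCompact K → ∃ c > 0, (∀ᵐ x ∂vol[Ω], x ∈ K → c ≤ e x) ∧
    ∀ᵐ x ∂ν, x ∈ K → c ≤ e x
  int : ∀ φ, IsTestFunction Ω φ → ∀ l, IsCutoff l →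
    Integrable (fun x => φ x * l (e x) * Q[A,G,G]x) vol[Ω]
  ineq : ∀ φ, IsTestFunction Ω φ → (∀ x, 0 ≤ φ x) → ∀ l, IsCutoff l → (∀ t, 0 ≤ l t) →
    ∫⁻ x, ofReal (φ x * l (e x)) ∂ν ≤ ofReal (truncForm Ω A e G φ l) ∧
      0 ≤ truncForm Ω A e G φ l

/-- `∫ (|G|_A² / e²) u²` for a real-valued function `e`. -/
noncomputable def hardyR (Ω : Set (Eu n)) (A : Eu n → Mat n) (e : Eu n → ℝ)
    (G : Eu n → Eu n) (u : Eu n → ℝ) : ℝ≥0∞ :=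
  ∫⁻ x in Ω, ofReal (u x ^ 2 / e x ^ 2 * Q[A,G,G]x)

lemma integrable_of_le_of_compact {F : Type*} [NormedAddCommGroup F] {f : Eu n → F} {g : Eu n → ℝ}
    (hf : LocallyIntegrableOn f Ω volume) (hg : AEStronglyMeasurable g vol[Ω]) (hK : IsCompact K)
    (hKΩ : K ⊆ Ω) (h : ∀ᵐ x ∂vol[Ω], |g x| ≤ C * ‖f x‖) (h0 : ∀ᵐ x ∂vol[Ω], x ∉ K → g x = 0) :
    Integrable g vol[Ω] := by
  have h1 : IntegrableOn (fun x => C * ‖f x‖) K volume :=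
    (hf.integrableOn_compact_subset hKΩ hK).norm.const_mul C
  have h2 : Integrable (K.indicator fun x => C * ‖f x‖) vol[Ω] :=
    (h1.integrable_indicator hK.measurableSet).mono_measure restrict_le_self
  refine h2.mono' hg ?_; filter_upwards [h, h0] with x hx hx0
  by_cases hxK : x ∈ K
  · rw [indicator_of_mem hxK]; exact hx
  · rw [indicator_of_notMem hxK, hx0 hxK, norm_zero]

lemma integrable_matForm_of_compact (hΩ : IsOpen Ω) (hA : IsUniformlyElliptic Ω A) (hG :
    LocallyIntegrableOn G Ω volume) {b : Eu n → ℝ} {H : Eu n → Eu n} (hb : AEStronglyMeasurable b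
    vol[Ω]) (hC : ∀ x, |b x| ≤ C) (hH : AEStronglyMeasurable H vol[Ω]) (hD : ∀ x, ‖H x‖ ≤ D) (hK :
    IsCompact K) (hKΩ : K ⊆ Ω) (h0 : ∀ x, x ∉ K → b x = 0 ∨ H x = 0) : Integrable (fun x => b x *
    Q[A,G,H]x) vol[Ω] := by
  obtain ⟨lam, Lam, hl, hL, hb'⟩ := hA.exists_bounds
  refine integrable_of_le_of_compact (C := C * (Lam * D)) hG
    (hb.mul (hA.aestronglyMeasurable hG.aestronglyMeasurable hH)) hK hKΩ ?_ ?_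
  · filter_upwards [hΩ.ae_mem] with x hx; rw [abs_mul, mul_assoc]
    refine mul_le_mul (hC x) (((hb' x hx).2 _ _).trans ?_) (abs_nonneg _)
      ((abs_nonneg _).trans (hC x))
    calc Lam * ‖G x‖ * ‖H x‖ ≤ Lam * ‖G x‖ * D := by gcongr; exact hD x
      _ = _ := by ring
  · refine .of_forall fun x hx => ?_
    rcases h0 x hx with h | h <;> simp [h]

lemma IsTestFunction.integrable_energy (hφ : IsTestFunction Ω φ) (hΩ : IsOpen Ω) (hA :
    IsUniformlyElliptic Ω A) {b : Eu n → ℝ} (hb : AEStronglyMeasurable b vol[Ω]) (hC : ∀ x, |b x| ≤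
    C) : Integrable (fun x => b x * Q[A,∇ φ,∇ φ]x) vol[Ω] := by
  obtain ⟨D, hD⟩ := hφ.gradient_bounded
  refine integrable_matForm_of_compact hΩ hA
    (hφ.continuous_gradient.locallyIntegrable.locallyIntegrableOn Ω) hb hC
    hφ.continuous_gradient.aesm hD hφ.compactSupport hφ.support_subset ?_
  exact fun x hx => Or.inr (gradient_eq_zero hx)

namespace IsSupersolution

lemma measurable_comp (h : IsSupersolution Ω A e G ν) (hl : Continuous l) : AEStronglyMeasurable
    (fun x => l (e x)) vol[Ω] :=
  hl.comp_aestronglyMeasurable h.meas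

lemma integrable_cross (h : IsSupersolution Ω A e G ν) (hφ : IsTestFunction Ω φ) (hl : IsCutoff l) :
    Integrable (fun x => l (e x) * Q[A,G,∇ φ]x) vol[Ω] := by
  obtain ⟨D, hD⟩ := hφ.gradient_bounded; obtain ⟨C, hC⟩ := hl.bounded
  exact integrable_matForm_of_compact h.isOpen h.elliptic h.loc (h.measurable_comp hl.continuous)
    (fun x => hC _) hφ.continuous_gradient.aesm hD hφ.compactSupport
    hφ.support_subset fun x hx => Or.inr (gradient_eq_zero hx)

/-- The admissible substitute for φ²/e is φ² l(e) with l(t) = ζ(t)/t. Adding half of the form tested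
with it to the left-hand density leaves ζ(e)|∇φ|² + ½ φ² (ζ'(e)/e)|G|², and this is at most |∇φ|²,
because ζ ≤ 1 and ζ' ≤ 0 where e ≥ c. -/
lemma hardy_plateau (h : IsSupersolution Ω A e G ν) (hφ : IsTestFunction Ω φ) (hc : 0 < c) (hN : 0 <
    N) (hlow : ∀ᵐ x ∂vol[Ω], x ∈ tsupport φ → c ≤ e x) : (∫⁻ x in Ω, ofReal (plateau c N (e x) *
    P[A,∇ φ,φ,e,G]x)) + ∫⁻ x, ofReal (1 / 2 * (φ x ^ 2 * (plateau c N (e x) / e x))) ∂ν ≤ energyA Ω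
    A (∇ φ) := by
  set ζ := plateau c N; have hζ : IsCutoff ζ := plateau_isCutoff hc hN
  set l : ℝ → ℝ := fun t => ζ t / t with hl_def; have hl : IsCutoff l := hζ.div_id
  have hl2 : IsCutoff (fun t => l t / t) := hl.div_id; have hφ2 := hφ.sq
  have hl0 : ∀ t, 0 ≤ l t := fun t => by
    rcases le_or_gt t 0 with h0 | h0
    · exact (hl.eq_zero_of_nonpos h0).ge
    · exact div_nonneg (plateau_nonneg _) h0.le
  have i1 : Integrable (fun x => ζ (e x) * Q[A,∇ φ,∇ φ]x)
      vol[Ω] := hφ.integrable_energy h.isOpen h.elliptic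
        (h.measurable_comp hζ.continuous) (C := 1) fun x => by
          rw [abs_of_nonneg (plateau_nonneg _)]; exact plateau_le_one _
  have i1' : Integrable (fun x => 1 * Q[A,∇ φ,∇ φ]x)
      vol[Ω] := hφ.integrable_energy h.isOpen h.elliptic
        aestronglyMeasurable_const (C := 1) fun x => by simp
  have i2 := h.integrable_cross hφ2 hl; have i3 := h.int _ hφ2 _ hl2
  have i4 := h.int _ hφ2 _ hl.deriv
  set F : Eu n → ℝ := fun x => plateau c N (e x) * P[A,∇ φ,φ,e,G]x with hF
  -- The completed square, multiplied by ζ(e): the cross term is written through ∇(φ²), and the two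
  -- terms in |G|² add up to the coefficient ¼ + ¼ = ½.
  have hpt : ∀ᵐ x ∂vol[Ω], F x = ζ (e x) * Q[A,∇ φ,∇ φ]x
      - 1 / 2 * (l (e x) * Q[A,G,∇ (fun y => φ y ^ 2)]x)
      + 1 / 2 * (φ x ^ 2 * (l (e x) / e x) * Q[A,G,G]x) := by
    filter_upwards [hlow, h.isOpen.ae_mem] with x hx hxΩ
    have hs := h.elliptic.symm x hxΩ; simp only [hF]; rw [hφ.gradient_sq]
    by_cases hxs : x ∈ tsupport φ
    · have : e x ≠ 0 := (hc.trans_le (hx hxs)).ne'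
      simp only [hl_def, matForm_sub_left, matForm_sub_right, matForm_smul_left,
        matForm_smul_right, matForm_comm hs (∇ φ x) (G x), ζ]
      field_simp; ring
    · simp [gradient_eq_zero hxs, eq_zero_of_notMem hxs]
  have hF0 : ∀ᵐ x ∂vol[Ω], 0 ≤ F x := by
    filter_upwards [h.isOpen.ae_mem] with x hxΩ
    have a1 := h.elliptic.matForm_nonneg hxΩ R[∇ φ,φ,e,G]x
    have a2 := h.elliptic.matForm_nonneg hxΩ (G x)
    have a3 := plateau_nonneg (c := c) (N := N) (e x); simp only [hF]; positivity
  have iF : Integrable F vol[Ω] :=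
    (((i1.sub (i2.const_mul (1 / 2))).add (i3.const_mul (1 / 2)))).congr
      (hpt.mono fun x hx => hx.symm)
  have hle : (∫ x in Ω, F x) + 1 / 2 * truncForm Ω A e G (fun y => φ y ^ 2) l
      ≤ ∫ x in Ω, 1 * Q[A,∇ φ,∇ φ]x := by
    have i24 : Integrable (fun x => 1 / 2 * (l (e x) * Q[A,G,∇ (fun y => φ y ^ 2)]x + φ x ^ 2 * deriv l (e x) * Q[A,G,G]x))
        vol[Ω] := (i2.add i4).const_mul _
    rw [truncForm, ← integral_const_mul, ← integral_add iF i24]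
    refine integral_mono_ae (iF.add i24) i1' ?_
    filter_upwards [hpt, hlow, h.isOpen.ae_mem] with x hx hxl hxΩ
    rw [hx, one_mul]; have n1 := h.elliptic.matForm_nonneg hxΩ (∇ φ x)
    have n2 := h.elliptic.matForm_nonneg hxΩ (G x); have n3 : ζ (e x) ≤ 1 := plateau_le_one _
    by_cases hxs : x ∈ tsupport φ
    · have hce := hxl hxs; have hpos : 0 < e x := hc.trans_le hce
      have hd : deriv l (e x) = deriv ζ (e x) / e x - l (e x) / e x := by
        have := ((hζ.differentiable (e x)).hasDerivAt.div (hasDerivAt_id (e x)) hpos.ne').deriv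
        have e2 : deriv l (e x) = _ := this; rw [e2]; simp only [hl_def, id]; field_simp
      -- The only place where the truncation enters, and with the favourable sign.
      have n4 : deriv ζ (e x) / e x ≤ 0 :=
        div_nonpos_of_nonpos_of_nonneg (deriv_plateau_nonpos hc hN hce) hpos.le
      rw [hd]
      have n5 : φ x ^ 2 * (deriv ζ (e x) / e x) * Q[A,G,G]x ≤ 0 :=
        mul_nonpos_of_nonpos_of_nonneg (mul_nonpos_of_nonneg_of_nonpos (sq_nonneg _) n4) n2
      have n6 : ζ (e x) * Q[A,∇ φ,∇ φ]x ≤ Q[A,∇ φ,∇ φ]x := mul_le_of_le_one_left n1 n3; linarith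
    · rw [hφ.gradient_sq, gradient_eq_zero hxs, eq_zero_of_notMem hxs]; simp
  obtain ⟨hν, hΛ⟩ := h.ineq _ hφ2 (fun x => sq_nonneg _) l hl hl0
  have e1 : energyA Ω A (∇ φ) = ofReal (∫ x in Ω, 1 * Q[A,∇ φ,∇ φ]x) := by
    rw [ofReal_integral_eq_lintegral_ofReal i1']
    · simp [energyA]
    · filter_upwards [h.isOpen.ae_mem] with x hxΩ; simpa using h.elliptic.matForm_nonneg hxΩ (∇ φ x)
  have e2 : ∫⁻ x, ofReal (1 / 2 * (φ x ^ 2 * (plateau c N (e x) / e x))) ∂ν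
      = ofReal (1 / 2) * ∫⁻ x, ofReal (φ x ^ 2 * l (e x)) ∂ν := by
    rw [← lintegral_const_mul' _ _ ofReal_ne_top]; refine lintegral_congr fun x => ?_
    rw [← ofReal_mul (by norm_num)]
  rw [e1, e2]
  calc _ ≤ ofReal (∫ x in Ω, F x)
        + ofReal (1 / 2) * ofReal (truncForm Ω A e G (fun y => φ y ^ 2) l) := by
        rw [ofReal_integral_eq_lintegral_ofReal iF hF0]
        exact add_le_add le_rfl (mul_le_mul_right hν _)
    _ = ofReal ((∫ x in Ω, F x) + 1 / 2 * truncForm Ω A e G (fun y => φ y ^ 2) l) := by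
        rw [← ofReal_mul (by norm_num), ← ofReal_add (integral_nonneg_of_ae hF0) (by positivity)]
    _ ≤ _ := ofReal_le_ofReal hle

/-- Remainder and Hardy term are merged into one nonnegative density, so that limits are taken once
for both. -/
lemma energyA_add_hardyR (h : IsSupersolution Ω A e G ν) {w : Eu n → Eu n} (hw :
    AEStronglyMeasurable w vol[Ω]) (hu : AEStronglyMeasurable u vol[Ω]) : energyA Ω A (fun x => R[w,u,e,G]x) + 1 / 4 * hardyR Ω A e G u = ∫⁻ x in Ω, ofReal P[A,w,u,e,G]x ∧ AEMeasurable (fun x => P[A,w,u,e,G]x) vol[Ω] := by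
  have hw : AEStronglyMeasurable (fun x => R[w,u,e,G]x) vol[Ω] := by
    refine hw.sub (AEStronglyMeasurable.fun_smul ?_ h.loc.aestronglyMeasurable)
    exact (hu.aemeasurable.div (h.meas.aemeasurable.const_mul 2)).aestronglyMeasurable
  have hm1 := h.elliptic.aestronglyMeasurable hw hw
  have hm2 := h.elliptic.aestronglyMeasurable h.loc.aestronglyMeasurable h.loc.aestronglyMeasurable
  have hm3 : AEMeasurable (fun x => u x ^ 2 / e x ^ 2 * Q[A,G,G]x)
      vol[Ω] := (((hu.aemeasurable.pow_const 2).div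
        (h.meas.aemeasurable.pow_const 2))).mul hm2.aemeasurable
  refine ⟨?_, hm1.aemeasurable.add (hm3.const_mul _)⟩
  rw [energyA, hardyR, ← lintegral_const_mul'' _ hm3.ennreal_ofReal,
    ← lintegral_add_left' hm1.aemeasurable.ennreal_ofReal]
  refine lintegral_congr_ae ?_; filter_upwards [h.isOpen.ae_mem] with x hxΩ
  have a1 := h.elliptic.matForm_nonneg hxΩ R[w,u,e,G]x
  have a2 := h.elliptic.matForm_nonneg hxΩ (G x)
  rw [ofReal_add a1 (by positivity), ofReal_mul (by norm_num : (0:ℝ) ≤ 1 / 4), ofReal_quarter]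

/-- The Hardy inequality with remainder, for test functions. -/
theorem hardy_test (h : IsSupersolution Ω A e G ν) (hφ : IsTestFunction Ω φ) : energyA Ω A (fun x =>
    R[∇ φ,φ,e,G]x) + 1 / 4 * hardyR Ω A e G φ + 1 / 2 * ∫⁻ x, ofReal (φ x ^ 2 / e x) ∂ν ≤ energyA Ω
    A (∇ φ) := by
  obtain ⟨c, hc, hlow, hlow'⟩ := h.lower _ hφ.support_subset hφ.compactSupport
  obtain ⟨hsum, hm⟩ := h.energyA_add_hardyR hφ.continuous_gradient.aesm
    hφ.continuous.aesm
  have hsum2 : 1 / 2 * ∫⁻ x, ofReal (φ x ^ 2 / e x) ∂ν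
      = ∫⁻ x, ofReal (1 / 2 * (φ x ^ 2 / e x)) ∂ν := by
    rw [← lintegral_const_mul' _ _ (by norm_num)]
    refine lintegral_congr fun x => ?_; rw [ofReal_mul (by norm_num), ofReal_half]
  rw [hsum, hsum2]
  -- The plateau height N = j + 1 tends to infinity; since e ≥ c on the support, the plateaus are
  -- eventually one at each point.
  refine lintegral_add_lintegral_le_of_tendsto (c := fun _ => energyA Ω A (∇ φ)) ?_ ?_ ?_ ?_
    tendsto_const_nhds fun j : ℕ => h.hardy_plateau hφ hc (N := j + 1) (by positivity) hlow
  · intro j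
    exact (((h.measurable_comp (plateau_isCutoff hc (by positivity)).continuous).aemeasurable).mul
      hm).ennreal_ofReal
  · intro j
    refine AEMeasurable.ennreal_ofReal (AEMeasurable.const_mul (AEMeasurable.mul
      (hφ.continuous.aemeasurable.pow_const 2) ?_) _)
    exact ((plateau_isCutoff hc (by positivity)).continuous.measurable.comp_aemeasurable
      h.meas').div h.meas'
  · filter_upwards [hlow] with x hx
    by_cases hxs : x ∈ tsupport φ
    · refine tendsto_const_nhds.congr' ?_; filter_upwards [tendsto_plateau hc (hx hxs)] with j hj
      rw [hj, one_mul]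
    · rw [gradient_eq_zero hxs, eq_zero_of_notMem hxs]; simp
  · filter_upwards [hlow'] with x hx
    by_cases hxs : x ∈ tsupport φ
    · refine tendsto_const_nhds.congr' ?_; filter_upwards [tendsto_plateau hc (hx hxs)] with j hj
      rw [hj]; congr 1; ring
    · rw [eq_zero_of_notMem hxs]; simp

end IsSupersolution

end Hardy

/-! ### Averaging kernels and convergence in L^p. -/

section Kernel

variable {F : Type*} [NormedAddCommGroup F] [NormedSpace ℝ F]

/-- A bounded averaging kernel supported in the closed ball of radius `r`. -/
structure IsKernel (κ : Eu n → ℝ) (r : ℝ) : Prop where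
  nonneg : ∀ x, 0 ≤ κ x
  meas : AEStronglyMeasurable κ volume
  integral_one : ∫ x, κ x = 1
  bdd : ∃ C, ∀ x, κ x ≤ C
  supp : ∀ x, r < ‖x‖ → κ x = 0

/-- Convolution with a scalar kernel. -/
noncomputable def cv (κ : Eu n → ℝ) (f : Eu n → F) : Eu n → F :=
  convolution κ f (ContinuousLinearMap.lsmul ℝ ℝ) volume

lemma cv_apply (κ : Eu n → ℝ) (f : Eu n → F) (x : Eu n) : cv κ f x = ∫ t, κ t • f (x - t) := by
  simp [cv, convolution]

lemma cv_apply_swap (κ : Eu n → ℝ) (f : Eu n → F) (x : Eu n) : cv κ f x = ∫ t, κ (x - t) • f t := by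
  rw [cv_apply, ← integral_sub_left_eq_self _ volume x]; simp

namespace IsKernel

lemma integrable (h : IsKernel κ r) : Integrable κ volume := by
  by_contra h'; have := h.integral_one; rw [integral_undef h'] at this; exact zero_ne_one this

lemma lintegral_one (h : IsKernel κ r) : ∫⁻ t, ofReal (κ t) = 1 := by
  rw [← ofReal_integral_eq_lintegral_ofReal h.integrable (.of_forall h.nonneg),
    h.integral_one, ofReal_one]

lemma integrable_smul (h : IsKernel κ r) {f : Eu n → F} (hf : IntegrableOn f (closedBall x r)
    volume) : Integrable (fun t => κ (x - t) • f t) volume := by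
  obtain ⟨C, hC⟩ := h.bdd
  have h1 : Integrable (fun t => κ (x - t) • (closedBall x r).indicator f t) volume := by
    refine Integrable.bdd_smul (C := C) (hf.integrable_indicator measurableSet_closedBall) ?_ ?_
    · exact h.meas.comp_quasiMeasurePreserving (quasiMeasurePreserving_sub_left volume x)
    · refine .of_forall fun t => ?_; rw [norm_of_nonneg (h.nonneg _)]; exact hC _
  refine h1.congr (.of_forall fun t => ?_)
  by_cases ht : t ∈ closedBall x r
  · simp only [indicator_of_mem ht]
  · have : κ (x - t) = 0 := h.supp _ (by
      rw [mem_closedBall, dist_comm, dist_eq_norm, not_le] at ht; exact ht)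
    simp [this]

lemma cv_sub (h : IsKernel κ r) {f g : Eu n → F} (hf : IntegrableOn f (closedBall x r) volume) (hg :
    IntegrableOn g (closedBall x r) volume) : cv κ (fun y => f y - g y) x = cv κ f x - cv κ g x
    := by
  simp only [cv_apply_swap, smul_sub]
  exact integral_sub (h.integrable_smul hf) (h.integrable_smul hg)

lemma integral_swap_one (h : IsKernel κ r) (x : Eu n) : ∫ t, κ (x - t) = 1 := by
  rw [integral_sub_left_eq_self κ volume x, h.integral_one]

lemma cv_const [CompleteSpace F] (h : IsKernel κ r) (c : F) (x : Eu n) : cv κ (fun _ => c) x = c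
    := by
  rw [cv_apply, integral_smul_const, h.integral_one, one_smul]

lemma cv_congr (h : IsKernel κ r) {f g : Eu n → F} (hfg : ∀ᵐ t, t ∈ closedBall x r → f t = g t) : cv
    κ f x = cv κ g x := by
  rw [cv_apply_swap, cv_apply_swap]; refine integral_congr_ae ?_; filter_upwards [hfg] with t ht
  by_cases h' : t ∈ closedBall x r
  · rw [ht h']
  · have : κ (x - t) = 0 := h.supp _ (by
      rw [mem_closedBall, dist_comm, dist_eq_norm, not_le] at h'; exact h')
    simp [this]

lemma cv_eq_zero (h : IsKernel κ r) {f : Eu n → F} (hf : ∀ t ∈ closedBall x r, f t = 0) : cv κ f x =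
    0 := by
  rw [h.cv_congr (g := fun _ => 0) (.of_forall hf), cv_apply]; simp

lemma norm_cv_sub_le [CompleteSpace F] (h : IsKernel κ r) {f : Eu n → F} {c : F} (hf : IntegrableOn
    f (closedBall x r) volume) (hε : ∀ t ∈ closedBall x r, ‖f t - c‖ ≤ ε) : ‖cv κ f x - c‖ ≤ ε := by
  have h1 : cv κ f x - c = cv κ (fun t => f t - c) x := by
    rw [h.cv_sub hf (integrableOn_const (measure_closedBall_lt_top.ne)), h.cv_const]
  rw [h1, cv_apply_swap]
  calc ‖∫ t, κ (x - t) • (f t - c)‖ ≤ ∫ t, κ (x - t) * ε := by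
        refine norm_integral_le_of_norm_le ((h.integrable.comp_sub_left x).mul_const ε)
          (.of_forall fun t => ?_)
        rw [norm_smul, norm_of_nonneg (h.nonneg _)]
        by_cases h' : t ∈ closedBall x r
        · exact mul_le_mul_of_nonneg_left (hε t h') (h.nonneg _)
        · have : κ (x - t) = 0 := h.supp _ (by
            rw [mem_closedBall, dist_comm, dist_eq_norm, not_le] at h'; exact h')
          simp [this]
    _ = ε := by rw [integral_mul_const, h.integral_swap_one, one_mul]

lemma aestronglyMeasurable_cv (h : IsKernel κ r) {f : Eu n → F} (hf : AEStronglyMeasurable f volume)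
    : AEStronglyMeasurable (cv κ f) volume := by
  have := AEStronglyMeasurable.convolution_integrand (μ := volume) (ν := volume)
    (ContinuousLinearMap.lsmul ℝ ℝ) h.meas hf
  exact this.integral_prod_right'

lemma enorm_cv_le (h : IsKernel κ r) (f : Eu n → F) (x : Eu n) : ‖cv κ f x‖ₑ ≤ ∫⁻ t, ofReal (κ t) *
    ‖f (x - t)‖ₑ := by
  rw [cv_apply]; refine (enorm_integral_le_lintegral_enorm _).trans_eq (lintegral_congr fun t => ?_)
  rw [enorm_smul, enorm_of_nonneg (h.nonneg t)]

/-- The measure κ dx is a probability measure, so |κ * f|^p ≤ κ * |f|^p by Jensen; Tonelli and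
translation invariance do the rest. -/
lemma eLpNorm_cv_le (h : IsKernel κ r) {f : Eu n → F} (hf : AEStronglyMeasurable f volume) {p :
    ℝ≥0∞} (hp : 1 ≤ p) (hp' : p ≠ ⊤) : eLpNorm (cv κ f) p volume ≤ eLpNorm f p volume := by
  have hp0 : p ≠ 0 := (zero_lt_one.trans_le hp).ne'
  have hq : 1 ≤ p.toReal := by rwa [← toReal_one, toReal_le_toReal one_ne_top hp']
  have hq0 : 0 < p.toReal := zero_lt_one.trans_le hq
  rw [eLpNorm_eq_lintegral_rpow_enorm_toReal hp0 hp', eLpNorm_eq_lintegral_rpow_enorm_toReal hp0 hp']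
  refine ENNReal.rpow_le_rpow ?_ (by positivity)
  have hκm : AEMeasurable (fun t => ofReal (κ t)) volume := h.meas.aemeasurable.ennreal_ofReal
  let P : Measure (Eu n) := volume.withDensity fun t => ofReal (κ t)
  have hP : IsProbabilityMeasure P := ⟨by
    rw [withDensity_apply _ MeasurableSet.univ, restrict_univ, h.lintegral_one]⟩
  have hfx : ∀ x : Eu n, AEStronglyMeasurable (fun t => f (x - t)) volume := fun x =>
    hf.comp_quasiMeasurePreserving (quasiMeasurePreserving_sub_left volume x)
  have hpt : ∀ x, ‖cv κ f x‖ₑ ^ p.toReal ≤ ∫⁻ t, ofReal (κ t) * ‖f (x - t)‖ₑ ^ p.toReal := by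
    intro x
    have e1 : ∫⁻ t, ofReal (κ t) * ‖f (x - t)‖ₑ = eLpNorm' (fun t => f (x - t)) 1 P := by
      rw [eLpNorm'_eq_lintegral_enorm]; simp only [ENNReal.rpow_one, div_one]
      exact (lintegral_withDensity_eq_lintegral_mul₀ hκm (hfx x).enorm).symm
    have e2 : ∫⁻ t, ofReal (κ t) * ‖f (x - t)‖ₑ ^ p.toReal
        = eLpNorm' (fun t => f (x - t)) p.toReal P ^ p.toReal := by
      rw [eLpNorm'_eq_lintegral_enorm, ← ENNReal.rpow_mul, one_div, inv_mul_cancel₀ hq0.ne',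
        ENNReal.rpow_one]
      exact (lintegral_withDensity_eq_lintegral_mul₀ hκm ((hfx x).enorm.pow_const _)).symm
    rw [e2]; refine ENNReal.rpow_le_rpow ?_ hq0.le; refine (h.enorm_cv_le f x).trans ?_; rw [e1]
    exact eLpNorm'_le_eLpNorm'_of_exponent_le one_pos hq P
      ((hfx x).mono_ac (withDensity_absolutelyContinuous _ _))
  calc ∫⁻ x, ‖cv κ f x‖ₑ ^ p.toReal
      ≤ ∫⁻ x, ∫⁻ t, ofReal (κ t) * ‖f (x - t)‖ₑ ^ p.toReal := lintegral_mono hpt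
    _ = ∫⁻ t, ∫⁻ x, ofReal (κ t) * ‖f (x - t)‖ₑ ^ p.toReal := by
        refine lintegral_lintegral_swap ?_; refine AEMeasurable.mul ?_ ?_
        · exact hκm.comp_quasiMeasurePreserving quasiMeasurePreserving_snd
        · exact ((hf.comp_quasiMeasurePreserving
            (quasiMeasurePreserving_sub_of_right_invariant volume volume)).enorm).pow_const _
    _ = ∫⁻ t, ofReal (κ t) * ∫⁻ x, ‖f x‖ₑ ^ p.toReal := by
        refine lintegral_congr fun t => ?_
        rw [lintegral_const_mul' _ _ ofReal_ne_top,
          lintegral_sub_right_eq_self (fun x => ‖f x‖ₑ ^ p.toReal) t]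
    _ = ∫⁻ x, ‖f x‖ₑ ^ p.toReal := by rw [lintegral_mul_const'' _ hκm, h.lintegral_one, one_mul]

lemma memLp_cv (h : IsKernel κ r) {f : Eu n → F} {p : ℝ≥0∞} (hp : 1 ≤ p) (hp' : p ≠ ⊤) (hf : MemLp f
    p volume) : MemLp (cv κ f) p volume :=
  ⟨h.aestronglyMeasurable_cv hf.1, (h.eLpNorm_cv_le hf.1 hp hp').trans_lt hf.2⟩

lemma integrable_cv (h : IsKernel κ r) {f : Eu n → F} (hf : Integrable f) : Integrable (cv κ f) :=
  memLp_one_iff_integrable.1 (h.memLp_cv le_rfl (by norm_num) (memLp_one_iff_integrable.2 hf))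

lemma norm_cv_indicator_le (h : IsKernel κ r) (hi : Integrable (K.indicator f)) (hB : ∀ x, |f x| ≤
    B) (x : Eu n) : |cv κ (K.indicator f) x| ≤ B := by
  rw [← sub_zero (cv _ _ x)]; refine h.norm_cv_sub_le hi.integrableOn fun t _ => ?_
  rw [sub_zero]; exact (norm_indicator_le_norm_self f t).trans (hB t)

end IsKernel

/-- Averaging kernels with shrinking supports converge to the identity in `L^p`. -/
lemma tendsto_eLpNorm_cv_sub [CompleteSpace F] {κ : ℕ → Eu n → ℝ} {r : ℕ → ℝ} (hκ : ∀ m, IsKernel (κ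
    m) (r m)) (hr : Tendsto r atTop (𝓝 0)) {f : Eu n → F} {p : ℝ≥0∞} (hp : 1 ≤ p) (hp' : p ≠ ⊤) (hf
    : MemLp f p volume) : Tendsto (fun m => eLpNorm (fun x => cv (κ m) f x - f x) p volume) atTop (𝓝
    0) := by
  rw [ENNReal.tendsto_atTop_zero]; intro ε hε
  obtain ⟨δ, hδ, hδε⟩ : ∃ δ : ℝ≥0∞, 0 < δ ∧ δ + δ + δ ≤ ε := by
    refine ⟨ε / 3, ENNReal.div_pos hε.ne' (by simp), ?_⟩
    rw [ENNReal.add_thirds]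
  -- A continuous compactly supported g near f. By the contraction property the error splits into
  -- three parts of size δ each, and only the middle one, for g, uses the shrinking supports.
  obtain ⟨g, hgc, hfg, hg, hgp⟩ := hf.exists_hasCompactSupport_eLpNorm_sub_le hp' hδ.ne'
  set K := cthickening 1 (tsupport g) with hK; have hKc : IsCompact K := hgc.isCompact.cthickening
  -- A uniform error η on K costs η |K|^(1/p) in L^p; the witness δ/(V + 1) avoids dividing by a
  -- vanishing V.
  obtain ⟨η, hη, hηδ⟩ : ∃ η : ℝ, 0 < η ∧ ofReal η * volume K ^ (1 / p.toReal) ≤ δ := by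
    set V := volume K ^ (1 / p.toReal) with hV
    have hVt : V ≠ ⊤ := (rpow_lt_top_of_nonneg (by positivity) hKc.measure_lt_top.ne).ne
    rcases eq_or_ne δ ⊤ with rfl | hδt
    · exact ⟨1, one_pos, le_top⟩
    refine ⟨(δ / (V + 1)).toReal, toReal_pos ?_ ?_, ?_⟩
    · exact (ENNReal.div_pos hδ.ne' (by finiteness)).ne'
    · exact (div_lt_top hδt (by positivity)).ne
    · rw [ofReal_toReal (div_lt_top hδt (by positivity)).ne]
      calc δ / (V + 1) * V ≤ δ / (V + 1) * (V + 1) := by gcongr; exact le_self_add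
        _ = δ := ENNReal.div_mul_cancel (by positivity) (by finiteness)
  have huc : UniformContinuous g := hg.uniformContinuous_of_tendsto_cocompact (hgc.is_zero_at_infty)
  obtain ⟨ρ, hρ, hρg⟩ := Metric.uniformContinuous_iff.1 huc η hη
  have hev : ∀ᶠ m in atTop, r m < min ρ 1 := hr.eventually (gt_mem_nhds (by positivity))
  obtain ⟨N, hN⟩ := eventually_atTop.1 hev; refine ⟨N, fun m hm => ?_⟩; have hrm := hN m hm
  have hloc : ∀ (f : Eu n → F), MemLp f p volume → ∀ x, IntegrableOn f (closedBall x (r m)) :=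
    fun f hf x => (hf.locallyIntegrable hp).integrableOn_isCompact (isCompact_closedBall _ _)
  have e1 : (fun x => cv (κ m) f x - f x) =
      (cv (κ m) (fun x => f x - g x)) + ((fun x => cv (κ m) g x - g x) + fun x => g x - f x) := by
    ext x; simp only [Pi.add_apply]; rw [(hκ m).cv_sub (hloc f hf x) (hloc g hgp x)]; abel
  have m1 : MemLp (fun x => f x - g x) p volume := hf.sub hgp; have m2 := (hκ m).memLp_cv hp hp' m1
  have m3 : MemLp (fun x => cv (κ m) g x - g x) p volume := ((hκ m).memLp_cv hp hp' hgp).sub hgp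
  have m4 : MemLp (fun x => g x - f x) p volume := hgp.sub hf; rw [e1]
  refine (eLpNorm_add_le m2.1 (m3.add m4).1 hp).trans ?_
  refine (add_le_add le_rfl (eLpNorm_add_le m3.1 m4.1 hp)).trans ?_; rw [← add_assoc]
  refine le_trans ?_ hδε
  have b1 : eLpNorm (cv (κ m) (fun x => f x - g x)) p volume ≤ δ :=
    ((hκ m).eLpNorm_cv_le m1.1 hp hp').trans hfg
  have b3 : eLpNorm (fun x => g x - f x) p volume ≤ δ := by
    have := eLpNorm_sub_comm f g p volume; exact this.symm.le.trans hfg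
  have b2 : eLpNorm (fun x => cv (κ m) g x - g x) p volume ≤ δ := by
    have hb : ∀ x, ‖cv (κ m) g x - g x‖ ≤ (K.indicator (fun _ => η) x : ℝ) := by
      intro x
      by_cases hx : x ∈ K
      · rw [indicator_of_mem hx]; refine (hκ m).norm_cv_sub_le (hloc g hgp x) fun t ht => ?_
        rw [← dist_eq_norm]
        exact (hρg ((mem_closedBall.1 ht).trans_lt (hrm.trans_le (min_le_left _ _)))).le
      · rw [indicator_of_notMem hx, (hκ m).cv_eq_zero, eq_zero_of_notMem (f := g)]
        · simp
        · exact fun h => hx (self_subset_cthickening _ h)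
        · intro t ht
          by_contra h0; refine hx (mem_cthickening_of_dist_le x t 1 _ (subset_tsupport g h0) ?_)
          rw [dist_comm]; exact (mem_closedBall.1 ht).trans (hrm.le.trans (min_le_right _ _))
    refine (eLpNorm_mono_real hb).trans ?_
    rw [eLpNorm_indicator_const hKc.measurableSet (zero_lt_one.trans_le hp).ne' hp',
      enorm_of_nonneg hη.le]
    exact hηδ
  exact add_le_add (add_le_add b1 b2) b3

end Kernel

/-! ### Kernels acting on test functions, and ball averages. -/

section KernelTest

variable {Ω' : Set (Eu n)}

lemma IsKernel.locallyIntegrable (h : IsKernel κ r) : LocallyIntegrable κ volume :=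
  h.integrable.locallyIntegrable

lemma IsKernel.gradient_cv (h : IsKernel κ r) (hφ : IsTestFunction Ω φ) (x : Eu n) : ∇ (cv κ φ) x =
    cv κ (∇ φ) x := by
  have h1 := (hφ.compactSupport.hasFDerivAt_convolution_right (ContinuousLinearMap.lsmul ℝ ℝ)
    h.locallyIntegrable (hφ.smooth.of_le (by exact_mod_cast le_top)) x).fderiv
  have h2 : fderiv ℝ (cv κ φ) x = ∫ t, κ t • fderiv ℝ φ (x - t) := by
    refine h1.trans ?_; rw [convolution]
    refine integral_congr_fun fun t => ?_; ext v; simp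
  rw [gradient, h2, cv_apply]
  have := (InnerProductSpace.toDual ℝ (Eu n)).symm.toContinuousLinearEquiv.toContinuousLinearMap
  rw [← LinearIsometryEquiv.coe_toContinuousLinearEquiv, ← ContinuousLinearEquiv.integral_comp_comm]
  simp [gradient]

lemma IsKernel.contDiff_cv (h : IsKernel κ r) (hφ : IsTestFunction Ω φ) : ContDiff ℝ ∞ (cv κ φ) :=
  hφ.compactSupport.contDiff_convolution_right _ h.locallyIntegrable hφ.smooth

lemma IsKernel.support_cv_subset {F : Type*} [NormedAddCommGroup F] [NormedSpace ℝ F] (h : IsKernel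
    κ r) {f : Eu n → F} (hf : ∀ x, x ∉ K → f x = 0) : Function.support (cv κ f) ⊆ cthickening r K
    := by
  intro x hx
  by_contra hx'; refine hx (h.cv_eq_zero fun t ht => hf t fun htK => hx' ?_)
  exact mem_cthickening_of_dist_le x t r _ htK (by rw [dist_comm]; exact mem_closedBall.1 ht)

lemma IsKernel.isTestFunction_cv (h : IsKernel κ r) (hφ : IsTestFunction Ω φ) (hr : cthickening r
    (tsupport φ) ⊆ Ω') : IsTestFunction Ω' (cv κ φ) := by
  have hs : tsupport (cv κ φ) ⊆ cthickening r (tsupport φ) :=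
    closure_minimal (h.support_cv_subset fun x hx => eq_zero_of_notMem hx) isClosed_cthickening
  exact ⟨h.contDiff_cv hφ, hφ.compactSupport.isCompact.cthickening.of_isClosed_subset
    (isClosed_tsupport _) hs, hs.trans hr⟩

/-- The kernel of the average over the ball of radius `r`. -/
noncomputable def ballKernel (n : ℕ) (r : ℝ) : Eu n → ℝ :=
  (ball (0 : Eu n) r).indicator fun _ => (volume.real (ball (0 : Eu n) r))⁻¹

lemma volume_real_ball_pos (hr : 0 < r) (x : Eu n) : 0 < volume.real (ball x r) :=
  toReal_pos (measure_ball_pos volume x hr).ne' measure_ball_lt_top.ne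

lemma isKernel_ballKernel (hr : 0 < r) : IsKernel (ballKernel n r) r where
  nonneg x := indicator_nonneg (fun _ _ => by positivity) x
  meas := (measurable_const.indicator measurableSet_ball).aestronglyMeasurable
  integral_one := by
    rw [ballKernel, integral_indicator measurableSet_ball, setIntegral_const, smul_eq_mul,
      mul_inv_cancel₀ (volume_real_ball_pos hr 0).ne']
  bdd := ⟨(volume.real (ball (0 : Eu n) r))⁻¹, fun x =>
    indicator_le_self' (fun _ _ => by positivity) x⟩
  supp x hx := indicator_of_notMem (by simpa using hx.le) _

lemma cv_ballKernel {F : Type*} [NormedAddCommGroup F] [NormedSpace ℝ F] (f : Eu n → F) (x : Eu n) :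
    cv (ballKernel n r) f x = ⨍ y in ball x r, f y := by
  rw [cv_apply_swap, setAverage_eq]
  have e1 : volume.real (ball x r) = volume.real (ball (0 : Eu n) r) := by
    simp [Measure.real, addHaar_ball_center volume x r]
  rw [e1, ← integral_smul, ← integral_indicator measurableSet_ball]
  refine integral_congr_fun fun t => ?_
  by_cases ht : t ∈ ball x r
  · have ht' : x - t ∈ ball (0 : Eu n) r := by rwa [mem_ball_zero_iff, ← dist_eq_norm, dist_comm]
    simp only [ballKernel, indicator_of_mem ht, indicator_of_mem ht']
  · have ht' : x - t ∉ ball (0 : Eu n) r := by rwa [mem_ball_zero_iff, ← dist_eq_norm, dist_comm]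
    simp only [ballKernel, indicator_of_notMem ht, indicator_of_notMem ht', zero_smul]

end KernelTest

/-! ### Continuity of the energy in L². -/

section L2

lemma eLpNorm_matForm_le (hΩ : IsOpen Ω) {Lam : ℝ} (hb : ∀ x ∈ Ω, ∀ ξ η, |matForm (A x) ξ η| ≤ Lam *
    ‖ξ‖ * ‖η‖) {f : Eu n → Eu n} (hf : AEStronglyMeasurable f vol[Ω]) (hg : AEStronglyMeasurable g
    vol[Ω]) : eLpNorm (fun x => Q[A,f,g]x) 1 vol[Ω] ≤ ofReal Lam * (eLpNorm f 2 vol[Ω] * eLpNorm g 2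
    vol[Ω]) := by
  have h1 : eLpNorm (fun x => ‖f x‖ • ‖g x‖) 1 vol[Ω] ≤ eLpNorm (fun x => ‖f x‖) 2 vol[Ω]
        * eLpNorm (fun x => ‖g x‖) 2 vol[Ω] :=
    eLpNorm_smul_le_mul_eLpNorm (𝕜 := ℝ) (φ := fun x => ‖f x‖) (f := fun x => ‖g x‖) hg.norm hf.norm
  have h3 : eLpNorm (fun x => ‖f x‖ • ‖g x‖) 1 vol[Ω]
      ≤ eLpNorm f 2 vol[Ω] * eLpNorm g 2 vol[Ω] := by
    rw [← eLpNorm_norm f, ← eLpNorm_norm g]; exact h1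
  have h2 : ∀ᵐ x ∂vol[Ω], ‖Q[A,f,g]x‖ ≤ Lam * ‖‖f x‖ • ‖g x‖‖ := by
    filter_upwards [hΩ.ae_mem] with x hx
    rw [norm_eq_abs, smul_eq_mul, norm_mul, norm_norm, norm_norm, ← mul_assoc]; exact hb x hx _ _
  exact (eLpNorm_le_mul_eLpNorm_of_ae_le_mul h2 1).trans (mul_le_mul' le_rfl h3)

lemma integrable_matForm (hΩ : IsOpen Ω) (hA : IsUniformlyElliptic Ω A) {f : Eu n → Eu n} (hf :
    MemLp f 2 vol[Ω]) (hg : MemLp g 2 vol[Ω]) : Integrable (fun x => Q[A,f,g]x) vol[Ω] := by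
  obtain ⟨lam, Lam, hl, hL, hb⟩ := hA.exists_bounds; rw [← memLp_one_iff_integrable]
  refine ⟨hA.aestronglyMeasurable hf.1 hg.1, (eLpNorm_matForm_le hΩ (fun x hx => (hb x hx).2)
    hf.1 hg.1).trans_lt ?_⟩
  exact mul_lt_top ofReal_lt_top (mul_lt_top hf.2 hg.2)

lemma tendsto_integral_matForm (hΩ : IsOpen Ω) (hA : IsUniformlyElliptic Ω A) {f : Eu n → Eu n} {F H
    : ℕ → Eu n → Eu n} (hf : MemLp f 2 vol[Ω]) (hg : MemLp g 2 vol[Ω]) (hF : ∀ j, MemLp (F j) 2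
    vol[Ω]) (hH : ∀ j, MemLp (H j) 2 vol[Ω]) (hFf : Tendsto (fun j => eLpNorm (fun x => F j x - f x)
    2 vol[Ω]) atTop (𝓝 0)) (hHg : Tendsto (fun j => eLpNorm (fun x => H j x - g x) 2 vol[Ω]) atTop
    (𝓝 0)) : Tendsto (fun j => ∫ x in Ω, Q[A,F j,H j]x) atTop (𝓝 (∫ x in Ω, Q[A,f,g]x)) := by
  obtain ⟨lam, Lam, hl, hL, hb⟩ := hA.exists_bounds
  refine tendsto_integral_of_L1' _ (integrable_matForm hΩ hA hf hg).1
    (.of_forall fun j => integrable_matForm hΩ hA (hF j) (hH j)) ?_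
  have hfin : Tendsto (fun j => ofReal Lam *
      (eLpNorm (fun x => F j x - f x) 2 vol[Ω] * (eLpNorm (fun x => H j x - g x) 2
        vol[Ω] + eLpNorm g 2 vol[Ω])) + ofReal Lam *
      (eLpNorm f 2 vol[Ω] * eLpNorm (fun x => H j x - g x) 2 vol[Ω]))
      atTop (𝓝 0) := by
    have h1 : Tendsto (fun j => ofReal Lam *
      (eLpNorm (fun x => F j x - f x) 2 vol[Ω] * (eLpNorm (fun x => H j x - g x) 2
        vol[Ω] + eLpNorm g 2 vol[Ω]))) atTop (𝓝 (ofReal Lam *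
        (0 * (0 + eLpNorm g 2 vol[Ω])))) :=
      ENNReal.Tendsto.const_mul (ENNReal.Tendsto.mul hFf (Or.inr (by simpa using hg.2.ne))
        (hHg.add tendsto_const_nhds) (Or.inr zero_ne_top)) (Or.inr ofReal_ne_top)
    have h2 : Tendsto (fun j => ofReal Lam *
      (eLpNorm f 2 vol[Ω] * eLpNorm (fun x => H j x - g x) 2 vol[Ω]))
      atTop (𝓝 (ofReal Lam * (eLpNorm f 2 vol[Ω] * 0))) :=
      ENNReal.Tendsto.const_mul (ENNReal.Tendsto.const_mul hHg (Or.inr hf.2.ne))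
        (Or.inr ofReal_ne_top)
    simpa using h1.add h2
  refine tendsto_zero_of_le hfin fun j => ?_
  have e1 : ∀ x, Q[A,F j,H j]x - Q[A,f,g]x
      = matForm (A x) (F j x - f x) (H j x) + matForm (A x) (f x) (H j x - g x) := fun x => by
    rw [matForm_sub_left, matForm_sub_right]; ring
  have m1 := hA.aestronglyMeasurable ((hF j).1.sub hf.1) (hH j).1
  have m2 := hA.aestronglyMeasurable hf.1 ((hH j).1.sub hg.1)
  calc eLpNorm ((fun x => Q[A,F j,H j]x) - fun x => Q[A,f,g]x) 1
        vol[Ω]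
      = eLpNorm ((fun x => matForm (A x) (F j x - f x) (H j x))
        + fun x => matForm (A x) (f x) (H j x - g x)) 1 vol[Ω] := by
        congr 1; ext x; exact e1 x
    _ ≤ _ := eLpNorm_add_le m1 m2 le_rfl
    _ ≤ _ := by
        refine add_le_add ((eLpNorm_matForm_le hΩ (fun x hx => (hb x hx).2)
          ((hF j).1.sub hf.1) (hH j).1).trans ?_) (eLpNorm_matForm_le hΩ (fun x hx => (hb x hx).2)
          hf.1 ((hH j).1.sub hg.1))
        have := eLpNorm_add_le ((hH j).1.sub hg.1) hg.1 (p := 2) (by norm_num)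
        rw [sub_add_cancel] at this; exact mul_le_mul' le_rfl (mul_le_mul' le_rfl this)

lemma energyA_eq_ofReal (hΩ : IsOpen Ω) (hA : IsUniformlyElliptic Ω A) {f : Eu n → Eu n} (hf : MemLp
    f 2 vol[Ω]) : energyA Ω A f = ofReal (∫ x in Ω, Q[A,f,f]x) := by
  rw [energyA, ofReal_integral_eq_lintegral_ofReal (integrable_matForm hΩ hA hf hf)]
  exact hA.ae_nonneg hΩ _

lemma energyA_lt_top (hΩ : IsOpen Ω) (hA : IsUniformlyElliptic Ω A) {f : Eu n → Eu n} (hf : MemLp f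
    2 vol[Ω]) : energyA Ω A f < ⊤ := by
  rw [energyA_eq_ofReal hΩ hA hf]; exact ofReal_lt_top

lemma tendsto_energyA (hΩ : IsOpen Ω) (hA : IsUniformlyElliptic Ω A) {f : Eu n → Eu n} {F : ℕ → Eu n
    → Eu n} (hf : MemLp f 2 vol[Ω]) (hF : ∀ j, MemLp (F j) 2 vol[Ω]) (hFf : Tendsto (fun j =>
    eLpNorm (fun x => F j x - f x) 2 vol[Ω]) atTop (𝓝 0)) : Tendsto (fun j => energyA Ω A (F j))
    atTop (𝓝 (energyA Ω A f)) := by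
  simp only [energyA_eq_ofReal hΩ hA hf, energyA_eq_ofReal hΩ hA (hF _)]
  exact tendsto_ofReal (tendsto_integral_matForm hΩ hA hf hf hF hF hFf hFf)

lemma energyA_le (hΩ : IsOpen Ω) {Lam : ℝ} (hL : 0 ≤ Lam) (hb : ∀ x ∈ Ω, ∀ ξ η, |matForm (A x) ξ η|
    ≤ Lam * ‖ξ‖ * ‖η‖) (f : Eu n → Eu n) : energyA Ω A f ≤ ofReal Lam * eLpNorm f 2 vol[Ω] ^ 2 := by
  rw [← ENNReal.rpow_natCast, eLpNorm_eq_lintegral_rpow_enorm_toReal (by norm_num) (by norm_num),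
    ← ENNReal.rpow_mul, energyA]
  simp only [toReal_ofNat, Nat.cast_ofNat, one_div, ne_eq, OfNat.ofNat_ne_zero,
    not_false_eq_true, inv_mul_cancel₀, ENNReal.rpow_one]
  rw [← lintegral_const_mul' _ _ ofReal_ne_top]; refine lintegral_mono_ae ?_
  filter_upwards [hΩ.ae_mem] with x hx; have h1 := (le_abs_self _).trans (hb x hx (f x) (f x))
  rw [← ofReal_norm, ofReal_rpow_of_nonneg (norm_nonneg _) (by norm_num), ← ofReal_mul hL]
  refine ofReal_le_ofReal (h1.trans_eq ?_); rw [Real.rpow_two]; ring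

end L2

/-! ### Approximating sequences in H¹₀ that also converge almost everywhere. -/

section H10

/-- `φⱼ → u` in `H¹₀(Ω)` and almost everywhere. -/
structure H10Approx (Ω : Set (Eu n)) (φ : ℕ → Eu n → ℝ) (u : Eu n → ℝ) (g : Eu n → Eu n) :
    Prop where
  memLp : MemLp u 2 vol[Ω]
  memLp_grad : MemLp g 2 vol[Ω]
  test : ∀ j, IsTestFunction Ω (φ j)
  tendsto : Tendsto (fun j => eLpNorm (fun x => φ j x - u x) 2 vol[Ω]) atTop (𝓝 0)
  tendsto_grad : Tendsto (fun j => eLpNorm (fun x => ∇ (φ j) x - g x) 2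
    vol[Ω]) atTop (𝓝 0)
  ae : ∀ᵐ x ∂vol[Ω], Tendsto (fun j => φ j x) atTop (𝓝 (u x))
  ae_grad : ∀ᵐ x ∂vol[Ω], Tendsto (fun j => ∇ (φ j) x) atTop (𝓝 (g x))

lemma exists_subseq_ae_of_eLpNorm {α F : Type*} [MeasurableSpace α] [NormedAddCommGroup F] {m :
    Measure α} {p : ℝ≥0∞} (hp : p ≠ 0) {f : ℕ → α → F} {f₀ : α → F} (hf : ∀ j, AEStronglyMeasurable
    (f j) m) (hf₀ : AEStronglyMeasurable f₀ m) (h : Tendsto (fun j => eLpNorm (fun x => f j x - f₀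
    x) p m) atTop (𝓝 0)) : ∃ ns : ℕ → ℕ, StrictMono ns ∧ ∀ᵐ x ∂m, Tendsto (fun i => f (ns i) x)
    atTop (𝓝 (f₀ x)) :=
  (tendstoInMeasure_of_tendsto_eLpNorm hp hf hf₀ h).exists_seq_tendsto_ae

lemma MemH10.exists_approx (h : MemH10 Ω u g) : ∃ φ, H10Approx Ω φ u g := by
  obtain ⟨φ, hφ, h1, h2⟩ := h.approx
  obtain ⟨ns, hns, ha⟩ := exists_subseq_ae_of_eLpNorm two_ne_zero
    (fun j => (hφ j).continuous.aesm) h.memLp.1 h1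
  obtain ⟨ms, hms, ha'⟩ := exists_subseq_ae_of_eLpNorm two_ne_zero
    (fun j => (hφ (ns j)).continuous_gradient.aesm) h.memLp_grad.1
    (h2.comp hns.tendsto_atTop)
  refine ⟨fun j => φ (ns (ms j)), h.memLp, h.memLp_grad, fun j => hφ _,
    h1.comp (hns.comp hms).tendsto_atTop, h2.comp (hns.comp hms).tendsto_atTop, ?_, ha'⟩
  filter_upwards [ha] with x hx using hx.comp hms.tendsto_atTop

lemma H10Approx.memH10 {φ : ℕ → Eu n → ℝ} (h : H10Approx Ω φ u g) : MemH10 Ω u g :=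
  ⟨h.memLp, h.memLp_grad, φ, h.test, h.tendsto, h.tendsto_grad⟩

lemma IsTestFunction.memH10 (h : IsTestFunction Ω φ) : MemH10 Ω φ (∇ φ) :=
  ⟨h.memLp _ _, h.memLp_gradient _ _, fun _ => φ, fun _ => h, by simp, by simp⟩

lemma MemH10.sub {f : Eu n → Eu n} (h : MemH10 Ω u g) (h' : MemH10 Ω v f) : MemH10 Ω (fun x => u x -
    v x) (fun x => g x - f x) := by
  obtain ⟨φ, hφ⟩ := h.exists_approx; obtain ⟨ψ, hψ⟩ := h'.exists_approx
  refine ⟨h.memLp.sub h'.memLp, h.memLp_grad.sub h'.memLp_grad, fun j x => φ j x - ψ j x,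
    fun j => (hφ.test j).sub (hψ.test j), ?_, ?_⟩
  · refine tendsto_zero_of_le (by simpa using hφ.tendsto.add hψ.tendsto) fun j => ?_
    have e : (fun x => φ j x - ψ j x - (u x - v x))
        = (fun x => φ j x - u x) - fun x => ψ j x - v x := by
      ext x; simp only [Pi.sub_apply]; ring
    simp only [e]
    exact eLpNorm_sub_le ((hφ.test j).continuous.aesm.sub h.memLp.1)
      ((hψ.test j).continuous.aesm.sub h'.memLp.1) (by norm_num)
  · refine tendsto_zero_of_le (by simpa using hφ.tendsto_grad.add hψ.tendsto_grad) fun j => ?_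
    have e : (fun x => ∇ (fun x => φ j x - ψ j x) x - (g x - f x))
        = (fun x => ∇ (φ j) x - g x) - fun x => ∇ (ψ j) x - f x := by
      ext1 x
      rw [gradient_fun_sub ((hφ.test j).differentiable x) ((hψ.test j).differentiable x)]
      simp only [Pi.sub_apply]; abel
    simp only [e]
    exact eLpNorm_sub_le ((hφ.test j).continuous_gradient.aesm.sub h.memLp_grad.1)
      ((hψ.test j).continuous_gradient.aesm.sub h'.memLp_grad.1) (by norm_num)

lemma MemH10.congr {f : Eu n → Eu n} (h : MemH10 Ω u g) (hv : u =ᵐ[vol[Ω]] v) (hf : g =ᵐ[vol[Ω]] f)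
    : MemH10 Ω v f := by
  obtain ⟨φ, hφ, h1, h2⟩ := h.approx
  refine ⟨h.memLp.ae_eq hv, h.memLp_grad.ae_eq hf, φ, hφ, h1.congr fun j => ?_,
    h2.congr fun j => ?_⟩
  · exact eLpNorm_congr_ae (hv.mono fun x hx => by simp [hx])
  · exact eLpNorm_congr_ae (hf.mono fun x hx => by simp [hx])

end H10

lemma IsOpen.exists_compact_exhaustion (hΩ : IsOpen Ω) : ∃ K : ℕ → Set (Eu n), (∀ i, IsCompact (K
    i)) ∧ (∀ i, K i ⊆ Ω) ∧ Monotone K ∧ ⋃ i, K i = Ω := by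
  obtain ⟨F, hF, hFΩ, hU, hm⟩ := hΩ.exists_iUnion_isClosed
  refine ⟨fun i => F i ∩ closedBall 0 i, fun i => ?_, fun i => inter_subset_left.trans (hFΩ i),
    fun i j hij => inter_subset_inter (hm hij) (closedBall_subset_closedBall
      (by exact_mod_cast hij)), ?_⟩
  · exact (isCompact_closedBall _ _).inter_left (hF i)
  · refine subset_antisymm (iUnion_subset fun i => inter_subset_left.trans (hFΩ i)) fun x hx => ?_
    rw [← hU] at hx; obtain ⟨i, hi⟩ := mem_iUnion.1 hx; obtain ⟨j, hj⟩ := exists_nat_ge ‖x‖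
    refine mem_iUnion.2 ⟨max i j, hm (le_max_left _ _) hi, ?_⟩; rw [mem_closedBall_zero_iff]
    exact hj.trans (by exact_mod_cast le_max_right _ _)

lemma ENNReal.sq_le_sq_iff {a b : ℝ≥0∞} : a ^ 2 ≤ b ^ 2 ↔ a ≤ b := by
  refine ⟨fun h => ?_, fun h => pow_le_pow_left' h 2⟩
  by_contra! h'; exact h.not_gt (ENNReal.pow_lt_pow_left two_ne_zero h')

lemma tendsto_matForm {ι : Type*} {l : Filter ι} {f g : ι → Eu n} {a b : Eu n} (B : Mat n) (hf :
    Tendsto f l (𝓝 a)) (hg : Tendsto g l (𝓝 b)) : Tendsto (fun i => matForm B (f i) (g i)) l (𝓝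
    (matForm B a b)) := by
  unfold matForm
  exact (((Matrix.toEuclideanLin B).toContinuousLinearMap.continuous.tendsto a).comp hf).inner hg

/-! ### The trace inequality and the measure term in H¹₀. -/

section Averages

lemma H10Approx.tendsto_average {φ : ℕ → Eu n → ℝ} (h : H10Approx Ω φ u g) (hr : ball x r ⊆ Ω) :
    Tendsto (fun i => ⨍ y in ball x r, φ i y) atTop (𝓝 (⨍ y in ball x r, u y)) := by
  have hle : volume.restrict (ball x r) ≤ vol[Ω] := restrict_mono hr le_rfl
  simp only [setAverage_eq]; refine Tendsto.const_smul ?_ _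
  have : IsFiniteMeasure (volume.restrict (ball x r)) :=
    ⟨by rw [restrict_apply_univ]; exact measure_ball_lt_top⟩
  refine tendsto_integral_of_L1' _ (h.memLp.1.mono_measure hle)
    (.of_forall fun i => ((h.test i).memLp 1 _).integrable le_rfl) ?_
  have hb : ∀ i, eLpNorm (fun y => φ i y - u y) 1 (volume.restrict (ball x r))
      ≤ eLpNorm (fun y => φ i y - u y) 2 vol[Ω]
        * volume.restrict (ball x r) univ ^ (1 / (1 : ℝ≥0∞).toReal - 1 / (2 : ℝ≥0∞).toReal) :=
    fun i => (eLpNorm_le_eLpNorm_mul_rpow_measure_univ (by norm_num)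
      ((h.test i).continuous.aesm.sub (h.memLp.1.mono_measure hle))).trans
      (mul_le_mul' (eLpNorm_mono_measure _ hle) le_rfl)
  refine tendsto_zero_of_le ?_ hb
  have := ENNReal.Tendsto.mul_const h.tendsto (b := volume.restrict (ball x r) univ ^
    (1 / (1 : ℝ≥0∞).toReal - 1 / (2 : ℝ≥0∞).toReal)) (Or.inr ?_)
  · simpa using this
  · exact rpow_ne_top_of_nonneg (by norm_num) (measure_ne_top _ _)

lemma IsTestFunction.continuous_average (hφ : IsTestFunction Ω φ) (hr : 0 < r) : Continuous fun x =>
    ⨍ y in ball x r, φ y := by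
  have := ((isKernel_ballKernel (n := n) hr).contDiff_cv hφ).continuous
  refine this.congr fun x => cv_ballKernel _ _

lemma MemH10.aestronglyMeasurable_average (h : MemH10 Ω u g) (hr : 0 < r) (hK : MeasurableSet K)
    (hKΩ : ∀ x ∈ K, ball x r ⊆ Ω) (ν : Measure (Eu n)) : AEStronglyMeasurable (fun x => ⨍ y in ball
    x r, u y) (ν.restrict K) := by
  obtain ⟨φ, hφ⟩ := h.exists_approx
  refine aestronglyMeasurable_of_tendsto_ae atTop
    (fun i => ((hφ.test i).continuous_average hr).aestronglyMeasurable) ?_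
  filter_upwards [ae_restrict_mem hK] with x hx using hφ.tendsto_average (hKΩ x hx)

/-- The measure `ν / e`. -/
noncomputable def wMeas (e : Eu n → ℝ) (ν : Measure (Eu n)) : Measure (Eu n) :=
  ν.withDensity fun x => ofReal (e x)⁻¹

lemma eLpNorm_two_sq {α : Type*} [MeasurableSpace α] {m : Measure α} (f : α → ℝ) : eLpNorm f 2 m ^ 2
    = ∫⁻ x, ofReal (f x ^ 2) ∂m := by
  rw [← ENNReal.rpow_natCast, eLpNorm_eq_lintegral_rpow_enorm_toReal (by norm_num) (by norm_num),
    ← ENNReal.rpow_mul]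
  simp only [toReal_ofNat, Nat.cast_ofNat, one_div, ne_eq, OfNat.ofNat_ne_zero,
    not_false_eq_true, inv_mul_cancel₀, ENNReal.rpow_one]
  refine lintegral_congr fun x => ?_
  rw [← ofReal_norm, ofReal_rpow_of_nonneg (norm_nonneg _) (by norm_num),
    Real.rpow_two, norm_eq_abs, sq_abs]

namespace IsSupersolution

lemma lintegral_wMeas (h : IsSupersolution Ω A e G ν) (f : Eu n → ℝ≥0∞) : ∫⁻ x, f x ∂wMeas e ν = ∫⁻
    x, ofReal (e x)⁻¹ * f x ∂ν :=
  lintegral_withDensity_eq_lintegral_mul_non_measurable₀ _ h.meas'.inv.ennreal_ofReal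
    (.of_forall fun _ => ofReal_lt_top) f

lemma eLpNorm_wMeas_sq (h : IsSupersolution Ω A e G ν) (f : Eu n → ℝ) : eLpNorm f 2 (wMeas e ν) ^ 2
    = ∫⁻ x, ofReal (f x ^ 2 / e x) ∂ν := by
  rw [eLpNorm_two_sq, h.lintegral_wMeas]; refine lintegral_congr fun x => ?_
  rw [div_eq_mul_inv, ofReal_mul (sq_nonneg _), mul_comm]

/-- The Hardy inequality is its own trace inequality: dropping the other terms leaves ½ ∫ φ²/e dν ≤
Λ ‖∇φ‖². -/
lemma exists_trace (h : IsSupersolution Ω A e G ν) : ∃ C : ℝ≥0∞, C ≠ ⊤ ∧ ∀ φ, IsTestFunction Ω φ →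
    eLpNorm φ 2 (wMeas e ν) ≤ C * eLpNorm (∇ φ) 2 vol[Ω] := by
  obtain ⟨lam, Lam, hl, hL, hb⟩ := h.elliptic.exists_bounds
  refine ⟨ofReal √(2 * Lam), ofReal_ne_top, fun φ hφ => ?_⟩
  rw [← ENNReal.sq_le_sq_iff, h.eLpNorm_wMeas_sq, mul_pow,
    ← ofReal_pow (sqrt_nonneg _), sq_sqrt (by positivity),
    ofReal_mul (by norm_num), mul_assoc]
  refine le_trans ?_ (mul_le_mul' le_rfl (energyA_le h.isOpen hL.le (fun x hx => (hb x hx).2) _))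
  calc _ = ofReal 2 * (1 / 2 * ∫⁻ x, ofReal (φ x ^ 2 / e x) ∂ν) := by
        rw [← mul_assoc, ofReal_ofNat, one_div, ENNReal.mul_inv_cancel (by norm_num)
          (by norm_num), one_mul]
    _ ≤ _ := mul_le_mul' le_rfl (le_trans le_add_self (h.hardy_test hφ))

/-- Local finiteness of ν/e comes from the trace inequality for a test function equal to one on K.
-/
lemma wMeas_lt_top (h : IsSupersolution Ω A e G ν) (hK : IsCompact K) (hKΩ : K ⊆ Ω) : wMeas e ν K <
    ⊤ := by
  obtain ⟨χ, hχ, h0, h1, U, hU, hKU, hχU⟩ := exists_testFunction hK h.isOpen hKΩ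
  obtain ⟨C, hC, htr⟩ := h.exists_trace
  have h2 : eLpNorm χ 2 (wMeas e ν) < ⊤ :=
    (htr χ hχ).trans_lt (mul_lt_top hC.lt_top (hχ.memLp_gradient 2 _).2)
  calc wMeas e ν K = ∫⁻ x in K, 1 ∂wMeas e ν := by simp
    _ ≤ ∫⁻ x in K, ofReal (χ x ^ 2) ∂wMeas e ν := by
        refine setLIntegral_mono' hK.measurableSet fun x hx => ?_; rw [hχU x (hKU hx)]; simp
    _ ≤ ∫⁻ x, ofReal (χ x ^ 2) ∂wMeas e ν := setLIntegral_le_lintegral _ _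
    _ = eLpNorm χ 2 (wMeas e ν) ^ 2 := (eLpNorm_two_sq _).symm
    _ < ⊤ := pow_lt_top h2

/-- A trace inequality for averages over small balls. -/
lemma exists_trace_average (h : IsSupersolution Ω A e G ν) (hK : IsCompact K) (hKΩ : K ⊆ Ω) : ∃ C :
    ℝ≥0∞, C ≠ ⊤ ∧ ∃ δ > 0, ∀ r, 0 < r → r < δ → (∀ x ∈ K, ball x r ⊆ Ω) ∧ ∀ w f, MemH10 Ω w f →
    eLpNorm (fun x => ⨍ y in ball x r, w y) 2 ((wMeas e ν).restrict K) ≤ C * (eLpNorm w 2 vol[Ω] +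
    eLpNorm f 2 vol[Ω]) := by
  obtain ⟨χ, hχ, h0, h1, U, hU, hKU, hχU⟩ := exists_testFunction hK h.isOpen hKΩ
  obtain ⟨C, hC, htr⟩ := h.exists_trace; obtain ⟨D, hD⟩ := hχ.gradient_bounded
  obtain ⟨δ₁, hδ₁, hs₁⟩ := hK.exists_cthickening_subset_open (hU.inter h.isOpen)
    (subset_inter hKU hKΩ)
  obtain ⟨δ₂, hδ₂, hs₂⟩ := hχ.compactSupport.isCompact.exists_cthickening_subset_open h.isOpen
    hχ.support_subset
  have hball : ∀ r, 0 < r → r < min δ₁ δ₂ → ∀ x ∈ K, closedBall x r ⊆ U ∩ Ω := by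
    intro r hr hrδ x hx y hy
    exact hs₁ (mem_cthickening_of_dist_le y x δ₁ K hx
      ((mem_closedBall.1 hy).trans (hrδ.le.trans (min_le_left _ _))))
  refine ⟨C * (ofReal D + 1), mul_ne_top hC (by simp), min δ₁ δ₂,
    lt_min hδ₁ hδ₂, fun r hr hrδ => ⟨fun x hx => ball_subset_closedBall.trans
    ((hball r hr hrδ x hx).trans inter_subset_right), fun w f hw => ?_⟩⟩
  obtain ⟨φ, hφ⟩ := hw.exists_approx; have hκ := isKernel_ballKernel (n := n) hr
  -- Multiplying by χ keeps the ball averages compactly supported in Ω. They are then test functions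
  -- for the trace inequality, and on K they agree with the averages of φ i, since χ is one on the
  -- balls involved.
  have hψ : ∀ i, IsTestFunction Ω (fun x => χ x * φ i x) := fun i =>
    (hφ.test i).mul_left hχ.smooth
  have hcv : ∀ i, IsTestFunction Ω (cv (ballKernel n r) (fun x => χ x * φ i x)) := fun i => by
    refine hκ.isTestFunction_cv (hψ i) ((cthickening_mono (hrδ.le.trans (min_le_right _ _))
      _).trans ((cthickening_subset_of_subset _ ?_).trans hs₂))
    exact tsupport_mul_subset_left (f := χ) (g := φ i)
  have hev : ∀ i, ∀ x ∈ K, cv (ballKernel n r) (fun x => χ x * φ i x) x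
      = ⨍ y in ball x r, φ i y := fun i x hx => by
    rw [← cv_ballKernel]; refine hκ.cv_congr (.of_forall fun t ht => ?_)
    rw [hχU t (hball r hr hrδ x hx ht).1, one_mul]
  have hlim : ∀ᵐ x ∂(wMeas e ν).restrict K, Tendsto (fun i =>
      cv (ballKernel n r) (fun x => χ x * φ i x) x) atTop (𝓝 (⨍ y in ball x r, w y)) := by
    filter_upwards [ae_restrict_mem hK.measurableSet] with x hx
    exact (hφ.tendsto_average (ball_subset_closedBall.trans
      ((hball r hr hrδ x hx).trans inter_subset_right))).congr fun i => (hev i x hx).symm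
  refine (Lp.eLpNorm_lim_le_liminf_eLpNorm (fun i => (hcv i).continuous.aesm) _
    hlim).trans ?_
  have hbd : ∀ i, eLpNorm (cv (ballKernel n r) (fun x => χ x * φ i x)) 2 ((wMeas e ν).restrict K)
      ≤ C * (ofReal D + 1) * (eLpNorm (φ i) 2 vol[Ω] + eLpNorm (∇ (φ i)) 2 vol[Ω]) := fun i => by
    -- Averaging commutes with the gradient and contracts L², so the constant does not depend on r.
    have e1 : ∇ (cv (ballKernel n r) (fun x => χ x * φ i x))
        = cv (ballKernel n r) (∇ (fun x => χ x * φ i x)) :=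
      funext fun x => hκ.gradient_cv (hψ i) x
    have e2 : eLpNorm (∇ (fun x => χ x * φ i x)) 2 volume
        = eLpNorm (∇ (fun x => χ x * φ i x)) 2 vol[Ω] := by
      refine (eLpNorm_restrict_eq_of_support_subset ?_).symm
      exact (subset_tsupport _).trans ((tsupport_gradient_subset _).trans (hψ i).support_subset)
    have e3 : eLpNorm (∇ (fun x => χ x * φ i x)) 2 vol[Ω] ≤ eLpNorm (∇ (φ i)) 2 vol[Ω]
          + ofReal D * eLpNorm (φ i) 2 vol[Ω] := by
      have : ∇ (fun x => χ x * φ i x) = (fun x => χ x • ∇ (φ i) x) + fun x => φ i x • ∇ χ x := by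
        ext1 x
        rw [gradient_fun_mul (hχ.differentiable x) ((hφ.test i).differentiable x)]; rfl
      rw [this]; refine (eLpNorm_add_le ?_ ?_ (by norm_num)).trans (add_le_add ?_ ?_)
      · exact (hχ.continuous.smul (hφ.test i).continuous_gradient).aestronglyMeasurable
      · exact ((hφ.test i).continuous.smul hχ.continuous_gradient).aestronglyMeasurable
      · refine eLpNorm_mono fun x => ?_; rw [norm_smul, norm_of_nonneg (h0 x)]
        exact mul_le_of_le_one_left (norm_nonneg _) (h1 x)
      · refine eLpNorm_le_mul_eLpNorm_of_ae_le_mul (.of_forall fun x => ?_) 2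
        rw [norm_smul, mul_comm]; exact mul_le_mul_of_nonneg_right (hD x) (norm_nonneg _)
    calc _ ≤ eLpNorm (cv (ballKernel n r) (fun x => χ x * φ i x)) 2 (wMeas e ν) :=
          eLpNorm_mono_measure _ restrict_le_self
      _ ≤ C * eLpNorm (∇ (cv (ballKernel n r) (fun x => χ x * φ i x))) 2 vol[Ω] := htr _ (hcv i)
      _ ≤ C * eLpNorm (cv (ballKernel n r) (∇ (fun x => χ x * φ i x))) 2 volume := by
          rw [e1]; gcongr; exact restrict_le_self
      _ ≤ C * eLpNorm (∇ (fun x => χ x * φ i x)) 2 volume := by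
          gcongr
          exact hκ.eLpNorm_cv_le (hψ i).continuous_gradient.aesm (by norm_num)
            (by norm_num)
      _ ≤ C * (eLpNorm (∇ (φ i)) 2 vol[Ω] + ofReal D * eLpNorm (φ i) 2 vol[Ω]) := by rw [e2]; gcongr
      _ ≤ C * ((ofReal D + 1) * (eLpNorm (φ i) 2 vol[Ω] + eLpNorm (∇ (φ i)) 2 vol[Ω])) := by
          gcongr; rw [add_mul, mul_add, one_mul, add_comm]; exact add_le_add le_self_add le_add_self
      _ = _ := (mul_assoc _ _ _).symm
  have hlimB : Tendsto (fun i => C * (ofReal D + 1) * (eLpNorm (fun x => φ i x - w x) 2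
      vol[Ω] + eLpNorm w 2 vol[Ω] + (eLpNorm (fun x => ∇ (φ i) x
        - f x) 2 vol[Ω] + eLpNorm f 2 vol[Ω]))) atTop
      (𝓝 (C * (ofReal D + 1) * (0 + eLpNorm w 2 vol[Ω] + (0 + eLpNorm f 2 vol[Ω])))) :=
    ENNReal.Tendsto.const_mul ((hφ.tendsto.add tendsto_const_nhds).add
      (hφ.tendsto_grad.add tendsto_const_nhds))
      (Or.inr (mul_ne_top hC (by simp)))
  rw [zero_add, zero_add] at hlimB; rw [← hlimB.liminf_eq]
  refine liminf_le_liminf (.of_forall fun i => (hbd i).trans ?_); gcongr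
  · have := eLpNorm_add_le ((hφ.test i).continuous.aesm.sub hφ.memLp.1) hφ.memLp.1
      (p := 2) (by norm_num)
    rwa [sub_add_cancel] at this
  · have := eLpNorm_add_le ((hφ.test i).continuous_gradient.aesm.sub
      hφ.memLp_grad.1) hφ.memLp_grad.1 (p := 2) (by norm_num)
    rwa [sub_add_cancel] at this

/-- Write u = (u − φ) + φ. The ball averages of u − φ are controlled in L²(ν/e) uniformly in the
radius, those of φ converge uniformly to φ, and Fatou along radii tending to 0 reaches the precise
representative. -/
lemma setLIntegral_preciseSq_le (h : IsSupersolution Ω A e G ν) (hK : IsCompact K) (hKΩ : K ⊆ Ω) : ∃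
    C : ℝ≥0∞, C ≠ ⊤ ∧ ∀ u g, MemH10 Ω u g → ∀ φ, IsTestFunction Ω φ → ∫⁻ x in K, preciseSq u x
    ∂wMeas e ν ≤ (C * (eLpNorm (fun x => u x - φ x) 2 vol[Ω] + eLpNorm (fun x => g x - ∇ φ x) 2
    vol[Ω]) + eLpNorm φ 2 (wMeas e ν)) ^ 2 := by
  obtain ⟨C, hC, δ, hδ, htr⟩ := h.exists_trace_average hK hKΩ; refine ⟨C, hC, fun u g hu φ hφ => ?_⟩
  set w := fun x => u x - φ x
  set B := C * (eLpNorm w 2 vol[Ω] + eLpNorm (fun x => g x - ∇ φ x) 2 vol[Ω])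
  have hw := hu.sub hφ.memH10; set m := (wMeas e ν).restrict K
  have hmfin : m univ ≠ ⊤ := by rw [restrict_apply_univ]; exact (h.wMeas_lt_top hK hKΩ).ne
  obtain ⟨r, -, hrm, hr⟩ := exists_seq_strictAnti_tendsto' hδ
  have hr0 := fun i => (hrm i).1; have hrδ := fun i => (hrm i).2
  have hrlim : Tendsto r atTop (𝓝[>] 0) := tendsto_nhdsWithin_iff.2 ⟨hr, .of_forall hr0⟩
  have huc := hφ.continuous.uniformContinuous_of_tendsto_cocompact
    (hφ.compactSupport.is_zero_at_infty)
  have hosc : ∀ ε > 0, ∀ᶠ i in atTop, ∀ x, ‖(⨍ y in ball x (r i), φ y) - φ x‖ ≤ ε := by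
    intro ε hε; obtain ⟨η, hη, hη'⟩ := Metric.uniformContinuous_iff.1 huc ε hε
    filter_upwards [(tendsto_nhdsWithin_iff.1 hrlim).1.eventually (gt_mem_nhds hη)] with i hi x
    rw [← cv_ballKernel]
    refine (isKernel_ballKernel (hr0 i)).norm_cv_sub_le
      (hφ.continuous.continuousOn.integrableOn_compact (isCompact_closedBall _ _)) fun t ht => ?_
    exact (hη' ((mem_closedBall.1 ht).trans_lt hi)).le
  have hmain : ∀ ε > 0, ∀ᶠ i in atTop, eLpNorm (fun x => ⨍ y in ball x (r i), u y) 2 m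
      ≤ B + (m univ ^ (2 : ℝ≥0∞).toReal⁻¹ * ofReal ε + eLpNorm φ 2 (wMeas e ν)) := by
    intro ε hε; filter_upwards [hosc ε hε] with i hi
    obtain ⟨hball, htr'⟩ := htr (r i) (hr0 i) (hrδ i)
    have hB : eLpNorm (fun x => ⨍ y in ball x (r i), w y) 2 m ≤ B := htr' _ _ hw
    have m1 := hw.aestronglyMeasurable_average (hr0 i) hK.measurableSet hball (wMeas e ν)
    have m2 := (hφ.continuous_average (hr0 i)).aestronglyMeasurable (μ := m)
    have m3 := hφ.continuous.aesm (μ := m)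
    have e1 : (fun x => ⨍ y in ball x (r i), u y) =ᵐ[m] (fun x => ⨍ y in ball x (r i), w y)
        + (((fun x => ⨍ y in ball x (r i), φ y) - φ) + φ) := by
      filter_upwards [ae_restrict_mem hK.measurableSet] with x hx
      have hle : volume.restrict (ball x (r i)) ≤ vol[Ω] := restrict_mono (hball x hx) le_rfl
      have : IsFiniteMeasure (volume.restrict (ball x (r i))) :=
        ⟨by rw [restrict_apply_univ]; exact measure_ball_lt_top⟩
      simp only [Pi.add_apply, sub_add_cancel, setAverage_eq, w]
      rw [integral_sub ((hu.memLp.mono_measure hle).integrable (by norm_num))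
        ((hφ.memLp 1 _).integrable le_rfl), smul_sub, sub_add_cancel]
    rw [eLpNorm_congr_ae e1]
    refine (eLpNorm_add_le m1 ((m2.sub m3).add m3) (by norm_num)).trans (add_le_add hB ?_)
    refine (eLpNorm_add_le (m2.sub m3) m3 (by norm_num)).trans (add_le_add ?_
      (eLpNorm_mono_measure _ restrict_le_self))
    exact eLpNorm_le_of_ae_bound (.of_forall hi)
  have hfat : ∫⁻ x in K, preciseSq u x ∂wMeas e ν
      ≤ liminf (fun i => eLpNorm (fun x => ⨍ y in ball x (r i), u y) 2 m ^ 2) atTop := by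
    simp only [eLpNorm_two_sq]
    calc _ ≤ ∫⁻ x in K, liminf (fun i => ofReal ((⨍ y in ball x (r i), u y) ^ 2))
          atTop ∂wMeas e ν := by
          refine lintegral_mono fun x => ?_; exact (liminf_le_liminf_of_le hrlim).trans_eq (by rfl)
      _ ≤ _ := lintegral_liminf_le' fun i => by
          have := hu.aestronglyMeasurable_average (hr0 i) hK.measurableSet
            (htr (r i) (hr0 i) (hrδ i)).1 (wMeas e ν)
          exact (this.aemeasurable.pow_const 2).ennreal_ofReal
  have hε : ∀ ε > 0, ∫⁻ x in K, preciseSq u x ∂wMeas e ν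
      ≤ (B + (m univ ^ (2 : ℝ≥0∞).toReal⁻¹ * ofReal ε + eLpNorm φ 2 (wMeas e ν))) ^ 2 := by
    intro ε hε; refine hfat.trans (liminf_le_of_le (by isBoundedDefault) fun b hb => ?_)
    obtain ⟨i, h1, h2⟩ := (hb.and (hmain ε hε)).exists; exact h1.trans (pow_le_pow_left' h2 2)
  have hlim : Tendsto (fun ε : ℝ => (B + (m univ ^ (2 : ℝ≥0∞).toReal⁻¹ * ofReal ε
      + eLpNorm φ 2 (wMeas e ν))) ^ 2) (𝓝[>] 0) (𝓝 ((B + (m univ ^ (2 : ℝ≥0∞).toReal⁻¹ * 0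
      + eLpNorm φ 2 (wMeas e ν))) ^ 2)) := by
    refine ENNReal.Tendsto.pow (tendsto_const_nhds.add (Tendsto.add (ENNReal.Tendsto.const_mul ?_
      (Or.inr (rpow_ne_top_of_nonneg (by norm_num) hmfin))) tendsto_const_nhds))
    rw [← ofReal_zero]; exact (continuous_ofReal.tendsto 0).mono_left nhdsWithin_le_nhds
  rw [mul_zero, zero_add] at hlim
  exact ge_of_tendsto hlim (by filter_upwards [self_mem_nhdsWithin] with ε h using hε ε h)

/-- The Hardy inequality with remainder and measure term in `H¹₀`, on compact sets. -/
lemma hardy_memH10_compact (h : IsSupersolution Ω A e G ν) (hu : MemH10 Ω u g) (hK : IsCompact K)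
    (hKΩ : K ⊆ Ω) : energyA Ω A (fun x => R[g,u,e,G]x) + 1 / 4 * hardyR Ω A e G u + 1 / 2 * ∫⁻ x in
    K, preciseSq u x ∂wMeas e ν ≤ energyA Ω A g := by
  obtain ⟨φ, hφ⟩ := hu.exists_approx; obtain ⟨C, hC, hP⟩ := h.setLIntegral_preciseSq_le hK hKΩ
  set T := ∫⁻ x in K, preciseSq u x ∂wMeas e ν
  set b : ℕ → ℝ≥0∞ := fun j => C * (eLpNorm (fun x => u x - φ j x) 2 vol[Ω]
      + eLpNorm (fun x => g x - ∇ (φ j) x) 2 vol[Ω])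
  have hb : Tendsto b atTop (𝓝 0) := by
    have := ENNReal.Tendsto.const_mul (hφ.tendsto.add hφ.tendsto_grad) (a := C) (Or.inr hC)
    rw [add_zero, mul_zero] at this; refine this.congr fun j => ?_; simp only [b]; congr 2
    · exact eLpNorm_sub_comm _ _ _ _
    · exact eLpNorm_sub_comm _ _ _ _
  -- With S = √T the previous bound reads S ≤ b j + ‖φ j‖. The truncated difference S − b j is hence
  -- dominated by the trace norm of φ j, and it tends to S.
  set S := T ^ (1 / 2 : ℝ)
  have hST : S ^ 2 = T := by rw [← ENNReal.rpow_natCast, ← ENNReal.rpow_mul]; norm_num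
  have hSb : ∀ j, (S - b j) ^ 2 ≤ ∫⁻ x, ofReal (φ j x ^ 2 / e x) ∂ν := fun j => by
    rw [← h.eLpNorm_wMeas_sq]; refine pow_le_pow_left' (tsub_le_iff_left.2 ?_) 2
    rw [← ENNReal.sq_le_sq_iff, hST]; exact hP u g hu _ (hφ.test j)
  have hlim : Tendsto (fun j => 1 / 2 * (S - b j) ^ 2) atTop (𝓝 (1 / 2 * T)) := by
    rw [← hST]; refine ENNReal.Tendsto.const_mul (ENNReal.Tendsto.pow ?_) (Or.inr (by norm_num))
    simpa using ENNReal.Tendsto.sub (tendsto_const_nhds (x := S)) hb (Or.inr zero_ne_top)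
  obtain ⟨s1, m1⟩ := h.energyA_add_hardyR hφ.memLp_grad.1 hφ.memLp.1
  -- The measure term is already a number for each j; it enters the two-measure Fatou lemma as a
  -- constant on a one-point space with Dirac mass.
  have := lintegral_add_lintegral_le_of_tendsto (μ := vol[Ω])
    (ν := dirac ()) (h := fun j _ => 1 / 2 * (S - b j) ^ 2) (H := fun _ => 1 / 2 * T)
    (c := fun j => energyA Ω A (∇ (φ j)))
    (fun j => (h.energyA_add_hardyR (hφ.test j).continuous_gradient.aesm
      (hφ.test j).continuous.aesm).2.ennreal_ofReal) (fun j => aemeasurable_const)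
    (F := fun x => ofReal P[A,g,u,e,G]x) ?_
    (.of_forall fun _ => hlim) (tendsto_energyA h.isOpen h.elliptic hφ.memLp_grad
      (fun j => (hφ.test j).memLp_gradient 2 _) hφ.tendsto_grad) fun j => ?_
  · rw [s1]; simpa using this
  · filter_upwards [hφ.ae, hφ.ae_grad] with x h1 h2; refine tendsto_ofReal (Tendsto.add ?_ ?_)
    · have hl : Tendsto (fun j => R[∇ (φ j),φ j,e,G]x) atTop
          (𝓝 R[g,u,e,G]x) := h2.sub ((h1.div_const _).smul_const _)
      exact tendsto_matForm (A x) hl hl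
    · exact ((((h1.pow 2).div_const _).mul_const _).const_mul _)
  · rw [lintegral_const, measure_univ, mul_one, ← (h.energyA_add_hardyR
      (hφ.test j).continuous_gradient.aesm
      (hφ.test j).continuous.aesm).1]
    refine le_trans ?_ (h.hardy_test (hφ.test j)); gcongr; exact hSb j

/-- The Hardy inequality with remainder and measure term in `H¹₀`. -/
theorem hardy_memH10 (h : IsSupersolution Ω A e G ν) (hu : MemH10 Ω u g) : energyA Ω A (fun x => R[g,u,e,G]x) + 1 / 4 * hardyR Ω A e G u + 1 / 2 * ∫⁻ x in Ω, preciseSq u x ∂wMeas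
    e ν ≤ energyA Ω A g := by
  obtain ⟨K, hK, hKΩ, hm, hU⟩ := h.isOpen.exists_compact_exhaustion
  have : ∫⁻ x in Ω, preciseSq u x ∂wMeas e ν = ⨆ i, ∫⁻ x in K i, preciseSq u x ∂wMeas e ν := by
    rw [← setLIntegral_iUnion_of_directed _ hm.directed_le, hU]
  rw [this, mul_iSup, add_iSup]; exact iSup_le fun i => h.hardy_memH10_compact hu (hK i) (hKΩ i)

end IsSupersolution

end Averages

/-! ### Functions of H¹₀ with vanishing gradient. -/

section Vanishing

/-- Integration by parts against arctan(x_i), which is bounded by π/2 and has derivative 1/(1 +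
x_i²). It replaces a Poincaré inequality and works in unbounded domains too. -/
lemma IsTestFunction.integral_sq_div_le (hφ : IsTestFunction Ω φ) (i : Fin n) : ∫ x, φ x ^ 2 / (1 +
    x i ^ 2) ≤ Real.pi * ∫ x, ‖φ x • ∇ φ x‖ := by
  set v : Eu n := EuclideanSpace.single i 1
  have hat : ∀ x : Eu n, HasFDerivAt (fun y : Eu n => arctan (y i))
      ((1 / (1 + x i ^ 2)) • (EuclideanSpace.proj i : Eu n →L[ℝ] ℝ)) x := fun x =>
    HasDerivAt.comp_hasFDerivAt (f := fun y : Eu n => y i) x (hasDerivAt_arctan (x i))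
      (EuclideanSpace.proj (𝕜 := ℝ) i : Eu n →L[ℝ] ℝ).hasFDerivAt
  have hdv : ∀ x : Eu n, fderiv ℝ (fun y : Eu n => arctan (y i)) x v = 1 / (1 + x i ^ 2) := by
    intro x
    have : (EuclideanSpace.proj (𝕜 := ℝ) i : Eu n →L[ℝ] ℝ) v = 1 := by change v i = 1; simp [v]
    rw [(hat x).fderiv, _root_.smul_apply, this, smul_eq_mul, mul_one]
  have hd2 : ∀ x, fderiv ℝ (fun y => φ y ^ 2) x v = 2 * φ x * inner ℝ (∇ φ x) v := by
    intro x; rw [fderiv_fun_pow 2 (hφ.differentiable x)]; simp [gradient, inner, mul_assoc]; left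
    exact (InnerProductSpace.toDual_symm_apply (𝕜 := ℝ)).symm
  have hden : ∀ x : Eu n, (1 + x i ^ 2) ≠ 0 := fun x => by positivity
  have hcd : Continuous fun x : Eu n => 1 / (1 + x i ^ 2) := continuous_const.div (by fun_prop) hden
  have hca : Continuous fun x : Eu n => arctan (x i) := continuous_arctan.comp (by fun_prop)
  have hφ2c : Continuous fun x => φ x ^ 2 := hφ.continuous.pow 2
  have hi : ∀ f : Eu n → ℝ, Continuous f → ∀ h : Eu n → ℝ, Continuous h →
      (∀ x, x ∉ tsupport φ → h x = 0) → Integrable (fun x => f x * h x) := fun f hf h hh h0 =>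
    (hf.mul hh).integrable_of_hasCompactSupport
      (HasCompactSupport.intro hφ.compactSupport.isCompact fun x hx => by simp [h0 x hx])
  have hgc : Continuous fun x => 2 * φ x * inner ℝ (∇ φ x) v :=
    (continuous_const.mul hφ.continuous).mul (hφ.continuous_gradient.inner continuous_const)
  have h0 : ∀ x, x ∉ tsupport φ → φ x = 0 := fun x hx => eq_zero_of_notMem hx
  have ibp : ∫ x, arctan (x i) * (fderiv ℝ (fun y => φ y ^ 2) x v)
      = -∫ x, (fderiv ℝ (fun y : Eu n => arctan (y i)) x v) * φ x ^ 2 := by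
    refine integral_mul_fderiv_eq_neg_fderiv_mul_of_integrable ?_ ?_ ?_
      (fun x _ => (hat x).differentiableAt) (fun x _ => hφ.sq.differentiable x)
    · simp only [hdv]; exact hi _ hcd _ hφ2c fun x hx => by simp [h0 x hx]
    · simp only [hd2]; exact hi _ hca _ hgc fun x hx => by simp [h0 x hx]
    · exact hi _ hca _ hφ2c fun x hx => by simp [h0 x hx]
  have e1 : ∫ x, φ x ^ 2 / (1 + x i ^ 2)
      = ∫ x, (fderiv ℝ (fun y : Eu n => arctan (y i)) x v) * φ x ^ 2 := by
    refine integral_congr_fun fun x => ?_; simp only [hdv]; ring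
  rw [e1, ← neg_eq_iff_eq_neg.2 ibp, ← integral_neg, ← integral_const_mul]
  refine integral_mono ?_ ?_ fun x => ?_
  · simp only [hd2]; exact (hi _ hca _ hgc fun x hx => by simp [h0 x hx]).neg
  · refine (Continuous.integrable_of_hasCompactSupport ?_ ?_).const_mul _
    · exact (hφ.continuous.smul hφ.continuous_gradient).norm
    · exact HasCompactSupport.intro hφ.compactSupport.isCompact fun x hx => by simp [h0 x hx]
  · simp only [hd2]
    have h1 : |arctan (x i)| ≤ Real.pi / 2 := abs_le.2
      ⟨(neg_pi_div_two_lt_arctan _).le, (arctan_lt_pi_div_two _).le⟩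
    have h2 : |inner ℝ (∇ φ x) v| ≤ ‖∇ φ x‖ := by
      have := abs_real_inner_le_norm (∇ φ x) v; simpa [v] using this
    calc -(arctan (x i) * (2 * φ x * inner ℝ (∇ φ x) v))
        ≤ |arctan (x i) * (2 * φ x * inner ℝ (∇ φ x) v)| := neg_le_abs _
      _ = 2 * (|arctan (x i)| * (|φ x| * |inner ℝ (∇ φ x) v|)) := by
          rw [abs_mul, abs_mul, abs_mul, abs_two]; ring
      _ ≤ 2 * (Real.pi / 2 * (|φ x| * ‖∇ φ x‖)) := by gcongr
      _ = Real.pi * ‖φ x • ∇ φ x‖ := by rw [norm_smul, norm_eq_abs]; ring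

/-- In the limit the weighted inequality bounds ∫ u²/(1 + x_i²) by π ‖u‖ ‖g‖ = 0; the condition 1 ≤
n provides a coordinate. -/
lemma MemH10.ae_eq_zero_of_grad (hn : 1 ≤ n) (hΩ : IsOpen Ω) (h : MemH10 Ω u g) (hg : ∀ᵐ x ∂vol[Ω],
    g x = 0) : ∀ᵐ x ∂vol[Ω], u x = 0 := by
  obtain ⟨φ, hφ⟩ := h.exists_approx; set i : Fin n := ⟨0, hn⟩
  have hb : ∀ j, ∫⁻ x in Ω, ofReal (φ j x ^ 2 / (1 + x i ^ 2)) ≤ ofReal Real.pi *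
      (eLpNorm (φ j) 2 vol[Ω] * eLpNorm (∇ (φ j)) 2 vol[Ω]) := by
    intro j; have h0 : ∀ x, x ∉ tsupport (φ j) → φ j x = 0 := fun x hx => eq_zero_of_notMem hx
    have i1 : Integrable (fun x : Eu n => φ j x ^ 2 / (1 + x i ^ 2)) := by
      refine Continuous.integrable_of_hasCompactSupport ?_ (HasCompactSupport.intro
        (hφ.test j).compactSupport.isCompact fun x hx => by simp [h0 x hx])
      exact ((hφ.test j).continuous.pow 2).div (by fun_prop) fun x => by positivity
    calc _ ≤ ∫⁻ x, ofReal (φ j x ^ 2 / (1 + x i ^ 2)) := setLIntegral_le_lintegral _ _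
      _ = ofReal (∫ x, φ j x ^ 2 / (1 + x i ^ 2)) :=
          (ofReal_integral_eq_lintegral_ofReal i1 (.of_forall fun x => by positivity)).symm
      _ ≤ ofReal (Real.pi * ∫ x, ‖φ j x • ∇ (φ j) x‖) :=
          ofReal_le_ofReal ((hφ.test j).integral_sq_div_le i)
      _ = ofReal Real.pi * eLpNorm (φ j • ∇ (φ j)) 1 volume := by
          rw [ofReal_mul pi_pos.le, ofReal_integral_norm_eq_lintegral_enorm,
            eLpNorm_one_eq_lintegral_enorm]
          · rfl
          · exact ((hφ.test j).continuous.smul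
              (hφ.test j).continuous_gradient).integrable_of_hasCompactSupport
              (HasCompactSupport.intro (hφ.test j).compactSupport.isCompact
                fun x hx => by simp [h0 x hx])
      _ ≤ ofReal Real.pi * (eLpNorm (φ j) 2 volume * eLpNorm (∇ (φ j)) 2 volume) := by
          gcongr
          exact eLpNorm_smul_le_mul_eLpNorm (hφ.test j).continuous_gradient.aesm
            (hφ.test j).continuous.aesm
      _ = _ := by
          rw [eLpNorm_restrict_eq_of_support_subset
            ((subset_tsupport _).trans (hφ.test j).support_subset),
            eLpNorm_restrict_eq_of_support_subset ((subset_tsupport _).trans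
              ((tsupport_gradient_subset _).trans (hφ.test j).support_subset))]
  have hG : Tendsto (fun j => eLpNorm (∇ (φ j)) 2 vol[Ω]) atTop (𝓝 0) := by
    refine hφ.tendsto_grad.congr fun j => eLpNorm_congr_ae ?_; filter_upwards [hg] with x hx
    rw [hx, sub_zero]
  have hlim : Tendsto (fun j => ofReal Real.pi * ((eLpNorm (fun x => φ j x - u x) 2
      vol[Ω] + eLpNorm u 2 vol[Ω]) * eLpNorm (∇ (φ j)) 2
      vol[Ω])) atTop (𝓝 (ofReal Real.pi * ((0 + eLpNorm u 2 vol[Ω]) * 0))) :=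
    ENNReal.Tendsto.const_mul (ENNReal.Tendsto.mul (hφ.tendsto.add tendsto_const_nhds)
      (Or.inr zero_ne_top) hG (Or.inr (by simpa using h.memLp.2.ne)))
      (Or.inr ofReal_ne_top)
  rw [mul_zero, mul_zero] at hlim
  have hmeas : ∀ {f : Eu n → ℝ}, AEMeasurable f vol[Ω] →
      AEMeasurable (fun x => ofReal (f x ^ 2 / (1 + x i ^ 2))) vol[Ω] :=
    fun hf => ((hf.pow_const 2).div (by fun_prop)).ennreal_ofReal
  have hz : ∫⁻ x in Ω, ofReal (u x ^ 2 / (1 + x i ^ 2)) = 0 := by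
    refine le_antisymm ?_ zero_le
    calc _ = ∫⁻ x in Ω, liminf (fun j => ofReal (φ j x ^ 2 / (1 + x i ^ 2))) atTop := by
          refine lintegral_congr_ae ?_; filter_upwards [hφ.ae] with x hx
          exact (tendsto_ofReal ((hx.pow 2).div_const _)).liminf_eq.symm
      _ ≤ _ := lintegral_liminf_le' fun j => hmeas (hφ.test j).continuous.aemeasurable
      _ ≤ liminf (fun j => ofReal Real.pi * ((eLpNorm (fun x => φ j x - u x) 2
          vol[Ω] + eLpNorm u 2 vol[Ω]) * eLpNorm (∇ (φ j)) 2
          vol[Ω])) atTop := by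
          refine liminf_le_liminf (.of_forall fun j => (hb j).trans ?_); gcongr
          have := eLpNorm_add_le ((hφ.test j).continuous.aesm.sub h.memLp.1)
            h.memLp.1 (p := 2) (by norm_num)
          rwa [sub_add_cancel] at this
      _ = 0 := hlim.liminf_eq
  rw [lintegral_eq_zero_iff' (hmeas h.memLp.1.aemeasurable)] at hz; filter_upwards [hz] with x hx
  have h1 : u x ^ 2 / (1 + x i ^ 2) ≤ 0 := ofReal_eq_zero.1 hx
  have h2 : (0 : ℝ) < 1 + x i ^ 2 := by positivity
  have h3 : u x ^ 2 ≤ 0 := by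
    have := mul_le_mul_of_nonneg_right h1 h2.le; rwa [div_mul_cancel₀ _ h2.ne', zero_mul] at this
  exact pow_eq_zero_iff two_ne_zero |>.1 (le_antisymm h3 (sq_nonneg _))

end Vanishing

/-! ### Equality is never attained. -/

section Strict

lemma eLpNorm_sq_le_energyA (hΩ : IsOpen Ω) {lam : ℝ} (hl : 0 ≤ lam) (hb : ∀ x ∈ Ω, ∀ ξ, lam * ‖ξ‖ ^
    2 ≤ matForm (A x) ξ ξ) (f : Eu n → Eu n) : ofReal lam * eLpNorm f 2 vol[Ω] ^ 2 ≤ energyA Ω A f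
    := by
  rw [← eLpNorm_norm, eLpNorm_two_sq, energyA, ← lintegral_const_mul' _ _ ofReal_ne_top]
  refine lintegral_mono_ae ?_; filter_upwards [hΩ.ae_mem] with x hx; rw [← ofReal_mul hl]
  exact ofReal_le_ofReal (hb x hx _)

lemma energyA_smul_eq_hardyR (u : Eu n → ℝ) : energyA Ω A (fun x => (u x / e x) • G x) = hardyR Ω A
    e G u := by
  rw [energyA, hardyR]; refine lintegral_congr fun x => ?_
  rw [matForm_smul_left, matForm_smul_right]; ring_nf

namespace IsSupersolution

/-- With the lower ellipticity bound, the Hardy inequality says that u ↦ (u/e) G is continuous from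
H¹₀ to L². Integrals quadratic in this field thus pass to the limit along test functions. -/
lemma exists_eLpNorm_le (h : IsSupersolution Ω A e G ν) : ∃ C : ℝ≥0∞, C ≠ ⊤ ∧ ∀ u g, MemH10 Ω u g →
    eLpNorm (fun x => (u x / e x) • G x) 2 vol[Ω] ≤ C * eLpNorm g 2 vol[Ω] := by
  obtain ⟨lam, Lam, hl, hL, hb⟩ := h.elliptic.exists_bounds
  refine ⟨ofReal √(4 * Lam / lam), ofReal_ne_top, fun u g hu => ?_⟩
  have h1 := eLpNorm_sq_le_energyA h.isOpen hl.le (fun x hx => (hb x hx).1)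
    (fun x => (u x / e x) • G x)
  rw [energyA_smul_eq_hardyR] at h1
  have h2 : 1 / 4 * hardyR Ω A e G u ≤ energyA Ω A g :=
    le_trans (le_trans le_add_self le_self_add) (h.hardy_memH10 hu)
  have h3 := energyA_le h.isOpen hL.le (fun x hx => (hb x hx).2) g
  rw [← ENNReal.sq_le_sq_iff, mul_pow, ← ofReal_pow (sqrt_nonneg _), sq_sqrt (by positivity)]
  have h4 : hardyR Ω A e G u ≤ ofReal 4 * (ofReal Lam * eLpNorm g 2 vol[Ω] ^ 2) := by
    calc hardyR Ω A e G u = ofReal 4 * (1 / 4 * hardyR Ω A e G u) := by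
          rw [← mul_assoc, ofReal_ofNat, one_div, ENNReal.mul_inv_cancel (by norm_num)
            (by norm_num), one_mul]
      _ ≤ _ := mul_le_mul' le_rfl (h2.trans h3)
  calc _ = ofReal (1 / lam) * (ofReal lam *
        eLpNorm (fun x => (u x / e x) • G x) 2 vol[Ω] ^ 2) := by
        rw [← mul_assoc, ← ofReal_mul (by positivity), one_div_mul_cancel hl.ne',
          ofReal_one, one_mul]
    _ ≤ ofReal (1 / lam) * (ofReal 4 * (ofReal Lam
      * eLpNorm g 2 vol[Ω] ^ 2)) := mul_le_mul' le_rfl (h1.trans h4)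
    _ = _ := by
        rw [← mul_assoc, ← mul_assoc, ← ofReal_mul (by positivity), ← ofReal_mul (by positivity)]
        congr 2; ring

lemma memLp_div_smul (h : IsSupersolution Ω A e G ν) (hu : MemH10 Ω u g) : MemLp (fun x => (u x / e
    x) • G x) 2 vol[Ω] := by
  obtain ⟨C, hC, hb⟩ := h.exists_eLpNorm_le
  exact ⟨AEStronglyMeasurable.fun_smul (hu.memLp.1.aemeasurable.div
    h.meas.aemeasurable).aestronglyMeasurable h.loc.aestronglyMeasurable,
    (hb u g hu).trans_lt (mul_lt_top hC.lt_top hu.memLp_grad.2)⟩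

/-- The inequality is tested with φⱼ² k(e)/e and φⱼ → u. With p = (u/e) G the limit is 2∫k⟨p, g⟩ + ∫
e k'|p|² − ∫ k|p|², and the first and last terms cancel since g = p/2. -/
lemma integral_deriv_cutoff_nonneg (h : IsSupersolution Ω A e G ν) (hu : MemH10 Ω u g) (hg : ∀ᵐ x
    ∂vol[Ω], g x = (u x / (2 * e x)) • G x) {k : ℝ → ℝ} (hk : IsCutoff k) (hk0 : ∀ t, 0 ≤ k t) : 0 ≤
    ∫ x in Ω, e x * deriv k (e x) * matForm (A x) ((u x / e x) • G x) ((u x / e x) • G x) := by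
  obtain ⟨φ, hφ⟩ := hu.exists_approx; obtain ⟨C, hC, hb⟩ := h.exists_eLpNorm_le
  set p : Eu n → Eu n := fun x => (u x / e x) • G x with hp
  set P : ℕ → Eu n → Eu n := fun j x => (φ j x / e x) • G x with hP
  have hPl : ∀ j, MemLp (P j) 2 vol[Ω] := fun j =>
    h.memLp_div_smul (hφ.test j).memH10
  have hpl : MemLp p 2 vol[Ω] := h.memLp_div_smul hu
  have hconv : Tendsto (fun j => eLpNorm (fun x => P j x - p x) 2 vol[Ω]) atTop (𝓝 0) := by
    have h1 : Tendsto (fun j => C * eLpNorm (fun x => ∇ (φ j) x - g x) 2 vol[Ω]) atTop (𝓝 0) := by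
      simpa using ENNReal.Tendsto.const_mul hφ.tendsto_grad (Or.inr hC)
    refine tendsto_zero_of_le h1 fun j => ?_
    refine le_trans (le_of_eq ?_) (hb _ _ ((hφ.test j).memH10.sub hu)); congr 1
    ext1 x
    simp only [hP, hp, ← sub_smul, sub_div]
  have hmul : ∀ {b : ℝ → ℝ}, IsCutoff b → (∀ F : Eu n → Eu n, MemLp F 2 vol[Ω] →
      MemLp (fun x => b (e x) • F x) 2 vol[Ω]) ∧
      Tendsto (fun j => eLpNorm (fun x => b (e x) • P j x - b (e x) • p x) 2 vol[Ω])
        atTop (𝓝 0) := by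
    intro b hbc; obtain ⟨D, hD⟩ := hbc.bounded
    have hle : ∀ F : Eu n → Eu n, eLpNorm (fun x => b (e x) • F x) 2 vol[Ω]
        ≤ ofReal D * eLpNorm F 2 vol[Ω] := fun F =>
      eLpNorm_le_mul_eLpNorm_of_ae_le_mul (.of_forall fun x => by
        rw [norm_smul]; exact mul_le_mul_of_nonneg_right (hD _) (norm_nonneg _)) 2
    refine ⟨fun F hF => ⟨(h.measurable_comp hbc.continuous).fun_smul hF.1,
      (hle F).trans_lt (mul_lt_top ofReal_lt_top hF.2)⟩, ?_⟩
    have h1 : Tendsto (fun j => ofReal D * eLpNorm (fun x => P j x - p x) 2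
        vol[Ω]) atTop (𝓝 0) := by
      simpa using ENNReal.Tendsto.const_mul hconv (Or.inr ofReal_ne_top)
    refine tendsto_zero_of_le h1 fun j => ?_; simp only [← smul_sub]; exact hle _
  have hm : IsCutoff (fun t => t * deriv k t) := hk.deriv.mul_left contDiffOn_id
  have hl : IsCutoff (fun t => k t / t) := hk.div_id
  have T1 := tendsto_integral_matForm h.isOpen h.elliptic ((hmul hk).1 p hpl) hφ.memLp_grad
    (fun j => (hmul hk).1 _ (hPl j)) (fun j => (hφ.test j).memLp_gradient 2 _) (hmul hk).2
    hφ.tendsto_grad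
  have T2 := tendsto_integral_matForm h.isOpen h.elliptic ((hmul hm).1 p hpl) hpl
    (fun j => (hmul hm).1 _ (hPl j)) hPl (hmul hm).2 hconv
  have T3 := tendsto_integral_matForm h.isOpen h.elliptic ((hmul hk).1 p hpl) hpl
    (fun j => (hmul hk).1 _ (hPl j)) hPl (hmul hk).2 hconv
  have T := ((T1.const_mul 2).add T2).sub T3
  have hlimval : 2 * (∫ x in Ω, matForm (A x) (k (e x) • p x) (g x))
      = ∫ x in Ω, matForm (A x) (k (e x) • p x) (p x) := by
    rw [← integral_const_mul]; refine integral_congr_ae ?_; filter_upwards [hg] with x hx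
    have : p x = (2 : ℝ) • g x := by rw [hx, hp, smul_smul]; congr 1; ring
    rw [this, matForm_smul_right _ _ _ (g x)]
  rw [hlimval, add_sub_cancel_left] at T
  have hval : ∫ x in Ω, e x * deriv k (e x) * Q[A,p,p]x
      = ∫ x in Ω, matForm (A x) ((e x * deriv k (e x)) • p x) (p x) := by
    simp only [matForm_smul_left]
  rw [hval]; refine ge_of_tendsto' T fun j => ?_
  have hl0 : ∀ t, 0 ≤ k t / t := fun t => by
    rcases le_or_gt t 0 with h0 | h0
    · exact (hl.eq_zero_of_nonpos h0).ge
    · exact div_nonneg (hk0 t) h0.le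
  have hΛ := (h.ineq _ (hφ.test j).sq (fun x => sq_nonneg _) _ hl hl0).2; refine hΛ.trans_eq ?_
  have I1 := integrable_matForm h.isOpen h.elliptic ((hmul hk).1 _ (hPl j))
    ((hφ.test j).memLp_gradient 2 _)
  have I2 := integrable_matForm h.isOpen h.elliptic ((hmul hm).1 _ (hPl j)) (hPl j)
  have I3 := integrable_matForm h.isOpen h.elliptic ((hmul hk).1 _ (hPl j)) (hPl j)
  rw [truncForm, ← integral_const_mul, ← integral_add (I1.const_mul 2) I2, ← integral_sub]
  rotate_left
  · exact (I1.const_mul 2).add I2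
  · exact I3
  refine integral_congr_fun fun x => ?_
  simp only [(hφ.test j).gradient_sq, hP, matForm_smul_left, matForm_smul_right]
  rcases le_or_gt (e x) 0 with h0 | h0
  · simp [hk.eq_zero_of_nonpos h0, hk.deriv.eq_zero_of_nonpos h0, hl.deriv.eq_zero_of_nonpos h0]
  · have hd : deriv (fun t => k t / t) (e x) = deriv k (e x) / e x - k (e x) / e x ^ 2 := by
      have := ((hk.differentiable (e x)).hasDerivAt.div (hasDerivAt_id (e x)) h0.ne').deriv
      have e2 : deriv (fun t => k t / t) (e x) = _ := this; rw [e2]; simp only [id]; field_simp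
    rw [hd]; field_simp; ring

/-- The Hardy inequality is not attained. -/
theorem hardy_strict (hn : 1 ≤ n) (h : IsSupersolution Ω A e G ν) (hu : MemH10 Ω u g) (hu0 :
    IsNontrivialOn Ω u) (hpos : ∀ᵐ x ∂vol[Ω], 0 < e x) : 1 / 4 * hardyR Ω A e G u + 1 / 2 * ∫⁻ x in
    Ω, preciseSq u x ∂wMeas e ν < energyA Ω A g := by
  by_contra! hle; refine hu0 ?_; have hfin := energyA_lt_top h.isOpen h.elliptic hu.memLp_grad
  have hH := h.hardy_memH10 hu
  have hm : AEStronglyMeasurable (fun x => R[g,u,e,G]x) vol[Ω] :=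
    hu.memLp_grad.1.sub (AEStronglyMeasurable.fun_smul (hu.memLp.1.aemeasurable.div
      (h.meas.aemeasurable.const_mul 2)).aestronglyMeasurable h.loc.aestronglyMeasurable)
  -- The energy is finite and can be cancelled, so equality leaves nothing for the remainder.
  have hR : energyA Ω A (fun x => R[g,u,e,G]x) = 0 := by
    have h1 : energyA Ω A (fun x => R[g,u,e,G]x) + energyA Ω A g ≤ 0 + energyA Ω A g := by
      rw [zero_add]; exact (add_le_add le_rfl hle).trans ((add_assoc _ _ _).symm.le.trans hH)
    exact le_antisymm (ENNReal.le_of_add_le_add_right hfin.ne h1) zero_le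
  obtain ⟨lam, Lam, hl, hL, hb⟩ := h.elliptic.exists_bounds
  have hzero : ∀ {f : Eu n → Eu n}, ∀ x ∈ Ω, Q[A,f,f]x ≤ 0 → f x = 0 := by
    intro f x hx h0; have := ((hb x hx).1 (f x)).trans h0
    have h2 : ‖f x‖ ^ 2 ≤ 0 := by by_contra! h3; exact absurd this (not_le.2 (mul_pos hl h3))
    exact norm_eq_zero.1 (pow_eq_zero_iff two_ne_zero |>.1 (le_antisymm h2 (sq_nonneg _)))
  have hg : ∀ᵐ x ∂vol[Ω], g x = (u x / (2 * e x)) • G x := by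
    rw [energyA, lintegral_eq_zero_iff'
      (h.elliptic.aestronglyMeasurable hm hm).aemeasurable.ennreal_ofReal] at hR
    filter_upwards [hR, h.isOpen.ae_mem] with x hx hxΩ
    exact sub_eq_zero.1 (hzero (f := fun x => R[g,u,e,G]x) x hxΩ (ofReal_eq_zero.1 hx))
  set p : Eu n → Eu n := fun x => (u x / e x) • G x with hp
  have hpl : MemLp p 2 vol[Ω] := h.memLp_div_smul hu
  have hpi : Integrable (fun x => Q[A,p,p]x) vol[Ω] :=
    integrable_matForm h.isOpen h.elliptic hpl hpl
  have hp0 := h.elliptic.ae_nonneg h.isOpen p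
  obtain ⟨M, hM0, hM⟩ := exists_σ_deriv_le; have hα := σ_contDiff
  have hαd : Differentiable ℝ σ := hα.differentiable (by simp)
  have hαc : Continuous (deriv σ) := hα.continuous_deriv (by simp)
  have hbd : ∀ s, ‖deriv σ s‖ ≤ M := fun s => by rw [norm_of_nonneg (σ_deriv_nonneg s)]; exact hM s
  have key : ∀ s0 : ℝ, ∀ᵐ x ∂vol[Ω], deriv σ (s0 - log (e x)) * Q[A,p,p]x = 0 := by
    intro s0
    set q : Eu n → ℝ := fun x =>
      deriv σ (s0 - log (e x)) * Q[A,p,p]x with hq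
    have hqm : AEStronglyMeasurable (fun x => deriv σ (s0 - log (e x)))
        vol[Ω] := (hαc.measurable.comp_aemeasurable
          (aemeasurable_const.sub (measurable_log.comp_aemeasurable
            h.meas.aemeasurable))).aestronglyMeasurable
    have hqi : Integrable q vol[Ω] := hpi.bdd_mul hqm (c := M) (.of_forall fun x => hbd _)
    have hq0 : 0 ≤ᵐ[vol[Ω]] q := by
      filter_upwards [hp0] with x hx; exact mul_nonneg (σ_deriv_nonneg _) hx
    have hle : ∀ L : ℝ, 1 ≤ L → ∫ x in Ω, q x ≤ M / L * ∫ x in Ω, Q[A,p,p]x := by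
      intro L hL; have hL0 : 0 < L := one_pos.trans_le hL
      -- In the variable s = log e, the profile H climbs from 0 to 1 on [s0 − 2L, s0 − L] with slope
      -- at most M/L and falls back to 0 on [s0 − 1, s0]. Nonnegativity of ∫ H'(log e)|p|² bounds
      -- the quick fall by the slow rise.
      set H : ℝ → ℝ := fun s =>
        σ (2 + (s - s0) / L) * σ (s0 - s) with hH_def
      have hHc : ContDiff ℝ ∞ H := (hα.comp (by fun_prop)).mul (hα.comp (by fun_prop))
      have hHs : ∀ s, s ∉ Icc (s0 - 2 * L) s0 → H s = 0 := by
        intro s hs; simp only [hH_def]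
        by_cases h1 : s ≤ s0
        · have h2 : s < s0 - 2 * L := by by_contra! h2; exact hs ⟨h2, h1⟩
          rw [σ_eq_zero, zero_mul]; have : (s - s0) / L ≤ -2 := by rw [div_le_iff₀ hL0]; linarith
          linarith
        · rw [σ_eq_zero (x := s0 - s), mul_zero]; linarith
      have hcut := IsCutoff.of_log hHc hHs
      have hH0 : ∀ t : ℝ, 0 ≤ (if 0 < t then H (log t) else 0) := fun t => by
        split_ifs
        · exact mul_nonneg (σ_nonneg _) (σ_nonneg _)
        · exact le_rfl
      have hpos1 := h.integral_deriv_cutoff_nonneg hu hg hcut hH0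
      have hHd : ∀ s, deriv H s ≤ M / L - deriv σ (s0 - s) := by
        intro s
        have d1 : HasDerivAt (fun s => σ (2 + (s - s0) / L))
            (deriv σ (2 + (s - s0) / L) * (1 / L)) s := by
          have := (hαd (2 + (s - s0) / L)).hasDerivAt.comp s
            (((hasDerivAt_id s).sub_const s0).div_const L |>.const_add 2)
          exact this
        have d2 : HasDerivAt (fun s => σ (s0 - s)) (deriv σ (s0 - s) * (-1)) s := by
          have := (hαd (s0 - s)).hasDerivAt.comp s ((hasDerivAt_id s).const_sub s0); exact this
        rw [show deriv H s = _ from (d1.mul d2).deriv]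
        have a1 : deriv σ (2 + (s - s0) / L) * (1 / L) * σ (s0 - s) ≤ M / L := by
          calc _ ≤ M * (1 / L) * 1 := by
                gcongr
                · exact σ_nonneg _
                · exact hM _
                · exact σ_le_one _
            _ = M / L := by ring
        -- Where the falling factor has a nonzero derivative, s lies within 1 ≤ L of s0, so the
        -- rising factor is already one.
        have a2 : σ (2 + (s - s0) / L) * (deriv σ (s0 - s) * (-1)) = -deriv σ (s0 - s) := by
          by_cases hs : s0 - s ∈ Ioo (0 : ℝ) 1
          · rw [σ_eq_one]; · ring
            have : -1 ≤ (s - s0) / L := by rw [le_div_iff₀ hL0]; nlinarith [hs.1, hs.2]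
            linarith
          · rw [σ_deriv_of_notMem hs]; simp
        rw [a2]; linarith
      have hint : Integrable (fun x => e x * deriv (fun t => if 0 < t then H (log t) else 0)
          (e x) * Q[A,p,p]x) vol[Ω] := by
        obtain ⟨D, hD⟩ := (hcut.deriv.mul_left contDiffOn_id).bounded
        refine hpi.bdd_mul (c := D) ?_ (.of_forall fun x => ?_)
        · exact h.measurable_comp (hcut.deriv.mul_left contDiffOn_id).continuous
        · exact hD (e x)
      have hmono : ∫ x in Ω, e x * deriv (fun t => if 0 < t then H (log t) else 0) (e x) * Q[A,p,p]x
          ≤ ∫ x in Ω, (M / L * Q[A,p,p]x - q x) := by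
        refine integral_mono_ae hint ((hpi.const_mul _).sub hqi) ?_
        filter_upwards [hp0, hpos] with x hx hex; rw [IsCutoff.deriv_log hHc hex, hq]; simp only
        rw [← sub_mul]; refine mul_le_mul_of_nonneg_right ?_ hx
        have : e x * (deriv H (log (e x)) / e x) = deriv H (log (e x)) := by field_simp
        rw [this]; exact hHd _
      rw [integral_sub (hpi.const_mul _) hqi, integral_const_mul] at hmono; linarith
    -- The rise becomes arbitrarily slow: L → ∞.
    have hz : ∫ x in Ω, q x ≤ 0 := by
      have ht : Tendsto (fun L : ℝ => M / L * ∫ x in Ω, Q[A,p,p]x) atTop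
          (𝓝 (0 * ∫ x in Ω, Q[A,p,p]x)) :=
        (tendsto_const_nhds.div_atTop tendsto_id).mul_const _
      rw [zero_mul] at ht
      exact ge_of_tendsto ht (by filter_upwards [eventually_ge_atTop 1] with L hL using hle L hL)
    have := (integral_eq_zero_iff_of_nonneg_ae hq0 hqi).1
      (le_antisymm hz (integral_nonneg_of_ae hq0))
    exact this
  obtain ⟨s1, hs1⟩ : ∃ s, deriv σ s ≠ 0 := by
    by_contra! h0; have := is_const_of_deriv_eq_zero hαd h0 0 1
    rw [σ_eq_zero le_rfl, σ_eq_one le_rfl] at this; exact zero_ne_one this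
  -- Rational s0 give a common null set, and continuity extends the identity to all real s0. At each
  -- point one may then choose s0 − log(e x) = s1, where σ' does not vanish.
  have hpz : ∀ᵐ x ∂vol[Ω], g x = 0 := by
    have hall : ∀ᵐ x ∂vol[Ω], ∀ q : ℚ, deriv σ (q - log (e x)) * Q[A,p,p]x = 0 :=
      ae_all_iff.2 fun q => key q
    filter_upwards [hall, hg, h.isOpen.ae_mem] with x hx hgx hxΩ
    have hcont : Continuous fun s : ℝ =>
        deriv σ (s - log (e x)) * Q[A,p,p]x :=
      (hαc.comp (by fun_prop)).mul continuous_const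
    have heq : (fun s : ℝ => deriv σ (s - log (e x)) * Q[A,p,p]x) = fun _ => 0 :=
      Rat.denseRange_cast.equalizer hcont continuous_const (funext hx)
    have h1 := congrFun heq (s1 + log (e x)); simp only [add_sub_cancel_right] at h1
    have h2 := hzero (f := p) x hxΩ ((mul_eq_zero.1 h1).resolve_left hs1).le
    have : g x = (1 / 2 : ℝ) • p x := by rw [hgx, hp, smul_smul]; congr 1; ring
    rw [this, h2, smul_zero]
  exact hu.ae_eq_zero_of_grad hn h.isOpen hpz

end IsSupersolution

end Strict

/-! ### Smooth mollifiers and Lebesgue points. -/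

section Mollifier

/-- A smooth even bump function with integral one, supported in the closed unit ball. -/
noncomputable def baseBump (n : ℕ) : Eu n → ℝ :=
  (⟨1 / 2, 1, by norm_num, by norm_num⟩ : ContDiffBump (0 : Eu n)).normed volume

/-- The mollifier of radius `r`. -/
noncomputable def mol (n : ℕ) (r : ℝ) (x : Eu n) : ℝ := (r ^ n)⁻¹ * baseBump n (r⁻¹ • x)

lemma contDiff_baseBump : ContDiff ℝ ∞ (baseBump n) := ContDiffBump.contDiff_normed _

lemma baseBump_eq_zero (hx : 1 ≤ ‖x‖) : baseBump n x = 0 := by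
  by_contra h; have : x ∈ Function.support (baseBump n) := h
  rw [baseBump, ContDiffBump.support_normed_eq, mem_ball_zero_iff] at this
  exact absurd this (not_lt.2 hx)

lemma hasCompactSupport_baseBump : HasCompactSupport (baseBump n) :=
  ContDiffBump.hasCompactSupport_normed _

lemma isTestFunction_baseBump : IsTestFunction univ (baseBump n) :=
  ⟨contDiff_baseBump, hasCompactSupport_baseBump, subset_univ _⟩

lemma contDiff_mol : ContDiff ℝ ∞ (mol n r) :=
  contDiff_const.mul (contDiff_baseBump.comp (contDiff_id.const_smul r⁻¹))

lemma mol_neg (x : Eu n) : mol n r (-x) = mol n r x := by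
  rw [mol, mol, smul_neg, baseBump, ContDiffBump.normed_neg]

lemma mol_sub_comm (x y : Eu n) : mol n r (x - y) = mol n r (y - x) := by
  rw [← mol_neg, neg_sub]

lemma mol_eq_zero (hr : 0 < r) (hx : r ≤ ‖x‖) : mol n r x = 0 := by
  rw [mol, baseBump_eq_zero, mul_zero]
  rw [norm_smul, norm_inv, norm_of_nonneg hr.le, ← div_eq_inv_mul, one_le_div hr]; exact hx

lemma tsupport_mol_subset (hr : 0 < r) : tsupport (mol n r) ⊆ closedBall 0 r := by
  refine closure_minimal (fun x hx => ?_) isClosed_closedBall; rw [mem_closedBall_zero_iff]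
  by_contra! h; exact hx (mol_eq_zero hr h.le)

lemma isTestFunction_mol (hr : 0 < r) : IsTestFunction univ (mol n r) :=
  ⟨contDiff_mol, (isCompact_closedBall (0 : Eu n) r).of_isClosed_subset (isClosed_tsupport _)
    (tsupport_mol_subset hr), subset_univ _⟩

lemma exists_baseBump_le (n : ℕ) : ∃ C, 0 ≤ C ∧ ∀ x, baseBump n x ≤ C := by
  obtain ⟨C, hC⟩ := (isTestFunction_baseBump (n := n)).bounded
  exact ⟨C, (abs_nonneg _).trans (hC 0), fun x => (le_abs_self _).trans (hC x)⟩

lemma mol_nonneg (hr : 0 < r) (x : Eu n) : 0 ≤ mol n r x :=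
  mul_nonneg (by positivity) (ContDiffBump.nonneg_normed _ _)

lemma isKernel_mol (hr : 0 < r) : IsKernel (mol n r) r where
  nonneg := mol_nonneg hr
  meas := contDiff_mol.continuous.aesm
  integral_one := by
    simp only [mol]
    rw [integral_const_mul, integral_comp_inv_smul, finrank_euclideanSpace_fin,
      abs_of_pos (by positivity), baseBump, ContDiffBump.integral_normed, smul_eq_mul, mul_one,
      inv_mul_cancel₀ (by positivity)]
  bdd := by
    obtain ⟨C, hC0, hC⟩ := exists_baseBump_le n
    exact ⟨(r ^ n)⁻¹ * C, fun x => mul_le_mul_of_nonneg_left (hC _) (by positivity)⟩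
  supp x hx := mol_eq_zero hr hx.le

lemma gradient_comp_smul (hf : Differentiable ℝ f) (c : ℝ) (x : Eu n) : ∇ (fun y => f (c • y)) x = c
    • ∇ f (c • x) := by
  have h1 : HasFDerivAt (fun y : Eu n => f (c • y)) ((fderiv ℝ f (c • x)).comp
      (c • ContinuousLinearMap.id ℝ (Eu n))) x :=
    (hf (c • x)).hasFDerivAt.comp x ((ContinuousLinearMap.id ℝ (Eu n)).hasFDerivAt.const_smul c)
  have h2 : (fderiv ℝ f (c • x)).comp (c • ContinuousLinearMap.id ℝ (Eu n))
      = c • fderiv ℝ f (c • x) := by ext v; simp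
  rw [gradient, h1.fderiv, h2, map_smul, gradient]

lemma gradient_mol (x : Eu n) : ∇ (mol n r) x = (r ^ n)⁻¹ • r⁻¹ • ∇ (baseBump n) (r⁻¹ • x) := by
  have hd : Differentiable ℝ (baseBump n) := contDiff_baseBump.differentiable (by simp)
  have : mol n r = fun x => (r ^ n)⁻¹ * (fun y => baseBump n (r⁻¹ • y)) x := rfl
  have h1 : DifferentiableAt ℝ (fun y => baseBump n (r⁻¹ • y)) x :=
    (hd _).comp x (differentiableAt_id.const_smul r⁻¹)
  rw [this, gradient_const_mul' _ h1, gradient_comp_smul hd]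

/-- The rate 1/r is exactly compensated, in the commutator estimate, by the oscillation of order r
of a Lipschitz coefficient. -/
lemma exists_integral_gradient_mol_le (n : ℕ) : ∃ C, 0 ≤ C ∧ ∀ r : ℝ, 0 < r → ∫ x, ‖∇ (mol n r) x‖ ≤
    C / r := by
  refine ⟨∫ x, ‖∇ (baseBump n) x‖, integral_nonneg fun _ => norm_nonneg _, fun r hr => ?_⟩
  simp only [gradient_mol, norm_smul, norm_inv, norm_pow, norm_of_nonneg hr.le]
  rw [integral_const_mul, integral_const_mul,
    integral_comp_inv_smul volume (fun x => ‖∇ (baseBump n) x‖) r,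
    finrank_euclideanSpace_fin, abs_of_pos (by positivity), smul_eq_mul]
  refine le_of_eq ?_; field_simp

lemma gradient_comp_sub_left (hf : Differentiable ℝ f) (x t : Eu n) : ∇ (fun y => f (x - y)) t = -∇
    f (x - t) := by
  have h1 : HasFDerivAt (fun y : Eu n => f (x - y)) ((fderiv ℝ f (x - t)).comp
      (-ContinuousLinearMap.id ℝ (Eu n))) t :=
    (hf (x - t)).hasFDerivAt.comp t ((ContinuousLinearMap.id ℝ (Eu n)).hasFDerivAt.const_sub x)
  have h2 : (fderiv ℝ f (x - t)).comp (-ContinuousLinearMap.id ℝ (Eu n))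
      = -fderiv ℝ f (x - t) := by ext v; simp
  rw [gradient, h1.fderiv, h2, map_neg, gradient]

lemma isTestFunction_mol_sub (hr : 0 < r) (h : closedBall x r ⊆ Ω) : IsTestFunction Ω (fun t => mol
    n r (x - t)) := by
  have hs : tsupport (fun t => mol n r (x - t)) ⊆ closedBall x r := by
    refine closure_minimal (fun t ht => ?_) isClosed_closedBall
    rw [mem_closedBall, dist_comm, dist_eq_norm]
    by_contra! h'; exact ht (mol_eq_zero hr h'.le)
  exact ⟨contDiff_mol.comp (contDiff_const.sub contDiff_id),
    (isCompact_closedBall x r).of_isClosed_subset (isClosed_tsupport _) hs, hs.trans h⟩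

lemma contDiff_cv_mol (hr : 0 < r) (hf : Integrable f) : ContDiff ℝ ∞ (cv (mol n r) f) :=
  (isTestFunction_mol hr).compactSupport.contDiff_convolution_left _ contDiff_mol
    hf.locallyIntegrable

lemma gradient_cv_mol (hr : 0 < r) (hf : Integrable f) (x : Eu n) : ∇ (cv (mol n r) f) x = ∫ t, f t
    • ∇ (mol n r) (x - t) := by
  have h1 := ((isTestFunction_mol (n := n) hr).compactSupport.hasFDerivAt_convolution_left
    (ContinuousLinearMap.lsmul ℝ ℝ) (contDiff_mol.of_le (by exact_mod_cast le_top))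
    hf.locallyIntegrable x).fderiv
  have h2 : fderiv ℝ (cv (mol n r) f) x = ∫ t, f t • fderiv ℝ (mol n r) (x - t) := by
    refine h1.trans ?_; rw [convolution, ← integral_sub_left_eq_self _ volume x]
    refine integral_congr_fun fun t => ?_; ext v; simp [mul_comm]
  rw [gradient, h2, ← LinearIsometryEquiv.coe_toContinuousLinearEquiv,
    ← ContinuousLinearEquiv.integral_comp_comm]
  simp [gradient]

/-- If the closed ball lies in K, the function t ↦ mol(x − t) is a test function for the weak
gradient. Cutting off by the indicator of K makes v and g integrable on the whole space without
being felt at x. -/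
lemma HasWeakGradient.gradient_cv (h : HasWeakGradient Ω v g) (hr : 0 < r) (hK : IsCompact K) (hKΩ :
    K ⊆ Ω) (hx : closedBall x r ⊆ K) : ∇ (cv (mol n r) (K.indicator v)) x = cv (mol n r)
    (K.indicator g) x := by
  have hd : Differentiable ℝ (mol n r) := contDiff_mol.differentiable (by simp)
  have hz : ∀ t, t ∉ K → mol n r (x - t) = 0 ∧ ∇ (mol n r) (x - t) = 0 := by
    intro t ht
    have h1 : x - t ∉ tsupport (mol n r) := fun h' => ht (hx (by
      have := tsupport_mol_subset hr h'
      rwa [mem_closedBall_zero_iff, ← dist_eq_norm, dist_comm] at this))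
    exact ⟨eq_zero_of_notMem h1, gradient_eq_zero h1⟩
  have hi : Integrable (K.indicator v) := h.locInt.integrable_indicator hKΩ hK
  have hset : ∀ F : Eu n → Eu n, (∀ t, t ∉ K → F t = 0) → ∫ t in Ω, F t = ∫ t, F t := fun F hF =>
    setIntegral_eq_integral_of_forall_compl_eq_zero fun t ht => hF t fun h' => ht (hKΩ h')
  have hp := h.parts _ (isTestFunction_mol_sub hr (hx.trans hKΩ))
  simp only [gradient_comp_sub_left hd, smul_neg, integral_neg, neg_inj] at hp
  rw [gradient_cv_mol hr hi, cv_apply_swap]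
  have e1 : ∫ t, K.indicator v t • ∇ (mol n r) (x - t) = ∫ t in Ω, v t • ∇ (mol n r) (x - t) := by
    rw [hset _ fun t ht => by rw [(hz t ht).2, smul_zero]]
    refine integral_congr_fun fun t => ?_
    by_cases ht : t ∈ K
    · simp only [indicator_of_mem ht]
    · simp only [(hz t ht).2, smul_zero]
  have e2 : ∫ t, mol n r (x - t) • K.indicator g t = ∫ t in Ω, mol n r (x - t) • g t := by
    rw [hset _ fun t ht => by rw [(hz t ht).1, zero_smul]]
    refine integral_congr_fun fun t => ?_
    by_cases ht : t ∈ K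
    · simp only [indicator_of_mem ht]
    · simp only [(hz t ht).1, zero_smul]
  rw [e1, e2, hp]

/-- Fubini, together with the evenness of the mollifier. -/
lemma integral_cv_mul (hr : 0 < r) {g : Eu n → ℝ} (hf : Integrable f) (hg : Continuous g) (hC : ∀ x,
    |g x| ≤ C) : ∫ x, cv (mol n r) f x * g x = ∫ x, f x * cv (mol n r) g x := by
  have hk := isKernel_mol (n := n) hr
  have e1 : ∀ x, cv (mol n r) f x * g x = ∫ t, mol n r (x - t) * f t * g x := fun x => by
    rw [cv_apply_swap, ← integral_mul_const]; rfl
  have e2 : ∀ t, f t * cv (mol n r) g t = ∫ x, mol n r (x - t) * f t * g x := fun t => by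
    rw [cv_apply_swap, ← integral_const_mul]; refine integral_congr_fun fun x => ?_
    simp only [smul_eq_mul]; rw [mol_sub_comm t x]; ring
  simp only [e1, e2]; refine integral_integral_swap ?_
  have h1 : Integrable (fun p : Eu n × Eu n => mol n r (p.1 - p.2) * f p.2)
      (volume.prod volume) := by
    have h2 := Integrable.convolution_integrand (μ := volume) (ν := volume)
      (ContinuousLinearMap.mul ℝ ℝ) hf hk.integrable
    refine h2.congr (.of_forall fun p => ?_); simp only [ContinuousLinearMap.mul_apply']; ring
  exact h1.mul_bdd (c := C) (hg.comp continuous_fst).aestronglyMeasurable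
    (.of_forall fun p => hC p.1)

/-- Mollifications near a Lebesgue point. -/
lemma eventually_cv_mol_sub_le (hf : Integrable f) (h : Tendsto (fun r : ℝ => ⨍⁻ y in ball x r, ‖f y
    - c‖ₑ ∂volume) (𝓝[>] 0) (𝓝 0)) (hε : 0 < ε) : ∀ᶠ r in 𝓝[>] (0 : ℝ), ∀ t ∈ closedBall x r, |cv
    (mol n r) f t - c| ≤ ε := by
  obtain ⟨C, hC0, hC⟩ := exists_baseBump_le n; set V := volume (ball (0 : Eu n) 1) with hV
  have hV0 : V ≠ ⊤ := measure_ball_lt_top.ne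
  -- For t within r of x the mollifier at t is supported in the ball of radius 3r about x and is at
  -- most C r^(−n); multiplying by the volume of that ball leaves C 3^n |B₁|.
  set D : ℝ≥0∞ := ofReal C * (ofReal (3 ^ n) * V) with hD
  have hDt : D ≠ ⊤ := mul_ne_top ofReal_ne_top (mul_ne_top ofReal_ne_top hV0)
  have h3 : Tendsto (fun r : ℝ => 3 * r) (𝓝[>] 0) (𝓝[>] 0) := by
    refine tendsto_nhdsWithin_iff.2 ⟨?_, ?_⟩
    · have : Tendsto (fun r : ℝ => 3 * r) (𝓝 0) (𝓝 (3 * 0)) := tendsto_id.const_mul 3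
      rw [mul_zero] at this; exact this.mono_left nhdsWithin_le_nhds
    · filter_upwards [self_mem_nhdsWithin] with r hr; exact mul_pos three_pos (mem_Ioi.1 hr)
  have h4 : Tendsto (fun r : ℝ => D * ⨍⁻ y in ball x (3 * r), ‖f y - c‖ₑ ∂volume) (𝓝[>] 0)
      (𝓝 0) := by
    simpa using ENNReal.Tendsto.const_mul (h.comp h3) (Or.inr hDt)
  filter_upwards [h4.eventually (ge_mem_nhds (ofReal_pos.2 hε)), self_mem_nhdsWithin]
    with r h5 hr t ht
  have hr : 0 < r := hr; have hk := isKernel_mol (n := n) hr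
  have hcv : cv (mol n r) f t - c = ∫ s, mol n r (t - s) • (f s - c) := by
    rw [← cv_apply_swap (mol n r) (fun s => f s - c), hk.cv_sub hf.integrableOn
      (integrableOn_const measure_closedBall_lt_top.ne), hk.cv_const]
  have hsub : closedBall t r ⊆ ball x (3 * r) := by
    intro s hs; rw [mem_closedBall] at hs ht; rw [mem_ball]; linarith [dist_triangle s t x]
  have hvol : volume (ball x (3 * r)) = ofReal (r ^ n) * (ofReal (3 ^ n) * V) := by
    rw [addHaar_ball_of_pos volume x (by positivity), finrank_euclideanSpace_fin, ← mul_assoc,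
      ← ofReal_mul (by positivity), mul_pow, mul_comm ((3 : ℝ) ^ n)]
  have hvol0 : volume (ball x (3 * r)) ≠ 0 := (measure_ball_pos volume _ (by positivity)).ne'
  have hvolt : volume (ball x (3 * r)) ≠ ⊤ := measure_ball_lt_top.ne
  have hest : ‖cv (mol n r) f t - c‖ₑ ≤ D * ⨍⁻ y in ball x (3 * r), ‖f y - c‖ₑ ∂volume := by
    rw [hcv]
    calc _ ≤ ∫⁻ s, ‖mol n r (t - s) • (f s - c)‖ₑ := enorm_integral_le_lintegral_enorm _
      _ ≤ ∫⁻ s in ball x (3 * r), ofReal ((r ^ n)⁻¹ * C) * ‖f s - c‖ₑ := by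
          rw [← lintegral_indicator measurableSet_ball]; refine lintegral_mono fun s => ?_
          by_cases hs : s ∈ ball x (3 * r)
          · rw [indicator_of_mem hs, enorm_smul, enorm_of_nonneg (mol_nonneg hr _)]; gcongr
            exact mul_le_mul_of_nonneg_left (hC _) (by positivity)
          · have : mol n r (t - s) = 0 := mol_eq_zero hr (by
              by_contra! h'
              exact hs (hsub (by rw [mem_closedBall, dist_comm, dist_eq_norm]; exact h'.le)))
            simp [this]
      _ = ofReal ((r ^ n)⁻¹ * C) * ∫⁻ s in ball x (3 * r), ‖f s - c‖ₑ :=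
          lintegral_const_mul' _ _ ofReal_ne_top
      _ = ofReal ((r ^ n)⁻¹ * C) * (volume (ball x (3 * r)) *
          ⨍⁻ y in ball x (3 * r), ‖f y - c‖ₑ ∂volume) := by
          rw [setLAverage_eq, ENNReal.mul_div_cancel hvol0 hvolt]
      _ = _ := by
          rw [← mul_assoc, hvol, ← mul_assoc (ofReal ((r ^ n)⁻¹ * C)), ← ofReal_mul (by positivity)]
          congr 2; have : (r ^ n)⁻¹ * C * r ^ n = C := by field_simp
          rw [this]
  have := hest.trans h5; rw [← ofReal_norm, norm_eq_abs] at this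
  exact (ofReal_le_ofReal_iff hε.le).1 this

/-- For a lower semicontinuous function which is the limit of its averages, every point where it
is finite is a Lebesgue point. -/
lemma tendsto_laverage_sub (hΩ : IsOpen Ω) (hfin : ∀ᵐ x ∂vol[Ω], E x < ⊤) (hlsc :
    LowerSemicontinuousOn E Ω) (hx : x ∈ Ω) (hEx : E x < ⊤) (hav : Tendsto (fun r : ℝ => ⨍⁻ y in
    ball x r, E y ∂volume) (𝓝[>] 0) (𝓝 (E x))) (hm : AEMeasurable E vol[Ω]) : Tendsto (fun r : ℝ =>
    ⨍⁻ y in ball x r, ‖E§y - E§x‖ₑ ∂volume) (𝓝[>] 0) (𝓝 0) := by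
  rw [ENNReal.tendsto_nhds_zero]; intro ε hε
  rcases eq_or_ne ε ⊤ with rfl | hεt
  · exact .of_forall fun _ => le_top
  set δ : ℝ≥0∞ := ε / 3 with hδ; have hδ0 : 0 < δ := ENNReal.div_pos hε.ne' (by simp)
  have hδt : δ ≠ ⊤ := div_ne_top hεt (by simp)
  have hδ3 : δ + δ + δ = ε := by rw [hδ]; exact ENNReal.add_thirds ε
  have hlow : ∀ᶠ y in 𝓝 x, y ∈ Ω → E x ≤ E y + δ := by
    rcases eq_or_ne (E x) 0 with h0 | h0
    · exact .of_forall fun y _ => by simp [h0]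
    · have h1 := hlsc x hx (E x - δ) (ENNReal.sub_lt_self hEx.ne h0 hδ0.ne')
      filter_upwards [eventually_nhdsWithin_iff.1 h1] with y hy hyΩ
      exact tsub_le_iff_right.1 (hy hyΩ).le
  obtain ⟨ρ, hρ, hball⟩ := eventually_nhds_iff_ball.1 (hlow.and (hΩ.mem_nhds hx))
  have hav' : ∀ᶠ r in 𝓝[>] (0 : ℝ), ⨍⁻ y in ball x r, E y ∂volume ≤ E x + δ :=
    hav.eventually (ge_mem_nhds (lt_add_right hEx.ne hδ0.ne'))
  filter_upwards [hav', self_mem_nhdsWithin, nhdsWithin_le_nhds (gt_mem_nhds hρ)] with r h1 hr hrρ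
  have hr : 0 < r := hr
  have hsub : ball x r ⊆ Ω := fun y hy =>
    (hball y (ball_subset_ball hrρ.le hy)).2
  set m := volume.restrict (ball x r) with hmdef
  have hv0 : volume (ball x r) ≠ 0 := (measure_ball_pos volume _ hr).ne'
  have hvt : volume (ball x r) ≠ ⊤ := measure_ball_lt_top.ne
  have hle : m ≤ vol[Ω] := restrict_mono hsub le_rfl
  -- If b ≤ a + δ then |a − b| + b ≤ a + 2δ. Lower semicontinuity gives the hypothesis for b = E x,
  -- and averaging then uses only the convergence of the averages of E.
  have hpt : ∀ᵐ y ∂m, ‖E§y - E§x‖ₑ + E x ≤ E y + (δ + δ) := by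
    filter_upwards [hfin.filter_mono (ae_mono hle), ae_restrict_mem measurableSet_ball]
      with y hy hyb
    have h2 : E x ≤ E y + δ := (hball y (ball_subset_ball hrρ.le hyb)).1 (hsub hyb)
    have h3 : E§x ≤ E§y + δ.toReal := by
      rw [← toReal_add hy.ne hδt]; exact toReal_mono (add_ne_top.2 ⟨hy.ne, hδt⟩) h2
    have h4 : |E§y - E§x| + E§x ≤ E§y + (δ.toReal + δ.toReal) := by
      have : 0 ≤ δ.toReal := toReal_nonneg
      rcases abs_cases (E§y - E§x) with ⟨h, _⟩ | ⟨h, _⟩ <;> rw [h] <;> linarith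
    have h5 := ofReal_le_ofReal h4
    rw [ofReal_add (abs_nonneg _) toReal_nonneg, ofReal_add toReal_nonneg (by positivity),
      ofReal_add toReal_nonneg toReal_nonneg,
      ofReal_toReal hEx.ne, ofReal_toReal hy.ne, ofReal_toReal hδt] at h5
    rwa [← ofReal_norm, norm_eq_abs]
  have hint := lintegral_mono_ae hpt
  rw [lintegral_add_right _ measurable_const, lintegral_add_right _ measurable_const,
    lintegral_const, lintegral_const, hmdef, restrict_apply_univ] at hint
  have hdiv := ENNReal.div_le_div_right hint (volume (ball x r))
  rw [ENNReal.add_div, ENNReal.add_div, ENNReal.mul_div_cancel_right hv0 hvt,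
    ENNReal.mul_div_cancel_right hv0 hvt, ← setLAverage_eq, ← setLAverage_eq] at hdiv
  have h6 : (⨍⁻ y in ball x r, ‖E§y - E§x‖ₑ ∂volume) + E x ≤ ε + E x := by
    refine (le_trans ?_ hdiv).trans ?_
    · exact le_rfl
    · calc _ ≤ E x + δ + (δ + δ) := add_le_add h1 le_rfl
        _ = ε + E x := by rw [← hδ3]; ring
  exact ENNReal.le_of_add_le_add_right hEx.ne h6

end Mollifier

/-! ### Calculus of weak gradients. -/

section WeakGradient

lemma IsTestFunction.integrable (h : IsTestFunction Ω φ) (μ : Measure (Eu n))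
    [IsFiniteMeasureOnCompacts μ] : Integrable φ μ :=
  memLp_one_iff_integrable.1 (h.memLp 1 μ)

lemma IsTestFunction.integrable_gradient (h : IsTestFunction Ω φ) (μ : Measure (Eu n))
    [IsFiniteMeasureOnCompacts μ] : Integrable (∇ φ) μ :=
  memLp_one_iff_integrable.1 (h.memLp_gradient 1 μ)

lemma IsTestFunction.integral_gradient_eq_zero {θ : Eu n → ℝ} (h : IsTestFunction Ω θ) : ∫ x, ∇ θ x
    = 0 := by
  refine ext_inner_right ℝ fun w => ?_; have hi : Integrable (∇ θ) := h.integrable_gradient _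
  have e1 : ∀ x, inner ℝ w (∇ θ x) = fderiv ℝ θ x w := fun x => by
    rw [real_inner_comm, gradient, InnerProductSpace.toDual_symm_apply]
  have e2 := integral_inner (𝕜 := ℝ) hi w; rw [inner_zero_left, real_inner_comm, ← e2]
  simp only [e1]
  have hint : Integrable (fun x => fderiv ℝ θ x w) := by simp only [← e1]; exact hi.const_inner w
  have := integral_mul_fderiv_eq_neg_fderiv_mul_of_integrable (μ := (volume : Measure (Eu n)))
    (f := fun _ : Eu n => (1 : ℝ)) (g := θ) (v := w) (by simp) (by simpa using hint)
    (by simpa using h.integrable volume) (fun x _ => differentiableAt_const _)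
    (fun x _ => h.differentiable x)
  simpa using this

lemma IsTestFunction.setIntegral_eq {F : Type*} [NormedAddCommGroup F] [NormedSpace ℝ F] (h : IsTestFunction Ω φ) {f : Eu n → F} (hf : ∀ x, x ∉ tsupport φ → f x = 0) :
    ∫ x in Ω, f x = ∫ x, f x :=
  setIntegral_eq_integral_of_forall_compl_eq_zero fun x hx => hf x fun h' =>
    hx (h.support_subset h')

lemma IsTestFunction.integral_smul_gradient {w : Eu n → ℝ} (h : IsTestFunction Ω φ) (hw : ContDiff ℝ
    ∞ w) : ∫ x in Ω, w x • ∇ φ x = -∫ x in Ω, φ x • ∇ w x := by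
  have hwd : Differentiable ℝ w := hw.differentiable (by simp)
  have hwc : Continuous (∇ w) := _root_.continuous_gradient (hw.of_le (by exact_mod_cast le_top))
  have h1 := (h.mul_left hw).integral_gradient_eq_zero
  have e1 : ∀ x, ∇ (fun y => w y * φ y) x = w x • ∇ φ x + φ x • ∇ w x :=
    fun x => gradient_fun_mul (hwd x) (h.differentiable x)
  simp only [e1] at h1; rw [integral_add] at h1
  · rw [h.setIntegral_eq fun x hx => by rw [gradient_eq_zero hx, smul_zero],
      h.setIntegral_eq fun x hx => by rw [eq_zero_of_notMem hx, zero_smul]]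
    exact eq_neg_of_add_eq_zero_left h1
  · exact (hw.continuous.smul h.continuous_gradient).integrable_of_hasCompactSupport
      (h.hasCompactSupport_gradient.smul_left)
  · exact (h.continuous.smul hwc).integrable_of_hasCompactSupport h.compactSupport.smul_right

lemma integrable_smul_of_compact {F : Type*} [NormedAddCommGroup F] [NormedSpace ℝ F] {f : Eu n → F}
    (hf : LocallyIntegrableOn f Ω volume) {b : Eu n → ℝ} (hb : AEStronglyMeasurable b vol[Ω]) (hC :
    ∀ x, |b x| ≤ C) (hK : IsCompact K) (hKΩ : K ⊆ Ω) (h0 : ∀ x, x ∉ K → b x = 0) : Integrable (fun x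
    => b x • f x) vol[Ω] := by
  have h1 : Integrable (K.indicator f) vol[Ω] := (hf.integrable_indicator hKΩ hK).mono_measure
      restrict_le_self
  refine (h1.bdd_smul C hb (.of_forall hC)).congr (.of_forall fun x => ?_)
  by_cases hx : x ∈ K
  · simp only [Pi.smul_apply', indicator_of_mem hx]
  · simp only [Pi.smul_apply', h0 x hx, zero_smul]

lemma LocallyIntegrableOn.bdd_smul' {F : Type*} [NormedAddCommGroup F] [NormedSpace ℝ F] (hΩ :
    IsOpen Ω) {f : Eu n → F} (hf : LocallyIntegrableOn f Ω volume) {b : Eu n → ℝ} (hb :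
    AEStronglyMeasurable b vol[Ω]) (hC : ∀ K ⊆ Ω, IsCompact K → ∃ C, ∀ x ∈ K, |b x| ≤ C) :
    LocallyIntegrableOn (fun x => b x • f x) Ω volume := by
  rw [locallyIntegrableOn_iff hΩ.isLocallyClosed]; intro K hK hKc; obtain ⟨C, hC⟩ := hC K hK hKc
  exact (hf.integrableOn_compact_subset hK hKc).bdd_smul C (hb.mono_measure
    (restrict_mono hK le_rfl)) ((ae_restrict_mem hKc.measurableSet).mono hC)

lemma exists_mol_seq (hf : Integrable f) (hδ : 0 < δ) : ∃ r : ℕ → ℝ, (∀ m, 0 < r m) ∧ (∀ m, r m < δ)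
    ∧ Tendsto r atTop (𝓝 0) ∧ ∀ᵐ x, Tendsto (fun m => cv (mol n (r m)) f x) atTop (𝓝 (f x)) := by
  obtain ⟨s, -, hsm, hs⟩ := exists_seq_strictAnti_tendsto' hδ
  have hs0 := fun i => (hsm i).1; have hsδ := fun i => (hsm i).2
  have h1 := tendsto_eLpNorm_cv_sub (fun m => isKernel_mol (hs0 m)) hs le_rfl (by norm_num)
    (memLp_one_iff_integrable.2 hf)
  obtain ⟨ns, hns, hae⟩ := exists_subseq_ae_of_eLpNorm one_ne_zero
    (fun m => ((isKernel_mol (hs0 m)).aestronglyMeasurable_cv hf.1)) hf.1 h1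
  exact ⟨fun m => s (ns m), fun m => hs0 _, fun m => hsδ _, hs.comp hns.tendsto_atTop, hae⟩

lemma IsTestFunction.exists_thickening (h : IsTestFunction Ω φ) (hΩ : IsOpen Ω) : ∃ δ > 0, ∃ K,
    IsCompact K ∧ K ⊆ Ω ∧ tsupport φ ⊆ K ∧ ∀ x ∈ tsupport φ, closedBall x δ ⊆ K := by
  obtain ⟨δ, hδ, hs⟩ := h.compactSupport.isCompact.exists_cthickening_subset_open hΩ
    h.support_subset
  refine ⟨δ, hδ, cthickening δ (tsupport φ), h.compactSupport.isCompact.cthickening, hs,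
    self_subset_cthickening _, fun x hx y hy => ?_⟩
  exact mem_cthickening_of_dist_le y x δ _ hx (mem_closedBall.1 hy)

/-- The chain rule for weak gradients. -/
lemma HasWeakGradient.comp (h : HasWeakGradient Ω v g) (hΩ : IsOpen Ω) (hl : ContDiff ℝ ∞ l) (hB : ∀
    t, |l t| ≤ B) (hD : ∀ t, |deriv l t| ≤ D) : HasWeakGradient Ω (fun x => l (v x)) (fun x => deriv
    l (v x) • g x) := by
  have hl'c : Continuous (deriv l) := hl.continuous_deriv (by simp)
  have hD0 : 0 ≤ D := (abs_nonneg _).trans (hD 0); have hvm := h.locInt.aestronglyMeasurable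
  have hlv : AEStronglyMeasurable (fun x => l (v x)) vol[Ω] :=
    hl.continuous.comp_aestronglyMeasurable hvm
  have hl'v : AEStronglyMeasurable (fun x => deriv l (v x)) vol[Ω] :=
    hl'c.comp_aestronglyMeasurable hvm
  refine ⟨?_, LocallyIntegrableOn.bdd_smul' hΩ h.locInt_grad hl'v fun K _ _ =>
    ⟨D, fun x _ => hD _⟩, fun φ hφ => ?_⟩
  · rw [locallyIntegrableOn_iff hΩ.isLocallyClosed]; intro K hK hKc
    have : IsFiniteMeasure (volume.restrict K) :=
      ⟨by rw [restrict_apply_univ]; exact hKc.measure_lt_top⟩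
    exact Integrable.of_bound (hlv.mono_measure (restrict_mono hK le_rfl)) B
      (.of_forall fun x => hB _)
  obtain ⟨δ, hδ, K, hK, hKΩ, hφK, hball⟩ := hφ.exists_thickening hΩ
  have hvi : Integrable (K.indicator v) := h.locInt.integrable_indicator hKΩ hK
  have hgi : Integrable (K.indicator g) := h.locInt_grad.integrable_indicator hKΩ hK
  obtain ⟨r, hr0, hrδ, hr, hae⟩ := exists_mol_seq hvi hδ
  set w : ℕ → Eu n → ℝ := fun m => cv (mol n (r m)) (K.indicator v) with hw
  have hwc : ∀ m, ContDiff ℝ ∞ (w m) := fun m => contDiff_cv_mol (hr0 m) hvi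
  obtain ⟨Cφ, hCφ⟩ := hφ.bounded; have hCφ0 : 0 ≤ Cφ := (abs_nonneg _).trans (hCφ 0)
  have hwae : ∀ᵐ x ∂vol[Ω], x ∈ K → Tendsto (fun m => w m x) atTop (𝓝 (v x)) := by
    filter_upwards [ae_restrict_of_ae hae] with x hx hxK; rwa [indicator_of_mem hxK] at hx
  have L : Tendsto (fun m => ∫ x in Ω, l (w m x) • ∇ φ x) atTop
      (𝓝 (∫ x in Ω, l (v x) • ∇ φ x)) := by
    refine tendsto_integral_of_dominated_convergence (fun x => B * ‖∇ φ x‖)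
      (fun m => ((hl.continuous.comp (hwc m).continuous).smul
        hφ.continuous_gradient).aestronglyMeasurable)
      ((hφ.integrable_gradient _).norm.const_mul B)
      (fun m => .of_forall fun x => ?_) ?_
    · rw [norm_smul]; exact mul_le_mul_of_nonneg_right (hB _) (norm_nonneg _)
    · filter_upwards [hwae] with x hx
      by_cases hxs : x ∈ tsupport φ
      · exact ((hl.continuous.tendsto _).comp (hx (hφK hxs))).smul_const _
      · simp [gradient_eq_zero hxs]
  have hgr : ∀ m, ∀ x, φ x • ∇ (fun y => l (w m y)) x
      = (φ x * deriv l (w m x)) • cv (mol n (r m)) (K.indicator g) x := by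
    intro m x
    rw [gradient_scomp (hl.differentiable (by simp) _) ((hwc m).differentiable (by simp) _)]
    by_cases hxs : x ∈ tsupport φ
    · rw [h.gradient_cv (hr0 m) hK hKΩ
        ((closedBall_subset_closedBall (hrδ m).le).trans (hball x hxs)), smul_smul]
    · simp [eq_zero_of_notMem hxs]
  have hb : ∀ m x, ‖φ x * deriv l (w m x)‖ ≤ Cφ * D := fun m x => by
    rw [norm_mul]; exact mul_le_mul (hCφ _) (hD _) (norm_nonneg _) hCφ0
  have hbm : ∀ m, AEStronglyMeasurable (fun x => φ x * deriv l (w m x)) vol[Ω] :=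
    fun m => (hφ.continuous.mul (hl'c.comp (hwc m).continuous)).aestronglyMeasurable
  have hcvi : ∀ m, Integrable (cv (mol n (r m)) (K.indicator g)) := fun m =>
    (isKernel_mol (hr0 m)).integrable_cv hgi
  -- The mollified gradient converges in L¹ and its coefficient φ l'(w m) is bounded; in R2 the
  -- coefficient converges almost everywhere against the fixed limit gradient.
  have R1 : Tendsto (fun m => ∫ x in Ω, (φ x * deriv l (w m x)) • (cv (mol n (r m))
      (K.indicator g) x - K.indicator g x)) atTop (𝓝 0) := by
    have hconv := tendsto_eLpNorm_cv_sub (fun m => isKernel_mol (hr0 m)) hr le_rfl (by norm_num)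
      (memLp_one_iff_integrable.2 hgi)
    have h2 : Tendsto (fun m => (Cφ * D) * (eLpNorm (fun x => cv (mol n (r m)) (K.indicator g) x
        - K.indicator g x) 1 volume).toReal) atTop (𝓝 ((Cφ * D) * (0 : ℝ≥0∞).toReal)) :=
      ((tendsto_toReal zero_ne_top).comp hconv).const_mul _
    rw [toReal_zero, mul_zero] at h2; refine squeeze_zero_norm (fun m => ?_) h2
    have hi := (hcvi m).sub hgi
    calc _ ≤ ∫ x in Ω, (Cφ * D) * ‖cv (mol n (r m)) (K.indicator g) x - K.indicator g x‖ := by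
          refine norm_integral_le_of_norm_le ((hi.mono_measure restrict_le_self).norm.const_mul _)
            (.of_forall fun x => ?_)
          rw [norm_smul]; exact mul_le_mul_of_nonneg_right (hb m x) (norm_nonneg _)
      _ ≤ ∫ x, (Cφ * D) * ‖cv (mol n (r m)) (K.indicator g) x - K.indicator g x‖ :=
          setIntegral_le_integral (hi.norm.const_mul _) (.of_forall fun x => by positivity)
      _ = _ := by
          rw [integral_const_mul, eLpNorm_one_eq_lintegral_enorm]; congr 1
          exact integral_norm_eq_lintegral_enorm hi.1
  have R2 : Tendsto (fun m => ∫ x in Ω, (φ x * deriv l (w m x)) • K.indicator g x) atTop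
      (𝓝 (∫ x in Ω, φ x • (deriv l (v x) • g x))) := by
    refine tendsto_integral_of_dominated_convergence (fun x => Cφ * D * ‖K.indicator g x‖)
      (fun m => (hbm m).smul (hgi.1.mono_measure restrict_le_self))
      ((hgi.mono_measure restrict_le_self).norm.const_mul _)
      (fun m => .of_forall fun x => ?_) ?_
    · rw [norm_smul]; exact mul_le_mul_of_nonneg_right (hb m x) (norm_nonneg _)
    · filter_upwards [hwae] with x hx
      by_cases hxs : x ∈ tsupport φ
      · rw [indicator_of_mem (hφK hxs), ← smul_assoc, smul_eq_mul]
        exact ((((hl'c.tendsto _).comp (hx (hφK hxs)))).const_mul _).smul_const _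
      · simp [eq_zero_of_notMem hxs]
  have R : Tendsto (fun m => -∫ x in Ω, φ x • ∇ (fun y => l (w m y)) x) atTop
      (𝓝 (-∫ x in Ω, φ x • (deriv l (v x) • g x))) := by
    have := (R1.add R2).neg; rw [zero_add] at this; refine this.congr fun m => ?_
    rw [← integral_add]
    · congr 1; refine integral_congr_fun fun x => ?_; simp only [hgr, ← smul_add, sub_add_cancel]
    · exact (((hcvi m).sub hgi).mono_measure restrict_le_self).bdd_smul _ (hbm m)
        (.of_forall (hb m))
    · exact (hgi.mono_measure restrict_le_self).bdd_smul _ (hbm m) (.of_forall (hb m))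
  refine tendsto_nhds_unique L (R.congr fun m => ?_)
  exact (hφ.integral_smul_gradient (hl.comp (hwc m))).symm

lemma HasWeakGradient.congr {v' : Eu n → ℝ} {g' : Eu n → Eu n} (h : HasWeakGradient Ω v g) (hΩ :
    IsOpen Ω) (hv : v =ᵐ[vol[Ω]] v') (hg : g =ᵐ[vol[Ω]] g') : HasWeakGradient Ω v' g' := by
  refine ⟨?_, ?_, fun φ hφ => ?_⟩
  · rw [locallyIntegrableOn_iff hΩ.isLocallyClosed]; intro K hK hKc
    exact (h.locInt.integrableOn_compact_subset hK hKc).congr (ae_mono (restrict_mono hK le_rfl) hv)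
  · rw [locallyIntegrableOn_iff hΩ.isLocallyClosed]; intro K hK hKc
    exact (h.locInt_grad.integrableOn_compact_subset hK hKc).congr
      (ae_mono (restrict_mono hK le_rfl) hg)
  · have := h.parts φ hφ
    have e1 : ∫ x in Ω, v x • ∇ φ x = ∫ x in Ω, v' x • ∇ φ x :=
      integral_congr_ae (hv.mono fun x hx => by simp only [hx])
    have e2 : ∫ x in Ω, φ x • g x = ∫ x in Ω, φ x • g' x :=
      integral_congr_ae (hg.mono fun x hx => by simp only [hx])
    rw [← e1, ← e2, this]

lemma integrable_smul_continuous (hv : LocallyIntegrableOn v Ω volume) {ψ : Eu n → Eu n} (hψ :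
    Continuous ψ) (hK : IsCompact K) (hKΩ : K ⊆ Ω) (h0 : ∀ x, x ∉ K → ψ x = 0) : Integrable (fun x
    => v x • ψ x) vol[Ω] := by
  obtain ⟨C, hC⟩ := hψ.bounded_above_of_compact_support (HasCompactSupport.intro hK h0)
  have h1 : Integrable (K.indicator v) vol[Ω] := (hv.integrable_indicator hKΩ hK).mono_measure
      restrict_le_self
  refine (h1.norm.const_mul C).mono' (hv.aestronglyMeasurable.smul hψ.aestronglyMeasurable)
    (.of_forall fun x => ?_)
  by_cases hx : x ∈ K
  · rw [indicator_of_mem hx, norm_smul, mul_comm]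
    exact mul_le_mul_of_nonneg_right (hC x) (norm_nonneg _)
  · simp [h0 x hx, indicator_of_notMem hx]

/-- The product rule for weak gradients. -/
lemma HasWeakGradient.smooth_mul (h : HasWeakGradient Ω v g) (hΩ : IsOpen Ω) {η : Eu n → ℝ} (hη :
    ContDiff ℝ ∞ η) : HasWeakGradient Ω (fun x => η x * v x) (fun x => η x • g x + v x • ∇ η x)
    := by
  have hηd : Differentiable ℝ η := hη.differentiable (by simp)
  have hηc : Continuous (∇ η) := continuous_gradient (hη.of_le (by exact_mod_cast le_top))
  have hbd : ∀ K ⊆ Ω, IsCompact K → ∃ C, ∀ x ∈ K, |η x| ≤ C := fun K _ hK =>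
    hK.exists_bound_of_continuousOn hη.continuous.continuousOn
  have hvg : LocallyIntegrableOn (fun x => v x • ∇ η x) Ω volume := by
    rw [locallyIntegrableOn_iff hΩ.isLocallyClosed]; intro K hK hKc
    obtain ⟨C, hC⟩ := hKc.exists_bound_of_continuousOn hηc.continuousOn
    have := h.locInt.integrableOn_compact_subset hK hKc
    refine (this.norm.const_mul C).mono' (this.1.smul hηc.aestronglyMeasurable) ?_
    filter_upwards [ae_restrict_mem hKc.measurableSet] with x hx; rw [norm_smul, mul_comm]
    exact mul_le_mul_of_nonneg_right (hC x hx) (norm_nonneg _)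
  refine ⟨LocallyIntegrableOn.bdd_smul' hΩ h.locInt hη.continuous.aesm hbd,
    (LocallyIntegrableOn.bdd_smul' hΩ h.locInt_grad hη.continuous.aesm hbd).add hvg,
    fun φ hφ => ?_⟩
  have hp := h.parts _ (hφ.mul_left hη)
  have e1 : ∀ x, ∇ (fun y => η y * φ y) x = η x • ∇ φ x + φ x • ∇ η x :=
    fun x => gradient_fun_mul (hηd x) (hφ.differentiable x)
  have h0 : ∀ x, x ∉ tsupport φ → φ x = 0 := fun x hx => eq_zero_of_notMem hx
  have hg0 : ∀ x, x ∉ tsupport φ → ∇ φ x = 0 := fun x hx =>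
    gradient_eq_zero hx
  have hK := hφ.compactSupport.isCompact
  have i1 : Integrable (fun x => v x • (η x • ∇ φ x)) vol[Ω] :=
    integrable_smul_continuous h.locInt (hη.continuous.smul hφ.continuous_gradient) hK
      hφ.support_subset fun x hx => by rw [hg0 x hx, smul_zero]
  have i2 : Integrable (fun x => v x • (φ x • ∇ η x)) vol[Ω] :=
    integrable_smul_continuous h.locInt (hφ.continuous.smul hηc) hK
      hφ.support_subset fun x hx => by rw [h0 x hx, zero_smul]
  obtain ⟨C, hC⟩ := (hφ.mul_left hη).bounded
  have i3 : Integrable (fun x => (η x * φ x) • g x) vol[Ω] :=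
    integrable_smul_of_compact h.locInt_grad
      (hη.continuous.mul hφ.continuous).aesm hC hK hφ.support_subset
      fun x hx => by rw [h0 x hx, mul_zero]
  simp only [e1, smul_add] at hp; rw [integral_add i1 i2] at hp
  have e2 : ∫ x in Ω, φ x • (η x • g x + v x • ∇ η x)
      = (∫ x in Ω, (η x * φ x) • g x) + ∫ x in Ω, v x • (φ x • ∇ η x) := by
    rw [← integral_add i3 i2]; refine integral_congr_fun fun x => ?_
    simp only [smul_add, smul_smul]; rw [mul_comm (φ x) (η x), mul_comm (φ x) (v x)]
  have e3 : ∫ x in Ω, (η x * v x) • ∇ φ x = ∫ x in Ω, v x • (η x • ∇ φ x) := by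
    refine integral_congr_fun fun x => ?_; simp only [smul_smul]; rw [mul_comm]
  rw [e2, e3, neg_add, ← hp, add_neg_cancel_right]

lemma HasWeakGradient.ae_unique {g' : Eu n → Eu n} (hΩ : IsOpen Ω) (h : HasWeakGradient Ω v g) (h' :
    HasWeakGradient Ω v g') : ∀ᵐ x ∂vol[Ω], g x = g' x := by
  have hz := hΩ.ae_eq_zero_of_integral_contDiff_smul_eq_zero (h.locInt_grad.sub h'.locInt_grad)
    fun φ hφ hc hs => by
      have ht : IsTestFunction Ω φ := ⟨hφ, hc, hs⟩; obtain ⟨C, hC⟩ := ht.bounded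
      have hp := h.parts φ ht; rw [h'.parts φ ht, neg_inj] at hp
      have h0 : ∀ x, x ∉ tsupport φ → φ x = 0 := fun x hx => eq_zero_of_notMem hx
      rw [← ht.setIntegral_eq fun x hx => by rw [h0 x hx, zero_smul]]
      simp only [Pi.sub_apply, smul_sub]
      rw [integral_sub (integrable_smul_of_compact h.locInt_grad
        ht.continuous.aesm hC ht.compactSupport.isCompact hs h0)
        (integrable_smul_of_compact h'.locInt_grad
        ht.continuous.aesm hC ht.compactSupport.isCompact hs h0), hp, sub_self]
  rw [ae_restrict_iff' hΩ.measurableSet]; filter_upwards [hz] with x hx hxΩ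
  exact sub_eq_zero.1 (hx hxΩ)

lemma MemLp.locallyIntegrableOn_two {F : Type*} [NormedAddCommGroup F] (hΩ : IsOpen Ω) {f : Eu n →
    F} (hf : MemLp f 2 vol[Ω]) : LocallyIntegrableOn f Ω volume := by
  rw [locallyIntegrableOn_iff hΩ.isLocallyClosed]; intro K hK hKc
  have : IsFiniteMeasure (volume.restrict K) :=
    ⟨by rw [restrict_apply_univ]; exact hKc.measure_lt_top⟩
  exact (hf.mono_measure (restrict_mono hK le_rfl)).integrable (by norm_num)

lemma tendsto_integral_smul_of_eLpNorm {F : Type*} [NormedAddCommGroup F] [NormedSpace ℝ F] {m :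
    Measure (Eu n)} {f : ℕ → Eu n → ℝ} {f₀ : Eu n → ℝ} {k : ℕ → Eu n → F} {k₀ : Eu n → F} (hf : ∀ j,
    MemLp (f j) 2 m) (hf₀ : MemLp f₀ 2 m) (hk : ∀ j, MemLp (k j) 2 m) (hk₀ : MemLp k₀ 2 m) (h :
    Tendsto (fun j => eLpNorm (fun x => f j x - f₀ x) 2 m) atTop (𝓝 0)) (h' : Tendsto (fun j =>
    eLpNorm (fun x => k j x - k₀ x) 2 m) atTop (𝓝 0)) : Tendsto (fun j => ∫ x, f j x • k j x ∂m)
    atTop (𝓝 (∫ x, f₀ x • k₀ x ∂m)) := by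
  have hprod : ∀ {a : Eu n → ℝ} {b : Eu n → F}, MemLp a 2 m → MemLp b 2 m →
      Integrable (fun x => a x • b x) m := fun ha hb => memLp_one_iff_integrable.1 (hb.smul ha)
  have hle : ∀ {a : Eu n → ℝ} {b : Eu n → F}, MemLp a 2 m → MemLp b 2 m →
      eLpNorm (fun x => a x • b x) 1 m ≤ eLpNorm a 2 m * eLpNorm b 2 m := fun {a b} ha hb =>
    eLpNorm_smul_le_mul_eLpNorm (𝕜 := ℝ) (φ := a) (f := b) hb.1 ha.1
  refine tendsto_integral_of_L1' _ (hprod hf₀ hk₀).1 (.of_forall fun j => hprod (hf j) (hk j)) ?_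
  have hlim : Tendsto (fun j => eLpNorm (fun x => f j x - f₀ x) 2 m *
      (eLpNorm (fun x => k j x - k₀ x) 2 m + eLpNorm k₀ 2 m)
      + eLpNorm f₀ 2 m * eLpNorm (fun x => k j x - k₀ x) 2 m) atTop
      (𝓝 (0 * (0 + eLpNorm k₀ 2 m) + eLpNorm f₀ 2 m * 0)) :=
    (ENNReal.Tendsto.mul h (Or.inr (by simpa using hk₀.2.ne)) (h'.add tendsto_const_nhds)
      (Or.inr zero_ne_top)).add (ENNReal.Tendsto.const_mul h' (Or.inr hf₀.2.ne))
  rw [zero_mul, mul_zero, add_zero] at hlim; refine tendsto_zero_of_le hlim fun j => ?_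
  have e1 : ((fun x => f j x • k j x) - fun x => f₀ x • k₀ x)
      = (fun x => (f j x - f₀ x) • k j x) + fun x => f₀ x • (k j x - k₀ x) := by
    ext x; simp only [Pi.sub_apply, Pi.add_apply, sub_smul, smul_sub]; abel
  simp only [e1]
  refine (eLpNorm_add_le (hprod ((hf j).sub hf₀) (hk j)).1 (hprod hf₀ ((hk j).sub hk₀)).1
    le_rfl).trans (add_le_add ((hle ((hf j).sub hf₀) (hk j)).trans ?_)
    (hle hf₀ ((hk j).sub hk₀)))
  have := eLpNorm_add_le ((hk j).1.sub hk₀.1) hk₀.1 (p := 2) (by norm_num)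
  rw [sub_add_cancel] at this; exact mul_le_mul' le_rfl this

lemma MemH10.hasWeakGradient (hΩ : IsOpen Ω) (h : MemH10 Ω v g) : HasWeakGradient Ω v g := by
  refine ⟨MemLp.locallyIntegrableOn_two hΩ h.memLp, MemLp.locallyIntegrableOn_two hΩ h.memLp_grad,
    fun φ hφ => ?_⟩
  obtain ⟨ψ, hψ⟩ := h.exists_approx
  have T1 := tendsto_integral_smul_of_eLpNorm (fun j => (hψ.test j).memLp 2 _) h.memLp
    (fun _ => hφ.memLp_gradient 2 vol[Ω]) (hφ.memLp_gradient 2 _) hψ.tendsto (by simp)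
  have T2 := tendsto_integral_smul_of_eLpNorm (fun _ => hφ.memLp 2 vol[Ω])
    (hφ.memLp 2 _) (fun j => (hψ.test j).memLp_gradient 2 _) h.memLp_grad (by simp) hψ.tendsto_grad
  exact tendsto_nhds_unique T1 (T2.neg.congr fun j =>
    (hφ.integral_smul_gradient (hψ.test j).smooth).symm)

lemma HasWeakGradient.extend_univ (h : HasWeakGradient Ω v g) (hΩ : IsOpen Ω) (hK : IsCompact K)
    (hKΩ : K ⊆ Ω) (hv : ∀ x, x ∉ K → v x = 0) (hg : ∀ x, x ∉ K → g x = 0) : HasWeakGradient univ v g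
    := by
  have hi : ∀ {F : Type} [NormedAddCommGroup F] {f : Eu n → F}, LocallyIntegrableOn f Ω volume →
      (∀ x, x ∉ K → f x = 0) → Integrable f := fun {F} _ {f} hf h0 => by
    have := hf.integrable_indicator hKΩ hK; rwa [indicator_eq_self.2] at this; intro x hx
    by_contra h'; exact hx (h0 x h')
  refine ⟨(hi h.locInt hv).locallyIntegrable.locallyIntegrableOn _,
    (hi h.locInt_grad hg).locallyIntegrable.locallyIntegrableOn _, fun φ hφ => ?_⟩
  obtain ⟨χ, hχ, -, -, U, hU, hKU, hχU⟩ := exists_testFunction hK hΩ hKΩ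
  have hp := h.parts _ (hχ.mul_right hφ.smooth); simp only [restrict_univ]
  have hs : ∀ f : Eu n → Eu n, (∀ x, x ∉ K → f x = 0) → ∫ x in Ω, f x = ∫ x, f x := fun f hf =>
    setIntegral_eq_integral_of_forall_compl_eq_zero fun x hx => hf x fun h' => hx (hKΩ h')
  rw [hs _ fun x hx => by rw [hv x hx, zero_smul],
    hs _ fun x hx => by rw [hg x hx, smul_zero]] at hp
  have e1 : ∀ x, v x • ∇ (fun y => χ y * φ y) x = v x • ∇ φ x := by
    intro x
    by_cases hx : x ∈ K
    · have : (fun y => χ y * φ y) =ᶠ[𝓝 x] φ := by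
        filter_upwards [hU.mem_nhds (hKU hx)] with y hy; rw [hχU y hy, one_mul]
      rw [gradient, this.fderiv_eq, gradient]
    · rw [hv x hx, zero_smul, zero_smul]
  have e2 : ∀ x, (χ x * φ x) • g x = φ x • g x := by
    intro x
    by_cases hx : x ∈ K
    · rw [hχU x (hKU hx), one_mul]
    · rw [hg x hx, smul_zero, smul_zero]
  simpa only [e1, e2] using hp

/-- A compactly supported function in `W^{1,2}` belongs to `H¹₀`. -/
lemma HasWeakGradient.exists_approx (h : HasWeakGradient Ω v g) (hΩ : IsOpen Ω) (hK : IsCompact K)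
    (hKΩ : K ⊆ Ω) (hv : ∀ x, x ∉ K → v x = 0) (hg : ∀ x, x ∉ K → g x = 0) (hv2 : MemLp v 2 vol[Ω])
    (hg2 : MemLp g 2 vol[Ω]) : ∃ (K' : Set (Eu n)) (φ : ℕ → Eu n → ℝ), IsCompact K' ∧ K' ⊆ Ω ∧ (∀ j,
    IsTestFunction Ω (φ j) ∧ tsupport (φ j) ⊆ K' ∧ ((∀ x, 0 ≤ v x) → ∀ x, 0 ≤ φ j x)) ∧ Tendsto (fun
    j => eLpNorm (fun x => φ j x - v x) 2 vol[Ω]) atTop (𝓝 0) ∧ Tendsto (fun j => eLpNorm (fun x =>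
    ∇ (φ j) x - g x) 2 vol[Ω]) atTop (𝓝 0) := by
  have hu := h.extend_univ hΩ hK hKΩ hv hg
  have hmem : ∀ {F : Type} [NormedAddCommGroup F] {f : Eu n → F}, MemLp f 2 vol[Ω] →
      (∀ x, x ∉ K → f x = 0) → MemLp f 2 volume := fun {F} _ {f} hf h0 => by
    have := (memLp_indicator_iff_restrict hΩ.measurableSet).2 hf; rwa [indicator_eq_self.2] at this
    intro x hx
    by_contra h'; exact hx (h0 x fun h'' => h' (hKΩ h''))
  have hv2' := hmem hv2 hv; have hg2' := hmem hg2 hg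
  obtain ⟨δ, hδ, hs⟩ := hK.exists_cthickening_subset_open hΩ hKΩ
  obtain ⟨r, -, hrm, hr⟩ := exists_seq_strictAnti_tendsto' hδ
  have hr0 := fun i => (hrm i).1; have hrδ := fun i => (hrm i).2
  have hvi : Integrable v := by
    have := h.locInt.integrable_indicator hKΩ hK; rwa [indicator_eq_self.2] at this; intro x hx
    by_contra h'; exact hx (hv x h')
  have hind : ∀ {F : Type} [Zero F] {f : Eu n → F} (K' : Set (Eu n)), K ⊆ K' →
      (∀ x, x ∉ K → f x = 0) → K'.indicator f = f := fun K' hK' h0 => by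
    rw [indicator_eq_self]; intro x hx
    by_contra h'; exact hx (h0 x fun h'' => h' (hK' h''))
  have hgr : ∀ m, ∇ (cv (mol n (r m)) v) = cv (mol n (r m)) g := fun m => by
    ext1 x
    have := hu.gradient_cv (hr0 m) (K := K ∪ closedBall x (r m))
      (hK.union (isCompact_closedBall _ _)) (subset_univ _) subset_union_right
    rwa [hind _ subset_union_left hv, hind _ subset_union_left hg] at this
  -- Mollification keeps the sign of v and a common compact support, as is needed when only a
  -- distributional inequality can be tested.
  refine ⟨_, fun m => cv (mol n (r m)) v, hK.cthickening (r := δ), hs, fun m => ?_, ?_, ?_⟩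
  · have hsub : tsupport (cv (mol n (r m)) v) ⊆ cthickening (r m) K :=
      closure_minimal ((isKernel_mol (hr0 m)).support_cv_subset hv) isClosed_cthickening
    have hsub' := hsub.trans (cthickening_mono (hrδ m).le _)
    refine ⟨⟨contDiff_cv_mol (hr0 m) hvi, hK.cthickening.of_isClosed_subset (isClosed_tsupport _)
      hsub, hsub'.trans hs⟩, hsub', fun h0 x => ?_⟩
    exact (integral_nonneg fun t => mul_nonneg ((isKernel_mol (hr0 m)).nonneg t) (h0 _)).trans_eq
      (cv_apply (mol n (r m)) v x).symm
  · exact tendsto_zero_of_le (tendsto_eLpNorm_cv_sub (fun m => isKernel_mol (hr0 m)) hr (by norm_num) (by norm_num) hv2') fun m => eLpNorm_mono_measure _ restrict_le_self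
  · simp only [hgr]
    exact tendsto_zero_of_le (tendsto_eLpNorm_cv_sub (fun m => isKernel_mol (hr0 m)) hr (by norm_num) (by norm_num) hg2') fun m => eLpNorm_mono_measure _ restrict_le_self

lemma HasWeakGradient.memH10 (h : HasWeakGradient Ω v g) (hΩ : IsOpen Ω) (hK : IsCompact K) (hKΩ : K
    ⊆ Ω) (hv : ∀ x, x ∉ K → v x = 0) (hg : ∀ x, x ∉ K → g x = 0) (hv2 : MemLp v 2 vol[Ω]) (hg2 :
    MemLp g 2 vol[Ω]) : MemH10 Ω v g := by
  obtain ⟨_, φ, -, -, hφ, h1, h2⟩ := h.exists_approx hΩ hK hKΩ hv hg hv2 hg2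
  exact ⟨hv2, hg2, φ, fun j => (hφ j).1, h1, h2⟩

end WeakGradient

/-! ### The truncated equation when E is continuous. -/

section Solution

/-- `-div (A∇e) = ν`, tested against products of test functions and cutoffs of `e`. -/
structure IsTruncSolution (Ω : Set (Eu n)) (A : Eu n → Mat n) (e : Eu n → ℝ)
    (G : Eu n → Eu n) (ν : Measure (Eu n)) : Prop extends IsSupersolution Ω A e G ν where
  eq : ∀ φ, IsTestFunction Ω φ → ∀ l, IsCutoff l →
    truncForm Ω A e G φ l = ∫ x, φ x * l (e x) ∂ν

lemma IsCutoff.deriv_bounded (hl : IsCutoff l) : ∃ C, ∀ t, |_root_.deriv l t| ≤ C :=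
  hl.deriv.bounded

lemma deriv_eq_zero_of_notMem_Icc {b : ℝ} (h : ∀ t, t ∉ Icc a b → l t = 0) (t : ℝ) (ht : t ∉ Icc a
    b) : deriv l t = 0 := by
  have : l =ᶠ[𝓝 t] fun _ => 0 := by
    filter_upwards [isClosed_Icc.isOpen_compl.mem_nhds ht] with s hs using h s hs
  rw [this.deriv_eq, deriv_const]

lemma IsTestFunction.integrable_mul_matForm {θ : Eu n → ℝ} (hθ : IsTestFunction Ω θ) (hΩ : IsOpen Ω)
    (hA : IsUniformlyElliptic Ω A) {Q : Eu n → Eu n} (hQ : LocallyIntegrableOn Q Ω volume) {b : Eu n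
    → ℝ} (hb : AEStronglyMeasurable b vol[Ω]) (hC : ∀ x, |b x| ≤ C) : Integrable (fun x => b x *
    Q[A,Q,∇ θ]x) vol[Ω] := by
  obtain ⟨D, hD⟩ := hθ.gradient_bounded
  exact integrable_matForm_of_compact hΩ hA hQ hb hC hθ.continuous_gradient.aesm
    hD hθ.compactSupport hθ.support_subset fun x hx =>
      Or.inr (gradient_eq_zero hx)

lemma LowerSemicontinuousOn.measurable_indicator (hΩ : IsOpen Ω) (h : LowerSemicontinuousOn E Ω) :
    Measurable (Ω.indicator E) := by
  refine LowerSemicontinuous.measurable fun x y hy => ?_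
  by_cases hx : x ∈ Ω
  · simp only [indicator_of_mem hx] at hy
    filter_upwards [eventually_nhdsWithin_iff.1 (h x hx y hy), hΩ.mem_nhds hx] with z hz hzΩ
    simp only [indicator_of_mem hzΩ]; exact hz hzΩ
  · simp only [indicator_of_notMem hx] at hy; exact absurd hy _root_.not_lt_zero

namespace IsPositiveSolution

lemma measurableSet_lt (hΩ : IsOpen Ω) (h : IsPositiveSolution Ω A E G μ) (c : ℝ≥0∞) : MeasurableSet
    {x ∈ Ω | E x < c} := by
  have : {x ∈ Ω | E x < c} = Ω ∩ Ω.indicator E ⁻¹' Iio c := by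
    ext x; simp only [mem_ofPred_eq, mem_inter_iff, mem_preimage, mem_Iio]
    refine and_congr_right fun hx => ?_; rw [indicator_of_mem hx]
  rw [this]; exact hΩ.measurableSet.inter (h.lsc.measurable_indicator hΩ measurableSet_Iio)

lemma aemeasurable (hΩ : IsOpen Ω) (h : IsPositiveSolution Ω A E G μ) (m : Measure (Eu n)) :
    AEMeasurable E (m.restrict Ω) :=
  ⟨_, h.lsc.measurable_indicator hΩ, by
    filter_upwards [hΩ.ae_mem] with x hx; rw [indicator_of_mem hx]⟩

/-- A positive lower semicontinuous function attains its minimum on K; the cap at 1 keeps the bound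
real where E is infinite. -/
lemma exists_lower (h : IsPositiveSolution Ω A E G μ) (hK : IsCompact K) (hKΩ : K ⊆ Ω) : ∃ c : ℝ, 0
    < c ∧ ∀ x ∈ K, ofReal c ≤ E x := by
  rcases K.eq_empty_or_nonempty with rfl | hne
  · exact ⟨1, one_pos, fun x hx => hx.elim⟩
  obtain ⟨a, ha, hmin⟩ := (h.lsc.mono hKΩ).exists_isMinOn hne hK
  have hpos : 0 < min (E a) 1 := lt_min (h.pos a (hKΩ ha)) one_pos
  have hfin : min (E a) 1 ≠ ⊤ := (min_lt_of_right_lt one_lt_top).ne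
  refine ⟨(min (E a) 1).toReal, toReal_pos hpos.ne' hfin, fun x hx => ?_⟩; rw [ofReal_toReal hfin]
  exact (min_le_left _ _).trans (hmin hx)

lemma exists_lower' (h : IsPositiveSolution Ω A E G μ) (hK : IsCompact K) (hKΩ : K ⊆ Ω) : ∃ c : ℝ, 0
    < c ∧ ∀ x ∈ K, E x < ⊤ → c ≤ E§x := by
  obtain ⟨c, hc, hcK⟩ := h.exists_lower hK hKΩ
  exact ⟨c, hc, fun x hx hxt => (ofReal_le_iff_le_toReal hxt.ne).1 (hcK x hx)⟩

/-- The part of `μ` on the set where `E` is finite. -/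
noncomputable def finPart (Ω : Set (Eu n)) (E : Eu n → ℝ≥0∞) (μ : Measure (Eu n)) :
    Measure (Eu n) := μ.restrict {x ∈ Ω | E x < ⊤}

lemma aemeasurable_toReal (hΩ : IsOpen Ω) (h : IsPositiveSolution Ω A E G μ) : AEMeasurable (fun x
    => E§x) (finPart Ω E μ) :=
  ((h.aemeasurable hΩ μ).mono_measure (restrict_mono (fun _ hx => hx.1) le_rfl)).ennreal_toReal

instance [IsFiniteMeasure μ] : IsFiniteMeasure (finPart Ω E μ) := by
  unfold finPart; infer_instance

lemma integrable_cutoff [IsFiniteMeasure μ] (hΩ : IsOpen Ω) (h : IsPositiveSolution Ω A E G μ) (hφ :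
    Continuous φ) (hC : ∀ x, |φ x| ≤ C) (hl : Continuous l) (hD : ∀ t, |l t| ≤ D) : Integrable (fun
    x => φ x * l E§x) (finPart Ω E μ) := by
  refine Integrable.of_bound (C := C * D) (hφ.aestronglyMeasurable.mul
    (hl.measurable.comp_aemeasurable (h.aemeasurable_toReal hΩ)).aestronglyMeasurable)
    (.of_forall fun x => ?_)
  rw [norm_mul]; exact mul_le_mul (hC x) (hD _) (norm_nonneg _) ((abs_nonneg _).trans (hC x))

/-- For a solution the inequality follows from the identity, so the regularity cases have only `int`
and `eq` to supply. Points with E = ∞ have real value 0, where every cutoff vanishes; this is why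
only the finite part of μ appears. -/
lemma isTruncSolution [IsFiniteMeasure μ] (hΩ : IsOpen Ω) (hA : IsUniformlyElliptic Ω A)
    (h : IsPositiveSolution Ω A E G μ)
    (int : ∀ φ, IsTestFunction Ω φ → ∀ l, IsCutoff l → Integrable (fun x =>
      φ x * l E§x * Q[A,G,G]x) vol[Ω])
    (eq : ∀ φ, IsTestFunction Ω φ → ∀ l, IsCutoff l →
      truncForm Ω A (fun x => E§x) G φ l = ∫ x, φ x * l E§x ∂finPart Ω E μ) :
    IsTruncSolution Ω A (fun x => E§x) G (finPart Ω E μ) where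
  isOpen := hΩ
  elliptic := hA
  meas := h.weakGrad.locInt.aestronglyMeasurable
  meas' := h.aemeasurable_toReal hΩ
  loc := h.weakGrad.locInt_grad
  lower K hK hKc := by
    obtain ⟨c, hc, hcK⟩ := h.exists_lower' hKc hK; refine ⟨c, hc, ?_, ?_⟩
    · filter_upwards [h.finite_ae] with x hx hxK using hcK x hxK hx
    · filter_upwards [ae_restrict_mem (h.measurableSet_lt hΩ ⊤)] with x hx hxK; exact hcK x hxK hx.2
  int := int
  ineq φ hφ hφ0 l hl hl0 := by
    obtain ⟨C, hC⟩ := hφ.bounded; obtain ⟨D, hD⟩ := hl.bounded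
    have h0 : ∀ x, 0 ≤ φ x * l E§x := fun x => mul_nonneg (hφ0 x) (hl0 _)
    rw [eq φ hφ l hl, ofReal_integral_eq_lintegral_ofReal
      (h.integrable_cutoff hΩ hφ.continuous hC hl.continuous hD) (.of_forall h0)]
    exact ⟨le_rfl, integral_nonneg h0⟩
  eq := eq

end IsPositiveSolution

/-- Passing to the limit in the form of a field against mollifications of a weakly
differentiable function. -/
lemma tendsto_integral_matForm_mol (hΩ : IsOpen Ω) (hA : IsUniformlyElliptic Ω A) {f Q : Eu n → Eu
    n} (hv : HasWeakGradient Ω v f) (hB : ∀ x, |v x| ≤ B) (hψ : IsTestFunction Ω ψ) (hQ :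
    LocallyIntegrableOn Q Ω volume) (hψQ : MemLp (fun x => ψ x • Q x) 2 vol[Ω]) (hK : IsCompact K)
    (hKΩ : K ⊆ Ω) (hψK : tsupport ψ ⊆ K) (hball : ∀ x ∈ tsupport ψ, closedBall x δ ⊆ K) (hf : MemLp
    (K.indicator f) 2 volume) {r : ℕ → ℝ} (hr0 : ∀ m, 0 < r m) (hrδ : ∀ m, r m < δ) (hr : Tendsto r
    atTop (𝓝 0)) (hae : ∀ᵐ x, Tendsto (fun m => cv (mol n (r m)) (K.indicator v) x) atTop (𝓝
    (K.indicator v x))) : Tendsto (fun m => ∫ x in Ω, Q[A,Q,∇ (fun y => ψ y * cv (mol n (r m))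
    (K.indicator v) y)]x) atTop (𝓝 (∫ x in Ω, (v x * Q[A,Q,∇ ψ]x + ψ x * Q[A,Q,f]x))) := by
  have hvi : Integrable (K.indicator v) := hv.locInt.integrable_indicator hKΩ hK
  set w : ℕ → Eu n → ℝ := fun m => cv (mol n (r m)) (K.indicator v) with hw
  have hwc : ∀ m, ContDiff ℝ ∞ (w m) := fun m => contDiff_cv_mol (hr0 m) hvi
  have hB0 : 0 ≤ B := (abs_nonneg _).trans (hB 0)
  have hwB : ∀ m x, |w m x| ≤ B := fun m x =>
    (isKernel_mol (hr0 m)).norm_cv_indicator_le hvi hB x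
  have hcv2 : ∀ m, MemLp (cv (mol n (r m)) (K.indicator f)) 2 vol[Ω] := fun m =>
    ((isKernel_mol (hr0 m)).memLp_cv (by norm_num) (by norm_num) hf).mono_measure restrict_le_self
  have hf2 : MemLp (K.indicator f) 2 vol[Ω] := hf.mono_measure restrict_le_self
  have hg0 : ∀ x, x ∉ tsupport ψ → ∇ ψ x = 0 := fun x hx =>
    gradient_eq_zero hx
  have h0 : ∀ x, x ∉ tsupport ψ → ψ x = 0 := fun x hx => eq_zero_of_notMem hx
  have hi1 : ∀ {b : Eu n → ℝ}, AEStronglyMeasurable b vol[Ω] → (∀ x, |b x| ≤ B) →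
      Integrable (fun x => b x * Q[A,Q,∇ ψ]x) vol[Ω] :=
    fun hb hbB => hψ.integrable_mul_matForm hΩ hA hQ hb hbB
  have hvm := hv.locInt.aestronglyMeasurable
  have T1 : Tendsto (fun m => ∫ x in Ω, w m x * Q[A,Q,∇ ψ]x) atTop
      (𝓝 (∫ x in Ω, v x * Q[A,Q,∇ ψ]x)) := by
    have hQψ := hi1 (b := fun _ => 1 * B) aestronglyMeasurable_const (fun _ => by
      rw [one_mul, abs_of_nonneg hB0])
    refine tendsto_integral_of_dominated_convergence (fun x => ‖1 * B * Q[A,Q,∇ ψ]x‖)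
      (fun m => (hi1 (hwc m).continuous.aesm (hwB m)).1) hQψ.norm
      (fun m => .of_forall fun x => ?_) ?_
    · rw [norm_mul, norm_mul, one_mul, norm_of_nonneg hB0]
      exact mul_le_mul_of_nonneg_right (hwB m x) (norm_nonneg _)
    · filter_upwards [ae_restrict_of_ae hae] with x hx
      by_cases hxs : x ∈ tsupport ψ
      · rw [indicator_of_mem (hψK hxs)] at hx; exact hx.mul_const _
      · simp [hg0 x hxs]
  have T2 := tendsto_integral_matForm hΩ hA hψQ hf2 (fun _ => hψQ) hcv2 (by simp)
    (tendsto_zero_of_le (tendsto_eLpNorm_cv_sub (fun m => isKernel_mol (hr0 m)) hr (by norm_num) (by norm_num) hf) fun m => eLpNorm_mono_measure _ restrict_le_self)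
  have T := T1.add T2; rw [← integral_add (hi1 hvm hB) (integrable_matForm hΩ hA hψQ hf2)] at T
  have e1 : ∫ x in Ω, (v x * Q[A,Q,∇ ψ]x + matForm (A x) (ψ x • Q x) (K.indicator f x))
      = ∫ x in Ω, (v x * Q[A,Q,∇ ψ]x + ψ x * Q[A,Q,f]x) := by
    refine integral_congr_fun fun x => ?_; simp only [matForm_smul_left]
    by_cases hxs : x ∈ tsupport ψ
    · rw [indicator_of_mem (hψK hxs)]
    · simp [h0 x hxs]
  rw [e1] at T; refine T.congr fun m => ?_
  rw [← integral_add (hi1 (hwc m).continuous.aesm (hwB m))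
    (integrable_matForm hΩ hA hψQ (hcv2 m))]
  refine integral_congr_fun fun x => ?_; simp only [matForm_smul_left]
  rw [gradient_fun_mul (hψ.differentiable x) ((hwc m).differentiable (by simp) x),
    matForm_add_right, matForm_smul_right, matForm_smul_right]
  by_cases hxs : x ∈ tsupport ψ
  · rw [hv.gradient_cv (hr0 m) hK hKΩ
      ((closedBall_subset_closedBall (hrδ m).le).trans (hball x hxs))]
    ring
  · simp [h0 x hxs, hg0 x hxs]

/-- Points of finiteness of `E` are Lebesgue points of the cutoffs of `E`. -/
lemma IsPositiveSolution.tendsto_laverage_comp_sub (hΩ : IsOpen Ω) (h : IsPositiveSolution Ω A E G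
    μ) (hl : IsCutoff l) (hxΩ : x ∈ Ω) (hEx : E x < ⊤) : Tendsto (fun r : ℝ => ⨍⁻ y in ball x r, ‖l
    E§y - l E§x‖ₑ ∂volume) (𝓝[>] 0) (𝓝 0) := by
  obtain ⟨M, hM⟩ := hl.deriv_bounded; have hM0 : 0 ≤ M := (abs_nonneg _).trans (hM 0)
  have hlip : ∀ s t, |l s - l t| ≤ M * |s - t| := fun s t => by
    have := Convex.norm_image_sub_le_of_norm_deriv_le (f := l) (C := M) (s := univ)
      (fun x _ => hl.differentiable x) (fun x _ => hM x) convex_univ (mem_univ t) (mem_univ s)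
    simpa [norm_eq_abs] using this
  have h1 := tendsto_laverage_sub hΩ h.finite_ae h.lsc hxΩ hEx (h.precise x hxΩ)
    (h.aemeasurable hΩ volume)
  have h3 : Tendsto (fun r : ℝ => ofReal M * ⨍⁻ y in ball x r,
      ‖E§y - E§x‖ₑ ∂volume) (𝓝[>] 0) (𝓝 0) := by
    simpa using ENNReal.Tendsto.const_mul h1 (Or.inr ofReal_ne_top)
  refine tendsto_zero_of_le h3 fun s => ?_
  rw [setLAverage_eq, setLAverage_eq, ← mul_div_assoc, ← lintegral_const_mul' _ _ ofReal_ne_top]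
  gcongr ?_ / _; refine lintegral_mono fun y => ?_
  rw [← ofReal_norm, ← ofReal_norm, ← ofReal_mul hM0]; exact ofReal_le_ofReal (hlip _ _)

/-- Mollifications of a cutoff of `E` converge at every point where `E` is finite. -/
lemma tendsto_cv_mol_comp (hΩ : IsOpen Ω) (h : IsPositiveSolution Ω A E G μ) (hl : IsCutoff l) (hK :
    IsCompact K) (hKΩ : K ⊆ Ω) (hδ : 0 < δ) (hx : closedBall x δ ⊆ K) (hEx : E x < ⊤) {r : ℕ → ℝ}
    (hr0 : ∀ m, 0 < r m) (hr : Tendsto r atTop (𝓝 0)) : Tendsto (fun m => cv (mol n (r m))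
    (K.indicator fun y => l E§y) x) atTop (𝓝 (l E§x)) := by
  have hxΩ : x ∈ Ω := hKΩ (hx (mem_closedBall_self hδ.le)); obtain ⟨C, hC⟩ := hl.bounded
  obtain ⟨M, hM⟩ := hl.deriv_bounded
  have hfi : Integrable (K.indicator fun y => l E§y) :=
    (h.weakGrad.comp hΩ hl.smooth hC hM).locInt.integrable_indicator hKΩ hK
  have h2 : Tendsto (fun r : ℝ => ⨍⁻ y in ball x r,
      ‖K.indicator (fun y => l E§y) y - l E§x‖ₑ ∂volume) (𝓝[>] 0) (𝓝 0) := by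
    refine (h.tendsto_laverage_comp_sub hΩ hl hxΩ hEx).congr' ?_
    filter_upwards [nhdsWithin_le_nhds (gt_mem_nhds hδ)] with s hs
    rw [setLAverage_eq, setLAverage_eq]; congr 1
    refine setLIntegral_congr_fun measurableSet_ball fun y hy => ?_
    rw [indicator_of_mem (hx (ball_subset_closedBall (ball_subset_ball hs.le hy)))]
  rw [Metric.tendsto_atTop']; intro ε hε
  have h4 := (tendsto_nhdsWithin_iff.2 ⟨hr, .of_forall hr0⟩ :
    Tendsto r atTop (𝓝[>] 0)).eventually (eventually_cv_mol_sub_le hfi h2 (half_pos hε))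
  obtain ⟨N, hN⟩ := eventually_atTop.1 h4; refine ⟨N, fun m hm => ?_⟩; rw [dist_eq]
  exact (hN m hm.le x (mem_closedBall_self (hr0 m).le)).trans_lt (half_lt_self hε)

/-- Cutoffs of a continuous solution are admissible test functions. -/
theorem IsPositiveSolution.isTruncSolution_of_continuous [IsFiniteMeasure μ] (hΩ : IsOpen Ω) (hA :
    IsUniformlyElliptic Ω A) (h : IsPositiveSolution Ω A E G μ) (hE : ContinuousOn E Ω) (hG :
    LocallyIntegrableOn (fun x => ‖G x‖ ^ 2) {x ∈ Ω | E x < ⊤} volume) : IsTruncSolution Ω A (fun x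
    => E§x) G (IsPositiveSolution.finPart Ω E μ) := by
  set W := {x ∈ Ω | E x < ⊤} with hW
  have hWo : IsOpen W := by have := hE.isOpen_inter_preimage hΩ isOpen_Iio (t := Iio ⊤); exact this
  have hWΩ : W ⊆ Ω := fun x hx => hx.1
  have hGm : AEStronglyMeasurable G vol[Ω] := h.weakGrad.locInt_grad.aestronglyMeasurable
  have hG2 : ∀ K ⊆ W, IsCompact K → MemLp (K.indicator G) 2 volume := by
    intro K hKW hK; rw [memLp_indicator_iff_restrict hK.measurableSet]
    rw [memLp_two_iff_integrable_sq_norm (hGm.mono_measure (restrict_mono (hKW.trans hWΩ) le_rfl))]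
    exact hG.integrableOn_compact_subset hKW hK
  -- The product φ l(E) lives on the part of the support of φ with E ≤ b, a compact subset of the
  -- open set W where E is finite. So φ may be replaced by a test function of W, where the gradient
  -- is locally square integrable.
  have hloc : ∀ φ, IsTestFunction Ω φ → ∀ l, IsCutoff l → ∃ ψ, IsTestFunction W ψ ∧
      ∀ x ∈ Ω, (φ x * l E§x = ψ x * l E§x) ∧ (φ x * deriv l E§x = ψ x * deriv l E§x) ∧
        l E§x • ∇ φ x = l E§x • ∇ ψ x := by
    intro φ hφ l hl; obtain ⟨a, b, ha, hab⟩ := hl.support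
    have hab' := deriv_eq_zero_of_notMem_Icc hab
    have hKc : IsCompact (tsupport φ ∩ E ⁻¹' Iic (ofReal b)) :=
      hφ.compactSupport.isCompact.of_isClosed_subset
        ((hE.mono hφ.support_subset).preimage_isClosed_of_isClosed (isClosed_tsupport _) isClosed_Iic)
        inter_subset_left
    obtain ⟨χ, hχ, -, -, U, hU, hKU, hχU⟩ := exists_testFunction hKc hWo fun x hx =>
      ⟨hφ.support_subset hx.1, (mem_Iic.1 hx.2).trans_lt ofReal_lt_top⟩
    refine ⟨_, hχ.mul_left hφ.smooth, fun x hx => ?_⟩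
    by_cases hxφ : x ∈ tsupport φ
    · by_cases hxE : E x ≤ ofReal b
      · have hxU := hKU ⟨hxφ, hxE⟩
        have : (fun y => φ y * χ y) =ᶠ[𝓝 x] φ := by
          filter_upwards [hU.mem_nhds hxU] with y hy; rw [hχU y hy, mul_one]
        have hg : ∇ (fun y => φ y * χ y) x = ∇ φ x := by rw [gradient, this.fderiv_eq, gradient]
        rw [hg, hχU x hxU, mul_one]; exact ⟨rfl, rfl, rfl⟩
      · have hn : E§x ∉ Icc a b := by
          rintro ⟨h1, h2⟩; refine hxE ?_
          have hne : E x ≠ ⊤ := fun h' => by rw [h', toReal_top] at h1; linarith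
          rw [← ofReal_toReal hne]; exact ofReal_le_ofReal h2
        simp [hab _ hn, hab' _ hn]
    · have h1 : x ∉ tsupport (fun y => φ y * χ y) := fun h' =>
        hxφ (tsupport_mul_subset_left (f := φ) (g := χ) h')
      simp [eq_zero_of_notMem hxφ, gradient_eq_zero hxφ, gradient_eq_zero h1]
  have hem : ∀ {k : ℝ → ℝ}, Continuous k → AEStronglyMeasurable (fun x => k E§x) vol[Ω] := fun hk =>
    hk.comp_aestronglyMeasurable h.weakGrad.locInt.aestronglyMeasurable
  have hmul : ∀ {b : Eu n → ℝ} {K : Set (Eu n)}, AEStronglyMeasurable b vol[Ω] →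
      (∃ C, ∀ x, |b x| ≤ C) → IsCompact K → K ⊆ W →
      MemLp (fun x => b x • K.indicator G x) 2 vol[Ω] := by
    intro b K hb hC hK hKW; obtain ⟨C, hC⟩ := hC
    have h2 := (hG2 K hKW hK).mono_measure (restrict_le_self (s := Ω))
    refine h2.of_le_mul (c := C) (hb.smul h2.1) (.of_forall fun x => ?_); rw [norm_smul]
    exact mul_le_mul_of_nonneg_right (hC x) (norm_nonneg _)
  refine h.isTruncSolution hΩ hA (fun φ hφ l hl => ?_) fun φ hφ l hl => ?_
  · obtain ⟨ψ, hψ, hψφ⟩ := hloc φ hφ l hl; obtain ⟨C, hC⟩ := hψ.bounded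
    obtain ⟨D, hD⟩ := hl.bounded
    have hb : ∀ x, |ψ x * l E§x| ≤ C * D := fun x => by
      rw [abs_mul]; exact mul_le_mul (hC x) (hD _) (abs_nonneg _) ((abs_nonneg _).trans (hC x))
    have hm := hmul (K := tsupport ψ) (b := fun x => ψ x * l E§x)
      (hψ.continuous.aesm.mul (hem hl.continuous)) ⟨_, hb⟩
      hψ.compactSupport hψ.support_subset
    have h2 := (hG2 _ hψ.support_subset hψ.compactSupport).mono_measure (restrict_le_self (s := Ω))
    refine (integrable_matForm hΩ hA hm h2).congr ?_; filter_upwards [hΩ.ae_mem] with x hx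
    rw [(hψφ x hx).1, matForm_smul_left]
    by_cases hxs : x ∈ tsupport ψ
    · rw [indicator_of_mem hxs]
    · simp [eq_zero_of_notMem hxs]
  · obtain ⟨ψ, hψ, hψφ⟩ := hloc φ hφ l hl; have hψΩ := hψ.mono hWΩ
    have e1 : truncForm Ω A (fun x => E§x) G φ l = truncForm Ω A (fun x => E§x) G ψ l := by
      refine integral_congr_ae ?_; filter_upwards [hΩ.ae_mem] with x hx
      rw [← matForm_smul_right, (hψφ x hx).2.2, matForm_smul_right, (hψφ x hx).2.1]
    have e2 : ∫ x, φ x * l E§x ∂IsPositiveSolution.finPart Ω E μ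
        = ∫ x, ψ x * l E§x ∂IsPositiveSolution.finPart Ω E μ := by
      refine integral_congr_ae ?_
      filter_upwards [ae_restrict_mem (h.measurableSet_lt hΩ ⊤)] with x hx using (hψφ x hx.1).1
    rw [e1, e2]; obtain ⟨C, hC⟩ := hψ.bounded; obtain ⟨B, hB⟩ := hl.bounded
    obtain ⟨D, hD⟩ := hl.deriv_bounded
    obtain ⟨δ, hδ, K, hK, hKW, hψK, hball⟩ := hψ.exists_thickening hWo
    have hv := h.weakGrad.comp hΩ hl.smooth hB hD
    have hvi : Integrable (K.indicator fun x => l E§x) :=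
      hv.locInt.integrable_indicator (hKW.trans hWΩ) hK
    obtain ⟨r, hr0, hrδ, hr, hae⟩ := exists_mol_seq hvi hδ
    have hψQ : MemLp (fun x => ψ x • G x) 2 vol[Ω] := by
      refine (hmul hψ.continuous.aesm ⟨C, hC⟩ hK hKW).ae_eq (.of_forall fun x => ?_)
      by_cases hxs : x ∈ K
      · simp only [indicator_of_mem hxs]
      · simp [eq_zero_of_notMem fun h' => hxs (hψK h')]
    have hf : MemLp (K.indicator fun x => deriv l E§x • G x) 2 volume := by
      have := (memLp_indicator_iff_restrict hΩ.measurableSet).2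
        (hmul (hem hl.deriv.continuous) ⟨D, fun x => hD _⟩ hK hKW)
      refine this.ae_eq (.of_forall fun x => ?_)
      by_cases hxs : x ∈ K
      · rw [indicator_of_mem (hWΩ (hKW hxs)), indicator_of_mem hxs, indicator_of_mem hxs]
      · simp [indicator, hxs]
    have T := tendsto_integral_matForm_mol hΩ hA hv (fun x => hB _) hψΩ h.weakGrad.locInt_grad hψQ
      hK (hKW.trans hWΩ) hψK hball hf hr0 hrδ hr hae
    have e3 : ∫ x in Ω, (l E§x * Q[A,G,∇ ψ]x + ψ x * matForm (A x) (G x) (deriv l E§x • G x))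
        = truncForm Ω A (fun x => E§x) G ψ l := by
      refine integral_congr_fun fun x => ?_; simp only [matForm_smul_right]; ring
    rw [e3] at T; refine tendsto_nhds_unique T ?_
    have hcs : ∀ m, ContDiff ℝ ∞ (cv (mol n (r m)) (K.indicator fun x => l E§x)) :=
      fun m => contDiff_cv_mol (hr0 m) hvi
    have hcB : ∀ m x, |cv (mol n (r m)) (K.indicator fun x => l E§x) x| ≤ B := fun m =>
      (isKernel_mol (hr0 m)).norm_cv_indicator_le hvi fun _ => hB _
    -- The mollified products are genuine test functions of the equation, and being supported in W
    -- they see only the finite part of μ.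
    have e4 : ∀ m, ∫ x in Ω, Q[A,G,∇ (fun y => ψ y *
        cv (mol n (r m)) (K.indicator fun x => l E§x) y)]x
        = ∫ x, ψ x * cv (mol n (r m)) (K.indicator fun x => l E§x) x
          ∂IsPositiveSolution.finPart Ω E μ := fun m => by
      rw [h.equation _ (hψΩ.mul_right (hcs m)), IsPositiveSolution.finPart]
      refine setIntegral_eq_of_subset_of_forall_sdiff_eq_zero hΩ.measurableSet hWΩ fun x hx => ?_
      rw [eq_zero_of_notMem fun h' => hx.2 (hψ.support_subset h'), zero_mul]
    simp only [e4]
    refine tendsto_integral_of_dominated_convergence (fun _ => C * B)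
      (fun m => (hψ.continuous.mul (hcs m).continuous).aesm)
      (integrable_const _) (fun m => .of_forall fun x => ?_)
      (.of_forall fun x => ?_)
    · rw [norm_mul]; exact mul_le_mul (hC x) (hcB m x) (norm_nonneg _) ((abs_nonneg _).trans (hC x))
    · by_cases hxs : x ∈ tsupport ψ
      -- As μ may be singular, almost everywhere convergence would not do: every point of finiteness
      -- is a Lebesgue point.
      · exact (tendsto_cv_mol_comp hΩ h hl hK (hKW.trans hWΩ) hδ (hball x hxs)
          (hψ.support_subset hxs).2 hr0 hr).const_mul _
      · simp [eq_zero_of_notMem hxs]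

end Solution

/-! ### Friedrichs' commutator lemma for Lipschitz coefficients. -/

section Friedrichs

lemma IsTestFunction.mono_univ (h : IsTestFunction Ω φ) :
    IsTestFunction univ φ := h.mono (subset_univ _)

lemma abs_coord_le (x : Eu n) (i : Fin n) : |x i| ≤ ‖x‖ := PiLp.norm_apply_le x i

lemma integral_coord {f : Eu n → Eu n} {m : Measure (Eu n)} (hf : Integrable f m) (i : Fin n) : (∫
    x, f x ∂m) i = ∫ x, f x i ∂m :=
  ((EuclideanSpace.proj (𝕜 := ℝ) i : Eu n →L[ℝ] ℝ).integral_comp_comm hf).symm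

lemma MeasureTheory.Integrable.coord {f : Eu n → Eu n} {m : Measure (Eu n)} (hf : Integrable f m) (i
    : Fin n) : Integrable (fun x => f x i) m :=
  (EuclideanSpace.proj (𝕜 := ℝ) i : Eu n →L[ℝ] ℝ).integrable_comp hf

lemma IsKernel.cv_coord (h : IsKernel κ r) {f : Eu n → Eu n} (hf : LocallyIntegrable f) (x : Eu n)
    (i : Fin n) : cv κ f x i = cv κ (fun y => f y i) x := by
  rw [cv_apply_swap, cv_apply_swap, integral_coord]
  · rfl
  · exact h.integrable_smul (hf.integrableOn_isCompact (isCompact_closedBall _ _))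

lemma gradient_coord (f : Eu n → ℝ) (x : Eu n) (i : Fin n) : ∇ f x i = fderiv ℝ f x
    (EuclideanSpace.single i 1) := by
  have : inner ℝ (∇ f x) (EuclideanSpace.single i (1 : ℝ))
      = fderiv ℝ f x (EuclideanSpace.single i 1) := by
    rw [gradient, InnerProductSpace.toDual_symm_apply]
  rw [← this, EuclideanSpace.inner_single_right]; simp

/-- `b` is the weak `i`-th partial derivative of `a`. -/
def HasWeakPartial (a b : Eu n → ℝ) (i : Fin n) : Prop :=
  ∀ θ, IsTestFunction univ θ → ∫ x, a x * ∇ θ x i = -∫ x, b x * θ x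

lemma LipschitzWith.hasWeakPartial {a : Eu n → ℝ} {L : ℝ≥0} (ha : LipschitzWith L a) (i : Fin n) :
    HasWeakPartial a (fun x => lineDeriv ℝ a x (EuclideanSpace.single i 1)) i := by
  intro θ hθ; set v : Eu n := EuclideanSpace.single i 1 with hv
  obtain ⟨D, hD⟩ := hθ.smooth.lipschitzWith_of_hasCompactSupport hθ.compactSupport (by simp)
  rw [ha.integral_lineDeriv_mul_eq hD hθ.compactSupport v, ← integral_neg]
  refine integral_congr_fun fun x => ?_
  have e1 : lineDeriv ℝ θ x (-v) = -(∇ θ x i) := by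
    rw [(hθ.differentiable x).lineDeriv_eq_fderiv, map_neg, hv, gradient_coord]
  simp only [e1]; ring

lemma LipschitzWith.exists_hasWeakPartial {a : Eu n → ℝ} {L : ℝ≥0} (ha : LipschitzWith L a) (i : Fin
    n) : ∃ b : Eu n → ℝ, Measurable b ∧ (∀ x, |b x| ≤ L) ∧ HasWeakPartial a b i := by
  refine ⟨_, measurable_lineDeriv ha.continuous, fun x => ?_, ha.hasWeakPartial i⟩
  simpa using norm_lineDeriv_le_of_lipschitz ℝ ha (x₀ := x) (v := EuclideanSpace.single i 1)

variable {a b : Eu n → ℝ} {i : Fin n}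

/-- The pairing of the commutator of mollification and multiplication by `a` with a partial
derivative. -/
noncomputable def commPairing (a : Eu n → ℝ) (i : Fin n) (r : ℝ) (V ψ : Eu n → ℝ) : ℝ :=
  ∫ x, (cv (mol n r) (fun y => a y * V y) x - a x * cv (mol n r) V x) * ∇ ψ x i

lemma IsTestFunction.continuous_partial (hψ : IsTestFunction Ω ψ) (i : Fin n) : Continuous fun x =>
    ∇ ψ x i :=
  (EuclideanSpace.proj (𝕜 := ℝ) i : Eu n →L[ℝ] ℝ).continuous.comp hψ.continuous_gradient

lemma gradient_mul_coord {g : Eu n → ℝ} (hf : DifferentiableAt ℝ f x) (hg : DifferentiableAt ℝ g x)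
    (i : Fin n) : ∇ (fun y => f y * g y) x i = f x * ∇ g x i + g x * ∇ f x i := by
  rw [gradient_fun_mul hf hg]; simp

lemma IsTestFunction.integral_partial (hψ : IsTestFunction Ω ψ) (i : Fin n) : ∫ x, ∇ ψ x i = 0 := by
  rw [← integral_coord (hψ.integrable_gradient _), hψ.integral_gradient_eq_zero]; simp

lemma integrable_bdd_mul {c : Eu n → ℝ} (hc : Measurable c) (hC : ∀ x, |c x| ≤ C) (hf : Integrable
    f) : Integrable fun x => c x * f x :=
  hf.bdd_mul hc.aestronglyMeasurable (.of_forall hC)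

/-- The pairing is ∫ V(y) ∫ mol(x − y)(a(y) − a(x)) ∂ψ(x) dx dy. Moving the derivative off ψ, it
falls either on a, costing M, or on the mollifier, costing C/r against |a(y) − a(x)| ≤ Lr. The bound
is uniform in r and sees only the supremum of ψ, not its gradient. -/
lemma abs_commPairing_le {L : ℝ≥0} (ha : LipschitzWith L a) (hB : ∀ x, |a x| ≤ B) (hbm : Measurable
    b) (hM : ∀ x, |b x| ≤ M) (hab : HasWeakPartial a b i) (hr : 0 < r) (hC : ∫ x, ‖∇ (mol n r) x‖ ≤
    C / r) {V : Eu n → ℝ} (hV : Integrable V) (hψ : IsTestFunction univ ψ) {S : ℝ} (hS : ∀ x, |ψ x|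
    ≤ S) : |commPairing a i r V ψ| ≤ (M + L * C) * S * ∫ y, |V y| := by
  have hk := isKernel_mol (n := n) hr; have hac := ha.continuous
  have hS0 : 0 ≤ S := (abs_nonneg _).trans (hS 0); have hM0 : 0 ≤ M := (abs_nonneg _).trans (hM 0)
  obtain ⟨D, hD⟩ := hψ.gradient_bounded; have hpc := hψ.continuous_partial i
  have hmt := isTestFunction_mol (n := n) hr
  have hmol : ∀ y, IsTestFunction univ (fun x => mol n r (x - y)) := fun y => by
    have := isTestFunction_mol_sub (n := n) hr (subset_univ (closedBall y r))
    simpa only [mol_sub_comm y] using this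
  have haV : Integrable fun y => a y * V y := integrable_bdd_mul hac.measurable hB hV
  have hin : ∀ y, |∫ x, mol n r (x - y) * (a y - a x) * ∇ ψ x i| ≤ (M + L * C) * S := by
    intro y
    have hmd : ∀ x, DifferentiableAt ℝ (fun x => mol n r (x - y)) x := (hmol y).differentiable
    have hgm : ∀ x, ∇ (fun x => mol n r (x - y)) x = ∇ (mol n r) (x - y) := fun x => by
      rw [gradient, gradient, fderiv_comp_sub]
    set θ : Eu n → ℝ := fun x => mol n r (x - y) * ψ x with hθ_def
    have hθ : IsTestFunction univ θ := hψ.mul_left (hmol y).smooth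
    have e1 : ∀ x, ∇ θ x i = mol n r (x - y) * ∇ ψ x i + ψ x * ∇ (mol n r) (x - y) i := fun x => by
      rw [hθ_def, gradient_mul_coord (hmd x) (hψ.differentiable x), hgm]
    have i1 : Integrable fun x => a y * ∇ θ x i :=
      ((hθ.integrable_gradient volume).coord i).const_mul _
    have i2 : Integrable fun x => a x * ∇ θ x i :=
      integrable_bdd_mul hac.measurable hB ((hθ.integrable_gradient volume).coord i)
    have i3 : Integrable fun x => (a y - a x) * (ψ x * ∇ (mol n r) (x - y) i) := by
      refine ((continuous_const.sub hac).mul (hψ.continuous.mul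
        ((hmt.continuous_partial i).comp (continuous_id.sub continuous_const)))
        ).integrable_of_hasCompactSupport ?_
      exact (hψ.compactSupport.mul_right).mul_left
    have e2 : ∫ x, mol n r (x - y) * (a y - a x) * ∇ ψ x i
        = (∫ x, b x * θ x) - ∫ x, (a y - a x) * (ψ x * ∇ (mol n r) (x - y) i) := by
      have h1 := hab θ hθ
      have h2 : ∫ x, (a y * ∇ θ x i - a x * ∇ θ x i) = ∫ x, b x * θ x := by
        rw [integral_sub i1 i2, integral_const_mul, hθ.integral_partial, h1]; ring
      have i12 : Integrable fun x => a y * ∇ θ x i - a x * ∇ θ x i := i1.sub i2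
      rw [← h2, ← integral_sub i12 i3]; refine integral_congr_fun fun x => ?_; simp only [e1]; ring
    have b1 : |∫ x, b x * θ x| ≤ M * S := by
      rw [← norm_eq_abs]
      calc ‖∫ x, b x * θ x‖ ≤ ∫ x, M * S * mol n r (x - y) := by
            refine norm_integral_le_of_norm_le (((hmol y).integrable _).const_mul _)
              (.of_forall fun x => ?_)
            rw [norm_mul, hθ_def, norm_mul, norm_of_nonneg (mol_nonneg hr _)]
            calc _ ≤ M * (mol n r (x - y) * S) := by
                  have := mol_nonneg hr (x - y); gcongr
                  · exact hM x
                  · exact hS x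
              _ = _ := by ring
        _ = M * S := by
            rw [integral_const_mul, integral_sub_right_eq_self (mol n r), hk.integral_one, mul_one]
    have b2 : |∫ x, (a y - a x) * (ψ x * ∇ (mol n r) (x - y) i)| ≤ L * C * S := by
      have hgi : Integrable fun x => L * r * S * ‖∇ (mol n r) (x - y)‖ :=
        ((hmt.integrable_gradient volume).norm.comp_sub_right y).const_mul _
      rw [← norm_eq_abs]
      calc _ ≤ ∫ x, L * r * S * ‖∇ (mol n r) (x - y)‖ := by
            refine norm_integral_le_of_norm_le hgi (.of_forall fun x => ?_); rw [norm_mul, norm_mul]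
            by_cases hx : x - y ∈ tsupport (mol n r)
            · have h1 : ‖x - y‖ ≤ r := mem_closedBall_zero_iff.1 (tsupport_mol_subset hr hx)
              have h2 : ‖a y - a x‖ ≤ L * r := by
                have := ha.dist_le_mul y x; rw [dist_eq_norm, dist_comm, dist_eq_norm] at this
                exact this.trans (mul_le_mul_of_nonneg_left h1 L.2)
              calc _ ≤ L * r * (S * ‖∇ (mol n r) (x - y)‖) := by
                    gcongr
                    · exact hS x
                    · exact abs_coord_le _ _
                _ = _ := by ring
            · rw [gradient_eq_zero hx]; simp
        _ = L * r * S * ∫ x, ‖∇ (mol n r) x‖ := by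
            rw [integral_const_mul, integral_sub_right_eq_self (fun x => ‖∇ (mol n r) x‖)]
        _ ≤ L * r * S * (C / r) := by gcongr
        _ = L * C * S := by field_simp
    rw [e2]
    calc _ ≤ M * S + L * C * S := (abs_sub _ _).trans (add_le_add b1 b2)
      _ = _ := by ring
  have e0 : commPairing a i r V ψ = ∫ y, V y * ∫ x, mol n r (x - y) * (a y - a x) * ∇ ψ x i := by
    have h1 : ∀ x, (cv (mol n r) (fun y => a y * V y) x - a x * cv (mol n r) V x) * ∇ ψ x i
        = ∫ y, V y * (mol n r (x - y) * (a y - a x) * ∇ ψ x i) := fun x => by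
      rw [cv_apply_swap, cv_apply_swap, ← integral_const_mul, ← integral_sub
        (hk.integrable_smul haV.integrableOn) ((hk.integrable_smul hV.integrableOn).const_mul _),
        ← integral_mul_const]
      refine integral_congr_fun fun y => ?_; simp only [smul_eq_mul]; ring
    simp only [commPairing, h1, ← integral_const_mul]; refine integral_integral_swap ?_
    have h2 : Integrable (fun p : Eu n × Eu n => V p.2 * mol n r (p.1 - p.2))
        (volume.prod volume) := by
      refine (Integrable.convolution_integrand (μ := volume) (ν := volume)
        (ContinuousLinearMap.mul ℝ ℝ) hV hk.integrable).congr (.of_forall fun p => ?_)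
      simp only [ContinuousLinearMap.mul_apply']
    have h3 : Integrable (fun p : Eu n × Eu n => (V p.2 * mol n r (p.1 - p.2))
        * ((a p.2 - a p.1) * ∇ ψ p.1 i)) (volume.prod volume) := by
      refine h2.mul_bdd (c := (B + B) * D) ?_ (.of_forall fun p => ?_)
      · exact (((hac.comp continuous_snd).sub (hac.comp continuous_fst)).mul
          (hpc.comp continuous_fst)).aestronglyMeasurable
      · rw [norm_mul]
        refine mul_le_mul ((norm_sub_le _ _).trans (add_le_add (hB _) (hB _)))
          ((abs_coord_le _ _).trans (hD _)) (norm_nonneg _) ?_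
        have := (abs_nonneg _).trans (hB 0); positivity
    refine h3.congr (.of_forall fun p => ?_); simp only [Function.uncurry]; ring
  rw [e0, ← norm_eq_abs]
  calc _ ≤ ∫ y, (M + L * C) * S * |V y| := by
        refine norm_integral_le_of_norm_le (hV.abs.const_mul _) (.of_forall fun y => ?_)
        rw [norm_mul, mul_comm]; exact mul_le_mul_of_nonneg_right (hin y) (norm_nonneg _)
    _ = _ := integral_const_mul _ _

lemma IsKernel.partial_cv (hk : IsKernel κ r) {θ : Eu n → ℝ} (hθ : IsTestFunction Ω θ) (x : Eu n) (i
    : Fin n) : ∇ (cv κ θ) x i = cv κ (fun y => ∇ θ y i) x := by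
  rw [hk.gradient_cv hθ, hk.cv_coord hθ.continuous_gradient.locallyIntegrable]

/-- For smooth V both terms of the commutator can be differentiated, and each derivative converges
to that of aV. This is convergence on a dense class, to be combined with the uniform bound. -/
lemma commPairing_eq_of_test (hac : Continuous a) (hB : ∀ x, |a x| ≤ B) (hbm : Measurable b) (hM : ∀
    x, |b x| ≤ M) (hab : HasWeakPartial a b i) (hr : 0 < r) {V : Eu n → ℝ} (hV : IsTestFunction univ
    V) (hψ : IsTestFunction univ ψ) : commPairing a i r V ψ = -∫ x, (cv (mol n r) (fun y => b y * V
    y + a y * ∇ V y i) x - (b x * cv (mol n r) V x + a x * cv (mol n r) (fun y => ∇ V y i) x)) * ψ x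
    := by
  have hk := isKernel_mol (n := n) hr
  have hcvV : IsTestFunction univ (cv (mol n r) V) := hk.isTestFunction_cv hV (subset_univ _)
  have hcvψ : IsTestFunction univ (cv (mol n r) ψ) := hk.isTestFunction_cv hψ (subset_univ _)
  obtain ⟨D, hD⟩ := hψ.gradient_bounded; obtain ⟨S, hS⟩ := hψ.bounded
  have hVi := hV.integrable volume; have hVpi := (hV.integrable_gradient volume).coord i
  have haV : Integrable fun y => a y * V y := integrable_bdd_mul hac.measurable hB hVi
  have hbV : Integrable fun y => b y * V y := integrable_bdd_mul hbm hM hVi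
  have haVp : Integrable fun y => a y * ∇ V y i := integrable_bdd_mul hac.measurable hB hVpi
  have hsum : Integrable fun y => b y * V y + a y * ∇ V y i := hbV.add haVp
  have mul_int : ∀ {f : Eu n → ℝ} {φ : Eu n → ℝ}, Integrable f → IsTestFunction univ φ →
      Integrable fun x => f x * φ x := fun {f φ} hf hφ => by
    obtain ⟨C, hC⟩ := hφ.bounded
    exact hf.mul_bdd hφ.continuous.aesm (.of_forall hC)
  have mul_int' : ∀ {f : Eu n → ℝ} {φ : Eu n → ℝ}, Integrable f → IsTestFunction univ φ →
      Integrable fun x => f x * ∇ φ x i := fun {f φ} hf hφ => by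
    obtain ⟨C, hC⟩ := hφ.gradient_bounded
    exact hf.mul_bdd (hφ.continuous_partial i).aesm
      (.of_forall fun x => (abs_coord_le _ _).trans (hC x))
  have cvi : ∀ {f : Eu n → ℝ}, Integrable f → Integrable (cv (mol n r) f) := fun hf =>
    hk.integrable_cv hf
  have j1 := mul_int' (integrable_bdd_mul hac.measurable hB (cvi hVi)) hψ
  have j2 := mul_int (integrable_bdd_mul hac.measurable hB (cvi hVpi)) hψ
  have j3 := mul_int (integrable_bdd_mul hbm hM (cvi hVi)) hψ
  have T1 : ∫ x, cv (mol n r) (fun y => a y * V y) x * ∇ ψ x i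
      = -∫ x, cv (mol n r) (fun y => b y * V y + a y * ∇ V y i) x * ψ x := by
    rw [integral_cv_mul hr haV (hψ.continuous_partial i) (fun x => (abs_coord_le _ _).trans (hD x)),
      integral_cv_mul hr hsum hψ.continuous hS]
    have h1 := hab _ (hcvψ.mul_left hV.smooth)
    have e1 : ∀ x, a x * ∇ (fun y => V y * cv (mol n r) ψ y) x i
        = a x * V x * cv (mol n r) (fun y => ∇ ψ y i) x
          + a x * ∇ V x i * cv (mol n r) ψ x := fun x => by
      rw [gradient_mul_coord (hV.differentiable x) (hcvψ.differentiable x), hk.partial_cv hψ]; ring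
    simp only [e1] at h1
    have i1 : Integrable fun x => a x * V x * cv (mol n r) (fun y => ∇ ψ y i) x := by
      have := mul_int' haV hcvψ; simpa only [hk.partial_cv hψ] using this
    rw [integral_add i1 (mul_int haVp hcvψ)] at h1
    have h2 : ∫ x, (b x * V x + a x * ∇ V x i) * cv (mol n r) ψ x
        = (∫ x, b x * (V x * cv (mol n r) ψ x)) + ∫ x, a x * ∇ V x i * cv (mol n r) ψ x := by
      rw [← integral_add _ (mul_int haVp hcvψ)]
      · refine integral_congr_fun fun x => ?_; simp only; ring
      · simpa only [mul_assoc] using mul_int hbV hcvψ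
    rw [h2]; linarith
  have T2 : ∫ x, a x * cv (mol n r) V x * ∇ ψ x i
      = -∫ x, (b x * cv (mol n r) V x + a x * cv (mol n r) (fun y => ∇ V y i) x) * ψ x := by
    have h1 := hab _ (hψ.mul_left hcvV.smooth)
    have e1 : ∀ x, a x * ∇ (fun y => cv (mol n r) V y * ψ y) x i = a x * cv (mol n r) V x * ∇ ψ x i
          + a x * cv (mol n r) (fun y => ∇ V y i) x * ψ x := fun x => by
      rw [gradient_mul_coord (hcvV.differentiable x) (hψ.differentiable x), hk.partial_cv hV]; ring
    simp only [e1] at h1; rw [integral_add j1 j2] at h1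
    have h2 : ∫ x, (b x * cv (mol n r) V x + a x * cv (mol n r) (fun y => ∇ V y i) x) * ψ x
        = (∫ x, b x * (cv (mol n r) V x * ψ x))
          + ∫ x, a x * cv (mol n r) (fun y => ∇ V y i) x * ψ x := by
      simp only [← mul_assoc]; rw [← integral_add j3 j2]; refine integral_congr_fun fun x => ?_
      simp only; ring
    rw [h2]; linarith
  have k1 := mul_int' (cvi haV) hψ; have k3 := mul_int (cvi hsum) hψ
  have k4 := (j3.add j2).congr (.of_forall fun x => (add_mul (b x * cv (mol n r) V x) _ _).symm)
  calc commPairing a i r V ψ = ∫ x, (cv (mol n r) (fun y => a y * V y) x * ∇ ψ x i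
        - a x * cv (mol n r) V x * ∇ ψ x i) :=
        integral_congr_ae (.of_forall fun x => sub_mul _ _ _)
    _ = (-∫ x, cv (mol n r) (fun y => b y * V y + a y * ∇ V y i) x * ψ x)
        - -∫ x, (b x * cv (mol n r) V x + a x * cv (mol n r) (fun y => ∇ V y i) x) * ψ x := by
        rw [integral_sub k1 j1, T1, T2]
    _ = _ := by
        rw [← neg_sub', ← integral_sub _ k4]
        · congr 1; exact integral_congr_ae (.of_forall fun x => (sub_mul _ _ _).symm)
        · exact k3

/-- Friedrichs' lemma: the commutator of mollification with a Lipschitz coefficient. -/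
lemma tendsto_commPairing {L : ℝ≥0} (ha : LipschitzWith L a) (hB : ∀ x, |a x| ≤ B) {V : Eu n → ℝ}
    (hV : Integrable V) (hK : IsCompact K) (hVK : ∀ x, x ∉ K → V x = 0) {r : ℕ → ℝ} (hr0 : ∀ m, 0 <
    r m) (hr : Tendsto r atTop (𝓝 0)) {ψ : ℕ → Eu n → ℝ} (hψ : ∀ m, IsTestFunction univ (ψ m)) {S :
    ℝ} (hS : ∀ m x, |ψ m x| ≤ S) (i : Fin n) : Tendsto (fun m => commPairing a i (r m) V (ψ m))
    atTop (𝓝 0) := by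
  obtain ⟨b, hbm, hM, hab⟩ := ha.exists_hasWeakPartial i
  obtain ⟨C, hC0, hC⟩ := exists_integral_gradient_mol_le n; have hac := ha.continuous
  set R : ℝ := (L + L * C) * S with hR
  have toR : ∀ {f : Eu n → ℝ}, Integrable f → ∫ y, |f y| = (eLpNorm f 1 volume).toReal :=
    fun {f} hf => by
      rw [eLpNorm_one_eq_lintegral_enorm]; exact integral_norm_eq_lintegral_enorm hf.1
  rw [Metric.tendsto_atTop']; intro ε hε
  -- V is replaced by one of its own mollifications W at a fixed scale s; the uniform bound makes
  -- the error at most ε/2 for every m.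
  obtain ⟨s, hs0, hsε⟩ : ∃ s : ℝ, 0 < s ∧ R * ∫ y, |V y - cv (mol n s) V y| < ε / 2 := by
    have h1 := tendsto_eLpNorm_cv_sub (fun m => isKernel_mol (hr0 m)) hr le_rfl (by norm_num)
      (memLp_one_iff_integrable.2 hV)
    have h2 : Tendsto (fun m => R * (eLpNorm (fun x => cv (mol n (r m)) V x - V x) 1
        volume).toReal) atTop (𝓝 (R * (0 : ℝ≥0∞).toReal)) :=
      ((tendsto_toReal zero_ne_top).comp h1).const_mul _
    rw [toReal_zero, mul_zero] at h2
    obtain ⟨m, hm⟩ := (h2.eventually (gt_mem_nhds (half_pos hε))).exists; refine ⟨r m, hr0 m, ?_⟩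
    have hi : Integrable fun x => cv (mol n (r m)) V x - V x :=
      ((isKernel_mol (hr0 m)).integrable_cv hV).sub hV
    simp only [abs_sub_comm (V _)]; rwa [toR hi]
  set W := cv (mol n s) V with hW_def
  have hW : IsTestFunction univ W := by
    have hsub : tsupport W ⊆ cthickening s K :=
      closure_minimal ((isKernel_mol hs0).support_cv_subset hVK) isClosed_cthickening
    exact ⟨contDiff_cv_mol hs0 hV, hK.cthickening.of_isClosed_subset (isClosed_tsupport _) hsub,
      subset_univ _⟩
  have hWi := hW.integrable volume; have hWpi := (hW.integrable_gradient volume).coord i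
  have hbW : Integrable fun y => b y * W y := integrable_bdd_mul hbm hM hWi
  have haWp : Integrable fun y => a y * ∇ W y i := integrable_bdd_mul hac.measurable hB hWpi
  have hsum : Integrable fun y => b y * W y + a y * ∇ W y i := hbW.add haWp
  have cvi : ∀ m {f : Eu n → ℝ}, Integrable f → Integrable (cv (mol n (r m)) f) := fun m {f} hf =>
    (isKernel_mol (hr0 m)).integrable_cv hf
  -- The derivative of the commutator for the smooth W; it tends to 0 in L¹, while the functions ψ m
  -- stay bounded.
  set Z : ℕ → Eu n → ℝ := fun m x => cv (mol n (r m)) (fun y => b y * W y + a y * ∇ W y i) x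
      - (b x * cv (mol n (r m)) W x + a x * cv (mol n (r m)) (fun y => ∇ W y i) x) with hZ
  have hZi : ∀ m, Integrable (Z m) := fun m => (cvi m hsum).sub
    ((integrable_bdd_mul hbm hM (cvi m hWi)).add
      (integrable_bdd_mul hac.measurable hB (cvi m hWpi)))
  have hZlim : Tendsto (fun m => ∫ x, |Z m x|) atTop (𝓝 0) := by
    have cvt : ∀ {f : Eu n → ℝ}, Integrable f →
        Tendsto (fun m => ∫ x, |cv (mol n (r m)) f x - f x|) atTop (𝓝 0) := by
      intro f hf
      have h1 := tendsto_eLpNorm_cv_sub (fun m => isKernel_mol (hr0 m)) hr le_rfl (by norm_num)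
        (memLp_one_iff_integrable.2 hf)
      have h2 := (tendsto_toReal zero_ne_top).comp h1; rw [toReal_zero] at h2
      exact h2.congr fun m => (toR ((cvi m hf).sub hf)).symm
    have hlim := ((cvt hsum).add ((cvt hWi).const_mul (L : ℝ))).add ((cvt hWpi).const_mul B)
    rw [mul_zero, mul_zero, add_zero, add_zero] at hlim
    refine squeeze_zero (fun m => integral_nonneg fun x => abs_nonneg _) (fun m => ?_) hlim
    have j : ∀ (c : ℝ) {f : Eu n → ℝ}, Integrable f →
        Integrable fun x => c * |cv (mol n (r m)) f x - f x| :=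
      fun c _ hf => ((cvi m hf).sub hf).abs.const_mul c
    have j1 := j 1 hsum; simp only [one_mul] at j1; have j12 := j1.add (j L hWi)
    simp only [Pi.add_def] at j12
    rw [← integral_const_mul, ← integral_const_mul, ← integral_add j1 (j L hWi),
      ← integral_add j12 (j B hWpi)]
    refine integral_mono (hZi m).abs (j12.add (j B hWpi)) fun x => ?_; simp only
    have e1 : Z m x = (cv (mol n (r m)) (fun y => b y * W y + a y * ∇ W y i) x
        - (b x * W x + a x * ∇ W x i)) - b x * (cv (mol n (r m)) W x - W x)
        - a x * (cv (mol n (r m)) (fun y => ∇ W y i) x - ∇ W x i) := by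
      simp only [hZ]; ring
    rw [e1]; refine (abs_sub _ _).trans (add_le_add ((abs_sub _ _).trans (add_le_add le_rfl ?_)) ?_)
    · rw [abs_mul]; exact mul_le_mul_of_nonneg_right (hM x) (abs_nonneg _)
    · rw [abs_mul]; exact mul_le_mul_of_nonneg_right (hB x) (abs_nonneg _)
  have hSZ : Tendsto (fun m => S * ∫ x, |Z m x|) atTop (𝓝 0) := by simpa using hZlim.const_mul S
  obtain ⟨N, hN⟩ := eventually_atTop.1 (hSZ.eventually (gt_mem_nhds (half_pos hε)))
  refine ⟨N, fun m hm => ?_⟩; rw [dist_eq, sub_zero]; have hk := isKernel_mol (n := n) (hr0 m)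
  have hVW : Integrable fun y => V y - W y := hV.sub hWi
  have mulint : ∀ {f : Eu n → ℝ}, Integrable f → Integrable fun x => (cv (mol n (r m))
      (fun y => a y * f y) x - a x * cv (mol n (r m)) f x) * ∇ (ψ m) x i := fun {f} hf => by
    obtain ⟨D, hD⟩ := (hψ m).gradient_bounded
    refine Integrable.mul_bdd (c := D) ?_ ((hψ m).continuous_partial i).aesm
      (.of_forall fun x => (abs_coord_le _ _).trans (hD x))
    exact (cvi m (integrable_bdd_mul hac.measurable hB hf)).sub
      (integrable_bdd_mul hac.measurable hB (cvi m hf))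
  have hsplit : commPairing a i (r m) V (ψ m)
      = commPairing a i (r m) (fun y => V y - W y) (ψ m) + commPairing a i (r m) W (ψ m) := by
    simp only [commPairing]; rw [← integral_add (mulint hVW) (mulint hWi)]
    refine integral_congr_fun fun x => ?_; simp only [mul_sub]
    rw [hk.cv_sub (integrable_bdd_mul hac.measurable hB hV).integrableOn
      (integrable_bdd_mul hac.measurable hB hWi).integrableOn,
      hk.cv_sub hV.integrableOn hWi.integrableOn]
    ring
  have b1 := abs_commPairing_le ha hB hbm hM hab (hr0 m) (hC _ (hr0 m)) hVW (hψ m) (hS m)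
  have b2 : |commPairing a i (r m) W (ψ m)| ≤ S * ∫ x, |Z m x| := by
    rw [commPairing_eq_of_test hac hB hbm hM hab (hr0 m) hW (hψ m), abs_neg, ← integral_const_mul]
    rw [← norm_eq_abs]
    refine norm_integral_le_of_norm_le ((hZi m).abs.const_mul _) (.of_forall fun x => ?_)
    rw [norm_mul, mul_comm]; exact mul_le_mul_of_nonneg_right (hS m x) (norm_nonneg _)
  rw [hsplit]
  calc _ ≤ |commPairing a i (r m) (fun y => V y - W y) (ψ m)| + |commPairing a i (r m) W (ψ m)| :=
        abs_add_le _ _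
    _ < ε / 2 + ε / 2 := add_lt_add (b1.trans_lt hsε) (b2.trans_lt (hN m hm.le))
    _ = ε := add_halves ε

end Friedrichs

/-! ### Testing the mollified equation with functions of E. -/

section LipschitzCoefficients

variable {r : ℕ → ℝ}

/-- Since all supports stay in a compact K, the coefficients may be replaced by bounded, globally
Lipschitz functions: extend from K, then truncate. -/
lemma LocallyLipschitzOn.exists_bounded_extension (hf : LocallyLipschitzOn Ω f) (hK : IsCompact K)
    (hKΩ : K ⊆ Ω) : ∃ (L : ℝ≥0) (B : ℝ) (g : Eu n → ℝ), LipschitzWith L g ∧ (∀ x, |g x| ≤ B) ∧ ∀ x ∈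
    K, g x = f x := by
  obtain ⟨L, hL⟩ := LocallyLipschitzOn.exists_lipschitzOnWith_of_compact hK (hf.mono hKΩ)
  obtain ⟨g, hg, hgf⟩ := hL.extend_real
  obtain ⟨C, hC⟩ := hK.exists_bound_of_continuousOn hL.continuousOn
  refine ⟨L, max C 0, _, (hg.min_const (max C 0)).const_max (-max C 0), fun x => ?_, fun x hx => ?_⟩
  · have := le_max_right C 0
    exact abs_le.2 ⟨le_max_left _ _, max_le (by linarith) (min_le_right _ _)⟩
  · have h1 := abs_le.1 ((hC x hx).trans (le_max_left C 0)); rw [hgf hx] at h1 ⊢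
    rw [min_eq_left h1.2, max_eq_right h1.1]

lemma IsKernel.le_cv (h : IsKernel κ s)
    (hf : IntegrableOn f (closedBall x s) volume)
    (hc : ∀ᵐ t, t ∈ closedBall x s → c ≤ f t) : c ≤ cv κ f x := by
  rw [← h.cv_const c x, cv_apply_swap, cv_apply_swap]
  have hconst : IntegrableOn (fun _ : Eu n => c) (closedBall x s) volume :=
    continuousOn_const.integrableOn_compact (isCompact_closedBall _ _)
  refine integral_mono_ae (h.integrable_smul hconst) (h.integrable_smul hf) ?_
  filter_upwards [hc] with t ht
  by_cases hts : t ∈ closedBall x s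
  · exact mul_le_mul_of_nonneg_left (ht hts) (h.nonneg _)
  · rw [h.supp _ (by rw [mem_closedBall, not_le, dist_comm, dist_eq_norm] at hts
                     exact hts)]
    simp

/-- The mollified equation, up to a commutator error. -/
lemma IsPositiveSolution.tendsto_mol_equation (hΩ : IsOpen Ω) (h : IsPositiveSolution Ω A E G μ) (hL
    : ∀ i j, LocallyLipschitzOn Ω (fun x => A x i j)) (hK : IsCompact K) (hKΩ : K ⊆ Ω) {T : Set (Eu
    n)} (hball : ∀ x ∈ T, closedBall x δ ⊆ K) (hr0 : ∀ m, 0 < r m) (hrδ : ∀ m, r m < δ) (hr :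
    Tendsto r atTop (𝓝 0)) {ψ : ℕ → Eu n → ℝ} (hψ : ∀ m, IsTestFunction Ω (ψ m)) (hT : ∀ m, tsupport
    (ψ m) ⊆ T) {S : ℝ} (hS : ∀ m x, |ψ m x| ≤ S) : Tendsto (fun m => (∫ x in Ω, matForm (A x) (cv
    (mol n (r m)) (K.indicator G) x) (∇ (ψ m) x)) - ∫ x in Ω, cv (mol n (r m)) (ψ m) x ∂μ) atTop (𝓝
    0) := by
  choose L B a haL haB haK using fun i j => (hL i j).exists_bounded_extension hK hKΩ
  have hG : Integrable (K.indicator G) := h.weakGrad.locInt_grad.integrable_indicator hKΩ hK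
  set V : Fin n → Eu n → ℝ := fun j x => K.indicator G x j with hV
  have hVi : ∀ j, Integrable (V j) := fun j => hG.coord j
  have hV0 : ∀ j x, x ∉ K → V j x = 0 := fun j x hx => by simp [hV, indicator_of_notMem hx]
  have haV : ∀ i j, Integrable fun y => a i j y * V j y := fun i j =>
    integrable_bdd_mul (haL i j).continuous.measurable (haB i j) (hVi j)
  -- The equation is tested with the mollification of ψ m and the mollifier is moved onto AG. The
  -- difference from the form of A with the mollified G is a sum of commutators, one per matrix
  -- entry.
  have key : ∀ m, (∫ x in Ω, Q[A,cv (mol n (r m)) (K.indicator G),∇ (ψ m)]x) - ∫ x in Ω, cv (mol n (r m)) (ψ m) x ∂μ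
      = ∑ i, ∑ j, -commPairing (a i j) i (r m) (V j) (ψ m) := by
    intro m; have hk := isKernel_mol (n := n) (hr0 m); obtain ⟨D, hD⟩ := (hψ m).gradient_bounded
    have hsub : cthickening (r m) (tsupport (ψ m)) ⊆ K := by
      rw [(hψ m).compactSupport.isCompact.cthickening_eq_biUnion_closedBall (hr0 m).le]
      exact iUnion₂_subset fun x hx =>
        (closedBall_subset_closedBall (hrδ m).le).trans (hball x (hT m hx))
    have hTK : tsupport (ψ m) ⊆ K := (self_subset_cthickening _).trans hsub
    have hcv : IsTestFunction Ω (cv (mol n (r m)) (ψ m)) :=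
      hk.isTestFunction_cv (hψ m) (hsub.trans hKΩ)
    have hcvK : ∀ x, x ∉ K → ∇ (cv (mol n (r m)) (ψ m)) x = 0 := fun x hx => by
      refine gradient_eq_zero fun h' => hx (hsub ?_)
      exact closure_minimal (hk.support_cv_subset fun y hy => eq_zero_of_notMem hy)
        isClosed_cthickening h'
    have mulp : ∀ {f : Eu n → ℝ}, Integrable f → ∀ i, Integrable fun x => f x * ∇ (ψ m) x i :=
      fun {f} hf i => hf.mul_bdd ((hψ m).continuous_partial i).aesm
        (.of_forall fun x => (abs_coord_le _ _).trans (hD x))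
    have cvi : ∀ {f : Eu n → ℝ}, Integrable f → Integrable (cv (mol n (r m)) f) := fun hf =>
      hk.integrable_cv hf
    have iA : ∀ i j, Integrable fun x => a i j x * cv (mol n (r m)) (V j) x
        * ∇ (ψ m) x i := fun i j => mulp (integrable_bdd_mul
      (haL i j).continuous.measurable (haB i j) (cvi (hVi j))) i
    have e1 : ∫ x in Ω, Q[A,cv (mol n (r m)) (K.indicator G),∇ (ψ m)]x
        = ∑ i, ∑ j, ∫ x, a i j x * cv (mol n (r m)) (V j) x * ∇ (ψ m) x i := by
      rw [(hψ m).setIntegral_eq fun x hx => by rw [gradient_eq_zero hx, matForm_zero_right]]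
      simp_rw [← integral_finsetSum _ fun j _ => iA _ j]
      rw [← integral_finsetSum _ fun i _ => integrable_finsetSum _ fun j _ => iA i j]
      refine integral_congr_fun fun x => ?_; simp only [matForm_eq_sum]
      refine Finset.sum_congr rfl fun i _ => Finset.sum_congr rfl fun j _ => ?_
      by_cases hx : x ∈ tsupport (ψ m)
      · rw [haK i j x (hTK hx), hk.cv_coord hG.locallyIntegrable]
      · simp [gradient_eq_zero hx]
    have iB : ∀ i j, Integrable fun x => a i j x * V j x
        * cv (mol n (r m)) (fun y => ∇ (ψ m) y i) x := fun i j => by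
      obtain ⟨D', hD'⟩ := hcv.gradient_bounded
      have := (haV i j).mul_bdd (hcv.continuous_partial i).aesm
        (.of_forall fun x => (abs_coord_le _ _).trans (hD' x))
      simpa only [hk.partial_cv (hψ m)] using this
    have e2 : ∫ x in Ω, cv (mol n (r m)) (ψ m) x ∂μ
        = ∑ i, ∑ j, ∫ x, cv (mol n (r m)) (fun y => a i j y * V j y) x * ∇ (ψ m) x i := by
      rw [← h.equation _ hcv, hcv.setIntegral_eq fun x hx => by
        rw [gradient_eq_zero hx, matForm_zero_right]]
      simp_rw [integral_cv_mul (hr0 m) (haV _ _) ((hψ m).continuous_partial _)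
        fun x => (abs_coord_le _ _).trans (hD x)]
      simp_rw [← integral_finsetSum _ fun j _ => iB _ j]
      rw [← integral_finsetSum _ fun i _ => integrable_finsetSum _ fun j _ => iB i j]
      refine integral_congr_fun fun x => ?_; simp only [matForm_eq_sum]
      refine Finset.sum_congr rfl fun i _ => Finset.sum_congr rfl fun j _ => ?_
      rw [← hk.partial_cv (hψ m)]
      by_cases hx : x ∈ K
      · rw [haK i j x hx]; simp only [hV, indicator_of_mem hx]
      · simp [hcvK x hx]
    rw [e1, e2, ← Finset.sum_sub_distrib]; refine Finset.sum_congr rfl fun i _ => ?_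
    rw [← Finset.sum_sub_distrib]; refine Finset.sum_congr rfl fun j _ => ?_
    rw [← integral_sub (iA i j) (mulp (cvi (haV i j)) i), commPairing, ← integral_neg]
    refine integral_congr_fun fun x => ?_; simp only; ring
  simp only [key]
  have : Tendsto (fun m => ∑ i, ∑ j, -commPairing (a i j) i (r m) (V j) (ψ m)) atTop
      (𝓝 (∑ _i : Fin n, ∑ _j : Fin n, -0)) :=
    tendsto_finsetSum _ fun i _ => tendsto_finsetSum _ fun j _ =>
      (tendsto_commPairing (haL i j) (haB i j) (hVi j) hK (hV0 j) hr0 hr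
        (fun m => (hψ m).mono_univ) hS i).neg
  simpa using this

/-- `h ∘ E`, with the value `L` where `E` is infinite. -/
noncomputable def compTop (h : ℝ → ℝ) (L : ℝ) (t : ℝ≥0∞) : ℝ := if t = ⊤ then L else h t.toReal

/-- The convergence is needed at every point, because μ may be singular. Where E is finite the point
is a Lebesgue point. Where E = ∞, lower semicontinuity makes the mollified values uniformly large
nearby, and h is close to its limit L there. -/
lemma IsPositiveSolution.eventually_comp_cv_mol_sub_le (hΩ : IsOpen Ω) (hE : IsPositiveSolution Ω A
    E G μ) (hK : IsCompact K) (hKΩ : K ⊆ Ω) (hδ : 0 < δ) (hball : closedBall x δ ⊆ K) {h : ℝ → ℝ}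
    (hh : Continuous h) (hL : Tendsto h atTop (𝓝 L)) (hε : 0 < ε) : ∀ᶠ s in 𝓝[>] (0 : ℝ), ∀ t ∈
    closedBall x s, |h (cv (mol n s) (K.indicator fun y => E§y) t) - compTop h L (E x)| ≤ ε := by
  have hxΩ : x ∈ Ω := hKΩ (hball (mem_closedBall_self hδ.le))
  have hei : Integrable (K.indicator fun y => E§y) := hE.weakGrad.locInt.integrable_indicator hKΩ hK
  have hfin : ∀ᵐ y, y ∈ Ω → E y < ⊤ := (ae_restrict_iff' hΩ.measurableSet).1 hE.finite_ae
  by_cases hx : E x = ⊤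
  · simp only [compTop, hx, if_true]
    obtain ⟨N, hN⟩ := eventually_atTop.1 (Metric.tendsto_nhds.1 hL ε hε)
    have h1 : ∀ᶠ y in 𝓝 x, ofReal N < E y := by
      have := hE.lsc x hxΩ (ofReal N) (by simp [hx])
      rwa [hΩ.nhdsWithin_eq hxΩ] at this
    obtain ⟨η, hη, hηN⟩ := eventually_nhds_iff_ball.1 h1
    filter_upwards [self_mem_nhdsWithin, nhdsWithin_le_nhds (gt_mem_nhds (half_pos hη)),
      nhdsWithin_le_nhds (gt_mem_nhds (half_pos hδ))] with s hs0 hs1 hs2 t ht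
    refine (hN _ ((isKernel_mol hs0).le_cv hei.integrableOn ?_)).le
    filter_upwards [hfin] with y hy hyt
    have hyx : dist y x ≤ s + s := (dist_triangle y t x).trans (add_le_add hyt ht)
    have hyK : y ∈ K := hball (hyx.trans (by linarith))
    rw [indicator_of_mem hyK]
    exact (ofReal_le_iff_le_toReal (hy (hKΩ hyK)).ne).1 (hηN y (mem_ball.2 (by linarith))).le
  · simp only [compTop, hx, if_false]
    obtain ⟨η, hη, hηh⟩ := continuousAt_iff.1 (hh.continuousAt (x := E§x)) ε hε
    have h1 := tendsto_laverage_sub hΩ hE.finite_ae hE.lsc hxΩ (Ne.lt_top hx) (hE.precise x hxΩ)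
      (hE.aemeasurable hΩ volume)
    have h2 : Tendsto (fun s : ℝ => ⨍⁻ y in ball x s,
        ‖K.indicator (fun y => E§y) y - E§x‖ₑ ∂volume) (𝓝[>] 0) (𝓝 0) := by
      refine h1.congr' ?_; filter_upwards [nhdsWithin_le_nhds (gt_mem_nhds hδ)] with s hs
      rw [setLAverage_eq, setLAverage_eq]; congr 1
      refine setLIntegral_congr_fun measurableSet_ball fun y hy => ?_
      rw [indicator_of_mem (hball (ball_subset_closedBall (ball_subset_ball hs.le hy)))]
    filter_upwards [eventually_cv_mol_sub_le hei h2 (half_pos hη)] with s hs t ht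
    exact (hηh ((hs t ht).trans_lt (half_lt_self hη))).le

/-- Testing the equation with `ψ h(E)` for `h` nondecreasing and bounded. -/
lemma IsPositiveSolution.integrable_comp_and_le [IsFiniteMeasure μ] (hΩ : IsOpen Ω) (hA :
    IsUniformlyElliptic Ω A) (hE : IsPositiveSolution Ω A E G μ) (hLip : ∀ i j, LocallyLipschitzOn Ω
    (fun x => A x i j)) (hψ : IsTestFunction Ω ψ) (hψ0 : ∀ x, 0 ≤ ψ x) (hδ : 0 < δ) (hK : IsCompact
    K) (hKΩ : K ⊆ Ω) (hψK : tsupport ψ ⊆ K) (hball : ∀ x ∈ tsupport ψ, closedBall x δ ⊆ K) (hc : ∀ x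
    ∈ K, E x < ⊤ → c ≤ E§x) {h : ℝ → ℝ} (hh : ContDiff ℝ ∞ h) (hB : ∀ t, |h t| ≤ B) (hd : ∀ t, c ≤ t
    → 0 ≤ deriv h t) (hL : Tendsto h atTop (𝓝 L)) : Integrable (fun x => ψ x * deriv h (E x).toReal
    * Q[A,G,G]x) vol[Ω] ∧ (∫ x in Ω, ψ x * deriv h E§x * Q[A,G,G]x) + ∫ x in Ω, h E§x * Q[A,G,∇ ψ]x
    ≤ ∫ x in Ω, ψ x * compTop h L (E x) ∂μ := by
  have hfin : ∀ᵐ y, y ∈ Ω → E y < ⊤ := (ae_restrict_iff' hΩ.measurableSet).1 hE.finite_ae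
  have hB0 : 0 ≤ B := (abs_nonneg _).trans (hB 0)
  have hei : Integrable (K.indicator fun y => E§y) := hE.weakGrad.locInt.integrable_indicator hKΩ hK
  have hGi : Integrable (K.indicator G) := hE.weakGrad.locInt_grad.integrable_indicator hKΩ hK
  obtain ⟨s, hs0, hsδ, hs, haes⟩ := exists_mol_seq hei hδ
  have hG1 := tendsto_eLpNorm_cv_sub (fun m => isKernel_mol (n := n) (hs0 m)) hs le_rfl
    (by norm_num) (memLp_one_iff_integrable.2 hGi)
  -- A further subsequence makes the mollified gradients converge almost everywhere as well, as
  -- Fatou requires for the quadratic term.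
  obtain ⟨ns, hns, haeG⟩ := exists_subseq_ae_of_eLpNorm one_ne_zero
    (fun m => ((isKernel_mol (hs0 m)).aestronglyMeasurable_cv hGi.1)) hGi.1 hG1
  replace hG1 := hG1.comp hns.tendsto_atTop; set r : ℕ → ℝ := fun m => s (ns m) with hr_def
  have hr0 : ∀ m, 0 < r m := fun m => hs0 _; have hrδ : ∀ m, r m < δ := fun m => hsδ _
  have hr : Tendsto r atTop (𝓝 0) := hs.comp hns.tendsto_atTop
  have hk := fun m => isKernel_mol (n := n) (hr0 m)
  set e : ℕ → Eu n → ℝ := fun m => cv (mol n (r m)) (K.indicator fun y => E§y) with he_def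
  set g : ℕ → Eu n → Eu n := fun m => cv (mol n (r m)) (K.indicator G) with hg_def
  have hae : ∀ᵐ x, Tendsto (fun m => e m x) atTop (𝓝 (K.indicator (fun y => E§y) x)) := by
    filter_upwards [haes] with x hx using hx.comp hns.tendsto_atTop
  have hec : ∀ m, ContDiff ℝ ∞ (e m) := fun m => contDiff_cv_mol (hr0 m) hei
  have hgi : ∀ m, Integrable (g m) := fun m =>
    (hk m).integrable_cv hGi
  have hge : ∀ m, ∀ x ∈ tsupport ψ, ∇ (e m) x = g m x := fun m x hx =>
    hE.weakGrad.gradient_cv (hr0 m) hK hKΩ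
      ((closedBall_subset_closedBall (hrδ m).le).trans (hball x hx))
  have hce : ∀ m, ∀ x ∈ tsupport ψ, c ≤ e m x := fun m x hx => by
    refine (hk m).le_cv hei.integrableOn ?_; filter_upwards [hfin] with y hy hyx
    have hyK := hball x hx (closedBall_subset_closedBall (hrδ m).le hyx); rw [indicator_of_mem hyK]
    exact hc y hyK (hy (hKΩ hyK))
  obtain ⟨C, hC⟩ := hψ.bounded; obtain ⟨D, hD⟩ := hψ.gradient_bounded
  have hψ0' : ∀ x, x ∉ tsupport ψ → ψ x = 0 := fun x hx => eq_zero_of_notMem hx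
  have hgψ0 : ∀ x, x ∉ tsupport ψ → ∇ ψ x = 0 := fun x hx =>
    gradient_eq_zero hx
  -- The test function uses the mollified E itself, so its gradient produces the nonnegative term ψ
  -- h'(e m)|g m|². The functions Ψ m are bounded uniformly although their gradients are not, which
  -- is what the commutator lemma allows.
  set Ψ : ℕ → Eu n → ℝ := fun m x => ψ x * h (e m x) with hΨ
  have hΨt : ∀ m, IsTestFunction Ω (Ψ m) := fun m => hψ.mul_right (hh.comp (hec m))
  have hΨB : ∀ m x, |Ψ m x| ≤ C * B := fun m x => by
    rw [hΨ, abs_mul]; exact mul_le_mul (hC x) (hB _) (abs_nonneg _) ((abs_nonneg _).trans (hC x))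
  have hΨs : ∀ m, tsupport (Ψ m) ⊆ tsupport ψ := fun m => tsupport_mul_subset_left
  have hΨg : ∀ m x, Q[A,g m,∇ (Ψ m)]x = ψ x * deriv h (e m x) * Q[A,g m,g m]x
        + h (e m x) * Q[A,g m,∇ ψ]x := fun m x => by
    have hhd : Differentiable ℝ h := hh.differentiable (by simp)
    have hed : Differentiable ℝ (e m) := (hec m).differentiable (by simp)
    have h1 : DifferentiableAt ℝ (fun y => h (e m y)) x := (hhd.comp hed) x; simp only [hΨ]
    rw [gradient_fun_mul (hψ.differentiable x) h1, gradient_scomp (hhd _) (hed x)]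
    by_cases hx : x ∈ tsupport ψ
    · rw [hge m x hx, matForm_add_right, matForm_smul_right, matForm_smul_right, matForm_smul_right]
      ring
    · simp [hψ0' x hx, hgψ0 x hx, matForm_zero_right]
  have hhe : ∀ m, Continuous fun x => h (e m x) := fun m => hh.continuous.comp (hec m).continuous
  have cross : ∀ {b : Eu n → ℝ} {Q : Eu n → Eu n} {θ : Eu n → ℝ} {B' : ℝ},
      LocallyIntegrableOn Q Ω volume → AEStronglyMeasurable b vol[Ω] →
      (∀ x, |b x| ≤ B') → IsTestFunction Ω θ →
      Integrable (fun x => b x * Q[A,Q,∇ θ]x) vol[Ω] :=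
    fun hQ hb hb' hθ => hθ.integrable_mul_matForm hΩ hA hQ hb hb'
  have hgl : ∀ m, LocallyIntegrableOn (g m) Ω volume := fun m =>
    (hgi m).locallyIntegrable.locallyIntegrableOn Ω
  have iT : ∀ m, Integrable (fun x => h (e m x) * Q[A,g m,∇ ψ]x) vol[Ω] := fun m =>
    cross (hgl m) (hhe m).aestronglyMeasurable (fun x => hB _) hψ
  have iP : ∀ m, Integrable (fun x => ψ x * deriv h (e m x) * Q[A,g m,g m]x) vol[Ω] := fun m => by
    have := (cross (b := fun _ => 1) (B' := 1) (hgl m) aestronglyMeasurable_const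
      (fun _ => by simp) (hΨt m)).sub (iT m)
    refine this.congr (.of_forall fun x => ?_); simp only [Pi.sub_apply, one_mul, hΨg]; ring
  obtain ⟨lam, Lam, hl, hLam, hb'⟩ := hA.exists_bounds
  have T1 : Tendsto (fun m => ∫ x in Ω, h (e m x) * Q[A,g m,∇ ψ]x) atTop
      (𝓝 (∫ x in Ω, h E§x * Q[A,G,∇ ψ]x)) := by
    have hGl := hE.weakGrad.locInt_grad
    have a1 : Tendsto (fun m => ∫ x in Ω, h (e m x) * Q[A,G,∇ ψ]x) atTop
        (𝓝 (∫ x in Ω, h E§x * Q[A,G,∇ ψ]x)) := by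
      refine tendsto_integral_of_dominated_convergence (fun x => ‖(fun _ => B) x * Q[A,G,∇ ψ]x‖)
        (fun m => (cross hGl (hhe m).aestronglyMeasurable (fun x => hB _) hψ).1)
        (cross hGl aestronglyMeasurable_const (fun _ => (abs_of_nonneg hB0).le) hψ).norm
        (fun m => .of_forall fun x => ?_) ?_
      · rw [norm_mul, norm_mul, norm_of_nonneg hB0]
        exact mul_le_mul_of_nonneg_right (hB _) (norm_nonneg _)
      · filter_upwards [ae_restrict_of_ae hae] with x hx
        by_cases hxs : x ∈ tsupport ψ
        · rw [indicator_of_mem (hψK hxs)] at hx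
          exact ((hh.continuous.tendsto _).comp hx).mul_const _
        · simp [hgψ0 x hxs, matForm_zero_right]
    have a2 : Tendsto (fun m => ∫ x in Ω,
        h (e m x) * matForm (A x) (g m x - K.indicator G x) (∇ ψ x)) atTop (𝓝 0) := by
      have hD0 : 0 ≤ D := (norm_nonneg _).trans (hD 0)
      have a3 : Tendsto (fun m => B * Lam * D * (eLpNorm (fun x => g m x - K.indicator G x) 1
          volume).toReal) atTop (𝓝 0) := by
        have := (tendsto_toReal zero_ne_top).comp hG1; simpa using this.const_mul (B * Lam * D)
      refine squeeze_zero_norm (fun m => ?_) a3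
      have hdi : Integrable fun x => g m x - K.indicator G x := (hgi m).sub hGi
      rw [eLpNorm_one_eq_lintegral_enorm, ← integral_norm_eq_lintegral_enorm hdi.1,
        ← integral_const_mul]
      refine (norm_integral_le_of_norm_le (hdi.norm.const_mul (B * Lam * D)).restrict ?_).trans
        (setIntegral_le_integral (hdi.norm.const_mul _) (.of_forall fun x => ?_))
      · filter_upwards [hΩ.ae_mem] with x hx; rw [norm_mul]
        calc _ ≤ B * (Lam * ‖g m x - K.indicator G x‖ * D) := by
              refine mul_le_mul (hB _) (((hb' x hx).2 _ _).trans ?_) (norm_nonneg _) hB0; gcongr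
              exact hD x
          _ = _ := by ring
      · simp only [Pi.zero_apply]; positivity
    have a4 := a1.add a2; rw [add_zero] at a4; refine a4.congr fun m => ?_
    have i1 := cross hGl (hhe m).aestronglyMeasurable (fun x => hB _) hψ
    have i2 : Integrable (fun x => h (e m x) * matForm (A x) (g m x - K.indicator G x)
        (∇ ψ x)) vol[Ω] :=
      cross ((hgi m).sub hGi |>.locallyIntegrable.locallyIntegrableOn Ω)
        (hhe m).aestronglyMeasurable (fun x => hB _) hψ
    rw [← integral_add i1 i2]; refine integral_congr_fun fun x => ?_
    by_cases hxs : x ∈ tsupport ψ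
    · rw [indicator_of_mem (hψK hxs), matForm_sub_left]; ring
    · simp [hgψ0 x hxs, matForm_zero_right]
  have T2 : Tendsto (fun m => ∫ x in Ω, cv (mol n (r m)) (Ψ m) x ∂μ) atTop
      (𝓝 (∫ x in Ω, ψ x * compTop h L (E x) ∂μ)) := by
    have hcont : ∀ m, Continuous (cv (mol n (r m)) (Ψ m)) := fun m =>
      ((hk m).contDiff_cv (hΨt m)).continuous
    refine tendsto_integral_of_dominated_convergence (fun _ => C * B)
      (fun m => (hcont m).aestronglyMeasurable) (integrable_const _)
      (fun m => .of_forall fun x => ?_) ?_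
    · rw [← sub_zero (cv _ _ x)]
      refine (hk m).norm_cv_sub_le (((hΨt m).integrable volume).integrableOn) fun t _ => ?_
      rw [sub_zero]; exact hΨB m t
    filter_upwards [hΩ.ae_mem] with x hxΩ; rw [Metric.tendsto_atTop']; intro ε hε
    have hC0 : 0 ≤ C := (abs_nonneg _).trans (hC 0)
    have hr' : Tendsto r atTop (𝓝[>] 0) := tendsto_nhdsWithin_iff.2 ⟨hr, .of_forall hr0⟩
    have hev : ∀ᶠ s in 𝓝[>] (0 : ℝ), ∀ t ∈ closedBall x s,
        |ψ t - ψ x| ≤ ε / (4 * (B + 1)) := by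
      have h1 := continuousAt_iff.1 (hψ.continuous.continuousAt (x := x))
        (ε / (4 * (B + 1))) (by positivity)
      obtain ⟨η, hη, h2⟩ := h1; filter_upwards [nhdsWithin_le_nhds (gt_mem_nhds hη)] with s hs t ht
      exact (h2 (lt_of_le_of_lt ht hs)).le
    have hev2 : ∀ᶠ m in atTop, ∀ t ∈ closedBall x (r m),
        |ψ x| * |h (e m t) - compTop h L (E x)| ≤ ε / 4 := by
      by_cases hxs : x ∈ tsupport ψ
      · filter_upwards [hr'.eventually (hE.eventually_comp_cv_mol_sub_le hΩ hK hKΩ hδ (hball x hxs)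
          hh.continuous hL (ε := ε / (4 * (C + 1))) (by positivity))] with m hm t ht
        calc _ ≤ C * (ε / (4 * (C + 1))) := mul_le_mul (hC x) (hm t ht) (abs_nonneg _) hC0
          _ = ε / 4 * (C / (C + 1)) := by field_simp
          _ ≤ ε / 4 * 1 := by gcongr; exact div_le_one_of_le₀ (by linarith) (by positivity)
          _ = _ := mul_one _
      · refine .of_forall fun m t _ => ?_; rw [hψ0' x hxs, abs_zero, zero_mul]; positivity
    obtain ⟨N, hN⟩ := eventually_atTop.1 ((hr'.eventually hev).and hev2); refine ⟨N, fun m hm => ?_⟩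
    obtain ⟨h1, h2⟩ := hN m hm.le; rw [dist_eq_norm]
    refine ((hk m).norm_cv_sub_le (((hΨt m).integrable volume).integrableOn)
      (ε := ε / 2) fun t ht => ?_).trans_lt (half_lt_self hε)
    have e1 : Ψ m t - ψ x * compTop h L (E x)
        = (ψ t - ψ x) * h (e m t) + ψ x * (h (e m t) - compTop h L (E x)) := by rw [hΨ]; ring
    rw [e1]
    calc _ ≤ ‖(ψ t - ψ x) * h (e m t)‖ + ‖ψ x * (h (e m t) - compTop h L (E x))‖ := norm_add_le _ _
      _ ≤ ε / (4 * (B + 1)) * B + ε / 4 := by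
          rw [norm_mul, norm_mul]
          exact add_le_add (mul_le_mul (h1 t ht) (hB _) (norm_nonneg _) (by positivity)) (h2 t ht)
      _ = ε / 4 * (B / (B + 1)) + ε / 4 := by field_simp
      _ ≤ ε / 4 * 1 + ε / 4 := by gcongr; exact div_le_one_of_le₀ (by linarith) (by positivity)
      _ = ε / 2 := by ring
  have T0 := hE.tendsto_mol_equation hΩ hLip hK hKΩ hball hr0 hrδ hr hΨt hΨs hΨB
  have hsplit : ∀ m, ∫ x in Ω, Q[A,g m,∇ (Ψ m)]x = (∫ x in Ω, ψ x * deriv h (e m x) * Q[A,g m,g m]x)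
        + ∫ x in Ω, h (e m x) * Q[A,g m,∇ ψ]x := fun m => by
    rw [← integral_add (iP m) (iT m)]; exact integral_congr_ae (.of_forall fun x => hΨg m x)
  have TP : Tendsto (fun m => ∫ x in Ω, ψ x * deriv h (e m x) * Q[A,g m,g m]x)
      atTop (𝓝 ((∫ x in Ω, ψ x * compTop h L (E x) ∂μ) - ∫ x in Ω, h E§x * Q[A,G,∇ ψ]x)) := by
    have := (T0.add T2).sub T1; rw [zero_add] at this; refine this.congr fun m => ?_; rw [hsplit]
    ring
  have hnn : ∀ m, ∀ x ∈ Ω, 0 ≤ ψ x * deriv h (e m x) * Q[A,g m,g m]x := by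
    intro m x hx
    by_cases hxs : x ∈ tsupport ψ
    · exact mul_nonneg (mul_nonneg (hψ0 x) (hd _ (hce m x hxs))) (hA.matForm_nonneg hx _)
    · rw [hψ0' x hxs, zero_mul, zero_mul]
  have hnn' : ∀ m, 0 ≤ᵐ[vol[Ω]] fun x =>
      ψ x * deriv h (e m x) * Q[A,g m,g m]x := fun m => by
    filter_upwards [hΩ.ae_mem] with x hx using hnn m x hx
  have hlim : ∀ᵐ x ∂vol[Ω], Tendsto (fun m =>
      ψ x * deriv h (e m x) * Q[A,g m,g m]x) atTop
      (𝓝 (ψ x * deriv h E§x * Q[A,G,G]x)) := by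
    filter_upwards [ae_restrict_of_ae hae, ae_restrict_of_ae haeG] with x hx hx'
    by_cases hxs : x ∈ tsupport ψ
    · rw [indicator_of_mem (hψK hxs)] at hx hx'
      exact ((((hh.continuous_deriv (by simp)).tendsto _).comp hx).const_mul _).mul
        (tendsto_matForm _ hx' hx')
    · simp [hψ0' x hxs]
  have hnnL : 0 ≤ᵐ[vol[Ω]] fun x =>
      ψ x * deriv h E§x * Q[A,G,G]x := by
    filter_upwards [hlim, hΩ.ae_mem] with x hx hxΩ using ge_of_tendsto' hx fun m => hnn m x hxΩ
  -- No L² bound on the gradients is known beforehand, so only Fatou applies. It yields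
  -- integrability of the quadratic term, and an inequality instead of an equality.
  have hF : ∫⁻ x in Ω, ofReal (ψ x * deriv h E§x * Q[A,G,G]x)
      ≤ ofReal ((∫ x in Ω, ψ x * compTop h L (E x) ∂μ) - ∫ x in Ω, h E§x * Q[A,G,∇ ψ]x) := by
    have h1 := tendsto_ofReal TP
    simp_rw [fun m => ofReal_integral_eq_lintegral_ofReal (iP m) (hnn' m)] at h1
    rw [← h1.liminf_eq]
    refine le_trans (lintegral_mono_ae ?_) (lintegral_liminf_le' fun m =>
      (iP m).1.aemeasurable.ennreal_ofReal)
    filter_upwards [hlim] with x hx using (tendsto_ofReal hx).liminf_eq.ge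
  have hmeas : AEStronglyMeasurable (fun x => ψ x * deriv h E§x * Q[A,G,G]x) vol[Ω] :=
    aestronglyMeasurable_of_tendsto_ae atTop (fun m => (iP m).1) hlim
  have hint : Integrable (fun x => ψ x * deriv h E§x * Q[A,G,G]x) vol[Ω] :=
    ⟨hmeas, (hasFiniteIntegral_iff_ofReal hnnL).2 (hF.trans_lt ofReal_lt_top)⟩
  refine ⟨hint, ?_⟩; have h0 := ge_of_tendsto' TP fun m => integral_nonneg_of_ae (hnn' m)
  rw [← ofReal_integral_eq_lintegral_ofReal hint hnnL, ofReal_le_ofReal_iff h0] at hF; linarith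

end LipschitzCoefficients

/-! ### The truncated equation when A is locally Lipschitz. -/

section LipschitzSolution

lemma memLp_of_integrable_matForm (hΩ : IsOpen Ω) (hA : IsUniformlyElliptic Ω A) {Q : Eu n → Eu n}
    (hQ : AEStronglyMeasurable Q vol[Ω]) (h : Integrable (fun x => Q[A,Q,Q]x) vol[Ω]) : MemLp Q 2
    vol[Ω] := by
  obtain ⟨lam, Lam, hl, hLam, hb⟩ := hA.exists_bounds; rw [memLp_two_iff_integrable_sq_norm hQ]
  refine (h.const_mul lam⁻¹).mono' (hQ.norm.pow 2) ?_; filter_upwards [hΩ.ae_mem] with x hx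
  rw [norm_of_nonneg (by positivity), le_inv_mul_iff₀ hl]
  exact (hb x hx).1 _

lemma IsTestFunction.memLp_smul_smul (hφ : IsTestFunction Ω φ) (hΩ : IsOpen Ω) (hA :
    IsUniformlyElliptic Ω A) (he : AEStronglyMeasurable e vol[Ω]) (hG : AEStronglyMeasurable G
    vol[Ω]) (int : ∀ φ, IsTestFunction Ω φ → ∀ l, IsCutoff l → Integrable (fun x => φ x * l (e x) *
    Q[A,G,G]x) vol[Ω]) (hl : IsCutoff l) : MemLp (fun x => φ x • l (e x) • G x) 2 vol[Ω] := by
  refine memLp_of_integrable_matForm hΩ hA (hφ.continuous.aesm.smul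
    ((hl.continuous.comp_aestronglyMeasurable he).smul hG)) ((int _ hφ.sq _ (hl.mul hl)).congr
      (.of_forall fun x => ?_))
  simp only [matForm_smul_left, matForm_smul_right]; ring

namespace IsPositiveSolution

lemma measurableSet_eq_top (hΩ : IsOpen Ω) (h : IsPositiveSolution Ω A E G μ) : MeasurableSet {x ∈ Ω
    | E x = ⊤} := by
  have : {x ∈ Ω | E x = ⊤} = Ω \ {x ∈ Ω | E x < ⊤} := by
    ext x; simp only [mem_ofPred_eq, Set.mem_sdiff, lt_top_iff_ne_top]; tauto
  rw [this]; exact MeasurableSet.diff hΩ.measurableSet (h.measurableSet_lt hΩ ⊤)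

lemma integral_eq_finPart_add (hΩ : IsOpen Ω) (h : IsPositiveSolution Ω A E G μ) (hf : IntegrableOn
    f Ω μ) : ∫ x in Ω, f x ∂μ = ∫ x, f x ∂finPart Ω E μ + ∫ x in {x ∈ Ω | E x = ⊤}, f x ∂μ := by
  have hu : Ω = {x ∈ Ω | E x < ⊤} ∪ {x ∈ Ω | E x = ⊤} := by
    ext x; simp only [mem_ofPred_eq, mem_union, lt_top_iff_ne_top]; tauto
  rw [finPart, ← setIntegral_union _ (h.measurableSet_eq_top hΩ)
    (hf.mono_set fun _ hx => hx.1) (hf.mono_set fun _ hx => hx.1), ← hu]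
  exact disjoint_left.2 fun x hx hx' => hx.2.ne hx'.2

/-- Test with h = arctan: its derivative 1/(1 + t²) is at least 1/(1 + b²) on the support [a, b] of
l. So ∇E is square integrable on bands of E, although it was only assumed locally integrable. -/
lemma integrable_of_lipschitz [IsFiniteMeasure μ] (hΩ : IsOpen Ω) (hA : IsUniformlyElliptic Ω A) (h
    : IsPositiveSolution Ω A E G μ) (hLip : ∀ i j, LocallyLipschitzOn Ω (fun x => A x i j)) (hφ :
    IsTestFunction Ω φ) (hl : IsCutoff l) : Integrable (fun x => φ x * l E§x * Q[A,G,G]x) vol[Ω]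
    := by
  obtain ⟨χ, hχ, hχ0, -, U, -, hU, hχ1⟩ := exists_testFunction hφ.compactSupport hΩ
    hφ.support_subset
  obtain ⟨δ, hδ, K, hK, hKΩ, hψK, hball⟩ := hχ.exists_thickening hΩ
  obtain ⟨c, -, hc⟩ := h.exists_lower' hK hKΩ
  have h1 := (h.integrable_comp_and_le hΩ hA hLip hχ hχ0 hδ hK hKΩ hψK hball hc
    contDiff_arctan (B := Real.pi / 2)
    (fun t => (abs_lt.2 ⟨by have := neg_pi_div_two_lt_arctan t; linarith,
      arctan_lt_pi_div_two t⟩).le)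
    (fun t _ => by rw [Real.deriv_arctan]; positivity)
    (tendsto_arctan_atTop.mono_right nhdsWithin_le_nhds)).1
  obtain ⟨C, hC⟩ := hφ.bounded; obtain ⟨D, hD⟩ := hl.bounded; obtain ⟨a, b, ha, hab⟩ := hl.support
  have hG := h.weakGrad.locInt_grad.aestronglyMeasurable
  refine (h1.const_mul (C * D * (1 + b ^ 2))).mono' ((hφ.continuous.aesm.mul
    (hl.continuous.comp_aestronglyMeasurable h.weakGrad.locInt.aestronglyMeasurable)).mul
    (hA.aestronglyMeasurable hG hG)) ?_
  have hC0 := (abs_nonneg _).trans (hC 0); have hD0 := (abs_nonneg _).trans (hD 0)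
  filter_upwards [hΩ.ae_mem] with x hx; have hm := hA.matForm_nonneg hx (G x)
  simp only [Real.deriv_arctan]; rw [norm_mul, norm_mul, norm_of_nonneg hm]
  by_cases hxs : x ∈ tsupport φ
  · rw [hχ1 x (hU hxs)]
    by_cases ht : E§x ∈ Icc a b
    · have h2 : 1 ≤ (1 + b ^ 2) * (1 / (1 + E§x ^ 2)) := by
        rw [mul_one_div, one_le_div (by positivity)]
        have := pow_le_pow_left₀ (ha.le.trans ht.1) ht.2 2; linarith
      calc _ ≤ C * D * 1 * Q[A,G,G]x := by
            rw [mul_one]; gcongr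
            · exact hC x
            · exact hD _
        _ ≤ C * D * ((1 + b ^ 2) * (1 / (1 + E§x ^ 2))) * Q[A,G,G]x := by gcongr
        _ = _ := by ring
    · rw [hab _ ht, norm_zero, mul_zero, zero_mul]; positivity
  · rw [eq_zero_of_notMem hxs, norm_zero, zero_mul, zero_mul]; have := hχ0 x; positivity

lemma measurable_compTop {h : ℝ → ℝ} (hh : Continuous h) (L : ℝ) : Measurable (compTop h L) :=
  Measurable.ite (measurableSet_singleton _) measurable_const (hh.measurable.comp measurable_toReal)

/-- Truncations of a solution by a plateau are supersolutions. -/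
lemma integral_plateau_le [IsFiniteMeasure μ] (hΩ : IsOpen Ω) (hA : IsUniformlyElliptic Ω A) (h :
    IsPositiveSolution Ω A E G μ) (hLip : ∀ i j, LocallyLipschitzOn Ω (fun x => A x i j)) (hφ :
    IsTestFunction Ω φ) (hφ0 : ∀ x, 0 ≤ φ x) (hδ : 0 < δ) (hK : IsCompact K) (hKΩ : K ⊆ Ω) (hφK :
    tsupport φ ⊆ K) (hball : ∀ x ∈ tsupport φ, closedBall x δ ⊆ K) (hc0 : 0 < c) (hc : ∀ x ∈ K, E x
    < ⊤ → c ≤ E§x) (hN : 0 < N) : ∫ x, φ x * plateau c N E§x ∂finPart Ω E μ ≤ ∫ x in Ω, plateau c N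
    E§x * Q[A,G,∇ φ]x := by
  have hp := plateau_isCutoff hc0 hN; set k := plateau c N
  have hd : ∀ t, deriv (fun t => 1 - k t) t = -deriv k t := fun t => by rw [deriv_const_sub]
  have hlim : Tendsto (fun t => 1 - k t) atTop (𝓝 1) := by
    obtain ⟨a, b, ha, hab⟩ := hp.support; refine tendsto_const_nhds.congr' ?_
    filter_upwards [eventually_gt_atTop b] with t ht; rw [hab t fun h' => ht.not_ge h'.2, sub_zero]
  obtain ⟨hi, hle⟩ := h.integrable_comp_and_le hΩ hA hLip hφ hφ0 hδ hK hKΩ hφK hball hc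
    (h := fun t => 1 - k t) (contDiff_const.sub hp.smooth) (B := 1)
    (fun t => abs_le.2 ⟨by linarith [plateau_le_one (c := c) (N := N) t],
      by linarith [plateau_nonneg (c := c) (N := N) t]⟩)
    (fun t ht => by rw [hd]; linarith [deriv_plateau_nonpos hc0 hN ht]) hlim
  have hnn : 0 ≤ ∫ x in Ω, φ x * deriv (fun t => 1 - k t) E§x * Q[A,G,G]x := by
    refine integral_nonneg_of_ae ?_; filter_upwards [hΩ.ae_mem, h.finite_ae] with x hx hxE
    by_cases hxs : x ∈ tsupport φ
    · rw [hd]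
      exact mul_nonneg (mul_nonneg (hφ0 x) (by
        linarith [deriv_plateau_nonpos hc0 hN (hc x (hφK hxs) hxE)])) (hA.matForm_nonneg hx _)
    · simp [eq_zero_of_notMem hxs]
  have cross : ∀ {b : Eu n → ℝ}, AEStronglyMeasurable b vol[Ω] → (∀ x, |b x| ≤ 1) →
      Integrable (fun x => b x * Q[A,G,∇ φ]x) vol[Ω] :=
    fun hb hb1 => hφ.integrable_mul_matForm hΩ hA h.weakGrad.locInt_grad hb hb1
  have i1 := cross (b := fun _ => 1) aestronglyMeasurable_const fun _ => by simp
  have i2 := cross (b := fun x => k E§x)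
    (hp.continuous.comp_aestronglyMeasurable h.weakGrad.locInt.aestronglyMeasurable)
    fun x => abs_le.2 ⟨by linarith [plateau_nonneg (c := c) (N := N) E§x], plateau_le_one _⟩
  -- The inequality for the nondecreasing function 1 − k is subtracted from the equation tested with
  -- φ; this turns 1 − k into k and reverses the inequality.
  have e1 : ∫ x in Ω, (1 - k E§x) * Q[A,G,∇ φ]x
      = (∫ x in Ω, φ x ∂μ) - ∫ x in Ω, k E§x * Q[A,G,∇ φ]x := by
    rw [← h.equation φ hφ]; simp only [one_mul] at i1; rw [← integral_sub i1 i2]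
    refine integral_congr_fun fun x => ?_; ring
  have e2 : ∫ x in Ω, φ x * compTop (fun t => 1 - k t) 1 (E x) ∂μ
      = (∫ x in Ω, φ x ∂μ) - ∫ x, φ x * k E§x ∂finPart Ω E μ := by
    have hφi := (hφ.integrable μ).integrableOn (s := Ω)
    have h3 : IntegrableOn (fun x => φ x * compTop (fun t => 1 - k t) 1 (E x)) Ω μ := by
      refine hφi.mul_bdd (c := 1) ((measurable_compTop (continuous_const.sub hp.continuous) 1
        ).comp_aemeasurable (h.aemeasurable hΩ μ)).aestronglyMeasurable
        (.of_forall fun x => ?_)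
      simp only [compTop]
      split_ifs
      · simp
      · exact abs_le.2 ⟨by linarith [plateau_le_one (c := c) (N := N) E§x],
          by linarith [plateau_nonneg (c := c) (N := N) E§x]⟩
    obtain ⟨C, hC⟩ := hφ.bounded; obtain ⟨D, hD⟩ := hp.bounded
    rw [h.integral_eq_finPart_add hΩ h3, h.integral_eq_finPart_add hΩ hφi,
      add_sub_right_comm, ← integral_sub (hφ.integrable _)
        (h.integrable_cutoff hΩ hφ.continuous hC hp.continuous hD)]
    congr 1
    · refine integral_congr_ae ?_
      filter_upwards [ae_restrict_mem (h.measurableSet_lt hΩ ⊤)] with x hx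
      rw [compTop, if_neg hx.2.ne]; ring
    · refine setIntegral_congr_fun (h.measurableSet_eq_top hΩ) fun x hx => ?_; simp [compTop, hx.2]
  rw [e1, e2] at hle; linarith

lemma abs_plateau_le_one (t : ℝ) : |plateau c N t| ≤ 1 :=
  abs_le.2 ⟨by linarith [plateau_nonneg (c := c) (N := N) t], plateau_le_one _⟩

lemma tendsto_integral_plateau [IsFiniteMeasure μ] (hΩ : IsOpen Ω) (h : IsPositiveSolution Ω A E G
    μ) (hφ : IsTestFunction Ω φ) (hc0 : 0 < c) (hc : ∀ x ∈ tsupport φ, E x < ⊤ → c ≤ E§x) : Tendsto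
    (fun j : ℕ => ∫ x, φ x * plateau c (j + 1) E§x ∂finPart Ω E μ) atTop (𝓝 (∫ x, φ x ∂finPart Ω E
    μ)) := by
  obtain ⟨C, hC⟩ := hφ.bounded
  refine tendsto_integral_of_dominated_convergence (fun _ => C)
    (fun m => (h.integrable_cutoff hΩ hφ.continuous hC
      (plateau_isCutoff hc0 (by positivity)).continuous abs_plateau_le_one).1) (integrable_const _)
    (fun m => .of_forall fun x => ?_) ?_
  · rw [norm_mul, ← mul_one C]
    exact mul_le_mul (hC x) (abs_plateau_le_one _) (norm_nonneg _) ((abs_nonneg _).trans (hC x))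
  · filter_upwards [ae_restrict_mem (h.measurableSet_lt hΩ ⊤)] with x hx
    by_cases hxs : x ∈ tsupport φ
    · refine tendsto_const_nhds.congr' ?_
      filter_upwards [tendsto_plateau hc0 (hc x hxs hx.2)] with j hj; rw [hj, mul_one]
    · simp [eq_zero_of_notMem hxs]

lemma tendsto_integral_plateau_matForm (hΩ : IsOpen Ω) (hA : IsUniformlyElliptic Ω A) (h :
    IsPositiveSolution Ω A E G μ) (hφ : IsTestFunction Ω φ) (hc0 : 0 < c) (hc : ∀ x ∈ tsupport φ, E
    x < ⊤ → c ≤ E§x) : Tendsto (fun j : ℕ => ∫ x in Ω, plateau c (j + 1) E§x * Q[A,G,∇ φ]x) atTop (𝓝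
    (∫ x in Ω, φ x ∂μ)) := by
  rw [← h.equation φ hφ]
  have i1 := hφ.integrable_mul_matForm hΩ hA h.weakGrad.locInt_grad
    (b := fun _ => 1) aestronglyMeasurable_const fun _ => abs_one.le
  refine tendsto_integral_of_dominated_convergence (fun x => ‖(fun _ => (1 : ℝ)) x * Q[A,G,∇ φ]x‖)
    (fun j => (hφ.integrable_mul_matForm hΩ hA h.weakGrad.locInt_grad
      ((plateau_isCutoff hc0 (by positivity)).continuous.comp_aestronglyMeasurable
        h.weakGrad.locInt.aestronglyMeasurable) fun x => abs_plateau_le_one _).1) i1.norm (fun j => .of_forall fun x => ?_) ?_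
  · rw [norm_mul, norm_mul, norm_one]
    exact mul_le_mul_of_nonneg_right (abs_plateau_le_one _) (norm_nonneg _)
  · filter_upwards [h.finite_ae] with x hx
    by_cases hxs : x ∈ tsupport φ
    · refine tendsto_const_nhds.congr' ?_
      filter_upwards [tendsto_plateau hc0 (hc x hxs hx)] with j hj; rw [hj, one_mul]
    · simp [gradient_eq_zero hxs, matForm_zero_right]

/-- Let v be a mollification of l(E), so |v| ≤ B. Both Bφ + φv and Bφ − φv are nonnegative and may
be tested in the plateau inequality. Removing the mollification and then letting N → ∞, the terms Bφ
contribute only the mass of φ on {E = ∞}, while ±φv gives both signs of the difference. -/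
lemma abs_truncForm_sub_le [IsFiniteMeasure μ] (hΩ : IsOpen Ω) (hA : IsUniformlyElliptic Ω A) (h :
    IsPositiveSolution Ω A E G μ) (hLip : ∀ i j, LocallyLipschitzOn Ω (fun x => A x i j)) (hφ :
    IsTestFunction Ω φ) (hφ0 : ∀ x, 0 ≤ φ x) (hl : IsCutoff l) (hB : ∀ t, |l t| ≤ B) : |truncForm Ω
    A (fun x => E§x) G φ l - ∫ x, φ x * l E§x ∂finPart Ω E μ| ≤ B * ∫ x in {x ∈ Ω | E x = ⊤}, φ x ∂μ
    := by
  obtain ⟨δ, hδ, K, hK, hKΩ, hφK, hball⟩ := hφ.exists_thickening hΩ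
  obtain ⟨c, hc0, hc⟩ := h.exists_lower' hK hKΩ; obtain ⟨a, b, ha, hab⟩ := hl.support
  obtain ⟨B', hB'⟩ := hl.deriv_bounded; obtain ⟨C, hC⟩ := hφ.bounded
  have hB0 : 0 ≤ B := (abs_nonneg _).trans (hB 0); have hab' := deriv_eq_zero_of_notMem_Icc hab
  have hem := h.weakGrad.locInt.aestronglyMeasurable
  have hGm := h.weakGrad.locInt_grad.aestronglyMeasurable
  have hint := fun θ hθ k hk => h.integrable_of_lipschitz (φ := θ) hΩ hA hLip hθ (l := k) hk
  set T := truncForm Ω A (fun x => E§x) G φ l with hT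
  set J := ∫ x, φ x * l E§x ∂finPart Ω E μ with hJ
  have cross : ∀ {b : Eu n → ℝ} {θ : Eu n → ℝ} {M : ℝ}, AEStronglyMeasurable b vol[Ω] →
      (∀ x, |b x| ≤ M) → IsTestFunction Ω θ →
      Integrable (fun x => b x * Q[A,G,∇ θ]x) vol[Ω] :=
    fun hb hbM hθ => hθ.integrable_mul_matForm hΩ hA h.weakGrad.locInt_grad hb hbM
  -- The condition b ≤ N makes the plateau equal to one on the support of l(E), so it disappears
  -- from the limits J and T.
  have step : ∀ N : ℝ, 0 < N → b ≤ N → ∀ s : ℝ, |s| = 1 →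
      B * (∫ x, φ x * plateau c N E§x ∂finPart Ω E μ) + s * J
        ≤ B * (∫ x in Ω, plateau c N E§x * Q[A,G,∇ φ]x) + s * T := by
    intro N hN hbN s hs; have hp := plateau_isCutoff hc0 hN
    have hkc : Continuous (plateau c N) := hp.continuous
    have hv := h.weakGrad.comp hΩ hl.smooth hB hB'
    have hvi : Integrable (K.indicator fun x => l E§x) := hv.locInt.integrable_indicator hKΩ hK
    obtain ⟨r, hr0, hrδ, hr, hae⟩ := exists_mol_seq hvi hδ
    set v : ℕ → Eu n → ℝ := fun m => cv (mol n (r m)) (K.indicator fun x => l E§x)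
    have hvs : ∀ m, ContDiff ℝ ∞ (v m) := fun m => contDiff_cv_mol (hr0 m) hvi
    have hvB : ∀ m x, |v m x| ≤ B := fun m =>
      (isKernel_mol (hr0 m)).norm_cv_indicator_le hvi fun _ => hB _
    have hφv : ∀ m, IsTestFunction Ω (fun x => φ x * v m x) := fun m => hφ.mul_right (hvs m)
    have hψ : ∀ m, IsTestFunction Ω (fun x => B * φ x + s * (φ x * v m x)) := fun m =>
      (hφ.const_mul B).add ((hφv m).const_mul s)
    have hψs : ∀ m, tsupport (fun x => B * φ x + s * (φ x * v m x)) ⊆ tsupport φ := fun m => by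
      have : (fun x => B * φ x + s * (φ x * v m x)) = fun x => φ x * (B + s * v m x) := by
        ext x; ring
      rw [this]; exact tsupport_mul_subset_left
    have kem : AEStronglyMeasurable (fun x => plateau c N E§x) vol[Ω] :=
      hkc.comp_aestronglyMeasurable hem
    have main := fun m => h.integral_plateau_le hΩ hA hLip (hψ m) (fun x => by
      have h1 : |s * v m x| ≤ B := by rw [abs_mul, hs, one_mul]; exact hvB m x
      have := (abs_le.1 h1).1
      have h2 : B * φ x + s * (φ x * v m x) = φ x * (B + s * v m x) := by ring
      rw [h2]; exact mul_nonneg (hφ0 x) (by linarith)) hδ hK hKΩ ((hψs m).trans hφK)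
      (fun x hx => hball x (hψs m hx)) hc0 hc hN
    have eL : ∀ m, ∫ x, (B * φ x + s * (φ x * v m x)) * plateau c N E§x ∂finPart Ω E μ
        = B * (∫ x, φ x * plateau c N E§x ∂finPart Ω E μ)
          + s * ∫ x, φ x * v m x * plateau c N E§x ∂finPart Ω E μ := fun m => by
      obtain ⟨Dv, hDv⟩ := (hφv m).bounded
      have i1 := (h.integrable_cutoff hΩ hφ.continuous hC hkc abs_plateau_le_one).const_mul B
      have i2 := (h.integrable_cutoff hΩ (hφv m).continuous hDv hkc abs_plateau_le_one).const_mul s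
      rw [← integral_const_mul, ← integral_const_mul, ← integral_add i1 i2]
      refine integral_congr_fun fun x => ?_; ring
    have eR : ∀ m, ∫ x in Ω, plateau c N E§x * Q[A,G,∇ (fun x => B * φ x + s * (φ x * v m x))]x
        = B * (∫ x in Ω, plateau c N E§x * Q[A,G,∇ φ]x)
          + s * ∫ x in Ω, matForm (A x) (plateau c N E§x • G x)
            (∇ (fun x => φ x * v m x) x) := fun m => by
      have i1 := (cross kem (fun x => abs_plateau_le_one _) hφ).const_mul B
      have i2 := (cross kem (fun x => abs_plateau_le_one _) (hφv m)).const_mul s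
      simp only [matForm_smul_left]
      rw [← integral_const_mul, ← integral_const_mul, ← integral_add i1 i2]
      refine integral_congr_fun fun x => ?_
      rw [gradient_fun_add ((hφ.differentiable x).const_mul B)
        (((hφv m).differentiable x).const_mul s), gradient_const_mul' B (hφ.differentiable x),
        gradient_const_mul' s ((hφv m).differentiable x), matForm_add_right, matForm_smul_right,
        matForm_smul_right]
      ring
    have limL : Tendsto (fun m => ∫ x, φ x * v m x * plateau c N E§x ∂finPart Ω E μ) atTop
        (𝓝 J) := by
      have hJ' : J = ∫ x, φ x * l E§x * plateau c N E§x ∂finPart Ω E μ := by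
        refine integral_congr_ae ?_
        filter_upwards [ae_restrict_mem (h.measurableSet_lt hΩ ⊤)] with x hx
        by_cases hxs : x ∈ tsupport φ
        · by_cases ht : E§x ∈ Icc a b
          · rw [plateau_eq_one hc0 hN (hc x (hφK hxs) hx.2) (ht.2.trans hbN), mul_one]
          · simp [hab _ ht]
        · simp [eq_zero_of_notMem hxs]
      rw [hJ']
      refine tendsto_integral_of_dominated_convergence (fun _ => C * B)
        (fun m => (hφv m).continuous.aesm.mul
          (hkc.measurable.comp_aemeasurable (h.aemeasurable_toReal hΩ)).aestronglyMeasurable)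
        (integrable_const _) (fun m => .of_forall fun x => ?_) ?_
      · rw [norm_mul, norm_mul, ← mul_one (C * B)]; have hC0 := (abs_nonneg _).trans (hC x)
        exact mul_le_mul (mul_le_mul (hC x) (hvB m x) (norm_nonneg _) hC0) (abs_plateau_le_one _)
          (norm_nonneg _) (by positivity)
      · filter_upwards [ae_restrict_mem (h.measurableSet_lt hΩ ⊤)] with x hx
        by_cases hxs : x ∈ tsupport φ
        · exact ((tendsto_cv_mol_comp hΩ h hl hK hKΩ hδ (hball x hxs) hx.2 hr0 hr).const_mul
            _).mul_const _
        · simp [eq_zero_of_notMem hxs]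
    have limR : Tendsto (fun m => ∫ x in Ω, matForm (A x) (plateau c N E§x • G x)
        (∇ (fun x => φ x * v m x) x)) atTop (𝓝 T) := by
      have hQl : LocallyIntegrableOn (fun x => plateau c N E§x • G x) Ω volume :=
        LocallyIntegrableOn.bdd_smul' hΩ h.weakGrad.locInt_grad kem
          fun _ _ _ => ⟨1, fun x _ => abs_plateau_le_one _⟩
      obtain ⟨χ, hχ, -, -, U, -, hU, hχ1⟩ := exists_testFunction hK hΩ hKΩ
      have hf : MemLp (K.indicator fun x => deriv l E§x • G x) 2 volume := by
        have := ((memLp_indicator_iff_restrict hΩ.measurableSet).2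
          (hχ.memLp_smul_smul hΩ hA hem hGm hint hl.deriv)).indicator hK.measurableSet
        refine this.ae_eq (.of_forall fun x => ?_)
        by_cases hxs : x ∈ K
        · rw [indicator_of_mem hxs, indicator_of_mem hxs, indicator_of_mem (hKΩ hxs),
            hχ1 x (hU hxs), one_smul]
        · simp [indicator, hxs]
      have := tendsto_integral_matForm_mol hΩ hA hv (fun x => hB _) hφ hQl
        (hφ.memLp_smul_smul hΩ hA hem hGm hint hp) hK hKΩ hφK hball hf hr0 hrδ hr hae
      convert this using 2
      refine integral_congr_ae ?_; filter_upwards [h.finite_ae] with x hx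
      simp only [matForm_smul_left, matForm_smul_right]
      by_cases hxs : x ∈ tsupport φ
      · by_cases ht : E§x ∈ Icc a b
        · rw [plateau_eq_one hc0 hN (hc x (hφK hxs) hx) (ht.2.trans hbN)]; ring
        · simp [hab _ ht, hab' _ ht]
      · simp [eq_zero_of_notMem hxs, gradient_eq_zero hxs, matForm_zero_right]
    refine le_of_tendsto_of_tendsto' ((limL.const_mul s).const_add _)
      ((limR.const_mul s).const_add _) fun m => ?_
    rw [← eL, ← eR]; exact main m
  have limJ := h.tendsto_integral_plateau hΩ hφ hc0 fun x hx => hc x (hφK hx)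
  have limX := h.tendsto_integral_plateau_matForm hΩ hA hφ hc0 fun x hx => hc x (hφK hx)
  -- As N → ∞ the left plateau term keeps only the finite part of μ while the right one gives all of
  -- μ; the gap is the mass on {E = ∞}.
  have fin : ∀ s : ℝ, |s| = 1 → s * (J - T) ≤ B * ∫ x in {x ∈ Ω | E x = ⊤}, φ x ∂μ := by
    intro s hs
    have h1 : B * (∫ x, φ x ∂finPart Ω E μ) + s * J ≤ B * (∫ x in Ω, φ x ∂μ) + s * T := by
      refine le_of_tendsto_of_tendsto ((limJ.const_mul B).add_const _)
        ((limX.const_mul B).add_const _) ?_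
      obtain ⟨j₀, hj₀⟩ := exists_nat_ge b; filter_upwards [eventually_ge_atTop j₀] with j hj
      have : (j₀ : ℝ) ≤ j := by exact_mod_cast hj
      exact step _ (by positivity) (by linarith) s hs
    rw [h.integral_eq_finPart_add hΩ (hφ.integrable μ).integrableOn] at h1; linarith
  rw [abs_le]; constructor <;> linarith [fin 1 (by simp), fin (-1) (by simp)]

/-- Cutoffs of a solution are admissible test functions if the coefficients are locally
Lipschitz. -/
theorem isTruncSolution_of_lipschitz [IsFiniteMeasure μ] (hΩ : IsOpen Ω) (hA : IsUniformlyElliptic Ω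
    A) (h : IsPositiveSolution Ω A E G μ) (hLip : ∀ i j, LocallyLipschitzOn Ω (fun x => A x i j)) :
    IsTruncSolution Ω A (fun x => E§x) G (finPart Ω E μ) := by
  have hint := fun θ hθ k hk => h.integrable_of_lipschitz (φ := θ) hΩ hA hLip hθ (l := k) hk
  have eq0 : ∀ φ, IsTestFunction Ω φ → (∀ x, 0 ≤ φ x) → ∀ l, IsCutoff l →
      truncForm Ω A (fun x => E§x) G φ l = ∫ x, φ x * l E§x ∂finPart Ω E μ := by
    intro φ hφ hφ0 l hl; obtain ⟨B, hB⟩ := hl.bounded; obtain ⟨C, hC⟩ := hφ.bounded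
    obtain ⟨a, b, ha, hab⟩ := hl.support; have hab' := deriv_eq_zero_of_notMem_Icc hab
    have hB0 : 0 ≤ B := (abs_nonneg _).trans (hB 0); have hC0 : 0 ≤ C := (abs_nonneg _).trans (hC 0)
    rw [← sub_eq_zero, ← abs_nonpos_iff]; refine le_of_forall_pos_le_add fun ε hε => ?_
    have hTm := h.measurableSet_eq_top hΩ
    -- By inner regularity, a compact S in {E = ∞} misses μ-mass less than ε/(BC + 1). The test
    -- function is then cut away near S, so that only this small mass enters the error bound.
    obtain ⟨S, hST, hS, hμS⟩ := hTm.exists_isCompact_sdiff_lt (measure_ne_top μ _)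
      (ε := ofReal (ε / (B * C + 1))) (by rw [Ne, ofReal_eq_zero, not_le]; positivity)
    have hV : IsOpen {x ∈ Ω | ofReal b < E x} := by
      rw [isOpen_iff_mem_nhds]; intro x hx; have := h.lsc x hx.1 _ hx.2
      rw [hΩ.nhdsWithin_eq hx.1] at this
      filter_upwards [this, hΩ.mem_nhds hx.1] with y hy hyΩ using ⟨hyΩ, hy⟩
    obtain ⟨χ, hχ, hχ0, hχ1, U, -, hSU, hχU⟩ := exists_testFunction hS hV fun x hx =>
      ⟨(hST hx).1, by rw [(hST hx).2]; exact ofReal_lt_top⟩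
    -- On the support of χ either b < E < ∞, or E = ∞ with real value 0 < a; in both cases l and l'
    -- vanish, so the cut changes neither side.
    have hdead : ∀ x ∈ tsupport χ, E§x ∉ Icc a b := by
      rintro x hx ⟨h1, h2⟩; have h3 := (hχ.support_subset hx).2
      rcases eq_or_ne (E x) ⊤ with h4 | h4
      · rw [h4, toReal_top] at h1; linarith
      · exact h3.not_ge (by rw [← ofReal_toReal h4]; exact ofReal_le_ofReal h2)
    have hχ' : ContDiff ℝ ∞ fun x => 1 - χ x := contDiff_const.sub hχ.smooth
    have hθ : IsTestFunction Ω fun x => φ x * (1 - χ x) := hφ.mul_right hχ'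
    have e1 : truncForm Ω A (fun x => E§x) G φ l
        = truncForm Ω A (fun x => E§x) G (fun x => φ x * (1 - χ x)) l := by
      refine integral_congr_fun fun x => ?_; simp only
      by_cases hx : x ∈ tsupport χ
      · simp [hab _ (hdead x hx), hab' _ (hdead x hx)]
      · rw [gradient_fun_mul (hφ.differentiable x) (hχ'.differentiable (by simp) x),
          gradient_fun_sub (differentiableAt_const _) (hχ.differentiable x),
          gradient_eq_zero hx, eq_zero_of_notMem hx]
        simp
    have e2 : ∫ x, φ x * l E§x ∂finPart Ω E μ = ∫ x, (φ x * (1 - χ x)) * l E§x ∂finPart Ω E μ := by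
      refine integral_congr_fun fun x => ?_
      by_cases hx : x ∈ tsupport χ
      · simp [hab _ (hdead x hx)]
      · simp [eq_zero_of_notMem hx]
    rw [e1, e2, zero_add]
    refine (h.abs_truncForm_sub_le hΩ hA hLip hθ
      (fun x => mul_nonneg (hφ0 x) (by linarith [hχ1 x])) hl hB).trans ?_
    have h5 : ∫ x in {x ∈ Ω | E x = ⊤}, φ x * (1 - χ x) ∂μ ≤ C * (ε / (B * C + 1)) := by
      have h6 : ∫ x in {x ∈ Ω | E x = ⊤}, φ x * (1 - χ x) ∂μ
          = ∫ x in {x ∈ Ω | E x = ⊤} \ S, φ x * (1 - χ x) ∂μ := by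
        refine setIntegral_eq_of_subset_of_forall_sdiff_eq_zero hTm sdiff_subset fun x hx => ?_
        rw [hχU x (hSU (by_contra fun h' => hx.2 ⟨hx.1, h'⟩)), sub_self, mul_zero]
      rw [h6]
      refine (le_norm_self _).trans ((norm_setIntegral_le_of_norm_le_const (C := C)
        (measure_lt_top _ _) fun x _ => ?_).trans ?_)
      · rw [norm_mul, ← mul_one C]
        exact mul_le_mul (hC x) (abs_le.2 ⟨by linarith [hχ1 x], by linarith [hχ0 x]⟩)
          (norm_nonneg _) hC0
      · refine mul_le_mul_of_nonneg_left ?_ hC0; exact toReal_le_of_le_ofReal (by positivity) hμS.le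
    calc _ ≤ B * (C * (ε / (B * C + 1))) := mul_le_mul_of_nonneg_left h5 hB0
      _ = ε * (B * C / (B * C + 1)) := by ring
      _ ≤ ε * 1 := by gcongr; exact div_le_one_of_le₀ (by linarith) (by positivity)
      _ = ε := mul_one _
  refine h.isTruncSolution hΩ hA hint fun φ hφ l hl => ?_
  obtain ⟨χ, hχ, hχ0, -, U, -, hU, hχ1⟩ := exists_testFunction hφ.compactSupport hΩ
    hφ.support_subset
  obtain ⟨C, hC⟩ := hφ.bounded; obtain ⟨D, hD⟩ := hl.bounded
  have hC0 : 0 ≤ C := (abs_nonneg _).trans (hC 0)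
  -- A test function of arbitrary sign is a difference of nonnegative ones, and both sides are
  -- linear.
  have hs : IsTestFunction Ω fun x => φ x + C * χ x := hφ.add (hχ.const_mul C)
  have h1 := eq0 _ hs (fun x => by
    by_cases hx : x ∈ tsupport φ
    · rw [hχ1 x (hU hx)]; linarith [(abs_le.1 (hC x)).1]
    · rw [eq_zero_of_notMem hx]; have := hχ0 x; positivity) l hl
  have h2 := eq0 _ hχ hχ0 l hl
  have it : ∀ {θ}, IsTestFunction Ω θ → Integrable (fun x => l E§x * Q[A,G,∇ θ]x + θ x * deriv l E§x * Q[A,G,G]x)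
      vol[Ω] := fun {θ} hθ => by
    exact (hθ.integrable_mul_matForm hΩ hA h.weakGrad.locInt_grad
      (hl.continuous.comp_aestronglyMeasurable h.weakGrad.locInt.aestronglyMeasurable)
      fun x => hD _).add
      (hint θ hθ _ hl.deriv)
  have h3 : truncForm Ω A (fun x => E§x) G (fun x => φ x + C * χ x) l
      = truncForm Ω A (fun x => E§x) G φ l + C * truncForm Ω A (fun x => E§x) G χ l := by
    rw [truncForm, truncForm, truncForm, ← integral_const_mul,
      ← integral_add (it hφ) ((it hχ).const_mul C)]
    refine integral_congr_fun fun x => ?_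
    rw [gradient_fun_add (hφ.differentiable x) ((hχ.differentiable x).const_mul C),
      gradient_const_mul' C (hχ.differentiable x), matForm_add_right, matForm_smul_right]
    ring
  have h4 : ∫ x, (φ x + C * χ x) * l E§x ∂finPart Ω E μ = ∫ x, φ x * l E§x ∂finPart Ω E μ
        + C * ∫ x, χ x * l E§x ∂finPart Ω E μ := by
    obtain ⟨C', hC'⟩ := hχ.bounded
    rw [← integral_const_mul, ← integral_add (h.integrable_cutoff hΩ hφ.continuous hC
      hl.continuous hD) ((h.integrable_cutoff hΩ hχ.continuous hC' hl.continuous hD).const_mul C)]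
    refine integral_congr_fun fun x => ?_; ring
  rw [h3, h4, h2] at h1; linarith

end IsPositiveSolution

end LipschitzSolution

/-! ### Boundary weights, and charges at the infinities of E. -/

section Optimality

lemma IsPositiveSolution.isTruncSolution_of_regularData [IsFiniteMeasure μ] (hΩ : IsOpen Ω) (hA :
    IsUniformlyElliptic Ω A) (h : IsPositiveSolution Ω A E G μ) (hreg : RegularData Ω A E G) :
    IsTruncSolution Ω A (fun x => E§x) G (IsPositiveSolution.finPart Ω E μ) := by
  rcases hreg with hL | ⟨hc, hG⟩
  · exact h.isTruncSolution_of_lipschitz hΩ hA hL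
  · exact h.isTruncSolution_of_continuous hΩ hA hc hG

lemma tendsto_eLpNorm_two_of_dominated {α F : Type*} [MeasurableSpace α] [NormedAddCommGroup F] {m :
    Measure α} {f : ℕ → α → F} {b : α → ℝ} (hf : ∀ j, AEStronglyMeasurable (f j) m) (hb : MemLp b 2
    m) (hle : ∀ j, ∀ᵐ x ∂m, ‖f j x‖ ≤ b x) (hlim : ∀ᵐ x ∂m, Tendsto (fun j => f j x) atTop (𝓝 0)) :
    Tendsto (fun j => eLpNorm (f j) 2 m) atTop (𝓝 0) := by
  have key : Tendsto (fun j => ∫⁻ x, ‖f j x‖ₑ ^ (2 : ℝ) ∂m) atTop (𝓝 (∫⁻ _, 0 ∂m)) := by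
    refine tendsto_lintegral_of_dominated_convergence' (fun x => ‖b x‖ₑ ^ (2 : ℝ))
      (fun j => (hf j).enorm.pow_const _) (fun j => ?_) ?_ ?_
    · filter_upwards [hle j] with x hx; refine ENNReal.rpow_le_rpow ?_ (by norm_num)
      rw [← ofReal_norm, ← ofReal_norm]; exact ofReal_le_ofReal (hx.trans (le_norm_self _))
    · have := lintegral_rpow_enorm_lt_top_of_eLpNorm_lt_top two_ne_zero ofNat_ne_top hb.2
      exact this.ne
    · filter_upwards [hlim] with x hx
      have h1 := (ENNReal.continuous_rpow_const (y := (2 : ℝ))).tendsto (0 : ℝ≥0∞)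
      rw [zero_rpow_of_pos two_pos] at h1; refine h1.comp ?_; have := hx.enorm
      rwa [enorm_zero] at this
  rw [lintegral_zero] at key
  have h1 := ((ENNReal.continuous_rpow_const (y := (1 / 2 : ℝ))).tendsto (0 : ℝ≥0∞)).comp key
  rw [zero_rpow_of_pos (by norm_num)] at h1
  refine h1.congr fun j => ?_; rw [eLpNorm_eq_lintegral_rpow_enorm_toReal two_ne_zero ofNat_ne_top]
  simp

lemma H10Approx.comp {φ : ℕ → Eu n → ℝ} (h : H10Approx Ω φ u g) {ς : ℝ → ℝ} (hς : ContDiff ℝ ∞ ς)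
    (h0 : ς 0 = 0) (hD : ∀ t, |deriv ς t| ≤ D) : H10Approx Ω (fun j x => ς (φ j x)) (fun x => ς (u
    x)) (fun x => deriv ς (u x) • g x) := by
  have hςd : Differentiable ℝ ς := hς.differentiable (by simp)
  have hςc : Continuous (deriv ς) := hς.continuous_deriv (by simp)
  have hlip : ∀ s t, |ς s - ς t| ≤ D * |s - t| := fun s t => by
    have := Convex.norm_image_sub_le_of_norm_deriv_le (f := ς) (C := D) (s := univ)
      (fun x _ => hςd x) (fun x _ => hD x) convex_univ (mem_univ t) (mem_univ s)
    simpa [norm_eq_abs] using this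
  have htest : ∀ j, IsTestFunction Ω fun x => ς (φ j x) := fun j => (h.test j).comp hς h0
  have hgr : ∀ j x, ∇ (fun x => ς (φ j x)) x = deriv ς (φ j x) • ∇ (φ j) x :=
    fun j x => gradient_scomp (hςd _) ((h.test j).differentiable x)
  have hum : AEStronglyMeasurable (fun x => deriv ς (u x)) vol[Ω] :=
    hςc.comp_aestronglyMeasurable h.memLp.1
  have hLp : MemLp (fun x => deriv ς (u x) • g x) 2 vol[Ω] := by
    refine h.memLp_grad.of_le_mul (c := D) (hum.smul h.memLp_grad.1) (.of_forall fun x => ?_)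
    rw [norm_smul]; exact mul_le_mul_of_nonneg_right (hD _) (norm_nonneg _)
  refine ⟨?_, hLp, htest, ?_, ?_, ?_, ?_⟩
  · refine h.memLp.of_le_mul (c := D) (hς.continuous.comp_aestronglyMeasurable h.memLp.1)
      (.of_forall fun x => ?_)
    have := hlip (u x) 0; rwa [h0, sub_zero, sub_zero] at this
  · have h1 := ENNReal.Tendsto.const_mul (a := ofReal D) h.tendsto (Or.inr ofReal_ne_top)
    rw [mul_zero] at h1
    refine tendsto_zero_of_le h1
      fun j => eLpNorm_le_mul_eLpNorm_of_ae_le_mul (.of_forall fun x => hlip _ _) 2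
  · have h1 := ENNReal.Tendsto.const_mul (a := ofReal D) h.tendsto_grad (Or.inr ofReal_ne_top)
    rw [mul_zero] at h1
    have h2 := tendsto_eLpNorm_two_of_dominated (m := vol[Ω])
      (f := fun j x => (deriv ς (φ j x) - deriv ς (u x)) • g x) (b := fun x => (D + D) * ‖g x‖)
      (fun j => ((hςc.comp (h.test j).continuous).aesm.sub hum).smul
        h.memLp_grad.1) (h.memLp_grad.norm.const_mul _)
      (fun j => .of_forall fun x => by
        rw [norm_smul]
        exact mul_le_mul_of_nonneg_right ((norm_sub_le _ _).trans (add_le_add (hD _) (hD _)))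
          (norm_nonneg _)) (by
        filter_upwards [h.ae] with x hx
        have := ((((hςc.tendsto _).comp hx).sub_const (deriv ς (u x))).smul_const (g x))
        simpa using this)
    have h3 := h1.add h2; rw [add_zero] at h3; refine tendsto_zero_of_le h3 fun j => ?_
    have e1 : (fun x => ∇ (fun x => ς (φ j x)) x - deriv ς (u x) • g x)
        = (fun x => deriv ς (φ j x) • (∇ (φ j) x - g x))
          + fun x => (deriv ς (φ j x) - deriv ς (u x)) • g x := by
      ext1 x
      rw [Pi.add_apply, hgr, smul_sub, sub_smul]; abel
    have mς := (hςc.comp (h.test j).continuous).aesm (μ := vol[Ω])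
    have m1 := (h.test j).continuous_gradient.aesm.sub h.memLp_grad.1; rw [e1]
    refine (eLpNorm_add_le (mς.smul m1) ((mς.sub hum).smul h.memLp_grad.1) (by norm_num)).trans
      (add_le_add (eLpNorm_le_mul_eLpNorm_of_ae_le_mul (.of_forall fun x => ?_) 2) le_rfl)
    rw [Pi.smul_apply', norm_smul]; exact mul_le_mul_of_nonneg_right (hD _) (norm_nonneg _)
  · filter_upwards [h.ae] with x hx using (hς.continuous.tendsto _).comp hx
  · filter_upwards [h.ae, h.ae_grad] with x hx hx'; simp only [hgr]
    exact ((hςc.tendsto _).comp hx).smul hx'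

namespace IsPositiveSolution

/-- Points of finiteness of E are Lebesgue points of l(E), so the precise representative is known
there with no exceptional set. -/
lemma preciseSq_comp (hΩ : IsOpen Ω) (h : IsPositiveSolution Ω A E G μ) (hl : IsCutoff l) (hxΩ : x ∈
    Ω) (hEx : E x < ⊤) : preciseSq (fun y => l E§y) x = ofReal (l E§x ^ 2) := by
  obtain ⟨C, hC⟩ := hl.bounded; obtain ⟨M, hM⟩ := hl.deriv_bounded
  obtain ⟨δ, hδ, hball⟩ := Metric.isOpen_iff.1 hΩ x hxΩ
  have hloc := (h.weakGrad.comp hΩ hl.smooth hC hM).locInt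
  have h1 : Tendsto (fun r : ℝ => ⨍ y in ball x r, l E§y) (𝓝[>] 0) (𝓝 (l E§x)) := by
    rw [tendsto_iff_edist_tendsto_0]
    refine tendsto_of_tendsto_of_tendsto_of_le_of_le' tendsto_const_nhds
      (h.tendsto_laverage_comp_sub hΩ hl hxΩ hEx) (.of_forall fun _ => zero_le) ?_
    filter_upwards [self_mem_nhdsWithin, nhdsWithin_le_nhds (gt_mem_nhds hδ)] with r hr hrδ
    have hk := isKernel_ballKernel (n := n) hr
    have hi := hloc.integrableOn_compact_subset
      ((closedBall_subset_ball hrδ).trans hball) (isCompact_closedBall x r)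
    have hc : IntegrableOn (fun _ : Eu n => l E§x) (closedBall x r) volume :=
      continuousOn_const.integrableOn_compact (isCompact_closedBall _ _)
    have e1 := hk.cv_sub hi hc; rw [hk.cv_const, cv_ballKernel, cv_ballKernel] at e1
    rw [edist_eq_enorm_sub, ← e1]; exact enorm_integral_le_lintegral_enorm _
  exact (tendsto_ofReal (h1.pow 2)).liminf_eq

/-- If `∫ φ² |∇E|² / E` is finite, then `φ²` does not charge the infinities of `E`. -/
lemma setIntegral_sq_eq_zero [IsFiniteMeasure μ] (hΩ : IsOpen Ω) (hA : IsUniformlyElliptic Ω A) (h :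
    IsPositiveSolution Ω A E G μ) (S : IsTruncSolution Ω A (fun x => E§x) G (finPart Ω E μ)) (hφ :
    IsTestFunction Ω φ) (hfin : Integrable (fun x => φ x ^ 2 / E§x * Q[A,G,G]x) vol[Ω]) : ∫ x in {x
    ∈ Ω | E x = ⊤}, φ x ^ 2 ∂μ = 0 := by
  obtain ⟨c, hc0, hc⟩ := h.exists_lower' hφ.compactSupport hφ.support_subset
  obtain ⟨M, hM0, hM⟩ := exists_σ_deriv_le
  have hp : ∀ j : ℕ, IsCutoff (plateau c (j + 1)) := fun j =>
    plateau_isCutoff hc0 (by positivity)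
  have hcψ : ∀ x ∈ tsupport (fun x => φ x ^ 2), E x < ⊤ → c ≤ E§x := fun x hx =>
    hc x (by
      have : (fun x => φ x ^ 2) = fun x => φ x * φ x := by ext; ring
      rw [this] at hx; exact tsupport_mul_subset_left hx)
  have lim1 := h.tendsto_integral_plateau_matForm hΩ hA hφ.sq hc0 hcψ
  have lim2 := h.tendsto_integral_plateau hΩ hφ.sq hc0 hcψ
  have lim3 : Tendsto (fun j : ℕ => ∫ x in Ω, φ x ^ 2 * deriv (plateau c (j + 1)) E§x
      * Q[A,G,G]x) atTop (𝓝 (∫ x in Ω, (0 : ℝ))) := by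
    refine tendsto_integral_of_dominated_convergence (fun x => 2 * M * ‖φ x ^ 2 / E§x * Q[A,G,G]x‖)
      (fun j => (S.int _ hφ.sq _ (hp j).deriv).1) (hfin.norm.const_mul _) (fun j => ?_) ?_
    · filter_upwards [h.finite_ae] with x hx
      by_cases hxs : x ∈ tsupport φ
      · have ht := hc x hxs hx; set t := E§x; have ht0 : 0 < t := hc0.trans_le ht
        have hj : (0 : ℝ) < j + 1 := by positivity
        rw [deriv_plateau hc0 ht, norm_mul, norm_mul, norm_neg, norm_mul, norm_div, ← mul_assoc]
        refine mul_le_mul_of_nonneg_right ?_ (norm_nonneg _)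
        rw [norm_div, norm_of_nonneg (σ_deriv_nonneg _),
          norm_of_nonneg hj.le, norm_of_nonneg ht0.le]
        -- The slope M/(j + 1) occurs only for t < 2(j + 1), where it is at most 2M/t; this
        -- dominates by the assumed integrable function.
        have : deriv σ (2 - t / (j + 1)) / (j + 1) ≤ 2 * M / t := by
          by_cases htN : t ≤ 2 * (j + 1)
          · rw [div_le_div_iff₀ hj ht0]
            calc _ ≤ M * (2 * (j + 1)) := mul_le_mul (hM _) htN ht0.le hM0.le
              _ = _ := by ring
          · rw [σ_deriv_of_notMem fun h' => htN ?_, zero_div]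
            · positivity
            · have := h'.1; rw [sub_pos, div_lt_iff₀ hj] at this; exact this.le
        calc _ ≤ ‖φ x ^ 2‖ * (2 * M / t) := mul_le_mul_of_nonneg_left this (norm_nonneg _)
          _ = _ := by ring
      · simp [eq_zero_of_notMem hxs]
    · filter_upwards [h.finite_ae] with x hx
      by_cases hxs : x ∈ tsupport φ
      · refine tendsto_const_nhds.congr' ?_; obtain ⟨j₀, hj₀⟩ := exists_nat_ge E§x
        filter_upwards [eventually_ge_atTop j₀] with j hj
        have h1 : (j₀ : ℝ) ≤ j := by exact_mod_cast hj
        rw [deriv_plateau hc0 (hc x hxs hx), σ_deriv_of_notMem, zero_div, neg_zero,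
          mul_zero, zero_mul]
        rintro ⟨-, h2⟩; have h3 : E§x / (j + 1) ≤ 1 := by rw [div_le_one (by positivity)]; linarith
        linarith
      · simp [eq_zero_of_notMem hxs]
  -- The truncated identity has two limits, the integral of φ² against μ and against its finite
  -- part; their difference is the mass on {E = ∞}.
  rw [integral_zero] at lim3; have key := lim1.add lim3
  have e1 : ∀ j : ℕ, (∫ x in Ω, plateau c (j + 1) E§x * Q[A,G,∇ (fun x => φ x ^ 2)]x) + (∫ x in Ω, φ x ^ 2 * deriv (plateau c (j + 1)) E§x
      * Q[A,G,G]x) = ∫ x, φ x ^ 2 * plateau c (j + 1) E§x ∂finPart Ω E μ := fun j => by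
    rw [← S.eq _ hφ.sq _ (hp j), truncForm, integral_add (S.integrable_cross hφ.sq (hp j))
      (S.int _ hφ.sq _ (hp j).deriv)]
  simp only [e1] at key; have := tendsto_nhds_unique key lim2
  rw [h.integral_eq_finPart_add hΩ (hφ.sq.integrable μ).integrableOn] at this; linarith

/-- Cutoffs of a boundary weight belong to `H¹₀`. -/
lemma memH10_comp [IsFiniteMeasure μ] (hΩ : IsOpen Ω) (hA : IsUniformlyElliptic Ω A) (h :
    IsPositiveSolution Ω A E G μ) (S : IsTruncSolution Ω A (fun x => E§x) G (finPart Ω E μ)) (hbd :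
    IsBoundaryWeight Ω E) (hl : IsCutoff l) : MemH10 Ω (fun x => l E§x) (fun x => deriv l E§x • G x)
    := by
  obtain ⟨C, hC⟩ := hl.bounded; obtain ⟨D, hD⟩ := hl.deriv_bounded
  obtain ⟨a, b, ha, hab⟩ := hl.support; have hw := h.weakGrad.comp hΩ hl.smooth hC hD
  have hem := h.weakGrad.locInt.aestronglyMeasurable
  have hl0 : l 0 = 0 := hl.eq_zero_of_nonpos le_rfl
  rcases hbd with ⟨hbdd, hlim⟩ | hsob
  -- If E tends to 0 at the boundary, the set where l(E) can be nonzero has compact closure inside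
  -- Ω.
  · set K := closure {x ∈ Ω | ofReal a ≤ E x} with hKdef
    have hK : IsCompact K := (hbdd.subset fun x hx => hx.1).isCompact_closure
    have hKΩ : K ⊆ Ω := by
      intro y hy
      by_contra hyΩ
      have hyf : y ∈ frontier Ω := by
        rw [hΩ.frontier_eq]; exact ⟨closure_mono (fun x hx => hx.1) hy, hyΩ⟩
      have h1 := (hlim y hyf).eventually (gt_mem_nhds (ofReal_pos.2 ha))
      rw [eventually_nhdsWithin_iff] at h1; obtain ⟨x, hx1, hx2⟩ := mem_closure_iff_nhds.1 hy _ h1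
      exact (hx1 hx2.1).not_ge hx2.2
    have hz : ∀ x ∈ Ω, x ∉ K → E§x ∉ Icc a b := by
      rintro x hxΩ hx ⟨h1, -⟩; refine hx (subset_closure ⟨hxΩ, ?_⟩)
      have hne : E x ≠ ⊤ := fun h' => by rw [h', toReal_top] at h1; linarith
      exact (ofReal_le_iff_le_toReal hne).2 h1
    have hv : (fun x => l E§x) =ᵐ[vol[Ω]] K.indicator fun x => l E§x := by
      filter_upwards [hΩ.ae_mem] with x hx
      by_cases hxK : x ∈ K
      · rw [indicator_of_mem hxK]
      · rw [indicator_of_notMem hxK, hab _ (hz x hx hxK)]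
    have hg : (fun x => deriv l E§x • G x) =ᵐ[vol[Ω]] K.indicator fun x => deriv l E§x • G x := by
      filter_upwards [hΩ.ae_mem] with x hx
      by_cases hxK : x ∈ K
      · rw [indicator_of_mem hxK]
      · rw [indicator_of_notMem hxK, deriv_eq_zero_of_notMem_Icc hab _ (hz x hx hxK), zero_smul]
    obtain ⟨χ, hχ, -, -, U, -, hU, hχ1⟩ := exists_testFunction hK hΩ hKΩ
    have : IsFiniteMeasure vol[Ω] := ⟨by rw [restrict_apply_univ]; exact hbdd.measure_lt_top⟩
    refine MemH10.congr (HasWeakGradient.memH10 (hw.congr hΩ hv hg) hΩ hK hKΩ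
      (fun x hx => indicator_of_notMem hx _) (fun x hx => indicator_of_notMem hx _) ?_ ?_)
      hv.symm hg.symm
    · exact (memLp_congr_ae hv).1 (MemLp.of_bound (hl.continuous.comp_aestronglyMeasurable hem) C
        (.of_forall fun x => hC _))
    · refine ((hχ.memLp_smul_smul hΩ hA hem h.weakGrad.locInt_grad.aestronglyMeasurable
        S.int hl.deriv).indicator hK.measurableSet).ae_eq (.of_forall fun x => ?_)
      by_cases hxK : x ∈ K
      · rw [indicator_of_mem hxK, indicator_of_mem hxK, hχ1 x (hU hxK), one_smul]
      · rw [indicator_of_notMem hxK, indicator_of_notMem hxK]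
  -- The level |b| + 1 exceeds b, so truncating E there does not change l(E); the gradient is then
  -- identified by uniqueness of weak gradients.
  · obtain ⟨k, hk⟩ : ∃ k : ℝ≥0, (k : ℝ) = |b| + 1 := ⟨⟨|b| + 1, by positivity⟩, rfl⟩
    obtain ⟨g, hg⟩ := hsob k; obtain ⟨φ, hφ⟩ := hg.exists_approx
    have h1 := (hφ.comp hl.smooth hl0 hD).memH10
    have hv : (fun x => l (min (E x) k).toReal) =ᵐ[vol[Ω]] fun x => l E§x := by
      filter_upwards [h.finite_ae] with x hx
      rcases le_total (E x) k with h2 | h2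
      · rw [min_eq_left h2]
      · have h3 := toReal_mono hx.ne h2; rw [min_eq_right h2]; rw [coe_toReal, hk] at h3 ⊢
        have := le_abs_self b
        rw [hab _ fun h' => by linarith [h'.2], hab _ fun h' => by linarith [h'.2]]
    refine h1.congr hv ?_
    exact HasWeakGradient.ae_unique hΩ ((h1.hasWeakGradient hΩ).congr hΩ hv EventuallyEq.rfl) hw

/-- For a boundary weight the test function can be removed from the truncated equation. Functions θⱼ
with values in [0, 1] tend to one where l(E) lives, and their gradients tend to a field vanishing
there. The cross term dies, and both bounds follow from 0 ≤ θⱼ ≤ 1. -/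
lemma integral_deriv_comp_bounds [IsFiniteMeasure μ] (hΩ : IsOpen Ω) (hA : IsUniformlyElliptic Ω A)
    (h : IsPositiveSolution Ω A E G μ) (S : IsTruncSolution Ω A (fun x => E§x) G (finPart Ω E μ))
    (hbd : IsBoundaryWeight Ω E) (hl : IsCutoff l) : Integrable (fun x => l E§x * Q[A,G,G]x) vol[Ω]
    ∧ ((∀ t, 0 ≤ l t) → 0 ≤ ∫ x in Ω, deriv l E§x * Q[A,G,G]x ∧ ∫ x in Ω, deriv l E§x * Q[A,G,G]x ≤
    ∫ x, l E§x ∂finPart Ω E μ) := by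
  have hB := fun k hk => h.memH10_comp hΩ hA S hbd (l := k) hk
  have hem := h.weakGrad.locInt.aestronglyMeasurable
  have hGm := h.weakGrad.locInt_grad.aestronglyMeasurable
  have hGL2 : ∀ k, IsCutoff k → MemLp (fun x => k E§x • G x) 2 vol[Ω] := by
    intro k hk; obtain ⟨a, b, ha, hab⟩ := hk.support; obtain ⟨C, hC⟩ := hk.bounded
    -- This cutoff is the identity near [a, b], so the gradient of its composition with E is G
    -- itself on the support of k(E).
    have hp : IsCutoff (fun t => t * plateau (a / 2) (|b| + 1) t) :=
      (plateau_isCutoff (half_pos ha) (by positivity)).mul_left contDiffOn_id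
    have h1 := (hB _ hp).memLp_grad
    refine h1.of_le_mul (c := C) ((hk.continuous.comp_aestronglyMeasurable hem).smul hGm)
      (.of_forall fun x => ?_)
    by_cases ht : E§x ∈ Icc a b
    · have e1 : (fun t => t * plateau (a / 2) (|b| + 1) t) =ᶠ[𝓝 E§x] fun t => t := by
        have := le_abs_self b
        filter_upwards [Ioo_mem_nhds (show a / 2 < E§x by linarith [ht.1])
          (show E§x < |b| + 1 by linarith [ht.2])] with t ht'
        rw [plateau_eq_one (half_pos ha) (by positivity) ht'.1.le ht'.2.le, mul_one]
      rw [e1.deriv_eq, deriv_id'', one_smul, norm_smul]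
      exact mul_le_mul_of_nonneg_right (hC _) (norm_nonneg _)
    · rw [hab _ ht, zero_smul, norm_zero]
      exact mul_nonneg ((abs_nonneg _).trans (hC 0)) (norm_nonneg _)
  obtain ⟨a, b, ha, hab⟩ := hl.support
  have hp := plateau_isCutoff (half_pos ha) (show 0 < |b| + 1 by positivity)
  have hint : ∀ k, IsCutoff k → (∀ t, t ∉ Icc a b → k t = 0) →
      Integrable (fun x => k E§x * Q[A,G,G]x) vol[Ω] := by
    intro k hk hkab
    refine (integrable_matForm hΩ hA (hGL2 k hk) (hGL2 _ hp)).congr (.of_forall fun x => ?_)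
    simp only [matForm_smul_left, matForm_smul_right]
    by_cases ht : E§x ∈ Icc a b
    · have := le_abs_self b
      rw [plateau_eq_one (half_pos ha) (by positivity) (by linarith [ht.1]) (by linarith [ht.2]),
        one_mul]
    · simp [hkab _ ht]
  refine ⟨hint l hl hab, fun hl0 => ?_⟩; obtain ⟨M, -, hM⟩ := exists_σ_deriv_le
  obtain ⟨φ, hφ⟩ := (hB _ hp).exists_approx
  -- Composition with σ forces values into [0, 1] while keeping test functions and H¹ convergence.
  have hθ := hφ.comp σ_contDiff smoothTransition.zero (D := M) fun t => by
    rw [abs_of_nonneg (σ_deriv_nonneg t)]; exact hM t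
  set θ : ℕ → Eu n → ℝ := fun j x => σ (φ j x); have hθ0 : ∀ j x, 0 ≤ θ j x := fun j x => σ_nonneg _
  have hθ1 : ∀ j x, θ j x ≤ 1 := fun j x => σ_le_one _
  have lim1 : Tendsto (fun j => ∫ x in Ω, l E§x * Q[A,G,∇ (θ j)]x) atTop (𝓝 0) := by
    have := tendsto_integral_matForm hΩ hA (hGL2 l hl) hθ.memLp_grad (fun _ => hGL2 l hl)
      (fun j => (hθ.test j).memLp_gradient 2 _) (by simp) hθ.tendsto_grad
    simp only [matForm_smul_left] at this; convert this using 2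
    rw [← integral_zero (Eu n) ℝ (μ := vol[Ω])]; refine integral_congr_fun fun x => ?_
    by_cases ht : E§x ∈ Icc a b
    · rw [deriv_plateau (half_pos ha) (by linarith [ht.1] : a / 2 ≤ E§x),
        σ_deriv_of_notMem (s := 2 - E§x / (|b| + 1)) fun h' => ?_]
      · simp [matForm_zero_right]
      · have h2 : E§x / (|b| + 1) ≤ 1 := by
          rw [div_le_one (by positivity)]
          linarith [ht.2, le_abs_self b]
        linarith [h'.2]
    · rw [hab _ ht, zero_mul]
  have lim2 : Tendsto (fun j => ∫ x in Ω, θ j x * deriv l E§x * Q[A,G,G]x)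
      atTop (𝓝 (∫ x in Ω, deriv l E§x * Q[A,G,G]x)) := by
    have hi := hint _ hl.deriv (deriv_eq_zero_of_notMem_Icc hab)
    refine tendsto_integral_of_dominated_convergence (fun x => ‖deriv l E§x * Q[A,G,G]x‖)
      (fun j => (S.int _ (hθ.test j) _ hl.deriv).1) hi.norm
      (fun j => .of_forall fun x => ?_) ?_
    · rw [mul_assoc, norm_mul]
      exact mul_le_of_le_one_left (norm_nonneg _) (abs_le.2 ⟨by linarith [hθ0 j x], hθ1 j x⟩)
    · filter_upwards [hθ.ae] with x hx
      by_cases ht : E§x ∈ Icc a b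
      · have := le_abs_self b
        rw [plateau_eq_one (half_pos ha) (by positivity) (by linarith [ht.1]) (by linarith [ht.2]),
          smoothTransition.one] at hx
        simpa [mul_assoc] using hx.mul_const (deriv l E§x * Q[A,G,G]x)
      · simp [deriv_eq_zero_of_notMem_Icc hab _ ht]
  have lim := lim1.add lim2; rw [zero_add] at lim
  have eqj : ∀ j, (∫ x in Ω, l E§x * Q[A,G,∇ (θ j)]x) + (∫ x in Ω, θ j x * deriv l E§x * Q[A,G,G]x)
      = ∫ x, θ j x * l E§x ∂finPart Ω E μ := fun j => by
    rw [← S.eq _ (hθ.test j) _ hl, truncForm, integral_add (S.integrable_cross (hθ.test j) hl)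
      (S.int _ (hθ.test j) _ hl.deriv)]
  simp only [eqj] at lim; obtain ⟨C, hC⟩ := hl.bounded
  refine ⟨ge_of_tendsto' lim fun j => integral_nonneg fun x => mul_nonneg (hθ0 j x) (hl0 _),
    le_of_tendsto' lim fun j => ?_⟩
  have i1 := fun {f : Eu n → ℝ} (hf : Continuous f) (hf1 : ∀ x, |f x| ≤ 1) =>
    h.integrable_cutoff hΩ hf hf1 hl.continuous hC
  have i2 := i1 (f := fun _ => 1) continuous_const fun _ => by simp
  simp only [one_mul] at i2
  refine integral_mono (i1 (hθ.test j).continuous fun x => abs_le.2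
    ⟨by linarith [hθ0 j x], hθ1 j x⟩) i2 fun x => ?_
  exact mul_le_of_le_one_left (hl0 _) (hθ1 j x)

end IsPositiveSolution

end Optimality

/-! ### Logarithmic cutoffs of √t. -/

section LogCutoff

/-- A plateau in the logarithmic variable. -/
noncomputable def logBump (L s : ℝ) : ℝ :=
  σ (2 + s / L) * σ (2 - s / L)

/-- A bound for the derivative of `logBump`. -/
noncomputable def logSlope (L s : ℝ) : ℝ :=
  deriv σ (2 + s / L) / L + deriv σ (2 - s / L) / L

/-- The function `t ↦ H (log t)` on `(0, ∞)`. -/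
noncomputable def liftLog (H : ℝ → ℝ) (t : ℝ) : ℝ := if 0 < t then H (log t) else 0

lemma liftLog_of_pos (H : ℝ → ℝ) (ht : 0 < t) : liftLog H t = H (log t) := if_pos ht

lemma contDiff_logBump (L : ℝ) : ContDiff ℝ ∞ (logBump L) :=
  (σ_contDiff.comp (contDiff_const.add (contDiff_id.div_const L))).mul
    (σ_contDiff.comp (contDiff_const.sub (contDiff_id.div_const L)))

lemma contDiff_logSlope (L : ℝ) : ContDiff ℝ ∞ (logSlope L) := by
  have h := (contDiff_infty_iff_deriv.1 σ_contDiff).2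
  exact ((h.comp (contDiff_const.add (contDiff_id.div_const L))).div_const L).add
    ((h.comp (contDiff_const.sub (contDiff_id.div_const L))).div_const L)

lemma logBump_nonneg : 0 ≤ logBump L s :=
  mul_nonneg (σ_nonneg _) (σ_nonneg _)

lemma logBump_le_one : logBump L s ≤ 1 :=
  mul_le_one₀ (σ_le_one _) (σ_nonneg _) (σ_le_one _)

lemma logBump_eq_zero (hL : 0 < L) (hs : s ∉ Icc (-(2 * L)) (2 * L)) : logBump L s = 0 := by
  rw [mem_Icc, not_and_or, not_le, not_le] at hs; rw [logBump]
  rcases hs with h | h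
  · rw [σ_eq_zero, zero_mul]; have : s / L ≤ -2 := by rw [div_le_iff₀ hL]; linarith
    linarith
  · rw [σ_eq_zero (x := 2 - s / L), mul_zero]; have : 2 ≤ s / L := by rw [le_div_iff₀ hL]; linarith
    linarith

lemma eventually_logBump_eq_one (s : ℝ) : ∀ᶠ j : ℕ in atTop, logBump (j + 1) s = 1 := by
  obtain ⟨j₀, hj₀⟩ := exists_nat_ge |s|; filter_upwards [eventually_ge_atTop j₀] with j hj
  have h1 : (j₀ : ℝ) ≤ j := by exact_mod_cast hj
  have h2 : |s / (j + 1)| ≤ 1 := by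
    rw [abs_div, abs_of_pos (by positivity : (0 : ℝ) < j + 1), div_le_one (by positivity)]
    linarith
  rw [logBump, σ_eq_one (by linarith [(abs_le.1 h2).1]),
    σ_eq_one (by linarith [(abs_le.1 h2).2]), mul_one]

lemma hasDerivAt_σ (s : ℝ) : HasDerivAt σ (deriv σ s) s :=
  (σ_contDiff.differentiable (by simp) s).hasDerivAt

lemma hasDerivAt_σ_add (L s : ℝ) : HasDerivAt (fun s => σ (2 + s / L)) (deriv σ (2 + s / L) / L) s
    := by
  have := (hasDerivAt_σ (2 + s / L)).comp s (((hasDerivAt_id s).div_const L).const_add 2)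
  rwa [mul_one_div] at this

lemma hasDerivAt_σ_sub (L s : ℝ) : HasDerivAt (fun s => σ (2 - s / L)) (-(deriv σ (2 - s / L) / L))
    s := by
  have := (hasDerivAt_σ (2 - s / L)).comp s (((hasDerivAt_id s).div_const L).const_sub 2)
  rwa [mul_neg, mul_one_div] at this

lemma abs_deriv_logBump_le (hL : 0 < L) : |deriv (logBump L) s| ≤ logSlope L s := by
  have h := (hasDerivAt_σ_add L s).mul (hasDerivAt_σ_sub L s)
  have e : deriv (logBump L) s = _ := h.deriv
  have h1 := div_nonneg (σ_deriv_nonneg (2 + s / L)) hL.le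
  have h2 := div_nonneg (σ_deriv_nonneg (2 - s / L)) hL.le
  have a0 := σ_nonneg (2 + s / L); have a1 := σ_le_one (2 + s / L)
  have b0 := σ_nonneg (2 - s / L); have b1 := σ_le_one (2 - s / L)
  rw [e, logSlope, mul_neg, ← sub_eq_add_neg]
  exact (abs_sub _ _).trans (add_le_add
    (by rw [abs_of_nonneg (by positivity)]; exact mul_le_of_le_one_right h1 b1)
    (by rw [abs_of_nonneg (by positivity)]; exact mul_le_of_le_one_left h2 a1))

lemma deriv_σ_add_eq_zero (hL : 0 < L) (hs : s ∉ Ioo (-(2 * L)) (-L)) : deriv σ (2 + s / L) = 0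
    := by
  refine σ_deriv_of_notMem fun h => hs ⟨?_, ?_⟩
  · have : -2 < s / L := by linarith [h.1]
    rw [lt_div_iff₀ hL] at this; linarith
  · have : s / L < -1 := by linarith [h.2]
    rw [div_lt_iff₀ hL] at this; linarith

lemma deriv_σ_sub_eq_zero (hL : 0 < L) (hs : s ∉ Ioo L (2 * L)) : deriv σ (2 - s / L) = 0 := by
  have e : 2 - s / L = 2 + -s / L := by ring
  rw [e]; exact deriv_σ_add_eq_zero hL fun h => hs ⟨by linarith [h.2], by linarith [h.1]⟩

lemma logSlope_eq_zero (hL : 0 < L) (hs : s ∉ Icc (-(2 * L)) (2 * L)) : logSlope L s = 0 := by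
  rw [logSlope, deriv_σ_add_eq_zero hL fun h => hs ⟨h.1.le, by linarith [h.2]⟩,
    deriv_σ_sub_eq_zero hL fun h => hs ⟨by linarith [h.1], h.2.le⟩]
  simp

lemma isCutoff_liftLog {H : ℝ → ℝ} (hH : ContDiff ℝ ∞ H) (h0 : ∀ s, s ∉ Icc (-(2 * L)) (2 * L) → H s
    = 0) : IsCutoff (liftLog H) :=
  IsCutoff.of_log hH h0

lemma deriv_liftLog {H : ℝ → ℝ} (hH : ContDiff ℝ ∞ H) (ht : 0 < t) :
    deriv (liftLog H) t = deriv H (log t) / t := IsCutoff.deriv_log hH ht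

/-- The function `√t η(log t)`, for `η = logBump L`. -/
noncomputable def sqrtCut (L : ℝ) : ℝ → ℝ := liftLog fun s => exp (s / 2) * logBump L s

lemma isCutoff_sqrtCut (hL : 0 < L) : IsCutoff (sqrtCut L) :=
  isCutoff_liftLog ((contDiff_exp.comp (contDiff_id.div_const 2)).mul (contDiff_logBump L))
    fun s hs => by rw [logBump_eq_zero hL hs, mul_zero]

lemma sqrtCut_sq (ht : 0 < t) : sqrtCut L t ^ 2 = t * logBump L (log t) ^ 2 := by
  rw [sqrtCut, liftLog_of_pos _ ht, mul_pow, ← exp_nat_mul]; congr 1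
  rw [Nat.cast_ofNat, mul_div_cancel₀ _ two_ne_zero, exp_log ht]

lemma deriv_sqrtCut (ht : 0 < t) : deriv (sqrtCut L) t = exp (log t / 2) / t * (1 / 2 * logBump L
    (log t) + deriv (logBump L) (log t)) := by
  have hc : ContDiff ℝ ∞ fun s => exp (s / 2) * logBump L s :=
    (contDiff_exp.comp (contDiff_id.div_const 2)).mul (contDiff_logBump L)
  have h1 : HasDerivAt (fun s : ℝ => exp (s / 2)) (exp (log t / 2) * (1 / 2))
    (log t) := ((hasDerivAt_id _).div_const 2).exp
  have h2 := ((contDiff_logBump L).differentiable (by simp) (log t)).hasDerivAt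
  have e : deriv (fun s => exp (s / 2) * logBump L s) (log t) = _ := (h1.mul h2).deriv
  rw [sqrtCut, deriv_liftLog hc ht, e]; ring

lemma deriv_sqrtCut_sq (ht : 0 < t) : deriv (sqrtCut L) t ^ 2 = (1 / 2 * logBump L (log t) + deriv
    (logBump L) (log t)) ^ 2 / t := by
  rw [deriv_sqrtCut ht, mul_pow, div_pow, ← exp_nat_mul, Nat.cast_ofNat,
    mul_div_cancel₀ _ two_ne_zero, exp_log ht]
  field_simp

lemma sqrtCut_mul_deriv (ht : 0 < t) : sqrtCut L t * deriv (sqrtCut L) t = logBump L (log t) * (1 /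
    2 * logBump L (log t) + deriv (logBump L) (log t)) := by
  have h : exp (log t / 2) * exp (log t / 2) = t := by rw [← exp_add, add_halves, exp_log ht]
  rw [deriv_sqrtCut ht, sqrtCut, liftLog_of_pos _ ht]
  calc _ = (exp (log t / 2) * exp (log t / 2)) / t * (logBump L (log t)
      * (1 / 2 * logBump L (log t) + deriv (logBump L) (log t))) := by ring
    _ = _ := by rw [h, div_self ht.ne', one_mul]

/-- `η(log t)² / t` -/
noncomputable def bumpCut (L : ℝ) : ℝ → ℝ := liftLog fun s => logBump L s ^ 2 * exp (-s)

/-- `β(log t) / t`, for `β = logSlope L` -/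
noncomputable def slopeCut (L : ℝ) : ℝ → ℝ := liftLog fun s => logSlope L s * exp (-s)

lemma contDiff_exp_neg : ContDiff ℝ ∞ fun s : ℝ => exp (-s) :=
  contDiff_exp.comp contDiff_neg

lemma isCutoff_bumpCut (hL : 0 < L) : IsCutoff (bumpCut L) :=
  isCutoff_liftLog (((contDiff_logBump L).pow 2).mul contDiff_exp_neg)
    fun s hs => by rw [logBump_eq_zero hL hs]; simp

lemma isCutoff_slopeCut (hL : 0 < L) : IsCutoff (slopeCut L) :=
  isCutoff_liftLog ((contDiff_logSlope L).mul contDiff_exp_neg)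
    fun s hs => by rw [logSlope_eq_zero hL hs]; simp

lemma bumpCut_of_pos (ht : 0 < t) : bumpCut L t = logBump L (log t) ^ 2 / t := by
  rw [bumpCut, liftLog_of_pos _ ht, exp_neg, exp_log ht, div_eq_mul_inv]

lemma slopeCut_of_pos (ht : 0 < t) : slopeCut L t = logSlope L (log t) / t := by
  rw [slopeCut, liftLog_of_pos _ ht, exp_neg, exp_log ht, div_eq_mul_inv]

lemma logSlope_le (hM : ∀ s, deriv σ s ≤ M) (hL : 0 < L) : logSlope L s ≤ 2 * M / L := by
  rw [logSlope, ← add_div, two_mul]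
  exact div_le_div_of_nonneg_right (add_le_add (hM _) (hM _)) hL.le

/-- The excess of the derivative of `sqrtCut`. -/
lemma deriv_sqrtCut_sq_le (hM : ∀ s, deriv σ s ≤ M) (hL : 1 ≤ L) (ht : 0 < t) : deriv (sqrtCut L) t
    ^ 2 ≤ 1 / 4 * bumpCut L t + (1 + 2 * M) * slopeCut L t := by
  have hL0 : 0 < L := one_pos.trans_le hL
  rw [deriv_sqrtCut_sq ht, bumpCut_of_pos ht, slopeCut_of_pos ht, mul_div_assoc', mul_div_assoc',
    ← add_div]
  refine div_le_div_of_nonneg_right ?_ ht.le; have h1 := abs_deriv_logBump_le (s := log t) hL0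
  have hM0 : 0 ≤ M := (σ_deriv_nonneg 0).trans (hM 0)
  have h2 : logSlope L (log t) ≤ 2 * M := (logSlope_le hM hL0).trans
    (div_le_self (by positivity) hL)
  set η := logBump L (log t); set d := deriv (logBump L) (log t); set β := logSlope L (log t)
  have e0 : 0 ≤ η := logBump_nonneg; have e1 : η ≤ 1 := logBump_le_one
  have h3 : η * d ≤ β := (le_abs_self _).trans (by
    rw [abs_mul, abs_of_nonneg e0]; exact (mul_le_of_le_one_left (abs_nonneg _) e1).trans h1)
  have h4 : d ^ 2 ≤ 2 * M * β := by
    rw [← sq_abs, sq]; exact mul_le_mul (h1.trans h2) h1 (abs_nonneg _) (by positivity)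
  linarith [show (1 / 2 * η + d) ^ 2 = 1 / 4 * η ^ 2 + η * d + d ^ 2 by ring]

lemma abs_sqrtCut_mul_deriv_le (hM : ∀ s, deriv σ s ≤ M) (hL : 1 ≤ L) (ht : 0 < t) : |sqrtCut L t *
    deriv (sqrtCut L) t| ≤ 1 / 2 + 2 * M := by
  have hL0 : 0 < L := one_pos.trans_le hL; have hM0 : 0 ≤ M := (σ_deriv_nonneg 0).trans (hM 0)
  have h1 := (abs_deriv_logBump_le (s := log t) hL0).trans ((logSlope_le hM hL0).trans
    (div_le_self (by positivity) hL))
  have e0 := logBump_nonneg (L := L) (s := log t); have e1 := logBump_le_one (L := L) (s := log t)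
  rw [sqrtCut_mul_deriv ht, abs_mul, abs_of_nonneg e0]
  refine (mul_le_of_le_one_left (abs_nonneg _) e1).trans ((abs_add_le _ _).trans (add_le_add ?_ h1))
  rw [abs_of_nonneg (by positivity)]
  linarith

/-- The slope of the logarithmic plateau is itself almost a derivative: h₁ carries the rising ramp,
h₂ the falling one, and both are closed off on |s| ≤ 1 for s = log t, at a cost k₀ independent of L.
Integrals of h'(E)|∇E|² are bounded by the equation, uniformly for 0 ≤ h ≤ 1. -/
lemma exists_slopeCut_le : ∃ k₀, IsCutoff k₀ ∧ ∀ L, 1 ≤ L → ∃ h₁ h₂, IsCutoff h₁ ∧ IsCutoff h₂ ∧ (∀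
    t, 0 ≤ h₁ t ∧ h₁ t ≤ 1) ∧ (∀ t, 0 ≤ h₂ t ∧ h₂ t ≤ 1) ∧ ∀ t, 0 < t → slopeCut L t ≤ deriv h₁ t -
    deriv h₂ t + k₀ t := by
  have hα := σ_contDiff; have hα' := (contDiff_infty_iff_deriv.1 hα).2
  refine ⟨liftLog fun s => (deriv σ s + deriv σ (-s))
    * exp (-s), isCutoff_liftLog (L := 1) ((hα'.add (hα'.comp contDiff_neg)).mul
      contDiff_exp_neg) fun s hs => ?_, fun L hL => ?_⟩
  · rw [σ_deriv_of_notMem fun h => hs ⟨by linarith [h.1], by linarith [h.2]⟩,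
      σ_deriv_of_notMem fun h => hs ⟨by linarith [h.2], by linarith [h.1]⟩]
    simp
  have hL0 : 0 < L := one_pos.trans_le hL
  have c1 : ContDiff ℝ ∞ fun s => σ (2 + s / L) * σ (-s) :=
    (hα.comp (contDiff_const.add (contDiff_id.div_const L))).mul (hα.comp contDiff_neg)
  have c2 : ContDiff ℝ ∞ fun s => σ s * σ (2 - s / L) :=
    hα.mul (hα.comp (contDiff_const.sub (contDiff_id.div_const L)))
  have b01 : ∀ (f g : ℝ → ℝ) (t : ℝ), 0 ≤ liftLog (fun s => σ (f s)
      * σ (g s)) t ∧ liftLog (fun s => σ (f s)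
      * σ (g s)) t ≤ 1 := by
    intro f g t; rw [liftLog]
    split_ifs
    · exact ⟨mul_nonneg (σ_nonneg _) (σ_nonneg _), mul_le_one₀ (σ_le_one _) (σ_nonneg _)
          (σ_le_one _)⟩
    · exact ⟨le_rfl, zero_le_one⟩
  refine ⟨_, _, isCutoff_liftLog (L := L) c1 fun s hs => ?_, isCutoff_liftLog (L := L) c2
    fun s hs => ?_, b01 _ _, b01 _ _, fun t ht => ?_⟩
  · rw [mem_Icc, not_and_or, not_le, not_le] at hs
    rcases hs with h | h
    · rw [σ_eq_zero, zero_mul]; have : s / L ≤ -2 := by rw [div_le_iff₀ hL0]; linarith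
      linarith
    · rw [σ_eq_zero (x := -s) (by linarith), mul_zero]
  · rw [mem_Icc, not_and_or, not_le, not_le] at hs
    rcases hs with h | h
    · rw [σ_eq_zero (x := s) (by linarith), zero_mul]
    · rw [σ_eq_zero (x := 2 - s / L), mul_zero]
      have : 2 ≤ s / L := by rw [le_div_iff₀ hL0]; linarith
      linarith
  rw [slopeCut_of_pos ht, deriv_liftLog c1 ht, deriv_liftLog c2 ht, liftLog_of_pos _ ht,
    exp_neg, exp_log ht, ← div_eq_mul_inv, ← sub_div, ← add_div]
  refine div_le_div_of_nonneg_right ?_ ht.le; set s := log t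
  have d1 := ((hasDerivAt_σ_add L s).mul ((hasDerivAt_σ (-s)).comp s (hasDerivAt_neg s))).deriv
  have d2 := ((hasDerivAt_σ s).mul (hasDerivAt_σ_sub L s)).deriv
  have e1 : deriv (fun s => σ (2 + s / L) * σ (-s)) s = _ := d1
  have e2 : deriv (fun s => σ s * σ (2 - s / L)) s = _ := d2; rw [e1, e2, logSlope]
  have n1 := σ_deriv_nonneg (-s); have n2 := σ_deriv_nonneg s
  have p1 : deriv σ (2 + s / L) / L * σ (-s) = deriv σ (2 + s / L) / L := by
    by_cases h : s ∈ Ioo (-(2 * L)) (-L)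
    · rw [σ_eq_one (by linarith [h.2]), mul_one]
    · simp [deriv_σ_add_eq_zero hL0 h]
  have p2 : σ s * (deriv σ (2 - s / L) / L) = deriv σ (2 - s / L) / L := by
    by_cases h : s ∈ Ioo L (2 * L)
    · rw [σ_eq_one (by linarith [h.1]), one_mul]
    · simp [deriv_σ_sub_eq_zero hL0 h]
  have q1 := mul_le_of_le_one_left n1 (σ_le_one (2 + s / L))
  have q2 := mul_le_of_le_one_right n2 (σ_le_one (2 - s / L))
  simp only [Function.comp_apply, mul_neg, mul_one] at p1 p2 ⊢; linarith

end LogCutoff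

/-! ### Optimality of 1/4 for interior weights. -/

section Sharpness

/-- An excess M that stays bounded is negligible against a main term that does not. -/
lemma exists_lt_mul_of_unbounded {x y : ℕ → ℝ≥0∞} {Y : ℕ → ℝ} (ha : 0 ≤ a) {c : ℝ≥0∞} (hc : ofReal a
    < c) (hx : ∀ j, x j ≤ ofReal (a * Y j + M)) (hy : ∀ j, ofReal (Y j) ≤ y j) (hY : ∀ R, ∃ j, R < Y
    j) : ∃ j, x j < c * y j := by
  obtain ⟨r, hr1, hr2⟩ := lt_iff_exists_nnreal_btwn.1 hc
  have hr : a < r := by rwa [ofReal, coe_lt_coe, ← NNReal.coe_lt_coe, coe_toNNReal _ ha] at hr1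
  obtain ⟨j, hj⟩ := hY (|M| / (r - a)); have h0 : 0 < (r : ℝ) - a := sub_pos.2 hr
  have hY0 : 0 < Y j := (by positivity : 0 ≤ |M| / (r - a)).trans_lt hj
  rw [div_lt_iff₀ h0] at hj; have hr0 : 0 < (r : ℝ) := ha.trans_lt hr
  refine ⟨j, (hx j).trans_lt (lt_of_lt_of_le ?_ (mul_le_mul' hr2.le (hy j)))⟩
  rw [← ofReal_coe_nnreal, ← ofReal_mul r.coe_nonneg]
  exact (ofReal_lt_ofReal_iff (by positivity)).2 (by linarith [le_abs_self M])

variable {α : Type*} [MeasurableSpace α] {m : Measure α} {p e a : α → ℝ}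

/-- The weight p covers both uses: φ² for interior weights, and 1 for boundary weights, where no
localization is needed. -/
lemma exists_integral_slopeCut_le (hp : ∀ x, 0 ≤ p x) (he : ∀ᵐ x ∂m, 0 < e x) (ha : ∀ᵐ x ∂m, 0 ≤ a
    x) (hi : ∀ k, IsCutoff k → Integrable (fun x => p x * k (e x) * a x) m) (hb : ∀ h, IsCutoff h →
    (∀ t, 0 ≤ h t ∧ h t ≤ 1) → |∫ x, p x * deriv h (e x) * a x ∂m| ≤ C) : ∃ C', 0 ≤ C' ∧ ∀ L, 1 ≤ L
    → ∫ x, p x * slopeCut L (e x) * a x ∂m ≤ C' := by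
  obtain ⟨k₀, hk₀, hk⟩ := exists_slopeCut_le
  refine ⟨|2 * C + ∫ x, p x * k₀ (e x) * a x ∂m|, abs_nonneg _, fun L hL => ?_⟩
  obtain ⟨h₁, h₂, c₁, c₂, b₁, b₂, hle⟩ := hk L hL; have i₁ := hi _ c₁.deriv
  have i₂ := hi _ c₂.deriv
  have i₁₂ : Integrable (fun x => p x * deriv h₁ (e x) * a x - p x * deriv h₂ (e x) * a x) m :=
    i₁.sub i₂
  have h1 : ∫ x, p x * slopeCut L (e x) * a x ∂m ≤ ∫ x, (p x * deriv h₁ (e x) * a x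
      - p x * deriv h₂ (e x) * a x + p x * k₀ (e x) * a x) ∂m := by
    refine integral_mono_ae (hi _ (isCutoff_slopeCut (one_pos.trans_le hL))) (i₁₂.add (hi _ hk₀)) ?_
    filter_upwards [he, ha] with x hx hax
    have := mul_le_mul_of_nonneg_right (mul_le_mul_of_nonneg_left (hle _ hx) (hp x)) hax; linarith
  rw [integral_add i₁₂ (hi _ hk₀), integral_sub i₁ i₂] at h1
  linarith [(abs_le.1 (hb _ c₁ b₁)).2, (abs_le.1 (hb _ c₂ b₂)).1,
    le_abs_self (2 * C + ∫ x, p x * k₀ (e x) * a x ∂m)]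

lemma eventually_bumpCut_eq (ht : 0 < t) : ∀ᶠ j : ℕ in atTop, bumpCut (j + 1) t = t⁻¹ := by
  filter_upwards [eventually_logBump_eq_one (log t)] with j hj
  rw [bumpCut_of_pos ht, hj, one_pow, one_div]

lemma bumpCut_nonneg (ht : 0 < t) : 0 ≤ bumpCut L t := by
  rw [bumpCut_of_pos ht]; positivity

lemma integrable_div_of_bumpCut_le (hp : ∀ x, 0 ≤ p x) (he : ∀ᵐ x ∂m, 0 < e x) (ha : ∀ᵐ x ∂m, 0 ≤ a
    x) (hi : ∀ k, IsCutoff k → Integrable (fun x => p x * k (e x) * a x) m) {R : ℝ} (hR : ∀ j : ℕ, ∫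
    x, p x * bumpCut (j + 1) (e x) * a x ∂m ≤ R) : Integrable (fun x => p x / e x * a x) m := by
  have hB : ∀ j : ℕ, IsCutoff (bumpCut (j + 1)) := fun j => isCutoff_bumpCut (by positivity)
  have hlim : ∀ᵐ x ∂m, Tendsto (fun j : ℕ => p x * bumpCut (j + 1) (e x) * a x) atTop
      (𝓝 (p x / e x * a x)) := by
    filter_upwards [he] with x hx; refine tendsto_nhds_of_eventually_eq ?_
    filter_upwards [eventually_bumpCut_eq hx] with j hj; rw [hj, div_eq_mul_inv]
  refine ⟨aestronglyMeasurable_of_tendsto_ae _ (fun j => (hi _ (hB j)).1) hlim, ?_⟩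
  have h1 : ∫⁻ x, ‖p x / e x * a x‖ₑ ∂m
      = ∫⁻ x, liminf (fun j : ℕ => ‖p x * bumpCut (j + 1) (e x) * a x‖ₑ) atTop ∂m := by
    refine lintegral_congr_ae ?_; filter_upwards [hlim] with x hx using hx.enorm.liminf_eq.symm
  rw [HasFiniteIntegral, h1]
  refine (lintegral_liminf_le' fun j => (hi _ (hB j)).1.enorm).trans_lt
    ((liminf_le_of_frequently_le' (x := ofReal R) (Frequently.of_forall fun j => ?_)).trans_lt
      ofReal_lt_top)
  have h0 : 0 ≤ᵐ[m] fun x => p x * bumpCut (j + 1) (e x) * a x := by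
    filter_upwards [he, ha] with x hx hax
      using mul_nonneg (mul_nonneg (hp x) (bumpCut_nonneg hx)) hax
  calc _ = ∫⁻ x, ofReal (p x * bumpCut (j + 1) (e x) * a x) ∂m := by
        refine lintegral_congr_ae ?_; filter_upwards [h0] with x hx; exact enorm_of_nonneg hx
    _ = ofReal _ := (ofReal_integral_eq_lintegral_ofReal (hi _ (hB j)) h0).symm
    _ ≤ _ := ofReal_le_ofReal (hR j)

lemma measure_eq_zero_of_testFunction [IsFiniteMeasure μ] (hΩ : IsOpen Ω) {T : Set (Eu n)} (hT : T ⊆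
    Ω) (h : ∀ φ, IsTestFunction Ω φ → ∫ x in T, φ x ^ 2 ∂μ = 0) : μ T = 0 := by
  obtain ⟨K, hK, hKΩ, -, hU⟩ := hΩ.exists_compact_exhaustion
  have : T ⊆ ⋃ i, K i ∩ T := by rw [← iUnion_inter, hU, inter_eq_self_of_subset_right hT]
  refine measure_mono_null this (measure_iUnion_null fun i => ?_)
  obtain ⟨χ, hχ, -, -, U, hUo, hKU, h1⟩ := exists_testFunction (hK i) hΩ (hKΩ i); have h2 := h χ hχ
  rw [integral_eq_zero_iff_of_nonneg (fun x => sq_nonneg _) (hχ.sq.integrable _)] at h2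
  have h3 : (μ.restrict T) (K i) = 0 := by
    refine measure_mono_null (fun x hx => ?_) (ae_iff.1 h2); simp [h1 x (hKU hx)]
  rwa [Measure.restrict_apply (hK i).measurableSet] at h3

namespace IsPositiveSolution

lemma ae_pos (hΩ : IsOpen Ω) (h : IsPositiveSolution Ω A E G μ) : ∀ᵐ x ∂vol[Ω], 0 < E§x := by
  filter_upwards [h.finite_ae, hΩ.ae_mem] with x hx hxΩ using toReal_pos (h.pos x hxΩ).ne' hx.ne

lemma ae_finPart_pos (hΩ : IsOpen Ω) (h : IsPositiveSolution Ω A E G μ) : ∀ᵐ x ∂finPart Ω E μ, x ∈ Ω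
    ∧ E x < ⊤ ∧ 0 < E§x := by
  filter_upwards [ae_restrict_mem (h.measurableSet_lt hΩ ⊤)] with x hx
    using ⟨hx.1, hx.2, toReal_pos (h.pos x hx.1).ne' hx.2.ne⟩

/-- The trial function is φ √E η(log E). Its energy is a quarter of the Hardy term plus terms
bounded uniformly in L: the slope of η is handled by `exists_integral_slopeCut_le`, the cross term
by the boundedness of √E η times its derivative, and the term with ∇φ by local integrability of E.
-/
lemma exists_energy_le_of_test [IsFiniteMeasure μ] (hΩ : IsOpen Ω) (hA : IsUniformlyElliptic Ω A) (h
    : IsPositiveSolution Ω A E G μ) (S : IsTruncSolution Ω A (fun x => E§x) G (finPart Ω E μ)) (hφ :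
    IsTestFunction Ω φ) : ∃ M, ∀ L, 1 ≤ L → ∃ u g, MemH10 Ω u g ∧ energyA Ω A g ≤ ofReal (1 / 4 * (∫
    x in Ω, φ x ^ 2 * bumpCut L E§x * Q[A,G,G]x) + M) ∧ ofReal (∫ x in Ω, φ x ^ 2 * bumpCut L E§x *
    Q[A,G,G]x) ≤ hardyR Ω A (fun x => E§x) G u := by
  obtain ⟨M, hM0, hM⟩ := exists_σ_deriv_le; have hem := h.weakGrad.locInt.aestronglyMeasurable
  have hGm := h.weakGrad.locInt_grad.aestronglyMeasurable; have hpos := h.ae_pos hΩ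
  have ha0 := hA.ae_nonneg hΩ G; have hi := S.int _ hφ.sq
  have hcr : Integrable (fun x => 1 * Q[A,G,∇ (fun x => φ x ^ 2)]x)
      vol[Ω] := hφ.sq.integrable_mul_matForm hΩ hA h.weakGrad.locInt_grad
    aestronglyMeasurable_const (C := 1) (by simp)
  simp only [one_mul] at hcr
  have hfp : Integrable (fun x => φ x ^ 2) (finPart Ω E μ) := hφ.sq.integrable _
  obtain ⟨C', hC'0, hC'⟩ := exists_integral_slopeCut_le (p := fun x => φ x ^ 2)
    (C := ∫ x, φ x ^ 2 ∂finPart Ω E μ + ∫ x in Ω, |Q[A,G,∇ (fun x => φ x ^ 2)]x|)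
    (fun x => sq_nonneg _) hpos ha0 hi (fun k hk hk01 => by
      have hk1 : ∀ t, |k t| ≤ 1 := fun t => abs_le.2 ⟨by linarith [(hk01 t).1], (hk01 t).2⟩
      have i1 : Integrable (fun x => k E§x * Q[A,G,∇ (fun x => φ x ^ 2)]x) vol[Ω] :=
        hφ.sq.integrable_mul_matForm hΩ hA h.weakGrad.locInt_grad
          (hk.continuous.comp_aestronglyMeasurable hem) fun x => hk1 _
      have e1 := S.eq _ hφ.sq _ hk; rw [truncForm, integral_add i1 (hi _ hk.deriv)] at e1
      have b1 : |∫ x, φ x ^ 2 * k E§x ∂finPart Ω E μ| ≤ ∫ x, φ x ^ 2 ∂finPart Ω E μ := by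
        rw [← norm_eq_abs]; refine norm_integral_le_of_norm_le hfp (.of_forall fun x => ?_)
        rw [norm_mul, norm_eq_abs, norm_eq_abs, abs_of_nonneg (sq_nonneg _)]
        exact mul_le_of_le_one_right (sq_nonneg _) (hk1 _)
      have b2 : |∫ x in Ω, k E§x * Q[A,G,∇ (fun x => φ x ^ 2)]x|
          ≤ ∫ x in Ω, |Q[A,G,∇ (fun x => φ x ^ 2)]x| := by
        rw [← norm_eq_abs]; refine norm_integral_le_of_norm_le hcr.abs (.of_forall fun x => ?_)
        rw [norm_mul]; exact mul_le_of_le_one_left (norm_nonneg _) (hk1 _)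
      rw [← eq_sub_iff_add_eq'] at e1; rw [e1]; exact (abs_sub _ _).trans (add_le_add b1 b2))
  obtain ⟨D, hD⟩ := hφ.gradient_bounded; obtain ⟨Bφ, hBφ⟩ := hφ.bounded
  obtain ⟨lam, Lam, hl0, hLam⟩ := hA.elliptic
  have hgm : AEStronglyMeasurable (∇ φ) vol[Ω] := hφ.continuous_gradient.aesm
  have hle : Integrable (fun x => E§x * Q[A,∇ φ,∇ φ]x) vol[Ω] := by
    refine integrable_of_le_of_compact (C := |Lam| * D ^ 2) h.weakGrad.locInt
      (hem.mul (hA.aestronglyMeasurable hgm hgm)) hφ.compactSupport hφ.support_subset ?_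
      (.of_forall fun x hx => by rw [gradient_eq_zero hx, matForm_zero_left, mul_zero])
    filter_upwards [hΩ.ae_mem] with x hx; rw [abs_mul, mul_comm, norm_eq_abs]
    refine mul_le_mul_of_nonneg_right ?_ (abs_nonneg _); rw [abs_of_nonneg (hA.matForm_nonneg hx _)]
    refine ((hLam x hx _).2.trans (mul_le_mul_of_nonneg_right (le_abs_self _) (by positivity))).trans
      ?_
    gcongr; exact hD x
  refine ⟨(1 + 2 * M) * C' + (1 / 2 + 2 * M) * (∫ x in Ω, |Q[A,G,∇ (fun x => φ x ^ 2)]x|)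
      + ∫ x in Ω, E§x * Q[A,∇ φ,∇ φ]x, fun L hL => ?_⟩
  have hL0 : 0 < L := one_pos.trans_le hL; have hW := isCutoff_sqrtCut hL0
  obtain ⟨B, hB⟩ := hW.bounded; obtain ⟨B', hB'⟩ := hW.deriv_bounded
  have hu := (h.weakGrad.comp hΩ hW.smooth hB hB').smooth_mul hΩ hφ.smooth
  have iW := hi _ (hW.deriv.mul hW.deriv)
  have hg1 : MemLp (fun x => φ x • deriv (sqrtCut L) E§x • G x) 2 vol[Ω] := by
    refine memLp_of_integrable_matForm hΩ hA (hφ.continuous.aesm.smul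
      ((hW.deriv.continuous.comp_aestronglyMeasurable hem).smul hGm))
      (iW.congr (.of_forall fun x => ?_))
    simp only [matForm_smul_left, matForm_smul_right]; ring
  have hg2 : MemLp (fun x => sqrtCut L E§x • ∇ φ x) 2 vol[Ω] := by
    refine (hφ.memLp_gradient 2 _).of_le_mul (c := B)
      ((hW.continuous.comp_aestronglyMeasurable hem).smul hgm) (.of_forall fun x => ?_)
    rw [norm_smul]; exact mul_le_mul_of_nonneg_right (hB _) (norm_nonneg _)
  have hgL : MemLp (fun x => φ x • deriv (sqrtCut L) E§x • G x
    + sqrtCut L E§x • ∇ φ x) 2 vol[Ω] := hg1.add hg2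
  have hmem : MemH10 Ω (fun x => φ x * sqrtCut L E§x)
      (fun x => φ x • deriv (sqrtCut L) E§x • G x + sqrtCut L E§x • ∇ φ x) := by
    refine hu.memH10 hΩ hφ.compactSupport hφ.support_subset (fun x hx => ?_) (fun x hx => ?_) ?_ hgL
    · rw [eq_zero_of_notMem hx, zero_mul]
    · rw [eq_zero_of_notMem hx, gradient_eq_zero hx, zero_smul, smul_zero, add_zero]
    · refine (hφ.memLp 2 _).of_le_mul (c := B) (hφ.continuous.aesm.mul
        (hW.continuous.comp_aestronglyMeasurable hem)) (.of_forall fun x => ?_)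
      rw [norm_mul, mul_comm]; exact mul_le_mul_of_nonneg_right (hB _) (norm_nonneg _)
  have ib := hi _ (isCutoff_bumpCut hL0); have is := hi _ (isCutoff_slopeCut hL0)
  refine ⟨_, _, hmem, ?_, ?_⟩
  · rw [energyA_eq_ofReal hΩ hA hgL]; refine ofReal_le_ofReal ?_
    calc _ ≤ ∫ x in Ω, (1 / 4 * (φ x ^ 2 * bumpCut L E§x * Q[A,G,G]x)
          + ((1 + 2 * M) * (φ x ^ 2 * slopeCut L E§x * Q[A,G,G]x)
          + ((1 / 2 + 2 * M) * |Q[A,G,∇ (fun x => φ x ^ 2)]x|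
          + E§x * Q[A,∇ φ,∇ φ]x))) := by
          refine integral_mono_ae (integrable_matForm hΩ hA hgL hgL) ((ib.const_mul _).add
            ((is.const_mul _).add ((hcr.abs.const_mul _).add hle))) ?_
          filter_upwards [hpos, ha0, hΩ.ae_mem] with x hx hax hxΩ
          have b1 := deriv_sqrtCut_sq_le hM hL hx; have b2 := abs_sqrtCut_mul_deriv_le hM hL hx
          have b3 := sqrtCut_sq (L := L) hx
          have b4 : sqrtCut L E§x ^ 2 ≤ E§x := by
            rw [b3]; exact mul_le_of_le_one_right hx.le (pow_le_one₀ logBump_nonneg logBump_le_one)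
          have c1 := mul_le_mul_of_nonneg_right (mul_le_mul_of_nonneg_left b1 (sq_nonneg (φ x))) hax
          have c2 := mul_le_mul_of_nonneg_right b4 (hA.matForm_nonneg hxΩ (∇ φ x))
          have c3 := (le_abs_self _).trans ((abs_mul (sqrtCut L E§x
            * deriv (sqrtCut L) E§x) (Q[A,G,∇ (fun x => φ x ^ 2)]x)).le.trans (mul_le_mul_of_nonneg_right b2 (abs_nonneg _)))
          rw [hφ.gradient_sq, matForm_smul_right] at c3 ⊢
          simp only [matForm_add_left, matForm_add_right, matForm_smul_left,
            matForm_smul_right, matForm_comm (hA.symm x hxΩ) (∇ φ x) (G x)]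
          linarith
      _ = _ := by
          have i3 : Integrable (fun x => (1 / 2 + 2 * M) * |Q[A,G,∇ (fun x => φ x ^ 2)]x|) vol[Ω] :=
            hcr.abs.const_mul _
          have i4 : Integrable (fun x => (1 / 2 + 2 * M) * |Q[A,G,∇ (fun x => φ x ^ 2)]x|
            + E§x * Q[A,∇ φ,∇ φ]x) vol[Ω] :=
            i3.add hle
          have i5 : Integrable (fun x => (1 + 2 * M) * (φ x ^ 2 * slopeCut L E§x
            * Q[A,G,G]x) + ((1 / 2 + 2 * M)
            * |Q[A,G,∇ (fun x => φ x ^ 2)]x|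
            + E§x * Q[A,∇ φ,∇ φ]x)) vol[Ω] :=
            (is.const_mul _).add i4
          rw [integral_add (ib.const_mul _) i5, integral_add (is.const_mul _) i4,
            integral_add i3 hle, integral_const_mul, integral_const_mul, integral_const_mul]
      _ ≤ _ := by
          have := mul_le_mul_of_nonneg_left (hC' L hL) (by positivity : 0 ≤ 1 + 2 * M)
          linarith
  · have h0 : 0 ≤ᵐ[vol[Ω]] fun x => φ x ^ 2 * bumpCut L E§x * Q[A,G,G]x := by
      filter_upwards [hpos, ha0] with x hx hax
        using mul_nonneg (mul_nonneg (sq_nonneg _) (bumpCut_nonneg hx)) hax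
    rw [ofReal_integral_eq_lintegral_ofReal ib h0, hardyR]; refine lintegral_mono_ae ?_
    filter_upwards [hpos] with x hx; refine le_of_eq ?_; congr 2
    rw [mul_pow, sqrtCut_sq hx, bumpCut_of_pos hx]; field_simp

/-- For interior weights, `1/4` is optimal. -/
theorem exists_energyA_lt_of_interior [IsFiniteMeasure μ] (hΩ : IsOpen Ω) (hA : IsUniformlyElliptic
    Ω A) (h : IsPositiveSolution Ω A E G μ) (S : IsTruncSolution Ω A (fun x => E§x) G (finPart Ω E
    μ)) (hint : IsInteriorWeight Ω E μ) (hμ : μ Ω ≠ 0) {c : ℝ≥0∞} (hc : 1 / 4 < c) : ∃ u g, MemH10 Ω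
    u g ∧ energyA Ω A g < c * hardyR Ω A (fun x => E§x) G u := by
  -- A measure is carried by its support, where an interior weight is infinite.
  have hT : μ {x ∈ Ω | E x = ⊤} ≠ 0 := fun h0 => hμ (by
    refine measure_mono_null (fun x hx => ?_)
      (measure_union_null h0 (mem_ae_iff.1 (support_mem_ae (μ := μ))))
    by_cases hs : x ∈ μ.support
    · exact Or.inl ⟨hx, hint x hx hs⟩
    · exact Or.inr hs)
  obtain ⟨φ, hφ, hne⟩ : ∃ φ, IsTestFunction Ω φ ∧ ∫ x in {x ∈ Ω | E x = ⊤}, φ x ^ 2 ∂μ ≠ 0 := by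
    by_contra! hall; exact hT (measure_eq_zero_of_testFunction hΩ (fun x hx => hx.1) hall)
  obtain ⟨M, hM⟩ := h.exists_energy_le_of_test hΩ hA S hφ
  choose u g hu hE hH using fun j : ℕ => hM (j + 1) (by simp)
  obtain ⟨j, hj⟩ := exists_lt_mul_of_unbounded (a := 1 / 4) (by norm_num)
    (by rwa [ofReal_quarter]) hE hH fun R => by
      by_contra! hR
      -- Bounded Hardy terms would make φ²|∇E|²/E integrable, and then φ² could not charge {E = ∞}.
      refine hne (h.setIntegral_sq_eq_zero hΩ hA S hφ (integrable_div_of_bumpCut_le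
        (fun x => sq_nonneg _) (h.ae_pos hΩ) ?_ (S.int _ hφ.sq) hR))
      exact hA.ae_nonneg hΩ _
  exact ⟨_, _, hu j, hj⟩

end IsPositiveSolution

end Sharpness

/-! ### Optimality of 1/4 and 1/2 for boundary weights. -/

section BoundarySharpness

lemma deriv_liftLog_sq (ht : 0 < t) : deriv (liftLog fun s => logBump L s ^ 2) t = 2 * logBump L
    (log t) * deriv (logBump L) (log t) / t := by
  rw [deriv_liftLog ((contDiff_logBump L).pow 2) ht, deriv_fun_pow
    ((contDiff_logBump L).differentiable (by simp) _)]
  norm_num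

lemma isCutoff_liftLog_sq (hL : 0 < L) : IsCutoff (liftLog fun s => logBump L s ^ 2) :=
  isCutoff_liftLog (L := L) ((contDiff_logBump L).pow 2) fun s hs => by simp [logBump_eq_zero hL hs]

lemma deriv_sqrtCut_sq_le' (hM : ∀ s, deriv σ s ≤ M) (hL : 0 < L) (ht : 0 < t) : deriv (sqrtCut L) t
    ^ 2 ≤ 1 / 4 * bumpCut L t + 1 / 2 * deriv (liftLog fun s => logBump L s ^ 2) t + 2 * M / L *
    slopeCut L t := by
  rw [deriv_sqrtCut_sq ht, bumpCut_of_pos ht, slopeCut_of_pos ht, deriv_liftLog_sq ht,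
    mul_div_assoc', mul_div_assoc', mul_div_assoc', ← add_div, ← add_div]
  refine div_le_div_of_nonneg_right ?_ ht.le; have h1 := abs_deriv_logBump_le (s := log t) hL
  have h2 := mul_le_mul (h1.trans (logSlope_le hM hL)) h1 (abs_nonneg _)
    ((abs_nonneg _).trans (h1.trans (logSlope_le hM hL)))
  rw [← sq, sq_abs] at h2; linarith

lemma deriv_liftLog_sq_le (hM : ∀ s, deriv σ s ≤ M) (hL : 0 < L) (ht : 0 < t) : deriv (liftLog fun s
    => logBump L s ^ 2) t ≤ 4 * M / L * t⁻¹ := by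
  rw [deriv_liftLog_sq ht, div_eq_mul_inv]; refine mul_le_mul_of_nonneg_right ?_ (inv_pos.2 ht).le
  have h1 := (abs_deriv_logBump_le (s := log t) hL).trans (logSlope_le hM hL)
  have h2 := mul_le_mul_of_nonneg_left ((le_abs_self _).trans h1)
    (logBump_nonneg (L := L) (s := log t))
  have h3 := mul_le_of_le_one_left ((abs_nonneg _).trans h1) (logBump_le_one (L := L) (s := log t))
  calc _ = 2 * (logBump L (log t) * deriv (logBump L) (log t)) := by ring
    _ ≤ 2 * (2 * M / L) := by linarith
    _ = _ := by ring

namespace IsPositiveSolution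

variable [IsFiniteMeasure μ]

lemma integrable_logBump_sq (hΩ : IsOpen Ω) (h : IsPositiveSolution Ω A E G μ) (L : ℝ) : Integrable
    (fun x => logBump L (log E§x) ^ 2) (finPart Ω E μ) := by
  refine Integrable.of_bound (C := 1) (((((contDiff_logBump L).continuous.pow 2).measurable.comp
    measurable_log).comp_aemeasurable (h.aemeasurable_toReal hΩ)).aestronglyMeasurable)
    (.of_forall fun x => ?_)
  rw [norm_pow, norm_of_nonneg logBump_nonneg]; exact pow_le_one₀ logBump_nonneg logBump_le_one

lemma tendsto_integral_logBump_sq (hΩ : IsOpen Ω) (h : IsPositiveSolution Ω A E G μ) : Tendsto (fun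
    j : ℕ => ∫ x, logBump (j + 1) (log E§x) ^ 2 ∂finPart Ω E μ) atTop (𝓝 ((finPart Ω E μ).real
    univ)) := by
  have := tendsto_integral_of_dominated_convergence (fun _ => (1 : ℝ))
    (fun j : ℕ => (h.integrable_logBump_sq hΩ (j + 1)).1) (integrable_const _)
    (f := fun _ => (1 : ℝ)) (fun j => .of_forall fun x => ?_)
    (.of_forall fun x => tendsto_nhds_of_eventually_eq ?_)
  · rwa [integral_const, smul_eq_mul, mul_one] at this
  · rw [norm_pow, norm_of_nonneg logBump_nonneg]; exact pow_le_one₀ logBump_nonneg logBump_le_one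
  · filter_upwards [eventually_logBump_eq_one (log E§x)] with j hj; rw [hj, one_pow]

lemma setLIntegral_wMeas (hΩ : IsOpen Ω) (h : IsPositiveSolution Ω A E G μ) (S : IsTruncSolution Ω A
    (fun x => E§x) G (finPart Ω E μ)) (f : Eu n → ℝ≥0∞) : ∫⁻ x in Ω, f x ∂wMeas (fun x => E§x)
    (finPart Ω E μ) = ∫⁻ x, ofReal (E§x)⁻¹ * f x ∂finPart Ω E μ := by
  have h1 : ∀ᵐ x ∂wMeas (fun x => E§x) (finPart Ω E μ), x ∈ Ω :=
    withDensity_absolutelyContinuous _ _ |>.ae_le ((h.ae_finPart_pos hΩ).mono fun x hx => hx.1)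
  rw [restrict_eq_self_of_ae_mem h1, S.lintegral_wMeas]

/-- For u = √E η(log E) every term of (2) is explicit; in particular u²/E = η(log E)², so the
measure term tends to μ({E < ∞}). -/
lemma sqrtCut_boundary (hΩ : IsOpen Ω) (hA : IsUniformlyElliptic Ω A) (h : IsPositiveSolution Ω A E
    G μ) (S : IsTruncSolution Ω A (fun x => E§x) G (finPart Ω E μ)) (hbd : IsBoundaryWeight Ω E) (hL
    : 0 < L) : MemH10 Ω (fun x => sqrtCut L E§x) (fun x => deriv (sqrtCut L) (E x).toReal • G x) ∧
    energyA Ω A (fun x => deriv (sqrtCut L) E§x • G x) = ofReal (∫ x in Ω, deriv (sqrtCut L) E§x ^ 2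
    * Q[A,G,G]x) ∧ hardyR Ω A (fun x => E§x) G (fun x => sqrtCut L E§x) = ofReal (∫ x in Ω, bumpCut
    L E§x * Q[A,G,G]x) ∧ ∫⁻ x in Ω, preciseSq (fun x => sqrtCut L E§x) x ∂wMeas (fun x => E§x)
    (finPart Ω E μ) = ofReal (∫ x, logBump L (log E§x) ^ 2 ∂finPart Ω E μ) := by
  have hW := isCutoff_sqrtCut hL; have hmem := h.memH10_comp hΩ hA S hbd hW
  refine ⟨hmem, ?_, ?_, ?_⟩
  · rw [energyA_eq_ofReal hΩ hA hmem.memLp_grad]; congr 2; ext x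
    rw [matForm_smul_left, matForm_smul_right]; ring
  · rw [ofReal_integral_eq_lintegral_ofReal
      (h.integral_deriv_comp_bounds hΩ hA S hbd (isCutoff_bumpCut hL)).1, hardyR]
    · refine lintegral_congr_ae ?_; filter_upwards [h.ae_pos hΩ] with x hx
      rw [sqrtCut_sq hx, bumpCut_of_pos hx]; congr 2; field_simp
    · filter_upwards [h.ae_pos hΩ, hΩ.ae_mem] with x hx hxΩ
        using mul_nonneg (bumpCut_nonneg hx) (hA.matForm_nonneg hxΩ _)
  · rw [h.setLIntegral_wMeas hΩ S, ofReal_integral_eq_lintegral_ofReal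
      (h.integrable_logBump_sq hΩ L) (.of_forall fun x => sq_nonneg _)]
    refine lintegral_congr_ae ?_; filter_upwards [h.ae_finPart_pos hΩ] with x ⟨hxΩ, hx, hx0⟩
    rw [h.preciseSq_comp hΩ hW hxΩ hx, ← ofReal_mul (inv_pos.2 hx0).le, sqrtCut_sq hx0,
      inv_mul_cancel_left₀ hx0.ne']

/-- In (½η + η')² = ¼η² + ½(η²)' + (η')² the middle term is kept exactly, as it saturates the
measure term. The last is at most (2M/L) times the slope bound, whose integral is bounded in L; this
gives the error C/L. -/
lemma exists_sqrtCut_excess_le (hΩ : IsOpen Ω) (hA : IsUniformlyElliptic Ω A) (h :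
    IsPositiveSolution Ω A E G μ) (S : IsTruncSolution Ω A (fun x => E§x) G (finPart Ω E μ)) (hbd :
    IsBoundaryWeight Ω E) : ∃ C, 0 ≤ C ∧ ∀ L, 1 ≤ L → ∫ x in Ω, deriv (sqrtCut L) (E x).toReal ^ 2 *
    Q[A,G,G]x ≤ 1 / 4 * (∫ x in Ω, bumpCut L E§x * Q[A,G,G]x) + 1 / 2 * (∫ x in Ω, deriv (liftLog
    fun s => logBump L s ^ 2) E§x * Q[A,G,G]x) + C / L := by
  obtain ⟨M, hM0, hM⟩ := exists_σ_deriv_le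
  have hi := fun k hk => (h.integral_deriv_comp_bounds hΩ hA S hbd (l := k) hk).1
  have ha0 := hA.ae_nonneg hΩ G
  obtain ⟨C', hC'0, hC'⟩ := exists_integral_slopeCut_le (p := fun _ => 1)
    (C := (finPart Ω E μ).real univ) (fun _ => zero_le_one) (h.ae_pos hΩ) ha0
    (fun k hk => by simpa only [one_mul] using hi k hk) (fun k hk hk01 => by
      obtain ⟨b1, b2⟩ := (h.integral_deriv_comp_bounds hΩ hA S hbd hk).2 fun t => (hk01 t).1
      simp only [one_mul]; rw [abs_of_nonneg b1]
      refine b2.trans ((integral_mono_of_nonneg (.of_forall fun x => (hk01 _).1)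
        (integrable_const 1) (.of_forall fun x => (hk01 _).2)).trans_eq ?_)
      rw [integral_const, smul_eq_mul, mul_one])
  simp only [one_mul] at hC'; refine ⟨2 * M * C', by positivity, fun L hL => ?_⟩
  have hL0 : 0 < L := one_pos.trans_le hL; have hW := isCutoff_sqrtCut hL0
  have ib := (hi _ (isCutoff_bumpCut hL0)).const_mul (1 / 4)
  have il := (hi _ (isCutoff_liftLog_sq hL0).deriv).const_mul (1 / 2)
  have is := (hi _ (isCutoff_slopeCut hL0)).const_mul (2 * M / L)
  have ibl : Integrable (fun x => 1 / 4 * (bumpCut L E§x * Q[A,G,G]x)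
    + 1 / 2 * (deriv (liftLog fun s => logBump L s ^ 2) E§x * Q[A,G,G]x))
    vol[Ω] := ib.add il
  calc _ ≤ ∫ x in Ω, (1 / 4 * (bumpCut L E§x * Q[A,G,G]x)
        + 1 / 2 * (deriv (liftLog fun s => logBump L s ^ 2) E§x * Q[A,G,G]x)
        + 2 * M / L * (slopeCut L E§x * Q[A,G,G]x)) := by
        refine integral_mono_ae ?_ (ibl.add is) ?_
        · simpa only [sq] using hi _ (hW.deriv.mul hW.deriv)
        · filter_upwards [h.ae_pos hΩ, ha0] with x hx hax
          have := mul_le_mul_of_nonneg_right (deriv_sqrtCut_sq_le' hM hL0 hx) hax; linarith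
    _ = _ + _ + 2 * M / L * (∫ x in Ω, slopeCut L E§x * Q[A,G,G]x) := by
        rw [integral_add ibl is, integral_add ib il, integral_const_mul, integral_const_mul,
          integral_const_mul]
    _ ≤ _ := by
        have := mul_le_mul_of_nonneg_left (hC' L hL) (by positivity : 0 ≤ 2 * M / L)
        have e : 2 * M * C' / L = 2 * M / L * C' := by ring
        linarith

/-- This converts the middle term of the excess into ∫ η(log E)² dμ over {E < ∞}, the exact
counterpart of the measure term. -/
lemma integral_deriv_liftLog_le (hΩ : IsOpen Ω) (hA : IsUniformlyElliptic Ω A) (h :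
    IsPositiveSolution Ω A E G μ) (S : IsTruncSolution Ω A (fun x => E§x) G (finPart Ω E μ)) (hbd :
    IsBoundaryWeight Ω E) (hL : 0 < L) : ∫ x in Ω, deriv (liftLog fun s => logBump L s ^ 2) E§x *
    Q[A,G,G]x ≤ ∫ x, logBump L (log E§x) ^ 2 ∂finPart Ω E μ := by
  refine ((h.integral_deriv_comp_bounds hΩ hA S hbd (isCutoff_liftLog_sq hL)).2 fun t => ?_).2.trans_eq
    (integral_congr_ae ?_)
  · rw [liftLog]
    split_ifs <;> positivity
  · filter_upwards [h.ae_finPart_pos hΩ] with x hx using liftLog_of_pos _ hx.2.2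

/-- For boundary weights, the weighted energy of `√E` is infinite. -/
lemma exists_lt_integral_bumpCut (hΩ : IsOpen Ω) (hA : IsUniformlyElliptic Ω A) (h :
    IsPositiveSolution Ω A E G μ) (S : IsTruncSolution Ω A (fun x => E§x) G (finPart Ω E μ)) (hbd :
    IsBoundaryWeight Ω E) (hμ : μ Ω ≠ 0) (R : ℝ) : ∃ j : ℕ, R < ∫ x in Ω, bumpCut (j + 1) E§x *
    Q[A,G,G]x := by
  by_contra! hR; have hi := fun k hk => (h.integral_deriv_comp_bounds hΩ hA S hbd (l := k) hk).1
  have ha0 := hA.ae_nonneg hΩ G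
  have hae := integrable_div_of_bumpCut_le (p := fun _ => 1) (fun _ => zero_le_one)
    (h.ae_pos hΩ) ha0 (fun k hk => by simpa only [one_mul] using hi k hk)
    (by simpa only [one_mul] using hR)
  simp only [one_div] at hae
  -- If the integrals were bounded, |∇E|²/E would be integrable, so μ would not charge {E = ∞}; the
  -- finite part remains to be excluded.
  have hT : μ {x ∈ Ω | E x = ⊤} = 0 := by
    refine measure_eq_zero_of_testFunction hΩ (fun x hx => hx.1) fun φ hφ =>
      h.setIntegral_sq_eq_zero hΩ hA S hφ ?_
    obtain ⟨C, hC⟩ := hφ.sq.bounded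
    refine (hae.bdd_mul (c := C) hφ.sq.continuous.aesm
      (.of_forall hC)).congr (.of_forall fun x => ?_)
    simp only; ring
  obtain ⟨M, hM0, hM⟩ := exists_σ_deriv_le
  obtain ⟨C, hC0, hC⟩ := h.exists_sqrtCut_excess_le hΩ hA S hbd
  set J := ∫ x in Ω, (E§x)⁻¹ * Q[A,G,G]x
  -- Inequality (2) is applied to the trial function. The quarter terms cancel, and since the
  -- derivative of the cutoff η(log t)² is at most (4M/L)/t, what bounds the measure term is O(1/L).
  -- In the limit the finite part of μ vanishes as well.
  have key : ∀ j : ℕ, ∫ x, logBump (j + 1) (log E§x) ^ 2 ∂finPart Ω E μ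
      ≤ (4 * M * J + 2 * C) / ((j : ℝ) + 1) := fun j => by
    have hL : (0 : ℝ) < j + 1 := by positivity
    obtain ⟨hmem, e1, e2, e3⟩ := h.sqrtCut_boundary hΩ hA S hbd hL
    have h1 := le_trans (add_le_add_left (le_add_left le_rfl) _) (S.hardy_memH10 hmem)
    have hY : 0 ≤ ∫ x in Ω, bumpCut (j + 1) E§x * Q[A,G,G]x := by
      refine integral_nonneg_of_ae ?_
      filter_upwards [h.ae_pos hΩ, ha0] with x hx hax using mul_nonneg (bumpCut_nonneg hx) hax
    rw [e1, e2, e3, ← ofReal_quarter, ← ofReal_half, ← ofReal_mul (by norm_num),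
      ← ofReal_mul (by norm_num), ← ofReal_add (by positivity) (by positivity)] at h1
    have h2 := (ofReal_le_ofReal_iff (integral_nonneg_of_ae (by
      filter_upwards [ha0] with x hax using mul_nonneg (sq_nonneg _) hax))).1 h1
    have h3 : ∫ x in Ω, deriv (liftLog fun s => logBump (j + 1) s ^ 2) E§x
        * Q[A,G,G]x ≤ 4 * M / (j + 1) * J := by
      rw [← integral_const_mul]
      refine integral_mono_ae (hi _ (isCutoff_liftLog_sq hL).deriv) (hae.const_mul _) ?_
      filter_upwards [h.ae_pos hΩ, ha0] with x hx hax
      have := mul_le_mul_of_nonneg_right (deriv_liftLog_sq_le hM hL hx) hax; linarith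
    have h4 := hC (j + 1) (by simp)
    have e : (4 * M * J + 2 * C) / ((j : ℝ) + 1) = 4 * M / (j + 1) * J + 2 * (C / (j + 1)) := by
      ring
    linarith
  have h5 := le_of_tendsto_of_tendsto' (h.tendsto_integral_logBump_sq hΩ)
    (tendsto_const_nhds.div_atTop (tendsto_atTop_add_const_right _ _
      tendsto_natCast_atTop_atTop)) key
  have h6 : finPart Ω E μ univ = 0 :=
    (measureReal_eq_zero_iff).1 (le_antisymm h5 measureReal_nonneg)
  rw [finPart, restrict_apply_univ] at h6
  refine hμ (measure_mono_null (fun x hx => ?_) (measure_union_null h6 hT))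
  rcases eq_or_ne (E x) ⊤ with hE | hE
  exacts [Or.inr ⟨hx, hE⟩, Or.inl ⟨hx, hE.lt_top⟩]

/-- For boundary weights, `1/4` is optimal. -/
theorem exists_energyA_lt_of_boundary (hΩ : IsOpen Ω) (hA : IsUniformlyElliptic Ω A) (h :
    IsPositiveSolution Ω A E G μ) (S : IsTruncSolution Ω A (fun x => E§x) G (finPart Ω E μ)) (hbd :
    IsBoundaryWeight Ω E) (hμ : μ Ω ≠ 0) {c : ℝ≥0∞} (hc : 1 / 4 < c) : ∃ u g, MemH10 Ω u g ∧ energyA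
    Ω A g < c * hardyR Ω A (fun x => E§x) G u := by
  obtain ⟨C, hC0, hC⟩ := h.exists_sqrtCut_excess_le hΩ hA S hbd
  obtain ⟨I, hI⟩ := (h.tendsto_integral_logBump_sq hΩ).bddAbove_range
  have hb := fun j : ℕ => h.sqrtCut_boundary hΩ hA S hbd (L := j + 1) (by positivity)
  have hle : ∀ j : ℕ, energyA Ω A (fun x => deriv (sqrtCut (j + 1)) E§x • G x)
      ≤ ofReal (1 / 4 * (∫ x in Ω, bumpCut (j + 1) E§x
        * Q[A,G,G]x) + (1 / 2 * I + C)) := fun j => by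
    rw [(hb j).2.1]; refine ofReal_le_ofReal ?_; have h1 := hC (j + 1) (by simp)
    have h2 := h.integral_deriv_liftLog_le hΩ hA S hbd (L := j + 1) (by positivity)
    have h3 := hI ⟨j, rfl⟩; have h4 : C / ((j : ℝ) + 1) ≤ C := div_le_self hC0 (by simp)
    simp only at h3; linarith
  obtain ⟨j, hj⟩ := exists_lt_mul_of_unbounded (by norm_num) (by rwa [ofReal_quarter]) hle
    (fun j => (hb j).2.2.1.ge) (h.exists_lt_integral_bumpCut hΩ hA S hbd hμ)
  exact ⟨_, _, (hb j).1, hj⟩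

/-- For boundary weights, `1/2` is optimal. -/
theorem exists_energyA_lt_of_boundary' (hΩ : IsOpen Ω) (hA : IsUniformlyElliptic Ω A) (h :
    IsPositiveSolution Ω A E G μ) (S : IsTruncSolution Ω A (fun x => E§x) G (finPart Ω E μ)) (hbd :
    IsBoundaryWeight Ω E) (hμ : μ {x ∈ Ω | E x < ⊤} ≠ 0) {c : ℝ≥0∞} (hc : 1 / 2 < c) : ∃ u g, MemH10
    Ω u g ∧ energyA Ω A g < 1 / 4 * hardyR Ω A (fun x => E§x) G u + c * ∫⁻ x in Ω, preciseSq u x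
    ∂wMeas (fun x => E§x) (finPart Ω E μ) := by
  obtain ⟨C, hC0, hC⟩ := h.exists_sqrtCut_excess_le hΩ hA S hbd
  obtain ⟨r, hr1, hr2⟩ := lt_iff_exists_nnreal_btwn.1 hc; rw [← ofReal_half] at hr1
  have hr : 1 / 2 < (r : ℝ) := by
    rwa [ofReal, coe_lt_coe, ← NNReal.coe_lt_coe, coe_toNNReal _ (by norm_num)] at hr1
  have hν : 0 < (finPart Ω E μ).real univ := by
    refine toReal_pos ?_ (measure_ne_top _ _); rwa [finPart, restrict_apply_univ]
  -- Raising ½ to r gains (r − ½) ∫ η² dμ, which tends to a positive number, whereas the error C/L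
  -- tends to 0.
  have hlim := ((h.tendsto_integral_logBump_sq hΩ).const_mul ((r : ℝ) - 1 / 2)).sub
    ((tendsto_const_nhds (x := C)).div_atTop (tendsto_atTop_add_const_right _ (1 : ℝ)
      tendsto_natCast_atTop_atTop))
  rw [sub_zero] at hlim
  obtain ⟨j, hj⟩ := (hlim.eventually (lt_mem_nhds (mul_pos (sub_pos.2 hr) hν))).exists
  have hL : (0 : ℝ) < j + 1 := by positivity
  obtain ⟨hmem, e1, e2, e3⟩ := h.sqrtCut_boundary hΩ hA S hbd hL
  refine ⟨_, _, hmem, lt_of_lt_of_le ?_ (add_le_add_right (mul_le_mul_left hr2.le _) _)⟩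
  have hY : 0 ≤ ∫ x in Ω, bumpCut (j + 1) E§x * Q[A,G,G]x := by
    refine integral_nonneg_of_ae ?_
    filter_upwards [h.ae_pos hΩ, hΩ.ae_mem] with x hx hxΩ
      using mul_nonneg (bumpCut_nonneg hx) (hA.matForm_nonneg hxΩ _)
  have h1 := hC (j + 1) (by simp)
  have h2 := h.integral_deriv_liftLog_le hΩ hA S hbd hL
  rw [e1, e2, e3, ← ofReal_quarter, ← ofReal_coe_nnreal, ← ofReal_mul (by norm_num),
    ← ofReal_mul r.coe_nonneg, ← ofReal_add (by positivity) (by positivity)]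
  refine (ofReal_lt_ofReal_iff_of_nonneg (integral_nonneg_of_ae ?_)).2 (by linarith)
  filter_upwards [hΩ.ae_mem] with x hxΩ using mul_nonneg (sq_nonneg _) (hA.matForm_nonneg hxΩ _)

end IsPositiveSolution

end BoundarySharpness

/-! ### The general inequality. -/

section GeneralHardy

namespace IsPositiveSolution

lemma hardyTerm_eq (hΩ : IsOpen Ω) (h : IsPositiveSolution Ω A E G μ) (u : Eu n → ℝ) : hardyTerm Ω A
    E G u = hardyR Ω A (fun x => E§x) G u := by
  refine lintegral_congr_ae ?_; filter_upwards [h.ae_pos hΩ, h.finite_ae] with x hx hxt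
  have e : E x = ofReal E§x := (ofReal_toReal hxt.ne).symm
  rw [e, toReal_ofReal hx.le, ← ofReal_pow hx.le,
    ← ofReal_div_of_pos (pow_pos hx 2), mul_comm, ← ofReal_mul (sq_nonneg _)]
  congr 1; ring

/-- The convention 1/∞ = 0 discards exactly the part of μ that the truncated equation does not see.
-/
lemma measureTerm_eq [IsFiniteMeasure μ] (hΩ : IsOpen Ω) (h : IsPositiveSolution Ω A E G μ) (S :
    IsTruncSolution Ω A (fun x => E§x) G (finPart Ω E μ)) (u : Eu n → ℝ) : measureTerm Ω E μ u = ∫⁻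
    x in Ω, preciseSq u x ∂wMeas (fun x => E§x) (finPart Ω E μ) := by
  have hT := h.measurableSet_lt hΩ ⊤; rw [h.setLIntegral_wMeas hΩ S, measureTerm, finPart]
  calc _ = ∫⁻ x in Ω, {x ∈ Ω | E x < ⊤}.indicator (fun x => preciseSq u x / E x) x ∂μ := by
        refine setLIntegral_congr_fun hΩ.measurableSet fun x hx => ?_
        by_cases hE : E x < ⊤
        · rw [indicator_of_mem (show x ∈ {x ∈ Ω | E x < ⊤} from ⟨hx, hE⟩)]
        · rw [indicator_of_notMem fun h' => hE h'.2, not_lt_top_iff.1 hE, div_top]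
    _ = ∫⁻ x in {x ∈ Ω | E x < ⊤}, preciseSq u x / E x ∂μ := by
        rw [lintegral_indicator hT, restrict_restrict hT,
          inter_eq_self_of_subset_left fun x hx => hx.1]
    _ = _ := by
        refine setLIntegral_congr_fun hT fun x hx => ?_
        rw [ofReal_inv_of_pos (toReal_pos (h.pos x hx.1).ne' hx.2.ne),
          ofReal_toReal hx.2.ne, mul_comm, div_eq_mul_inv]

end IsPositiveSolution

theorem generalHardy (hn : 1 ≤ n) (hΩ : IsOpen Ω) (hA : IsUniformlyElliptic Ω A) [IsFiniteMeasure μ]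
    (h : IsPositiveSolution Ω A E G μ) (hreg : RegularData Ω A E G) : (∀ u g, MemH10 Ω u g → 1 / 4 *
    hardyTerm Ω A E G u ≤ energyA Ω A g) ∧ (μ Ω ≠ 0 → IsInteriorWeight Ω E μ ∨ IsBoundaryWeight Ω E
    → (∀ c : ℝ≥0∞, 1 / 4 < c → ∃ u g, MemH10 Ω u g ∧ energyA Ω A g < c * hardyTerm Ω A E G u) ∧ (∀ u
    g, MemH10 Ω u g → IsNontrivialOn Ω u → 1 / 4 * hardyTerm Ω A E G u < energyA Ω A g)) ∧ (μ Ω ≠ 0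
    → IsBoundaryWeight Ω E → (∀ u g, MemH10 Ω u g → 1 / 4 * hardyTerm Ω A E G u + 1 / 2 *
    measureTerm Ω E μ u ≤ energyA Ω A g) ∧ (∀ c : ℝ≥0∞, 1 / 4 < c → ∃ u g, MemH10 Ω u g ∧ energyA Ω
    A g < c * hardyTerm Ω A E G u + 1 / 2 * measureTerm Ω E μ u) ∧ (μ {x ∈ Ω | E x < ⊤} ≠ 0 → ∀ c :
    ℝ≥0∞, 1 / 2 < c → ∃ u g, MemH10 Ω u g ∧ energyA Ω A g < 1 / 4 * hardyTerm Ω A E G u + c *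
    measureTerm Ω E μ u) ∧ (∀ u g, MemH10 Ω u g → IsNontrivialOn Ω u → 1 / 4 * hardyTerm Ω A E G u +
    1 / 2 * measureTerm Ω E μ u < energyA Ω A g)) := by
  have S := h.isTruncSolution_of_regularData hΩ hA hreg
  simp only [h.hardyTerm_eq hΩ, h.measureTerm_eq hΩ S]
  have hle := fun u g (hu : MemH10 Ω u g) => (le_add_self.trans (add_assoc _ _ _).symm.le).trans
    (S.hardy_memH10 hu)
  have hlt := fun u g (hu : MemH10 Ω u g) hu0 => S.hardy_strict hn hu hu0 (h.ae_pos hΩ)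
  refine ⟨fun u g hu => le_self_add.trans (hle u g hu), fun hμ hw => ⟨fun c hc => ?_,
    fun u g hu hu0 => le_self_add.trans_lt (hlt u g hu hu0)⟩, fun hμ hbd => ⟨hle, fun c hc => ?_,
    fun hμ' c hc => h.exists_energyA_lt_of_boundary' hΩ hA S hbd hμ' hc, hlt⟩⟩
  · exact hw.elim (fun hw => h.exists_energyA_lt_of_interior hΩ hA S hw hμ hc)
      fun hw => h.exists_energyA_lt_of_boundary hΩ hA S hw hμ hc
  -- Optimality of ¼ with ½ fixed follows from optimality in (1), as the added measure term is
  -- nonnegative.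
  · obtain ⟨u, g, hu, hlt⟩ := h.exists_energyA_lt_of_boundary hΩ hA S hbd hμ hc
    exact ⟨u, g, hu, hlt.trans_le le_self_add⟩

end GeneralHardy

/-! ### Powers of the distance to a set. -/

section Distance

lemma measurable_gradient (f : Eu n → ℝ) : Measurable (∇ f) :=
  (InnerProductSpace.toDual ℝ (Eu n)).symm.continuous.measurable.comp (measurable_fderiv ℝ f)

lemma norm_gradient (f : Eu n → ℝ) (x : Eu n) : ‖∇ f x‖ = ‖fderiv ℝ f x‖ :=
  LinearIsometryEquiv.norm_map _ _

lemma LipschitzWith.hasWeakGradient {a : Eu n → ℝ} {L : ℝ≥0} (ha : LipschitzWith L a) :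
    HasWeakGradient Ω a (∇ a) := by
  have hb : ∀ x, ‖∇ a x‖ ≤ L := fun x =>
    (norm_gradient a x).trans_le (norm_fderiv_le_of_lipschitz ℝ ha)
  have hl : LocallyIntegrable (∇ a) volume := by
    refine (locallyIntegrable_const (L : ℝ)).mono (measurable_gradient a).aestronglyMeasurable
      (.of_forall fun x => (hb x).trans (le_abs_self _))
  refine ⟨ha.continuous.locallyIntegrable.locallyIntegrableOn _, hl.locallyIntegrableOn _,
    fun φ hφ => ?_⟩
  have i1 : Integrable (fun x => a x • ∇ φ x) :=
    ((ha.continuous.smul hφ.continuous_gradient)).integrable_of_hasCompactSupport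
      hφ.hasCompactSupport_gradient.smul_left
  have i2 : Integrable (fun x => φ x • ∇ a x) :=
    (hφ.integrable volume).smul_bdd L (measurable_gradient a).aestronglyMeasurable (.of_forall hb)
  rw [setIntegral_eq_integral_of_forall_compl_eq_zero fun x hx => by
      rw [gradient_eq_zero fun h => hx (hφ.support_subset h), smul_zero],
    setIntegral_eq_integral_of_forall_compl_eq_zero fun x hx => by
      rw [eq_zero_of_notMem fun h => hx (hφ.support_subset h), zero_smul]]
  ext i; rw [PiLp.neg_apply, integral_coord i1, integral_coord i2]
  refine (ha.hasWeakPartial i φ hφ.mono_univ).trans (congrArg Neg.neg (integral_congr_ae ?_))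
  filter_upwards [ha.ae_differentiableAt] with x hx
  rw [hx.lineDeriv_eq_fderiv, ← gradient_coord, PiLp.smul_apply, smul_eq_mul, mul_comm]

/-- The distance is 1-Lipschitz, and along the segment towards a nearest point it decreases at unit
rate. -/
lemma norm_gradient_infDist {M : Set (Eu n)} (hM : M.Nonempty) (hx : x ∉ closure M) (hd :
    DifferentiableAt ℝ (fun x => infDist x M) x) : ‖∇ (fun x => infDist x M) x‖ = 1 := by
  rw [norm_gradient]
  refine le_antisymm (by simpa using norm_fderiv_le_of_lipschitz ℝ (lipschitz_infDist_pt M)) ?_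
  have h0 := (infDist_pos_iff_notMem_closure hM).1 hx
  obtain ⟨y, hy, hxy⟩ := isClosed_closure.exists_infDist_eq_dist hM.closure x
  rw [infDist_closure] at hxy
  have h1 : HasDerivAt (fun t : ℝ => infDist (x + t • (y - x)) M)
      (fderiv ℝ (fun x => infDist x M) x (y - x)) 0 := by
    have hl : HasDerivAt (fun t : ℝ => x + t • (y - x)) (y - x) 0 := by
      simpa using ((hasDerivAt_id (0 : ℝ)).smul_const (y - x)).const_add x
    exact HasFDerivAt.comp_hasDerivAt (f := fun t : ℝ => x + t • (y - x)) 0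
      (by simpa using hd.hasFDerivAt) hl
  have h2 := le_of_tendsto h1.tendsto_slope_zero_right (b := -infDist x M) (by
    filter_upwards [Ioo_mem_nhdsGT one_pos] with t ht
    have h3 : infDist (x + t • (y - x)) M ≤ (1 - t) * infDist x M := by
      rw [← infDist_closure, hxy]; refine (infDist_le_dist_of_mem hy).trans_eq ?_
      rw [dist_eq_norm, dist_eq_norm, show x + t • (y - x) - y = (1 - t) • (x - y) by module,
        norm_smul, norm_of_nonneg (by linarith [ht.2])]
    simp only [zero_add, zero_smul, add_zero, smul_eq_mul]; rw [inv_mul_le_iff₀ ht.1]; linarith)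
  have h3 := (neg_le_neg h2).trans ((neg_le_abs _).trans
    ((fderiv ℝ (fun x => infDist x M) x).le_opNorm (y - x)))
  rw [neg_neg, ← dist_eq_norm, dist_comm, ← hxy] at h3
  exact le_of_mul_le_mul_right (by rwa [one_mul]) h0

lemma tsupport_partial_subset (φ : Eu n → ℝ) (i : Fin n) : (tsupport fun x => ∇ φ x i) ⊆ tsupport φ
    :=
  (tsupport_comp_subset (g := fun y : Eu n => y i) rfl _).trans (tsupport_gradient_subset φ)

lemma IsTestFunction.isTestFunction_partial (hφ : IsTestFunction Ω φ) (i : Fin n) : IsTestFunction Ω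
    fun x => ∇ φ x i := by
  refine ⟨?_, hφ.hasCompactSupport_gradient.comp_left (g := fun y : Eu n => y i) rfl,
    (tsupport_partial_subset φ i).trans hφ.support_subset⟩
  simp only [gradient_coord]; exact (hφ.smooth.fderiv_right (by simp)).clm_apply contDiff_const

lemma IsTestFunction.laplacian_eq (hφ : IsTestFunction Ω φ) (x : Eu n) : Laplacian.laplacian φ x = ∑
    i, ∇ (fun y => ∇ φ y i) x i := by
  rw [InnerProductSpace.laplacian_eq_iteratedFDeriv_orthonormalBasis φ
    (EuclideanSpace.basisFun (Fin n) ℝ)]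
  refine Finset.sum_congr rfl fun i _ => ?_
  have hd : DifferentiableAt ℝ (fderiv ℝ φ) x :=
    (hφ.smooth.fderiv_right (m := ∞) (by simp)).differentiable (by simp) x
  simp only [iteratedFDeriv_two_apply, gradient_coord]
  rw [fderiv_clm_apply hd (differentiableAt_const _)]; simp

lemma HasWeakGradient.integral_laplacian (h : HasWeakGradient Ω v g) (hφ : IsTestFunction Ω φ) : ∫ x
    in Ω, v x * Laplacian.laplacian φ x = -∫ x in Ω, matForm 1 (g x) (∇ φ x) := by
  have ht := hφ.isTestFunction_partial
  have i1 : ∀ i, Integrable (fun x => v x • ∇ (fun y => ∇ φ y i) x)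
      vol[Ω] := fun i => integrable_smul_continuous h.locInt
    (ht i).continuous_gradient (ht i).compactSupport (ht i).support_subset
      fun x hx => gradient_eq_zero hx
  have i2 : ∀ i, Integrable (fun x => ∇ φ x i • g x) vol[Ω] := fun i => by
    obtain ⟨C, hC⟩ := (ht i).bounded
    exact integrable_smul_of_compact h.locInt_grad (ht i).continuous.aesm hC
      (ht i).compactSupport (ht i).support_subset fun x hx =>
        eq_zero_of_notMem (f := fun x => ∇ φ x i) hx
  have e1 : ∀ x, v x * Laplacian.laplacian φ x
      = ∑ i, (v x • ∇ (fun y => ∇ φ y i) x) i := fun x => by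
    simp [hφ.laplacian_eq, Finset.mul_sum]
  have e2 : ∀ x, matForm 1 (g x) (∇ φ x) = ∑ i, (∇ φ x i • g x) i := fun x => by
    rw [matForm_one, PiLp.inner_apply]; simp
  simp only [e1, e2]
  rw [integral_finsetSum _ fun i _ => (i1 i).coord i, integral_finsetSum _ fun i _ => (i2 i).coord i,
    ← Finset.sum_neg_distrib]
  refine Finset.sum_congr rfl fun i _ => ?_
  rw [← integral_coord (i1 i), ← integral_coord (i2 i), h.parts _ (ht i), PiLp.neg_apply]

/-- The weak ∇ of a power of the distance to `M`. -/
noncomputable def distPowGrad (M : Set (Eu n)) (s : ℝ) (x : Eu n) : Eu n :=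
  (s * infDist x M ^ (s - 1)) • ∇ (fun x => infDist x M) x

variable {M : Set (Eu n)}

lemma continuousOn_infDist_rpow (hpos : ∀ x ∈ Ω, 0 < infDist x M) (s : ℝ) :
    ContinuousOn (fun x => infDist x M ^ s) Ω := fun x hx =>
  ((continuous_infDist_pt M).continuousAt.rpow_const (Or.inl (hpos x hx).ne')).continuousWithinAt

lemma memLp_distPowGrad (hpos : ∀ x ∈ Ω, 0 < infDist x M) (hK : IsCompact K) (hKΩ : K ⊆ Ω) (s : ℝ)
    (p : ℝ≥0∞) : MemLp (K.indicator (distPowGrad M s)) p volume := by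
  rw [memLp_indicator_iff_restrict hK.measurableSet]
  haveI : IsFiniteMeasure (volume.restrict K) := ⟨by simpa using hK.measure_lt_top⟩
  have hc := (continuousOn_infDist_rpow hpos (s - 1)).mono hKΩ
  obtain ⟨C, hC⟩ := hK.exists_bound_of_continuousOn hc
  refine MemLp.of_bound (C := |s| * C) (((hc.aestronglyMeasurable hK.measurableSet).const_mul
    s).smul (measurable_gradient _).aestronglyMeasurable) ?_
  filter_upwards [ae_restrict_mem hK.measurableSet] with x hx
  have h1 : ‖∇ (fun x => infDist x M) x‖ ≤ 1 := (norm_gradient _ x).trans_le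
    (by simpa using norm_fderiv_le_of_lipschitz ℝ (lipschitz_infDist_pt M))
  rw [distPowGrad, norm_smul, norm_mul]
  exact (mul_le_of_le_one_right (by positivity) h1).trans
    (mul_le_mul_of_nonneg_left (hC x hx) (norm_nonneg _))

/-- On the support of a test function the distance stays between two positive bounds, so t^s may be
multiplied by a plateau equal to one there, and the chain rule for bounded smooth functions applies.
-/
lemma hasWeakGradient_infDist_rpow (hΩ : IsOpen Ω) (hpos : ∀ x ∈ Ω, 0 < infDist x M) (s : ℝ) :
    HasWeakGradient Ω (fun x => infDist x M ^ s) (distPowGrad M s) := by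
  refine ⟨(continuousOn_infDist_rpow hpos s).locallyIntegrableOn hΩ.measurableSet, ?_,
    fun φ hφ => ?_⟩
  · rw [locallyIntegrableOn_iff hΩ.isLocallyClosed]; intro K hK hKc
    rw [← integrable_indicator_iff hKc.measurableSet, ← memLp_one_iff_integrable]
    exact memLp_distPowGrad hpos hKc hK s 1
  obtain ⟨c, hc0, hc⟩ : ∃ c > 0, ∀ x ∈ tsupport φ, c ≤ infDist x M := by
    rcases (tsupport φ).eq_empty_or_nonempty with h0 | h0
    · exact ⟨1, one_pos, by simp [h0]⟩
    obtain ⟨y, hy, hmin⟩ := hφ.compactSupport.isCompact.exists_isMinOn h0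
      (continuous_infDist_pt M).continuousOn
    exact ⟨_, hpos y (hφ.support_subset hy), hmin⟩
  obtain ⟨N, hN⟩ := hφ.compactSupport.isCompact.exists_bound_of_continuousOn
    (continuous_infDist_pt M).continuousOn
  have hq : IsCutoff fun t => t ^ s * plateau c (|N| + 1) t :=
    (plateau_isCutoff hc0 (by positivity)).mul_left fun t ht =>
      (contDiffAt_rpow_const_of_ne (ne_of_gt ht)).contDiffWithinAt
  obtain ⟨B, hB⟩ := hq.bounded; obtain ⟨D, hD⟩ := hq.deriv_bounded
  have h1 := ((lipschitz_infDist_pt M).hasWeakGradient (Ω := Ω)).comp hΩ hq.smooth hB hD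
  have hle : ∀ x ∈ tsupport φ, infDist x M < |N| + 1 := fun x hx =>
    ((le_abs_self _).trans ((hN x hx).trans (le_abs_self N))).trans_lt (lt_add_one _)
  refine (setIntegral_congr_fun hΩ.measurableSet fun x _ => ?_).trans ((h1.parts φ hφ).trans
    (congrArg Neg.neg (setIntegral_congr_fun hΩ.measurableSet fun x _ => ?_)))
  rotate_left
  · by_cases hx : x ∈ tsupport φ
    · have hx0 := hc0.trans_le (hc x hx)
      have e : deriv (fun t => t ^ s * plateau c (|N| + 1) t) (infDist x M)
          = s * infDist x M ^ (s - 1) := by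
        rw [deriv_fun_mul (differentiableAt_rpow_const_of_ne _ hx0.ne')
          ((plateau_isCutoff hc0 (by positivity)).differentiable _), Real.deriv_rpow_const,
          plateau_eq_one hc0 (by positivity) (hc x hx) (hle x hx).le, deriv_plateau hc0 (hc x hx),
          σ_deriv_of_notMem]
        · ring
        · intro h
          have : infDist x M / (|N| + 1) ≤ 1 := (div_le_one (by positivity)).2 (hle x hx).le
          linarith [h.2]
      simp only [e]
      rfl
    · simp [eq_zero_of_notMem hx]
  · by_cases hx : x ∈ tsupport φ
    · rw [plateau_eq_one hc0 (by positivity) (hc x hx) (hle x hx).le, mul_one]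
    · simp [gradient_eq_zero hx]

/-- Powers of the distance to `M` that are superharmonic in the sense of distributions. -/
lemma isSupersolution_infDist_rpow (hΩ : IsOpen Ω) (hpos : ∀ x ∈ Ω, 0 < infDist x M)
    (hs0 : s ≠ 0) (hs : IsSuperharmonicDistrib Ω fun x => infDist x M ^ s) :
    IsSupersolution Ω (fun _ => 1) (fun x => infDist x M ^ s) (distPowGrad M s) 0 where
  isOpen := hΩ
  elliptic := isUniformlyElliptic_one Ω
  meas := (continuousOn_infDist_rpow hpos s).aestronglyMeasurable hΩ.measurableSet
  meas' := aemeasurable_zero_measure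
  loc := (hasWeakGradient_infDist_rpow hΩ hpos s).locInt_grad
  lower K hK hKc := by
    rcases K.eq_empty_or_nonempty with rfl | h0
    · exact ⟨1, one_pos, by simp⟩
    obtain ⟨y, hy, hmin⟩ := hKc.exists_isMinOn h0 ((continuousOn_infDist_rpow hpos s).mono hK)
    exact ⟨_, rpow_pos_of_pos (hpos y (hK hy)) s, .of_forall fun x hx => hmin hx, by simp⟩
  int φ hφ l hl := by
    have hK : IsCompact (tsupport φ) := hφ.compactSupport
    have h2 := (memLp_distPowGrad hpos hK hφ.support_subset s 2).restrict Ω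
    obtain ⟨C, hC⟩ := hφ.bounded; obtain ⟨B, hB⟩ := hl.bounded
    refine ((integrable_matForm hΩ (isUniformlyElliptic_one Ω) h2 h2).bdd_mul (c := C * B)
      (f := fun x => φ x * l (infDist x M ^ s)) (hφ.continuous.aesm.mul
      (hl.continuous.comp_aestronglyMeasurable ((continuousOn_infDist_rpow hpos s).aestronglyMeasurable
        hΩ.measurableSet))) (.of_forall fun x => ?_)).congr
      (.of_forall fun x => ?_)
    · rw [norm_mul]; exact mul_le_mul (hC x) (hB _) (norm_nonneg _) ((abs_nonneg _).trans (hC x))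
    · by_cases hx : x ∈ tsupport φ
      · simp only [indicator_of_mem hx]
      · simp [eq_zero_of_notMem hx]
  ineq φ hφ hφ0 l hl hl0 := by
    refine (fun h => ⟨by simp, h⟩) ?_
    obtain ⟨a, b, ha, hab⟩ := hl.support
    have hH : ContDiff ℝ ∞ fun ς => l (exp (s * ς)) :=
      hl.smooth.comp (contDiff_exp.comp (contDiff_const.mul contDiff_id))
    have hk : IsCutoff (liftLog fun ς => l (exp (s * ς))) := by
      set R := (|log a| + |log b|) / |s|
      refine IsCutoff.of_log (a := -R) (b := R) hH fun ς hς => hab _ fun h => hς (abs_le.1 ?_)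
      rw [le_div_iff₀ (abs_pos.2 hs0), mul_comm, ← abs_mul]; have h1 := log_le_log ha h.1
      have h2 := log_le_log (ha.trans_le h.1) h.2; rw [log_exp] at h1 h2
      exact abs_le.2 ⟨by linarith [neg_abs_le (log a), abs_nonneg (log b)],
        by linarith [le_abs_self (log b), abs_nonneg (log a)]⟩
    have ek : ∀ {t : ℝ}, 0 < t → liftLog (fun ς => l (exp (s * ς))) t = l (t ^ s) :=
      fun {t} ht => by rw [liftLog_of_pos _ ht, rpow_def_of_pos ht, mul_comm]
    have ek' : ∀ {t : ℝ}, 0 < t → deriv (liftLog fun ς => l (exp (s * ς))) t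
        = deriv l (t ^ s) * (s * t ^ (s - 1)) := fun {t} ht => by
      have : liftLog (fun ς => l (exp (s * ς))) =ᶠ[𝓝 t] fun t => l (t ^ s) := by
        filter_upwards [Ioi_mem_nhds ht] with t ht using ek ht
      rw [this.deriv_eq]
      exact ((hl.differentiable _).hasDerivAt.comp t (hasDerivAt_rpow_const (Or.inl ht.ne'))).deriv
    set k := liftLog fun ς => l (exp (s * ς)); obtain ⟨B, hB⟩ := hk.bounded
    obtain ⟨D, hD⟩ := hk.deriv_bounded
    -- With k(t) = l(t^s) the truncated form is the form of ∇d^s against ∇(φ k(d)). This product is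
    -- nonnegative with compact support, but only Lipschitz, so superharmonicity is tested on
    -- nonnegative smooth approximations with common compact support.
    have hv := (((lipschitz_infDist_pt M).hasWeakGradient (Ω := Ω)).comp hΩ hk.smooth hB
      hD).smooth_mul hΩ hφ.smooth
    obtain ⟨C, hC⟩ := hφ.bounded; have hdc := continuous_infDist_pt M
    have hG1 : ∀ x, ‖∇ (fun x => infDist x M) x‖ ≤ 1 := fun x =>
      (norm_gradient _ x).trans_le
        (by simpa using norm_fderiv_le_of_lipschitz ℝ (lipschitz_infDist_pt M))
    have hw : MemLp (fun x => φ x • deriv k (infDist x M)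
        • ∇ (fun x => infDist x M) x + k (infDist x M) • ∇ φ x) 2
        vol[Ω] := by
      refine MemLp.add ((hφ.memLp 2 _).of_le_mul (c := D)
        (hφ.continuous.aesm.smul ((hk.deriv.continuous.comp
          hdc).aestronglyMeasurable.smul (measurable_gradient _).aestronglyMeasurable))
        (.of_forall fun x => ?_)) ((hφ.memLp_gradient 2 _).of_le_mul (c := B)
        ((hk.continuous.comp hdc).aestronglyMeasurable.smul
          hφ.continuous_gradient.aesm) (.of_forall fun x => ?_))
      · rw [norm_smul, norm_smul, mul_comm]
        exact mul_le_mul_of_nonneg_right ((mul_le_of_le_one_right (norm_nonneg _) (hG1 x)).trans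
          (hD _)) (norm_nonneg _)
      · rw [norm_smul]; exact mul_le_mul_of_nonneg_right (hB _) (norm_nonneg _)
    obtain ⟨K, ψ, hK, hKΩ, hψ, -, hψg⟩ := hv.exists_approx hΩ hφ.compactSupport hφ.support_subset
      (fun x hx => by rw [eq_zero_of_notMem hx, zero_mul])
      (fun x hx => by rw [eq_zero_of_notMem hx,
        gradient_eq_zero hx, zero_smul, smul_zero, add_zero])
      ((hφ.memLp 2 _).of_le_mul (c := B) (hφ.continuous.mul
        (hk.continuous.comp hdc)).aestronglyMeasurable (.of_forall fun x => by
          rw [norm_mul, mul_comm]; exact mul_le_mul_of_nonneg_right (hB _) (norm_nonneg _))) hw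
    have hK' : IsCompact (K ∪ tsupport φ) := hK.union hφ.compactSupport
    have hGK := (memLp_distPowGrad hpos hK' (union_subset hKΩ hφ.support_subset) s 2).restrict Ω
    have hlim := tendsto_integral_matForm hΩ (isUniformlyElliptic_one Ω) hGK hw (fun _ => hGK)
      (fun j => (hψ j).1.memLp_gradient 2 _) (by simp) hψg
    have e : truncForm Ω (fun _ => 1) (fun x => infDist x M ^ s) (distPowGrad M s) φ l
        = ∫ x in Ω, matForm 1 ((K ∪ tsupport φ).indicator (distPowGrad M s) x)
          (φ x • deriv k (infDist x M) • ∇ (fun x => infDist x M) x + k (infDist x M) • ∇ φ x) := by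
      refine setIntegral_congr_fun hΩ.measurableSet fun x hx => ?_
      by_cases hxφ : x ∈ tsupport φ
      · simp only [indicator_of_mem (mem_union_right K hxφ), ek (hpos x hx), ek' (hpos x hx)]
        have e3 : matForm 1 (distPowGrad M s x) (distPowGrad M s x) = _ :=
          matForm_smul_right 1 (s * infDist x M ^ (s - 1)) (distPowGrad M s x)
            (∇ (fun x => infDist x M) x)
        rw [matForm_add_right, matForm_smul_right, matForm_smul_right, matForm_smul_right, e3]; ring
      · simp [eq_zero_of_notMem hxφ, gradient_eq_zero hxφ]
    rw [e]; refine ge_of_tendsto hlim (.of_forall fun j => ?_)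
    have h1 := hs (ψ j) (hψ j).1 ((hψ j).2.2 fun x => by
      refine mul_nonneg (hφ0 x) ?_; simp only [k, liftLog]
      split_ifs
      exacts [hl0 _, le_rfl])
    rw [(hasWeakGradient_infDist_rpow hΩ hpos s).integral_laplacian (hψ j).1, neg_neg] at h1
    refine h1.trans_eq (setIntegral_congr_fun hΩ.measurableSet fun x _ => ?_)
    by_cases hx : x ∈ K
    · simp only [indicator_of_mem (mem_union_left (tsupport φ) hx)]
    · simp [gradient_eq_zero fun h => hx ((hψ j).2.1 h)]

/-- With e = d^s and |∇d| = 1 almost everywhere, |∇e|²/e² = s²/d². -/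
theorem hardy_infDist (hn : 1 ≤ n) (hΩ : IsOpen Ω) (hM : M.Nonempty) (hΩM : ∀ x ∈ Ω, x ∉ closure M)
    (hs0 : s ≠ 0) (hs : IsSuperharmonicDistrib Ω fun x => infDist x M ^ s) : (∀ u g, MemH10 Ω u g →
    ofReal (s ^ 2 / 4) * distTerm Ω M u ≤ energy Ω g) ∧ ∀ u g, MemH10 Ω u g → IsNontrivialOn Ω u →
    ofReal (s ^ 2 / 4) * distTerm Ω M u < energy Ω g := by
  have hpos : ∀ x ∈ Ω, 0 < infDist x M := fun x hx =>
    (infDist_pos_iff_notMem_closure hM).1 (hΩM x hx)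
  have S := isSupersolution_infDist_rpow hΩ hpos hs0 hs
  have e1 : ∀ g, energy Ω g = energyA Ω (fun _ => 1) g := fun g => by
    simp only [energy, energyA, matForm_one, real_inner_self_eq_norm_sq]
  have e2 : ∀ u, ofReal (s ^ 2 / 4) * distTerm Ω M u
      = 1 / 4 * hardyR Ω (fun _ => 1) (fun x => infDist x M ^ s) (distPowGrad M s) u :=
    fun u => by
    rw [distTerm, hardyR, ← ofReal_quarter, ← lintegral_const_mul' _ _ ofReal_ne_top,
      ← lintegral_const_mul' _ _ ofReal_ne_top]
    refine lintegral_congr_ae ?_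
    filter_upwards [ae_restrict_of_ae (lipschitz_infDist_pt M).ae_differentiableAt,
      hΩ.ae_mem] with x hx hxΩ
    have h0 := hpos x hxΩ
    rw [← ofReal_mul (by positivity), ← ofReal_mul (by norm_num), matForm_one,
      real_inner_self_eq_norm_sq, distPowGrad, norm_smul, mul_pow,
      norm_gradient_infDist hM (hΩM x hxΩ) hx, norm_eq_abs, sq_abs, rpow_sub_one h0.ne']
    congr 1; field_simp
  simp only [e1, e2]
  exact ⟨fun u g hu => (le_add_self.trans le_self_add).trans (S.hardy_memH10 hu),
    fun u g hu hu0 => le_self_add.trans_lt (S.hardy_strict hn hu hu0 (by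
      filter_upwards [hΩ.ae_mem] with x hx using rpow_pos_of_pos (hpos x hx) s))⟩

end Distance

/-! ### The boundary inequality on convex domains. -/

section ConvexDomain

/-- A segment leaving Ω is connected and so meets the frontier, no farther from x than its endpoint.
-/
lemma ball_infDist_frontier_subset (hΩ : IsOpen Ω) (hx : x ∈ Ω) : ball x (infDist x (frontier Ω)) ⊆
    Ω := by
  intro y hy
  by_contra hyΩ
  obtain ⟨z, hz, hzf⟩ : ∃ z ∈ segment ℝ x y, z ∈ frontier Ω := by
    by_contra! h; rw [hΩ.frontier_eq] at h
    have h1 : ∀ z ∈ segment ℝ x y, z ∉ Ω → z ∈ (closure Ω)ᶜ := fun z hz hzΩ hzc =>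
      h z hz ⟨hzc, hzΩ⟩
    obtain ⟨z, -, hz, hz'⟩ := (convex_segment x y).isPreconnected Ω (closure Ω)ᶜ hΩ
      isClosed_closure.isOpen_compl (fun z hz => or_iff_not_imp_left.2 (h1 z hz))
      ⟨x, left_mem_segment ℝ x y, hx⟩ ⟨y, right_mem_segment ℝ x y, h1 y (right_mem_segment ℝ x y) hyΩ⟩
    exact hz' (subset_closure hz)
  have h1 := infDist_le_dist_of_mem hzf (x := x)
  have h2 : dist x z ≤ dist x y := by
    rw [dist_comm, dist_comm x]
    exact (convex_closedBall x (dist y x)).segment_subset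
      (mem_closedBall_self dist_nonneg) (mem_closedBall.2 le_rfl) hz
  rw [mem_ball, dist_comm] at hy; linarith

lemma le_infDist_frontier (hΩ : IsOpen Ω) (hf : (frontier Ω).Nonempty) (h : ball x r ⊆ Ω) : r ≤
    infDist x (frontier Ω) := by
  refine (le_infDist hf).2 fun y hy => ?_
  by_contra! hlt; rw [hΩ.frontier_eq] at hy; exact hy.2 (h (mem_ball'.2 hlt))

lemma infDist_frontier_pos (hΩ : IsOpen Ω) (hf : (frontier Ω).Nonempty) (hx : x ∈ Ω) : 0 < infDist x
    (frontier Ω) := by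
  refine (isClosed_frontier.notMem_iff_infDist_pos hf).1 fun h => ?_; rw [hΩ.frontier_eq] at h
  exact h.2 hx

/-- Each point of the ball of radius R = a dx + b dy about ax + by is a convex combination of points
in the balls of radii dx about x and dy about y, obtained by scaling its displacement w by dx/R and
dy/R. -/
lemma concaveOn_infDist_frontier (hΩ : IsOpen Ω) (hc : Convex ℝ Ω) (hf : (frontier Ω).Nonempty) :
    ConcaveOn ℝ Ω fun x => infDist x (frontier Ω) := by
  refine ⟨hc, fun x hx y hy a b ha hb hab => le_infDist_frontier hΩ hf fun z hz => ?_⟩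
  simp only [smul_eq_mul] at hz ⊢; have hdx := infDist_frontier_pos hΩ hf hx
  have hdy := infDist_frontier_pos hΩ hf hy; set dx := infDist x (frontier Ω)
  set dy := infDist y (frontier Ω); set R := a * dx + b * dy; set w := z - (a • x + b • y) with hw
  rw [mem_ball, dist_eq_norm, ← hw] at hz; have hR : 0 < R := (norm_nonneg _).trans_lt hz
  have key : ∀ {p : Eu n} {d : ℝ}, p ∈ Ω → 0 < d → d = infDist p (frontier Ω) →
      p + (d / R) • w ∈ Ω := fun {p d} hp hd h => by
    refine ball_infDist_frontier_subset hΩ hp ?_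
    rw [← h, mem_ball, dist_eq_norm, add_sub_cancel_left, norm_smul,
      norm_of_nonneg (by positivity), div_mul_eq_mul_div, div_lt_iff₀ hR]
    exact mul_lt_mul_of_pos_left hz hd
  have e : z = a • (x + (dx / R) • w) + b • (y + (dy / R) • w) := by
    have h1 : (a * (dx / R) + b * (dy / R)) = 1 := by
      rw [mul_div_assoc', mul_div_assoc', ← add_div, div_self hR.ne']
    calc z = a • x + b • y + (1 : ℝ) • w := by rw [hw]; module
      _ = _ := by rw [← h1]; module
  rw [e]; exact hc (key hx hdx rfl) (key hy hdy rfl) ha hb hab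

/-- Concave functions are superharmonic in the sense of distributions. -/
lemma ConcaveOn.isSuperharmonicDistrib (hΩ : IsOpen Ω) (hf : ConcaveOn ℝ Ω f) (hc : Continuous f) :
    IsSuperharmonicDistrib Ω f := by
  intro φ hφ hφ0
  obtain ⟨δ, hδ, hs⟩ := hφ.compactSupport.isCompact.exists_cthickening_subset_open hΩ
    hφ.support_subset
  have ht := hφ.isTestFunction_partial
  have hnear : ∀ x ∈ tsupport φ, ∀ w : Eu n, ‖w‖ ≤ δ → x - w ∈ Ω := fun x hx w hw =>
    hs (mem_cthickening_of_dist_le _ x _ _ hx (by rwa [dist_eq_norm, sub_sub_cancel_left,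
      norm_neg]))
  have hi : ∀ {p : Eu n → ℝ}, Continuous p → HasCompactSupport p → Integrable fun x => p x * f x :=
    fun hp hp' => (hp.mul hc).integrable_of_hasCompactSupport hp'.mul_right
  have hcs : ∀ w : Eu n, HasCompactSupport fun x => φ (x + w) := fun w =>
    hφ.compactSupport.comp_homeomorph (Homeomorph.addRight w)
  have hcw : ∀ w : Eu n, Continuous fun x => φ (x + w) := fun w => by
    have := hφ.continuous; fun_prop
  -- The second derivative is approximated by two successive difference quotients, with steps t and
  -- s in the same direction. Moved onto f they become mixed second differences, which concavity
  -- signs.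
  have key : ∀ i, ∫ x, lineDeriv ℝ (fun y => ∇ φ y i) x (EuclideanSpace.single i 1) * f x
      ≤ 0 := fun i => by
    set v : Eu n := EuclideanSpace.single i 1 with hv; have hv1 : ‖v‖ = 1 := by simp [hv]
    obtain ⟨D, hD⟩ := (ht i).smooth.lipschitzWith_of_hasCompactSupport (ht i).compactSupport (by simp)
    refine le_of_tendsto (hD.integral_inv_smul_sub_mul_tendsto_integral_lineDeriv_mul'
      (ht i).compactSupport hc v (μ := volume)) ?_
    filter_upwards [Ioo_mem_nhdsGT (half_pos hδ)] with t ht'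
    have hψs : ContDiff ℝ ∞ fun x => φ (x + t • v) - φ x :=
      (hφ.smooth.comp (contDiff_id.add contDiff_const)).sub hφ.smooth
    have hψc : HasCompactSupport fun x => φ (x + t • v) - φ x := (hcs _).sub hφ.compactSupport
    obtain ⟨C, hC⟩ := hψs.lipschitzWith_of_hasCompactSupport hψc (by simp)
    have h1 := hC.integral_inv_smul_sub_mul_tendsto_integral_lineDeriv_mul' hψc hc v (μ := volume)
    have h2 : ∫ x, lineDeriv ℝ (fun x => φ (x + t • v) - φ x) x v * f x ≤ 0 := by
      refine le_of_tendsto h1 ?_; filter_upwards [Ioo_mem_nhdsGT (half_pos hδ)] with s hs'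
      have sh : ∀ w, ∫ x, φ (x + w) * f x = ∫ x, φ x * f (x - w) := fun w => by
        rw [← integral_add_right_eq_self (fun x => φ x * f (x - w)) w]; simp
      have e1 : ∀ x, (s⁻¹ • (φ (x + s • v + t • v) - φ (x + s • v) - (φ (x + t • v) - φ x))) * f x
          = s⁻¹ * (φ (x + (s • v + t • v)) * f x - φ (x + s • v) * f x
            - (φ (x + t • v) * f x - φ (x + 0) * f x)) := fun x => by
        rw [smul_eq_mul, add_assoc, add_zero]; ring
      have j := fun w => hi (hcw w) (hcs w)
      have j1 : ∀ w w', Integrable fun x => φ (x + w) * f x - φ (x + w') * f x := fun w w' =>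
        (j w).sub (j w')
      have k : ∀ w, Integrable fun x => φ x * f (x - w) := fun w =>
        (hφ.continuous.mul (by fun_prop)).integrable_of_hasCompactSupport
          hφ.compactSupport.mul_right
      have k1 : ∀ w w', Integrable fun x => φ x * f (x - w) - φ x * f (x - w') := fun w w' =>
        (k w).sub (k w')
      simp only [e1]
      rw [integral_const_mul, integral_sub (j1 _ _) (j1 _ _), integral_sub (j _) (j _),
        integral_sub (j _) (j _), sh, sh, sh, sh, ← integral_sub (k _) (k _),
        ← integral_sub (k _) (k _), ← integral_sub (k1 _ _) (k1 _ _)]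
      refine mul_nonpos_of_nonneg_of_nonpos (inv_pos.2 hs'.1).le (integral_nonpos fun x => ?_)
      by_cases hx : x ∈ tsupport φ
      · have ns : ∀ c : ℝ, 0 < c → ‖c • v‖ = c := fun c hc => by
          rw [norm_smul, hv1, mul_one, norm_of_nonneg hc.le]
        have hst : 0 < s + t := add_pos hs'.1 ht'.1; have m0 := hnear x hx 0 (by simpa using hδ.le)
        have m1 := hnear x hx (s • v + t • v) (by
          rw [← add_smul, ns _ hst]; linarith [hs'.2, ht'.2])
        have a1 : 0 ≤ s / (s + t) := div_nonneg hs'.1.le hst.le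
        have a2 : 0 ≤ t / (s + t) := div_nonneg ht'.1.le hst.le
        have a3 : s / (s + t) + t / (s + t) = 1 := by rw [← add_div, div_self hst.ne']
        -- The points x − sv and x − tv are convex combinations of x − (s + t)v and x with weights
        -- s/(s + t) and t/(s + t), and conversely; adding the two inequalities removes the weights.
        have q1 := hf.2 m1 m0 a1 a2 a3; have q2 := hf.2 m1 m0 a2 a1 (by rw [add_comm, a3])
        have p1 : (s / (s + t)) • (x - (s • v + t • v)) + (t / (s + t)) • (x - 0) = x - s • v := by
          have : s / (s + t) * (s + t) = s := div_mul_cancel₀ _ hst.ne'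
          calc _ = (s / (s + t) + t / (s + t)) • x - (s / (s + t) * (s + t)) • v := by module
            _ = _ := by rw [a3, this, one_smul]
        have p2 : (t / (s + t)) • (x - (s • v + t • v)) + (s / (s + t)) • (x - 0) = x - t • v := by
          have : t / (s + t) * (s + t) = t := div_mul_cancel₀ _ hst.ne'
          calc _ = (s / (s + t) + t / (s + t)) • x - (t / (s + t) * (s + t)) • v := by module
            _ = _ := by rw [a3, this, one_smul]
        rw [p1] at q1; rw [p2] at q2; simp only [smul_eq_mul] at q1 q2
        have q3 : f (x - (s • v + t • v)) + f (x - 0) ≤ f (x - s • v) + f (x - t • v) := by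
          have : (s / (s + t) + t / (s + t)) * (f (x - (s • v + t • v)) + f (x - 0))
            = f (x - (s • v + t • v)) + f (x - 0) := by rw [a3, one_mul]
          linarith
        have := mul_nonneg (hφ0 x) (sub_nonneg.2 q3); simp only [Pi.zero_apply]; linarith
      · simp [eq_zero_of_notMem hx]
    have e2 : ∀ x, t⁻¹ • (∇ φ (x + t • v) i - ∇ φ x i) * f x
        = t⁻¹ * (lineDeriv ℝ (fun x => φ (x + t • v) - φ x) x v * f x) := fun x => by
      have hd1 : DifferentiableAt ℝ (fun x => φ (x + t • v)) x :=
        (hφ.differentiable _).comp x (differentiableAt_id.add_const _)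
      rw [(hd1.fun_sub (hφ.differentiable x)).lineDeriv_eq_fderiv, fderiv_fun_sub hd1
        (hφ.differentiable x), fderiv_comp_add_right, gradient_coord, gradient_coord]
      simp only [_root_.sub_apply, smul_eq_mul]; ring
    simp only [e2]; rw [integral_const_mul]
    exact mul_nonpos_of_nonneg_of_nonpos (inv_pos.2 ht'.1).le h2
  have e3 : ∀ x, f x * Laplacian.laplacian φ x = ∑ i, lineDeriv ℝ (fun y => ∇ φ y i) x
      (EuclideanSpace.single i 1) * f x := fun x => by
    rw [hφ.laplacian_eq, Finset.mul_sum]; refine Finset.sum_congr rfl fun i _ => ?_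
    rw [((ht i).differentiable x).lineDeriv_eq_fderiv, gradient_coord, mul_comm]
  have e4 : ∫ x in Ω, f x * Laplacian.laplacian φ x = ∫ x, f x * Laplacian.laplacian φ x := by
    refine hφ.setIntegral_eq fun x hx => ?_; rw [e3]; refine Finset.sum_eq_zero fun i _ => ?_
    rw [((ht i).differentiable x).lineDeriv_eq_fderiv, ← gradient_coord,
      gradient_eq_zero fun h => hx (tsupport_partial_subset φ i h)]
    simp
  rw [e4, neg_nonneg]; simp only [e3]; rw [integral_finsetSum _ fun i _ => ?_]
  · exact Finset.sum_nonpos fun i _ => key i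
  · have := (ht i).isTestFunction_partial i
    refine (hi this.continuous this.compactSupport).congr (.of_forall fun x => ?_); simp only
    rw [((ht i).differentiable x).lineDeriv_eq_fderiv, ← gradient_coord]

/-- By concavity of the distance, the homothety of ratio 1 − τ/r about x₀ sends Ω into {d ≥ τ}. Its
image has measure (1 − τ/r)^n |Ω|, at least (1 − nτ/r)|Ω| by Bernoulli. -/
lemma exists_measure_infDist_frontier_lt_le (hn : 1 ≤ n) (hΩ : IsOpen Ω) (hc : Convex ℝ Ω) (hne :
    Ω.Nonempty) (hb : Bornology.IsBounded Ω) (hf : (frontier Ω).Nonempty) : ∃ C : ℝ≥0∞, C ≠ ⊤ ∧ ∀ τ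
    : ℝ, 0 < τ → vol[Ω] {x | infDist x (frontier Ω) < τ} ≤ C * ofReal τ := by
  obtain ⟨x₀, hx₀⟩ := hne; have hr := infDist_frontier_pos hΩ hf hx₀
  set r := infDist x₀ (frontier Ω); have hV := hb.measure_lt_top (μ := volume)
  refine ⟨ofReal (n / r) * volume Ω, mul_ne_top ofReal_ne_top hV.ne, fun τ hτ => ?_⟩
  have hA : MeasurableSet {x : Eu n | infDist x (frontier Ω) < τ} :=
    (isOpen_lt (continuous_infDist_pt _) continuous_const).measurableSet
  rw [mul_right_comm, ← ofReal_mul (by positivity)]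
  have hn' : (1 : ℝ) ≤ n := by exact_mod_cast hn
  rcases le_or_gt r τ with h | h
  · refine (measure_mono (subset_univ _)).trans ?_; rw [restrict_apply_univ]
    refine le_mul_of_one_le_left zero_le (one_le_ofReal.2 ?_)
    rw [div_mul_eq_mul_div, one_le_div hr]; exact h.trans (le_mul_of_one_le_left hτ.le hn')
  · have hl1 : τ / r < 1 := (div_lt_one hr).2 h; have hl0 : 0 < τ / r := by positivity
    have hco := (concaveOn_infDist_frontier hΩ hc hf).2
    set H := AffineMap.homothety x₀ (1 - τ / r) '' Ω
    have hH : H ⊆ Ω \ {x | infDist x (frontier Ω) < τ} := by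
      rintro _ ⟨x, hx, rfl⟩
      have e : AffineMap.homothety x₀ (1 - τ / r) x = (1 - τ / r) • x + (τ / r) • x₀ := by
        rw [AffineMap.homothety_apply, vsub_eq_sub, vadd_eq_add]
        module
      rw [e]; refine ⟨hc hx hx₀ (by linarith) hl0.le (by ring), fun hlt => ?_⟩
      have h1 := hco hx hx₀ (by linarith : 0 ≤ 1 - τ / r) hl0.le (by ring)
      have h2 : τ / r * r = τ := div_mul_cancel₀ _ hr.ne'
      have h3 := mul_nonneg (by linarith : 0 ≤ 1 - τ / r)
        (infDist_nonneg (x := x) (s := frontier Ω))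
      rw [smul_eq_mul, smul_eq_mul, h2] at h1; rw [mem_ofPred_eq] at hlt; linarith
    rw [Measure.restrict_apply hA]
    have h1 : volume ({x | infDist x (frontier Ω) < τ} ∩ Ω) + volume H ≤ volume Ω := by
      rw [← measure_union' (disjoint_left.2 fun x hx hx' => (hH hx').2 hx.1)
        (hA.inter hΩ.measurableSet)]
      exact measure_mono (union_subset inter_subset_right fun x hx => (hH hx).1)
    rw [addHaar_image_homothety, finrank_euclideanSpace_fin,
      abs_of_nonneg (pow_nonneg (by linarith) n)] at h1
    refine ENNReal.le_of_add_le_add_right (mul_ne_top ofReal_ne_top hV.ne) (h1.trans ?_)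
    rw [← add_mul, ← ofReal_add (by positivity) (pow_nonneg (by linarith) n)]
    refine le_mul_of_one_le_left zero_le (one_le_ofReal.2 ?_)
    have h2 := one_add_mul_le_pow (a := -(τ / r)) (by linarith) n
    rw [← sub_eq_add_neg] at h2; have e : (n : ℝ) / r * τ = n * (τ / r) := by ring
    linarith

/-- Layer cake: {d^(−p) > t} = {d < t^(−1/p)} has measure O(t^(−1/p)), integrable at infinity
because p < 1. -/
lemma lintegral_infDist_frontier_rpow_lt_top (hn : 1 ≤ n) (hΩ : IsOpen Ω) (hc : Convex ℝ Ω) (hne :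
    Ω.Nonempty) (hb : Bornology.IsBounded Ω) (hf : (frontier Ω).Nonempty) {p : ℝ} (hp0 : 0 < p) (hp1
    : p < 1) : ∫⁻ x in Ω, ofReal (infDist x (frontier Ω) ^ (-p)) < ⊤ := by
  obtain ⟨C, hC, hm⟩ := exists_measure_infDist_frontier_lt_le hn hΩ hc hne hb hf
  rw [lintegral_eq_lintegral_meas_lt _ (.of_forall fun x => rpow_nonneg infDist_nonneg _)
    ((continuous_infDist_pt _).measurable.pow_const _).aemeasurable,
    ← Ioc_union_Ioi_eq_Ioi zero_le_one]
  refine (lintegral_union_le _ _ _).trans_lt (add_lt_top.2 ⟨?_, ?_⟩)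
  · refine (setLIntegral_mono' measurableSet_Ioc fun t _ =>
      measure_mono (subset_univ _)).trans_lt ?_
    rw [setLIntegral_const, restrict_apply_univ]; exact mul_lt_top hb.measure_lt_top (by simp)
  · refine (setLIntegral_mono' measurableSet_Ioi (g := fun t => C * ofReal (t ^ (-p⁻¹)))
      fun t ht => ?_).trans_lt ?_
    · have ht0 : (0 : ℝ) < t := one_pos.trans ht
      refine (measure_mono fun x hx => ?_).trans (hm _ (rpow_pos_of_pos ht0 _))
      by_contra h; rw [mem_ofPred_eq, not_lt] at h
      have h1 := rpow_le_rpow_of_nonpos (rpow_pos_of_pos ht0 _) h (neg_nonpos.2 hp0.le)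
      rw [← Real.rpow_mul ht0.le, neg_mul_neg, inv_mul_cancel₀ hp0.ne', Real.rpow_one] at h1
      exact absurd hx (not_lt.2 h1)
    · rw [lintegral_const_mul' _ _ hC]
      exact mul_lt_top hC.lt_top (integrableOn_Ioi_rpow_of_lt
        (neg_lt_neg ((one_lt_inv₀ hp0).2 hp1)) one_pos).lintegral_lt_top

lemma memH10_comp_infDist_frontier (hΩ : IsOpen Ω) (hb : Bornology.IsBounded Ω) (hf : (frontier
    Ω).Nonempty) (hl : IsCutoff l) : MemH10 Ω (fun x => l (infDist x (frontier Ω))) (fun x => deriv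
    l (infDist x (frontier Ω)) • ∇ (fun x => infDist x (frontier Ω)) x) := by
  have hlip := lipschitz_infDist_pt (frontier Ω); have hdc := hlip.continuous
  obtain ⟨a, b, ha, hab⟩ := hl.support; obtain ⟨B, hB⟩ := hl.bounded
  obtain ⟨D, hD⟩ := hl.deriv_bounded; set K := closure Ω ∩ {x | a ≤ infDist x (frontier Ω)}
  have hK : IsCompact K := hb.isCompact_closure.inter_right (isClosed_le continuous_const hdc)
  have hKΩ : K ⊆ Ω := fun x hx => by
    by_contra h; have h1 : x ∈ frontier Ω := by rw [hΩ.frontier_eq]; exact ⟨hx.1, h⟩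
    exact ha.not_ge (hx.2.trans_eq (infDist_zero_of_mem h1))
  have hKd : ∀ x ∈ Ω, x ∉ K → infDist x (frontier Ω) ∉ Icc a b := fun x hx hxK h =>
    hxK ⟨subset_closure hx, h.1⟩
  have e1 : (fun x => l (infDist x (frontier Ω))) =ᵐ[vol[Ω]]
      K.indicator fun x => l (infDist x (frontier Ω)) := by
    filter_upwards [hΩ.ae_mem] with x hx
    by_cases h : x ∈ K
    · rw [indicator_of_mem h]
    · rw [indicator_of_notMem h, hab _ (hKd x hx h)]
  have e2 : (fun x => deriv l (infDist x (frontier Ω))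
      • ∇ (fun x => infDist x (frontier Ω)) x) =ᵐ[vol[Ω]]
      K.indicator fun x => deriv l (infDist x (frontier Ω))
        • ∇ (fun x => infDist x (frontier Ω)) x := by
    filter_upwards [hΩ.ae_mem] with x hx
    by_cases h : x ∈ K
    · rw [indicator_of_mem h]
    · rw [indicator_of_notMem h, deriv_eq_zero_of_notMem_Icc hab _ (hKd x hx h), zero_smul]
  haveI : IsFiniteMeasure vol[Ω] := ⟨by simpa using hb.measure_lt_top⟩
  have m1 : MemLp (fun x => l (infDist x (frontier Ω))) 2 vol[Ω] :=
    MemLp.of_bound (C := B) (hl.continuous.comp hdc).aestronglyMeasurable (.of_forall fun x => hB _)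
  have m2 : MemLp (fun x => deriv l (infDist x (frontier Ω))
      • ∇ (fun x => infDist x (frontier Ω)) x) 2 vol[Ω] := by
    refine MemLp.of_bound (C := D) ((hl.deriv.continuous.comp hdc).aestronglyMeasurable.smul
      (measurable_gradient _).aestronglyMeasurable) (.of_forall fun x => ?_)
    rw [norm_smul, norm_gradient]
    exact (mul_le_of_le_one_right (norm_nonneg _)
      (by simpa using norm_fderiv_le_of_lipschitz ℝ hlip)).trans (hD _)
  exact ((((hlip.hasWeakGradient (Ω := Ω)).comp hΩ hl.smooth hB hD).congr hΩ e1 e2).memH10 hΩ hK hKΩ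
    (fun x hx => indicator_of_notMem hx _) (fun x hx => indicator_of_notMem hx _)
    (m1.ae_eq e1) (m2.ae_eq e2)).congr e1.symm e2.symm

/-- The function `t ^ a η(log t)`, for `η = logBump L`. -/
noncomputable def powCut (a L : ℝ) : ℝ → ℝ := liftLog fun s => exp (a * s) * logBump L s

lemma contDiff_powCut (a L : ℝ) : ContDiff ℝ ∞ fun s => exp (a * s) * logBump L s :=
  (contDiff_exp.comp (contDiff_const.mul contDiff_id)).mul (contDiff_logBump L)

lemma powCut_div (ht : 0 < t) : powCut a L t / t = t ^ (a - 1) * logBump L (log t) := by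
  rw [powCut, liftLog_of_pos _ ht, rpow_sub_one ht.ne', rpow_def_of_pos ht, mul_comm a]; ring

lemma deriv_powCut (ht : 0 < t) : deriv (powCut a L) t = t ^ (a - 1) * (a * logBump L (log t) +
    deriv (logBump L) (log t)) := by
  have h1 : HasDerivAt (fun s : ℝ => exp (a * s)) (exp (a * log t) * (a * 1))
    (log t) := ((hasDerivAt_id _).const_mul a).exp
  have h2 := ((contDiff_logBump L).differentiable (by simp) (log t)).hasDerivAt
  have e : deriv (fun s => exp (a * s) * logBump L s) (log t) = _ := (h1.mul h2).deriv
  rw [powCut, deriv_liftLog (contDiff_powCut a L) ht, e, rpow_sub_one ht.ne',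
    rpow_def_of_pos ht, mul_comm a (log t)]
  ring

/-- The constant `1/4` is optimal on bounded convex domains. -/
theorem exists_energy_lt_of_convex (hn : 1 ≤ n) (hΩ : IsOpen Ω) (hc : Convex ℝ Ω) (hne : Ω.Nonempty)
    (hb : Bornology.IsBounded Ω) (hf : (frontier Ω).Nonempty) {c : ℝ≥0∞} (hc4 : 1 / 4 < c) : ∃ u g,
    MemH10 Ω u g ∧ energy Ω g < c * distTerm Ω (frontier Ω) u := by
  obtain ⟨r, hr1, hr2⟩ := lt_iff_exists_nnreal_btwn.1
    (lt_min hc4 (by norm_num [ENNReal.div_lt_iff] : (1 / 4 : ℝ≥0∞) < 1))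
  rw [← ofReal_quarter, ofReal, coe_lt_coe, ← NNReal.coe_lt_coe,
    coe_toNNReal _ (by norm_num)] at hr1
  have hrc := hr2.trans_le (min_le_left _ _)
  have hr1' : (r : ℝ) < 1 := by exact_mod_cast hr2.trans_le (min_le_right _ _)
  -- The trial function is d^a, and the ratio of its two integrals is a² = r, between ¼ and min(c,
  -- 1). The bound a > ½ makes d^(2a−2) integrable, since 2 − 2a < 1.
  set a := sqrt r; have haa : a ^ 2 = r := sq_sqrt r.coe_nonneg; have ha0 : 0 ≤ a := sqrt_nonneg _
  have ha1 : 1 / 2 < a := by nlinarith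
  have ha2 : a < 1 := by nlinarith
  obtain ⟨M, hM0, hM⟩ := exists_σ_deriv_le; have hdc := continuous_infDist_pt (frontier Ω)
  have hpos : ∀ᵐ x ∂vol[Ω], 0 < infDist x (frontier Ω) := by
    filter_upwards [hΩ.ae_mem] with x hx using infDist_frontier_pos hΩ hf hx
  have hgr : ∀ᵐ x ∂vol[Ω], ‖∇ (fun x => infDist x (frontier Ω)) x‖ = 1 := by
    filter_upwards [ae_restrict_of_ae (lipschitz_infDist_pt (frontier Ω)).ae_differentiableAt,
      hpos] with x hx hx0 using norm_gradient_infDist hf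
        ((infDist_pos_iff_notMem_closure hf).2 hx0) hx
  set J := ∫⁻ x in Ω, ofReal ((infDist x (frontier Ω) ^ (a - 1)) ^ 2)
  have hJm : AEMeasurable (fun x => ofReal ((infDist x (frontier Ω) ^ (a - 1)) ^ 2)) vol[Ω] :=
    (((hdc.measurable.pow_const _).pow_const 2).ennreal_ofReal).aemeasurable
  have hJt : J < ⊤ := by
    refine lt_of_eq_of_lt (lintegral_congr fun x => ?_) (lintegral_infDist_frontier_rpow_lt_top hn
      hΩ hc hne hb hf (p := 2 - 2 * a) (by linarith) (by linarith))
    rw [← Real.rpow_natCast, ← Real.rpow_mul infDist_nonneg]; congr 2; push_cast; ring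
  have hJ0 : J ≠ 0 := fun h0 => by
    rw [lintegral_eq_zero_iff' hJm] at h0
    have h1 : ∀ᵐ x ∂vol[Ω], False := by
      filter_upwards [h0, hpos] with x hx hx0
      exact absurd (ofReal_eq_zero.1 hx) (not_le.2 (pow_pos (rpow_pos_of_pos hx0 _) 2))
    rw [ae_iff] at h1; simp only [not_false_eq_true, ofPred_true, restrict_apply_univ] at h1
    exact (hΩ.measure_pos volume hne).ne' h1
  have hl : ∀ j : ℕ, IsCutoff (powCut a (j + 1)) := fun j => by
    have hL : (0 : ℝ) < j + 1 := by positivity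
    exact isCutoff_liftLog (L := j + 1) (contDiff_powCut a _) fun s hs => by
      rw [logBump_eq_zero hL hs, mul_zero]
  have hlim : ∀ s, Tendsto (fun j : ℕ => deriv (logBump (j + 1)) s) atTop (𝓝 0) := fun s => by
    refine squeeze_zero_norm (fun j => (abs_deriv_logBump_le (by positivity)).trans
      (logSlope_le hM (by positivity))) ?_
    exact tendsto_const_nhds.div_atTop
      (tendsto_atTop_add_const_right _ _ tendsto_natCast_atTop_atTop)
  have hone : ∀ s, Tendsto (fun j : ℕ => logBump (j + 1) s) atTop (𝓝 1) := fun s =>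
    tendsto_nhds_of_eventually_eq (eventually_logBump_eq_one s)
  -- As the logarithmic cutoff is removed, the energies tend to a² J and the distance terms to J,
  -- with 0 < J < ∞.
  have hE : Tendsto (fun j : ℕ => energy Ω fun x => deriv (powCut a (j + 1))
      (infDist x (frontier Ω)) • ∇ (fun x => infDist x (frontier Ω)) x) atTop
      (𝓝 (r * J)) := by
    have e : (r : ℝ≥0∞) * J = ∫⁻ x in Ω, ofReal
        ((infDist x (frontier Ω) ^ (a - 1) * (a * 1 + 0)) ^ 2) := by
      rw [← lintegral_const_mul' _ _ coe_ne_top, ← ofReal_coe_nnreal, ← haa]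
      refine lintegral_congr fun x => ?_; rw [← ofReal_mul (sq_nonneg a)]; ring_nf
    rw [e]
    refine tendsto_lintegral_of_dominated_convergence' (fun x => ofReal ((a + 2 * M) ^ 2)
      * ofReal ((infDist x (frontier Ω) ^ (a - 1)) ^ 2)) (fun j => ?_)
      (fun j => ?_) ?_ ?_
    · exact ((((hl j).deriv.continuous.comp hdc).measurable.smul
        (measurable_gradient _)).norm.pow_const 2).ennreal_ofReal.aemeasurable
    · filter_upwards [hpos, hgr] with x hx hx1
      rw [norm_smul, hx1, mul_one, norm_eq_abs, sq_abs, ← ofReal_mul (sq_nonneg _),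
        deriv_powCut hx, mul_pow, mul_comm]
      refine ofReal_le_ofReal (mul_le_mul_of_nonneg_right ?_ (sq_nonneg _)); rw [← sq_abs]
      refine pow_le_pow_left₀ (abs_nonneg _) ((abs_add_le _ _).trans (add_le_add ?_
        ((abs_deriv_logBump_le (by positivity)).trans ((logSlope_le hM (by positivity)).trans
          (div_le_self (by positivity) (by simp)))))) 2
      rw [abs_of_nonneg (mul_nonneg ha0 logBump_nonneg)]
      exact mul_le_of_le_one_right ha0 logBump_le_one
    · rw [lintegral_const_mul' _ _ ofReal_ne_top]; exact mul_ne_top ofReal_ne_top hJt.ne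
    · filter_upwards [hpos, hgr] with x hx hx1
      simp only [norm_smul, hx1, mul_one, norm_eq_abs, sq_abs, deriv_powCut hx]
      exact tendsto_ofReal (((((hone _).const_mul a).add (hlim _)).const_mul _).pow 2
        |>.trans (by simp))
  have hD : Tendsto (fun j : ℕ => distTerm Ω (frontier Ω) fun x => powCut a (j + 1)
      (infDist x (frontier Ω))) atTop (𝓝 J) := by
    refine tendsto_lintegral_of_dominated_convergence' _ (fun j => ?_) (fun j => ?_) hJt.ne ?_
    · exact (((((hl j).continuous.comp hdc).pow 2).measurable).div
        (hdc.pow 2).measurable).ennreal_ofReal.aemeasurable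
    · filter_upwards [hpos] with x hx; rw [← div_pow, powCut_div hx, mul_pow]
      exact ofReal_le_ofReal (mul_le_of_le_one_right (sq_nonneg _)
        (pow_le_one₀ logBump_nonneg logBump_le_one))
    · filter_upwards [hpos] with x hx; simp only [← div_pow, powCut_div hx]
      have := tendsto_ofReal (((hone (log (infDist x (frontier Ω)))).const_mul
        (infDist x (frontier Ω) ^ (a - 1))).pow 2)
      rwa [mul_one] at this
  obtain ⟨j, hj⟩ := (hE.eventually_lt (ENNReal.Tendsto.const_mul hD (Or.inl hJ0))
    (ENNReal.mul_lt_mul_left hJ0 hJt.ne hrc)).exists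
  exact ⟨_, _, memH10_comp_infDist_frontier hΩ hb hf (hl j), hj⟩

end ConvexDomain
theorem mainTheorem6 (n : ℕ) (hn : 1 ≤ n) :
    -- the general inequality, its optimality, and the improvement for boundary weights
    (∀ (Ω : Set (EuclideanSpace ℝ (Fin n)))
        (A : EuclideanSpace ℝ (Fin n) → Matrix (Fin n) (Fin n) ℝ)
        (E : EuclideanSpace ℝ (Fin n) → ℝ≥0∞)
        (gE : EuclideanSpace ℝ (Fin n) → EuclideanSpace ℝ (Fin n))
        (μ : Measure (EuclideanSpace ℝ (Fin n))),
      IsOpen Ω → IsConnected Ω → IsUniformlyElliptic Ω A → IsFiniteMeasure μ →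
      IsPositiveSolution Ω A E gE μ → RegularData Ω A E gE →
      (∀ u g, MemH10 Ω u g → 1 / 4 * hardyTerm Ω A E gE u ≤ energyA Ω A g) ∧
      (μ Ω ≠ 0 → IsInteriorWeight Ω E μ ∨ IsBoundaryWeight Ω E →
        (∀ c : ℝ≥0∞, 1 / 4 < c →
          ∃ u g, MemH10 Ω u g ∧ energyA Ω A g < c * hardyTerm Ω A E gE u) ∧
        (∀ u g, MemH10 Ω u g → IsNontrivialOn Ω u →
          1 / 4 * hardyTerm Ω A E gE u < energyA Ω A g)) ∧
      (μ Ω ≠ 0 → IsBoundaryWeight Ω E →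
        (∀ u g, MemH10 Ω u g →
          1 / 4 * hardyTerm Ω A E gE u + 1 / 2 * measureTerm Ω E μ u ≤ energyA Ω A g) ∧
        (∀ c : ℝ≥0∞, 1 / 4 < c →
          ∃ u g, MemH10 Ω u g ∧
            energyA Ω A g < c * hardyTerm Ω A E gE u + 1 / 2 * measureTerm Ω E μ u) ∧
        (μ {x ∈ Ω | E x < ⊤} ≠ 0 → ∀ c : ℝ≥0∞, 1 / 2 < c →
          ∃ u g, MemH10 Ω u g ∧
            energyA Ω A g < 1 / 4 * hardyTerm Ω A E gE u + c * measureTerm Ω E μ u) ∧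
        (∀ u g, MemH10 Ω u g → IsNontrivialOn Ω u →
          1 / 4 * hardyTerm Ω A E gE u + 1 / 2 * measureTerm Ω E μ u < energyA Ω A g))) ∧
    -- Hardy's boundary inequality on bounded convex domains
    (∀ Ω : Set (EuclideanSpace ℝ (Fin n)),
      IsOpen Ω → Ω.Nonempty → Convex ℝ Ω → Bornology.IsBounded Ω →
      (∀ u g, MemH10 Ω u g → 1 / 4 * distTerm Ω (frontier Ω) u ≤ energy Ω g) ∧
      (∀ c : ℝ≥0∞, 1 / 4 < c →
        ∃ u g, MemH10 Ω u g ∧ energy Ω g < c * distTerm Ω (frontier Ω) u) ∧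
      (∀ u g, MemH10 Ω u g → IsNontrivialOn Ω u →
        1 / 4 * distTerm Ω (frontier Ω) u < energy Ω g)) ∧
    -- the inequality with the distance to a set `M`, for the codimension parameter `k`
    (∀ (Ω M : Set (EuclideanSpace ℝ (Fin n))) (k : ℕ),
      IsOpen Ω → M.Nonempty → 1 ≤ k → k ≤ n → k ≠ 2 →
      IsSuperharmonicDistrib (Ω \ closure M) (fun x => infDist x M ^ (2 - (k : ℝ))) →
      (∀ u g, MemH10 (Ω \ closure M) u g →
        ofReal (((k : ℝ) - 2) ^ 2 / 4) * distTerm (Ω \ closure M) M u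
          ≤ energy (Ω \ closure M) g) ∧
      (∀ u g, MemH10 (Ω \ closure M) u g → IsNontrivialOn (Ω \ closure M) u →
        ofReal (((k : ℝ) - 2) ^ 2 / 4) * distTerm (Ω \ closure M) M u
          < energy (Ω \ closure M) g)) := by
  refine ⟨fun Ω A E gE μ hΩ _ hA hμ h hreg => generalHardy hn hΩ hA h hreg,
    fun Ω hΩ hne hc hb => ?_, fun Ω M k hΩ hM _ _ hk2 hs => ?_⟩
  · have : Nonempty (Fin n) := ⟨⟨0, hn⟩⟩
    -- For n ≥ 1 the space is unbounded, so a bounded nonempty Ω is not everything and has a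
    -- boundary.
    have hf : (frontier Ω).Nonempty := nonempty_frontier_iff.2 ⟨hne, fun h =>
      NormedSpace.unbounded_univ ℝ (EuclideanSpace ℝ (Fin n)) (h ▸ hb)⟩
    have hs := (concaveOn_infDist_frontier hΩ hc hf).isSuperharmonicDistrib hΩ
      (continuous_infDist_pt _)
    -- The concave distance to the frontier with exponent s = 1 produces the constant 1²/4.
    have h := hardy_infDist (s := 1) hn hΩ hf (fun x hx h => by
      rw [isClosed_frontier.closure_eq, hΩ.frontier_eq] at h
      exact h.2 hx) one_ne_zero (by simpa only [Real.rpow_one] using hs)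
    rw [one_pow, ofReal_quarter] at h
    exact ⟨h.1, fun c hc4 => exists_energy_lt_of_convex hn hΩ hc hne hb hf hc4, h.2⟩
  -- The exponent is s = 2 − k; it is nonzero because k ≠ 2, and its square is (k − 2)².
  · have hk : (2 : ℝ) - k ≠ 0 := sub_ne_zero.2 fun h => hk2 (by exact_mod_cast h.symm)
    rw [← neg_sq, neg_sub]
    exact hardy_infDist hn (hΩ.sdiff isClosed_closure) hM (fun x hx => hx.2) hk hs
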